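/- For $\varkappa \ge 0$ consider on $\mathbb R$ the Whitham–Boussinesq system for real-valued $\eta(t,x)$, $v(t,x)$, $$ \partial_t \eta = -\partial_x v - i\tanh D\,(\eta v), \qquad \partial_t v = - i\tanh D\,(1+\varkappa D^2)\eta - i \tanh D\,(v^2/2), \tag{$S_\varkappa$} $$ where $D=-i\partial_x$ and $\tanh D$ is the Fourier multiplier with symbol $\tanh\xi$; $H^\sigma=H^\sigma(\mathbb R)$ is the Sobolev space with norm $\|(1+D^2)^{\sigma/2} f\|_{L^2}$. Let $s \ge 2$, $T>0$, $\eta_0\in H^{s+1/2}$, $v_0\in H^s$, and for each $\varkappa\in(0,1]$ let $$u^\varkappa=(\eta^\varkappa,v^\varkappa)\in C([0,T];H^{s+1/2}\times H^s)\cap C^1((0,T);H^{s-1}\times H^{s-3/2})$$ be a solution of $(S_\varkappa)$ with $u^\varkappa(0)=(\eta_0,v_0)$. Then: 1. The zero-surface-tension problem $(S_0)$ with the same data $(\eta_0,v_0)$ has, for some $T_0\in(0,T]$, a solution in $C([0,T_0];H^{s-1/2}\times H^s)\cap C^1((0,T_0);H^{s-1}\times H^{s-3/2})$. 2. Let $T'\in(0,T]$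 be any time such that $(S_0)$ with data $(\eta_0,v_0)$ has a solution $u=(\eta,v)\in C([0,T'];H^{s-1/2}\times H^s)\cap C^1((0,T');H^{s-1}\times H^{s-3/2})$ (for instance $T'=T$, if the solution exists on all of $[0,T]$). Then $u$ is the only such solution, and $u^\varkappa\to u$ in $C([0,T'];H^{s-1/2}\times H^s)$ as $\varkappa\to 0^+$. 3. If moreover $\eta_0,v_0\in H^\infty=\bigcap_{\sigma} H^\sigma$, then, as $\varkappa\to0^+$, $$\sup_{t\in[0,T']}\left(\|\eta^\varkappa(t)-\eta(t)\|_{L^2}+\|v^\varkappa(t)-v(t)\|_{H^{1/2}}\right)=O(\sqrt{\varkappa}).$$ -/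

import Mathlib

open MeasureTheory Filter Topology Set
open scoped FourierTransform ENNReal NNReal Real SchwartzMap

/-- The complex Hilbert space `L²(ℝ)`. -/
abbrev L2R : Type := Lp ℂ 2 (volume : Measure ℝ)

/-- The extended Sobolev norm `‖f‖_{H^σ} = ‖⟨D⟩^σ f‖_{L²}` of `f ∈ L²(ℝ)`, with `⟨ξ⟩ = √(1 + ξ²)`.
Mathlib's Fourier transform uses `e^{-2πixξ}`, so that `D = -i∂ₓ` has the symbol `2πξ`, and by
Plancherel's identity the norm is computed on the Fourier side.
For `σ ≥ 0`, `f ∈ H^σ(ℝ)` means that this quantity is finite. -/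
noncomputable def sobolevENorm (σ : ℝ) (f : L2R) : ℝ≥0∞ :=
  eLpNorm (fun ξ : ℝ => (((1 + (2 * π * ξ) ^ 2) ^ (σ / 2) : ℝ) : ℂ) * (𝓕 f : L2R) ξ) 2 volume

section
open TemperedDistribution

/-- Finiteness of the extended norm is membership in Mathlib's Sobolev space. -/
theorem memSobolev_iff_sobolevENorm_lt_top (σ : ℝ) (hσ : 0 ≤ σ) (f : L2R) :
    MemSobolev σ 2 (f : 𝓢'(ℝ, ℂ)) ↔ sobolevENorm σ f < ∞ := by
  have key : sobolevENorm σ f < ∞ ↔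
      MemLp (fun ξ : ℝ => (((1 + ‖ξ‖ ^ 2) ^ (σ / 2) : ℝ) : ℂ) * (𝓕 f : L2R) ξ) 2 volume := by
    have hm : AEStronglyMeasurable ((𝓕 f : L2R) : ℝ → ℂ) volume := Lp.aestronglyMeasurable _
    have m1 : AEStronglyMeasurable (fun ξ : ℝ => (((1 + ‖ξ‖ ^ 2) ^ (σ / 2) : ℝ) : ℂ) * (𝓕 f : L2R) ξ) volume := by
      refine AEStronglyMeasurable.mul ?_ hm
      exact (by fun_prop : Measurable _).aestronglyMeasurable
    have m2 : AEStronglyMeasurable (fun ξ : ℝ => (((1 + (2 * π * ξ) ^ 2) ^ (σ / 2) : ℝ) : ℂ) * (𝓕 f : L2R) ξ) volume := by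
      refine AEStronglyMeasurable.mul ?_ hm
      exact (by fun_prop : Measurable _).aestronglyMeasurable
    have hpi : (1:ℝ) ≤ 2 * π := by linarith [Real.pi_gt_three]
    have hpi2 : (1:ℝ) ≤ (2 * π)^2 := by nlinarith
    constructor
    · intro h
      refine MemLp.mono ⟨m2, h⟩ m1 (ae_of_all _ fun ξ => ?_)
      simp only [norm_mul, Complex.norm_real, Real.norm_eq_abs, sq_abs]
      refine mul_le_mul_of_nonneg_right ?_ (norm_nonneg _)
      rw [abs_of_nonneg (by positivity), abs_of_nonneg (by positivity)]
      apply Real.rpow_le_rpow (by positivity) _ (by positivity)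
      nlinarith [sq_nonneg ξ]
    · intro h
      refine (MemLp.of_le_mul (c := ((2 * π)^2) ^ (σ/2)) h m2 (ae_of_all _ fun ξ => ?_)).2
      simp only [norm_mul, Complex.norm_real, Real.norm_eq_abs, sq_abs]
      rw [← mul_assoc]
      gcongr
      rw [abs_of_nonneg (by positivity), abs_of_nonneg (by positivity), ← Real.mul_rpow (by positivity) (by positivity)]
      apply Real.rpow_le_rpow (by positivity) _ (by positivity)
      nlinarith [sq_nonneg ξ]
  rw [key, memSobolev_iff_exists_smulLeftCLM_fourier]
  have hW : (fun ξ : ℝ => (((1 + ‖ξ‖ ^ 2) ^ (σ / 2) : ℝ) : ℂ)).HasTemperateGrowth := by fun_prop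
  have hV : (fun ξ : ℝ => (((1 + ‖ξ‖ ^ 2) ^ (-(σ / 2)) : ℝ) : ℂ)).HasTemperateGrowth := by fun_prop
  have hWV : ∀ ξ : ℝ, (((1 + ‖ξ‖ ^ 2) ^ (σ / 2) : ℝ) : ℂ) * (((1 + ‖ξ‖ ^ 2) ^ (-(σ / 2)) : ℝ) : ℂ) = 1 := by
    intro ξ
    rw [← Complex.ofReal_mul, ← Real.rpow_add (by positivity)]; simp
  have hWV' : (fun ξ : ℝ => (((1 + ‖ξ‖ ^ 2) ^ (σ / 2) : ℝ) : ℂ)) *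
      (fun ξ : ℝ => (((1 + ‖ξ‖ ^ 2) ^ (-(σ / 2)) : ℝ) : ℂ)) = fun _ => 1 := funext hWV
  have hVb : MemLp (fun ξ : ℝ => (((1 + ‖ξ‖ ^ 2) ^ (-(σ / 2)) : ℝ) : ℂ)) ∞ (volume : Measure ℝ) := by
    refine memLp_top_of_bound hV.1.continuous.aestronglyMeasurable 1 (ae_of_all _ fun ξ => ?_)
    rw [Complex.norm_real, Real.norm_eq_abs, abs_of_nonneg (by positivity)]
    exact Real.rpow_le_one_of_one_le_of_nonpos (by nlinarith [sq_nonneg ‖ξ‖]) (by linarith)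
  have inj : ∀ a b : L2R, (a : 𝓢'(ℝ, ℂ)) = b → a = b := fun a b h =>
    LinearMap.ker_eq_bot.mp (Lp.ker_toTemperedDistributionCLM_eq_bot (F := ℂ) (μ := (volume : Measure ℝ)) (p := 2)) h
  rw [Lp.fourier_toTemperedDistribution_eq]
  constructor
  · rintro ⟨f', hf'⟩
    have h1 : (𝓕 f : L2R) = (hVb.toLp _ • f' : L2R) := by
      apply inj
      rw [Lp.toTemperedDistribution_smul_eq hV, ← hf', smulLeftCLM_smulLeftCLM_apply hW hV]
      rw [hWV']
      simp
    refine (memLp_congr_ae ?_).mp (Lp.memLp f')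
    rw [h1]
    filter_upwards [Lp.coeFn_lpSMul (r := 2) (hVb.toLp _) f', hVb.coeFn_toLp] with x h2 h3
    rw [h2, Pi.smul_apply', h3, smul_eq_mul, ← mul_assoc, hWV, one_mul]
  · intro h
    refine ⟨h.toLp _, ?_⟩
    have h1 : (𝓕 f : L2R) = (hVb.toLp _ • h.toLp _ : L2R) := by
      apply Lp.ext
      filter_upwards [Lp.coeFn_lpSMul (r := 2) (hVb.toLp _) (h.toLp _), hVb.coeFn_toLp, h.coeFn_toLp] with x h2 h3 h4
      rw [h2, Pi.smul_apply', h3, h4, smul_eq_mul, ← mul_assoc, mul_comm (Complex.ofReal _), hWV, one_mul]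
    generalize h.toLp _ = g at h1
    rw [h1, Lp.toTemperedDistribution_smul_eq hV, smulLeftCLM_smulLeftCLM_apply hV hW, mul_comm,
      hWV']
    simp

end

/-- `f` is (almost everywhere) real valued. -/
def IsRealValued (f : L2R) : Prop := ∀ᵐ x : ℝ, (f x).im = 0

/-- `f ∈ C(I; H^σ(ℝ))`. -/
def SobolevContinuousOn (σ : ℝ) (I : Set ℝ) (f : ℝ → L2R) : Prop :=
  ∀ t ∈ I, sobolevENorm σ (f t) < ∞ ∧
    Tendsto (fun τ => sobolevENorm σ (f τ - f t)) (𝓝[I] t) (𝓝 0)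

/-- For an open set `I` of times: `f ∈ C¹(I; H^σ(ℝ))`, with time derivative `f'`. -/
def SobolevC1On (σ : ℝ) (I : Set ℝ) (f f' : ℝ → L2R) : Prop :=
  SobolevContinuousOn σ I f ∧ SobolevContinuousOn σ I f' ∧
    ∀ t ∈ I, Tendsto (fun τ => sobolevENorm σ ((τ - t)⁻¹ • (f τ - f t) - f' t)) (𝓝[≠] t) (𝓝 0)

/-- The pair of equations
`η' = -∂ₓ v - i tanh D (η v)`, `v' = -i tanh D (1 + κ D²) η - i tanh D (v² / 2)`
between elements of `L²(ℝ)`, written on the Fourier side. The products `η v` and `v²` of `L²`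
functions are integrable, and their Fourier transforms are the usual integrals. -/
def WhithamBoussinesqEq (κ : ℝ) (η v η' v' : L2R) : Prop :=
  (∀ᵐ ξ : ℝ, (𝓕 η' : L2R) ξ =
      -(Complex.I * ((2 * π * ξ : ℝ) : ℂ) * (𝓕 v : L2R) ξ)
        - Complex.I * ((Real.tanh (2 * π * ξ) : ℝ) : ℂ)
          * (𝓕 (fun x : ℝ => (η x * v x : ℂ)) : ℝ → ℂ) ξ) ∧
  (∀ᵐ ξ : ℝ, (𝓕 v' : L2R) ξ =
      -(Complex.I * ((Real.tanh (2 * π * ξ) * (1 + κ * (2 * π * ξ) ^ 2) : ℝ) : ℂ)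
          * (𝓕 η : L2R) ξ)
        - Complex.I * ((Real.tanh (2 * π * ξ) : ℝ) : ℂ)
          * (𝓕 (fun x : ℝ => (v x ^ 2 / 2 : ℂ)) : ℝ → ℂ) ξ)

/-- `(η, v)` is a real valued solution on `[0, T]`, with surface tension `κ` and initial data
`(η₀, v₀)`, of the Whitham–Boussinesq system, in the class
`C([0, T]; H^r × H^s) ∩ C¹((0, T); H^{s - 1} × H^{s - 3/2})`. -/
structure IsSolution (κ r s T : ℝ) (η₀ v₀ : L2R) (η v : ℝ → L2R) : Prop where
  real : ∀ t ∈ Icc 0 T, IsRealValued (η t) ∧ IsRealValued (v t)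
  initial : η 0 = η₀ ∧ v 0 = v₀
  continuous_η : SobolevContinuousOn r (Icc 0 T) η
  continuous_v : SobolevContinuousOn s (Icc 0 T) v
  equation : ∃ η' v' : ℝ → L2R,
    SobolevC1On (s - 1) (Ioo 0 T) η η' ∧ SobolevC1On (s - 3 / 2) (Ioo 0 T) v v' ∧
      ∀ t ∈ Ioo 0 T, WhithamBoussinesqEq κ (η t) (v t) (η' t) (v' t)

/-! Everything is done on the Fourier side. The system becomes an evolution equation for a pair (h,
w) of L² functions, products become convolutions (`fourier_mul_eq_conv`), and Sobolev norms become
weighted L² norms.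

Uniform control in κ is sought in the norm ‖η‖_{s-1/2} + √κ ‖η‖_{s+1/2} + ‖v‖_s. The natural energy
is ∫ ⟨x⟩^{2s} ((1 + κx²)(tanh x / x)|h|² + |w|²) with x = 2πξ; its linear cross terms cancel. One
nonlinear term loses half a derivative: the capillary weight tests h against tanh D (ηw), which
would need s + 1/2 derivatives of w where only s are at hand. It is removed by adding to the energy
the correction ½ Re ∫ a w̄ (η ⋆ w) with a ≈ ⟨x⟩^{2s} tanh x / x. When the time derivative falls on
w, the capillary part of the velocity equation reproduces the bad term with the opposite sign, up to
a commutator of a with the convolution by η (`lintegral_commutator_le`) and a term of lower order;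
the sum is `energy_rate_le`. Taking x/(M² + x²) in place of 1/x makes the correction small for large
M, so that the energy stays coercive. A factor (1 + ex²)^{-(s+1)} in the weight makes all symbols
bounded, so the energy can be differentiated along curves that are only differentiable in L²; the
bounds do not depend on e, and e → 0 by Fatou's lemma. Gronwall's inequality then gives
`energy_gronwall`.

Convergence. The limit η lies only in H^{s-1/2}, so the difference of the solutions is not in the
energy space. As in the method of Bona and Smith, the solution with surface tension is compared with
the frequency truncation at n of the limit. The difference solves the linearised system with two
sources: the error of truncating products, which is small for large n uniformly in time because the
trajectory is compact, and the capillary term of the truncated elevation, which for fixed n tends to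
0 with κ. A continuous induction closes the argument (`FourierSolution.cutoff_stability`,
`bootstrap`, `FourierSolution.convergence`) and also shows √κ ‖η^κ‖_{s+1/2} ≤ 2.

Rate and uniqueness. In L² × H^{1/2} the energy without surface tension loses no derivative. The
capillary term is treated as a source whose H^{1/2} norm is at most κ ‖η^κ‖_{5/2} ≤ √κ · √κ
‖η^κ‖_{s+1/2} = O(√κ), because s ≥ 2 (`FourierSolution.low_stability`). Without source and with
equal data the same estimate is uniqueness.

Local existence for κ = 0. Since tanh D has order zero and H^{s-1/2}, H^s are algebras,
diagonalising the linear part leaves a bounded quadratic nonlinearity and a free group of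
isometries. Picard–Lindelöf applies in the interaction picture (`exists_fourierSolution`), and
reality of the solution is a symmetry of the resulting ODE. -/

/-! ### Symbols -/

/-- The weight `⟨x⟩^σ = (1 + x²)^{σ/2}`. -/
noncomputable def jw (σ x : ℝ) : ℝ := (1 + x ^ 2) ^ (σ / 2)

theorem jw_pos (σ x : ℝ) : 0 < jw σ x := by unfold jw; positivity

theorem jw_nonneg (σ x : ℝ) : 0 ≤ jw σ x := (jw_pos σ x).le

theorem jw_zero (x : ℝ) : jw 0 x = 1 := by simp [jw]

theorem jw_two (x : ℝ) : jw 2 x = 1 + x ^ 2 := by simp [jw]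

theorem jw_add (σ τ x : ℝ) : jw (σ + τ) x = jw σ x * jw τ x := by
  unfold jw
  rw [← Real.rpow_add (by positivity), add_div]

theorem jw_mul_neg (σ x : ℝ) : jw σ x * jw (-σ) x = 1 := by
  rw [← jw_add, add_neg_cancel, jw_zero]

theorem jw_even (σ x : ℝ) : jw σ (-x) = jw σ x := by simp [jw]

theorem jw_le_jw {σ τ : ℝ} (h : σ ≤ τ) (x : ℝ) : jw σ x ≤ jw τ x := by
  unfold jw
  exact Real.rpow_le_rpow_of_exponent_le (by nlinarith [sq_nonneg x]) (by linarith)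

theorem one_le_jw {σ : ℝ} (h : 0 ≤ σ) (x : ℝ) : 1 ≤ jw σ x := by
  simpa [jw_zero] using jw_le_jw h x

theorem jw_le_one {σ : ℝ} (h : σ ≤ 0) (x : ℝ) : jw σ x ≤ 1 := by
  simpa [jw_zero] using jw_le_jw h x

theorem jw_eq_rpow (σ x : ℝ) : jw σ x = jw 1 x ^ σ := by
  unfold jw
  rw [← Real.rpow_mul (by positivity)]
  congr 1; ring

theorem jw_one_sq (x : ℝ) : jw 1 x ^ 2 = 1 + x ^ 2 := by
  rw [sq, ← jw_add, ← jw_two]; norm_num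

theorem abs_le_jw_one (x : ℝ) : |x| ≤ jw 1 x :=
  abs_le_of_sq_le_sq' (by rw [jw_one_sq]; nlinarith) (jw_nonneg _ _) |> abs_le.mpr

theorem jw_one_le (x : ℝ) : jw 1 x ≤ 1 + |x| := by
  refine abs_le_of_sq_le_sq (a := jw 1 x) ?_ (by positivity) |> (le_abs_self _).trans
  rw [jw_one_sq]; nlinarith [sq_abs x, abs_nonneg x]

theorem jw_one_le_add (x y : ℝ) : jw 1 x ≤ jw 1 (x - y) + jw 1 y := by
  have h1 := jw_one_sq (x - y)
  have h2 := jw_one_sq y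
  have p1 := jw_pos 1 (x - y)
  have p2 := jw_pos 1 y
  refine (le_abs_self _).trans (abs_le_of_sq_le_sq ?_ (by positivity))
  rw [jw_one_sq]
  have a1 := abs_le_jw_one (x - y)
  have a2 := abs_le_jw_one y
  have : (x - y) * y ≤ jw 1 (x - y) * jw 1 y :=
    (le_abs_self _).trans (by rw [abs_mul]; gcongr)
  nlinarith

theorem jw_one_le_add' (x y : ℝ) : jw 1 y ≤ jw 1 x + jw 1 (x - y) := by
  have := jw_one_le_add y x
  rw [← jw_even 1 (x - y)]
  simpa [add_comm] using this

theorem jw_one_sub_le (x y : ℝ) : jw 1 (x - y) ≤ jw 1 x + jw 1 y := by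
  have := jw_one_le_add (x - y) (-y)
  rw [jw_even] at this
  simpa using this

theorem rpow_le_two_rpow_mul_add {A B D σ : ℝ} (hA : 0 ≤ A) (hB : 0 ≤ B) (hD : 0 ≤ D)
    (h : A ≤ B + D) (hσ : 0 ≤ σ) : A ^ σ ≤ 2 ^ σ * (B ^ σ + D ^ σ) := by
  have hm : A ≤ 2 * max B D := by
    have := le_max_left B D; have := le_max_right B D; linarith
  calc A ^ σ ≤ (2 * max B D) ^ σ := by gcongr
    _ = 2 ^ σ * (max B D) ^ σ := Real.mul_rpow (by norm_num) (by positivity)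
    _ ≤ 2 ^ σ * (B ^ σ + D ^ σ) := by
        gcongr
        have h1 : 0 ≤ B ^ σ := by positivity
        have h2 : 0 ≤ D ^ σ := by positivity
        rcases max_cases B D with h | h <;> rw [h.1] <;> linarith

/-- Peetre's inequality. -/
theorem jw_le_two_rpow_mul {σ : ℝ} (hσ : 0 ≤ σ) (x y : ℝ) :
    jw σ x ≤ 2 ^ σ * (jw σ (x - y) + jw σ y) := by
  rw [jw_eq_rpow σ x, jw_eq_rpow σ y, jw_eq_rpow σ (x - y)]
  exact rpow_le_two_rpow_mul_add (jw_nonneg _ _) (jw_nonneg _ _) (jw_nonneg _ _)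
    (jw_one_le_add x y) hσ

theorem jw_le_of_abs_le {σ x y : ℝ} (hσ : 0 ≤ σ) (h : |x| ≤ |y|) : jw σ x ≤ jw σ y := by
  unfold jw
  have := sq_le_sq.mpr h
  gcongr

@[fun_prop]
theorem continuous_jw (σ : ℝ) : Continuous (jw σ) := by
  unfold jw
  refine Continuous.rpow_const (by fun_prop) fun x => Or.inl (by positivity)

/-! ### The symbols tanh x and tanh x / x. -/

theorem abs_tanh_le_one (x : ℝ) : |Real.tanh x| ≤ 1 := by
  rw [Real.tanh_eq_sinh_div_cosh, abs_div, abs_of_pos (Real.cosh_pos x),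
    div_le_one (Real.cosh_pos x)]
  refine abs_le_of_sq_le_sq ?_ (Real.cosh_pos x).le
  have := Real.cosh_sq x
  linarith

theorem hasDerivAt_tanh (x : ℝ) : HasDerivAt Real.tanh (1 / Real.cosh x ^ 2) x := by
  have h := (Real.hasDerivAt_sinh x).div (Real.hasDerivAt_cosh x) (Real.cosh_pos x).ne'
  have e : Real.tanh = fun x => Real.sinh x / Real.cosh x := funext Real.tanh_eq_sinh_div_cosh
  rw [e]
  refine h.congr_deriv ?_
  rw [← Real.cosh_sq_sub_sinh_sq x]; ring

@[fun_prop]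
theorem continuous_tanh : Continuous Real.tanh :=
  continuous_iff_continuousAt.mpr fun x => (hasDerivAt_tanh x).continuousAt

/-- Since cosh² = 1 + sinh² and |sinh x| ≥ |x|. The decay of tanh′ by two powers is more than the
one power that the derivative bound of `modA` requires. -/
theorem one_div_cosh_sq_le (x : ℝ) : 1 / Real.cosh x ^ 2 ≤ (1 + x ^ 2)⁻¹ := by
  have h : 1 + x ^ 2 ≤ Real.cosh x ^ 2 := by
    rw [Real.cosh_sq]
    have : |x| ≤ |Real.sinh x| := by
      rcases le_total 0 x with hx | hx
      · rw [abs_of_nonneg hx]; exact (Real.self_le_sinh_iff.2 hx).trans (le_abs_self _)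
      · rw [abs_of_nonpos hx]
        refine le_trans ?_ (neg_le_abs _)
        have := Real.sinh_le_self_iff.2 hx
        linarith
    have := sq_le_sq.mpr this
    linarith
  rw [one_div]; gcongr

theorem abs_tanh_le_abs (x : ℝ) : |Real.tanh x| ≤ |x| := by
  have h := Convex.norm_image_sub_le_of_norm_hasDerivWithin_le (f := Real.tanh) (s := univ)
    (C := 1) (f' := fun x => 1 / Real.cosh x ^ 2)
    (fun x _ => (hasDerivAt_tanh x).hasDerivWithinAt) (fun x _ => by
      rw [Real.norm_eq_abs, abs_of_nonneg (by positivity)]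
      refine (one_div_cosh_sq_le x).trans (inv_le_one_of_one_le₀ (by nlinarith [sq_nonneg x])))
    convex_univ (mem_univ 0) (mem_univ x)
  simpa using h

/-- The symbol `tanh x / x`. -/
noncomputable def kap (x : ℝ) : ℝ := if x = 0 then 1 else Real.tanh x / x

theorem kap_mul_self (x : ℝ) : kap x * x = Real.tanh x := by
  unfold kap; split_ifs with h
  · simp [h]
  · field_simp

theorem kap_even (x : ℝ) : kap (-x) = kap x := by
  unfold kap
  by_cases h : x = 0 <;> simp [h]

@[fun_prop]
theorem measurable_kap : Measurable kap := by
  unfold kap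
  exact Measurable.ite (measurableSet_eq) measurable_const
    (continuous_tanh.measurable.div measurable_id)

theorem le_tanh_of_nonneg {x : ℝ} (hx : 0 ≤ x) : x / (1 + x) ≤ Real.tanh x := by
  rw [Real.tanh_eq_sinh_div_cosh, div_le_div_iff₀ (by positivity) (Real.cosh_pos x)]
  have h1 : x ≤ Real.sinh x := Real.self_le_sinh_iff.2 hx
  have h2 : Real.cosh x - Real.sinh x = Real.exp (-x) := Real.cosh_sub_sinh x
  have h3 : Real.exp (-x) ≤ 1 := Real.exp_le_one_iff.2 (by linarith)
  nlinarith

/-- Together with `kap_le`, tanh x / x is comparable to ⟨x⟩⁻¹. This is why the elevation is measured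
with half a derivative less than the velocity. -/
theorem inv_le_kap (x : ℝ) : jw (-1) x ≤ 2 * kap x := by
  have hj : jw (-1) x = (jw 1 x)⁻¹ := eq_inv_of_mul_eq_one_right (jw_mul_neg 1 x)
  have key : ∀ x : ℝ, 0 ≤ x → (jw 1 x)⁻¹ ≤ 2 * kap x := by
    intro x hx
    have h1 : (1 + x) ≤ 2 * jw 1 x := by
      have := abs_le_jw_one x; have := one_le_jw zero_le_one x
      rw [abs_of_nonneg hx] at *; linarith
    have h0 := jw_pos 1 x
    have : (jw 1 x)⁻¹ ≤ 2 / (1 + x) := by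
      rw [le_div_iff₀ (by positivity), inv_mul_le_iff₀ h0]; linarith
    refine this.trans ?_
    unfold kap
    split_ifs with h
    · simp [h]
    · have h4 := le_tanh_of_nonneg hx
      have hx' : 0 < x := lt_of_le_of_ne hx (Ne.symm h)
      rw [div_le_iff₀ (by positivity)] at h4 ⊢
      field_simp
      linarith
  rw [hj]
  rcases le_total 0 x with hx | hx
  · exact key x hx
  · have := key (-x) (by linarith)
    rwa [jw_even, kap_even] at this

theorem kap_pos (x : ℝ) : 0 < kap x := by
  have := inv_le_kap x; have := jw_pos (-1) x; linarith

theorem kap_le (x : ℝ) : kap x ≤ 2 * jw (-1) x := by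
  have hj : jw (-1) x = (jw 1 x)⁻¹ := eq_inv_of_mul_eq_one_right (jw_mul_neg 1 x)
  have h1 : kap x ≤ 1 := by
    unfold kap; split_ifs with h
    · rfl
    · refine (le_abs_self _).trans ?_
      rw [abs_div]; exact div_le_one_of_le₀ (abs_tanh_le_abs x) (abs_nonneg _)
  have h2 : kap x * |x| ≤ 1 := by
    rw [← abs_of_pos (kap_pos x), ← abs_mul, kap_mul_self]; exact abs_tanh_le_one x
  have h3 := jw_one_le x
  have h4 := jw_pos 1 x
  rw [hj, ← div_eq_mul_inv, le_div_iff₀ h4]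
  nlinarith [kap_pos x]

/-! ### The regularised weight and the symbol of the modified energy. -/

/-- The regularised weight `(1 + x²)^s (1 + e x²)^{-(s+1)}`. -/
noncomputable def regW (s e x : ℝ) : ℝ := (1 + x ^ 2) ^ s * (1 + e * x ^ 2) ^ (-(s + 1))

theorem regW_pos {s e : ℝ} (he : 0 ≤ e) (x : ℝ) : 0 < regW s e x := by
  unfold regW; positivity

theorem regW_le {s e : ℝ} (hs : 0 ≤ s) (he : 0 ≤ e) (x : ℝ) : regW s e x ≤ jw (2 * s) x := by
  unfold regW jw
  rw [show 2 * s / 2 = s by ring]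
  refine mul_le_of_le_one_right (by positivity) ?_
  exact Real.rpow_le_one_of_one_le_of_nonpos (by nlinarith [mul_nonneg he (sq_nonneg x)])
    (by linarith)

/-- For fixed e > 0 the regularised weight has order −2, which leaves room for the factor 1 + κx² of
the capillary energy. All symbols of the energy are then bounded, at a cost depending on e that does
not enter the final estimates. -/
theorem regW_mul_le {s e : ℝ} (hs : 0 ≤ s) (he : 0 < e) (he1 : e ≤ 1) (x : ℝ) :
    regW s e x * jw 2 x ≤ e ^ (-(s + 1)) := by
  have h1 : regW s e x * jw 2 x = (1 + x ^ 2) ^ (s + 1) * (1 + e * x ^ 2) ^ (-(s + 1)) := by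
    rw [jw_two, regW, Real.rpow_add_one (by positivity)]; ring
  rw [h1, Real.rpow_neg (by positivity), Real.rpow_neg (by positivity), ← div_eq_mul_inv,
    ← Real.div_rpow (by positivity) (by positivity), ← Real.inv_rpow he.le]
  gcongr
  rw [div_le_iff₀ (by positivity)]
  field_simp
  nlinarith [sq_nonneg x]

theorem hasDerivAt_regW {s e : ℝ} (he : 0 ≤ e) (x : ℝ) :
    HasDerivAt (regW s e) (regW s e x *
      (2 * s * x / (1 + x ^ 2) - 2 * (s + 1) * e * x / (1 + e * x ^ 2))) x := by
  have p1 : (0 : ℝ) < 1 + x ^ 2 := by positivity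
  have p2 : (0 : ℝ) < 1 + e * x ^ 2 := by positivity
  have h1 : HasDerivAt (fun x : ℝ => 1 + x ^ 2) (2 * x) x := by
    simpa using ((hasDerivAt_id x).pow 2).const_add 1
  have h2 : HasDerivAt (fun x : ℝ => 1 + e * x ^ 2) (e * (2 * x)) x := by
    simpa using (((hasDerivAt_id x).pow 2).const_mul e).const_add 1
  have h3 := h1.rpow_const (p := s) (Or.inl p1.ne')
  have h4 := h2.rpow_const (p := -(s + 1)) (Or.inl p2.ne')
  refine (h3.mul h4).congr_deriv ?_
  unfold regW
  rw [Real.rpow_sub_one p1.ne', Real.rpow_sub_one p2.ne']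
  field_simp
  ring

/-- The symbol of the modified part of the energy. -/
noncomputable def modA (s e M x : ℝ) : ℝ := regW s e x * Real.tanh x * (x / (M ^ 2 + x ^ 2))

theorem abs_modA_le {s e M : ℝ} (he : 0 ≤ e) (hM : 1 ≤ M) (x : ℝ) :
    |modA s e M x| ≤ regW s e x * jw (-1) x := by
  have hj : jw (-1) x = (jw 1 x)⁻¹ := eq_inv_of_mul_eq_one_right (jw_mul_neg 1 x)
  have hb : |x / (M ^ 2 + x ^ 2)| ≤ jw (-1) x := by
    rw [abs_div, abs_of_pos (by positivity : 0 < M ^ 2 + x ^ 2), hj, ← one_div,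
      div_le_div_iff₀ (by positivity) (jw_pos 1 x)]
    have := abs_le_jw_one x; have := jw_one_sq x; have := jw_pos 1 x
    nlinarith
  unfold modA
  rw [abs_mul, abs_mul, abs_of_pos (regW_pos he x)]
  have := abs_tanh_le_one x
  have h0 := (regW_pos (s := s) he x).le
  calc regW s e x * |Real.tanh x| * |x / (M ^ 2 + x ^ 2)| ≤ regW s e x * 1 * jw (-1) x := by gcongr
    _ = _ := by ring

theorem abs_modA_le' {s e M : ℝ} (hs : 0 ≤ s) (he : 0 ≤ e) (hM : 1 ≤ M) (x : ℝ) :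
    |modA s e M x| ≤ jw (2 * s - 1) x := by
  refine (abs_modA_le he hM x).trans ?_
  rw [show 2 * s - 1 = 2 * s + -1 by ring, jw_add]
  have := regW_le hs he x; have := jw_nonneg (-1) x
  gcongr

/-- A gain of `M^{-1/2}` at the price of half a derivative. -/
theorem abs_modA_le_gain {s e M : ℝ} (hs : 0 ≤ s) (he : 0 ≤ e) (hM : 1 ≤ M) (x : ℝ) :
    |modA s e (M ^ 2) x| ≤ M⁻¹ * jw (2 * s - 1 / 2) x := by
  have hj : jw (-(1 / 2)) x = (jw (1 / 2) x)⁻¹ := eq_inv_of_mul_eq_one_right (jw_mul_neg _ x)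
  have hjj : jw (1 / 2) x * jw (1 / 2) x = jw 1 x := by rw [← jw_add]; norm_num
  have hp := jw_pos (1 / 2) x
  have hb : |x / ((M ^ 2) ^ 2 + x ^ 2)| ≤ M⁻¹ * jw (-(1 / 2)) x := by
    rw [abs_div, abs_of_pos (by positivity : 0 < (M ^ 2) ^ 2 + x ^ 2), hj, ← mul_inv, ← one_div,
      div_le_div_iff₀ (by positivity) (by positivity), one_mul]
    have h1 := abs_le_jw_one x
    have h2 := jw_one_sq x
    have h3 := jw_one_le x
    set g := jw (1 / 2) x
    rw [← hjj] at h1 h2 h3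
    have hg1 : 1 ≤ g := one_le_jw (by norm_num) x
    have hx2 := sq_abs x
    have hax := abs_nonneg x
    have hgx : g ≤ 1 + |x| := by nlinarith
    -- Here g = ⟨x⟩^{1/2}. If g ≤ M, then Mg ≤ M² and the inequality of the means suffices. If g ≥
    -- M, then Mg ≤ g² = ⟨x⟩, which exceeds |x| by at most 1/(1 + |x|).
    have h5 : |x| * (M * g) ≤ (M ^ 2) ^ 2 + x ^ 2 := by
      rcases le_total g M with h | h
      · have : |x| * (M * g) ≤ |x| * (M ^ 2) := by
          have : M * g ≤ M ^ 2 := by nlinarith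
          gcongr
        nlinarith [sq_nonneg (M ^ 2 - |x|)]
      · have h6 : M * g ≤ 1 + |x| := by nlinarith
        have h7 : (1:ℝ) ≤ (M ^ 2) := by nlinarith
        rcases le_total (M * g) |x| with h8 | h8
        · nlinarith
        · have h9 : (1:ℝ) ≤ (M ^ 2) ^ 2 := by nlinarith
          have h10 : g * g = 1 ∨ M * g ≤ |x| + (M^2)^2 / (1 + |x|) := by
            right
            have : M * g ≤ g * g := by nlinarith
            have hgg : (g * g) * (g * g) = 1 + x ^ 2 := by rw [← h2]; ring
            have : M * g ≤ |x| + 1 / (1 + |x|) := by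
              refine this.trans ?_
              have : g * g * (1 + |x|) ≤ (|x| + 1 / (1 + |x|)) * (1 + |x|) := by
                rw [add_mul, div_mul_cancel₀ _ (by positivity)]
                have : (g * g * (1 + |x|)) ^ 2 ≤ (|x| * (1 + |x|) + 1) ^ 2 := by
                  rw [mul_pow, sq (g * g), hgg]
                  nlinarith
                exact le_of_sq_le_sq this (by positivity)
              exact le_of_mul_le_mul_right this (by positivity)
            refine this.trans ?_
            gcongr
          rcases h10 with h10 | h10
          · have : x ^ 2 = 0 := by nlinarith
            have : |x| = 0 := by nlinarith
            rw [this]; nlinarith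
          · calc |x| * (M * g) ≤ |x| * (|x| + (M^2)^2 / (1 + |x|)) := by gcongr
              _ = x ^ 2 + (M^2)^2 * (|x| / (1 + |x|)) := by rw [← hx2]; ring
              _ ≤ x ^ 2 + (M^2)^2 * 1 := by
                  gcongr
                  exact div_le_one_of_le₀ (by linarith) (by positivity)
              _ = _ := by ring
    exact h5
  unfold modA
  rw [abs_mul, abs_mul, abs_of_pos (regW_pos he x)]
  have h1 := abs_tanh_le_one x
  have h0 := (regW_pos (s := s) he x).le
  have h2 := regW_le hs he x
  calc regW s e x * |Real.tanh x| * |x / ((M ^ 2) ^ 2 + x ^ 2)|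
      ≤ jw (2 * s) x * 1 * (M⁻¹ * jw (-(1 / 2)) x) := by
        have := jw_nonneg (2 * s) x
        gcongr
    _ = _ := by rw [show 2 * s - 1 / 2 = 2 * s + -(1 / 2) by ring, jw_add]; ring
-- The three factors behave like symbols of orders 2s, 0 and −1, and a derivative lowers the total
-- order 2s − 1 by one. The point is that the constant depends neither on e nor on M.
theorem exists_hasDerivAt_modA {s e M : ℝ} (hs : 1 ≤ s) (he : 0 ≤ e) (he1 : e ≤ 1) (hM : 1 ≤ M)
    (x : ℝ) : ∃ d, HasDerivAt (modA s e M) d x ∧ |d| ≤ (4 * s + 4) * jw (2 * s - 2) x := by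
  have pM : 0 < M ^ 2 + x ^ 2 := by positivity
  have p1 : (0 : ℝ) < 1 + x ^ 2 := by positivity
  have p2 : (0 : ℝ) < 1 + e * x ^ 2 := by positivity
  have hb : HasDerivAt (fun x : ℝ => x / (M ^ 2 + x ^ 2))
      ((M ^ 2 - x ^ 2) / (M ^ 2 + x ^ 2) ^ 2) x := by
    have h1 : HasDerivAt (fun x : ℝ => M ^ 2 + x ^ 2) (2 * x) x := by
      simpa using ((hasDerivAt_id x).pow 2).const_add (M ^ 2)
    refine ((hasDerivAt_id x).div h1 pM.ne').congr_deriv ?_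
    simp only [id]
    congr 1
    ring
  refine ⟨_, ((hasDerivAt_regW he x).mul (hasDerivAt_tanh x)).mul hb, ?_⟩
  have hW := regW_pos (s := s) he x
  set w := regW s e x with hw
  set q := (1 + x ^ 2)⁻¹ with hq
  have q0 : 0 < q := by positivity
  have hM2 : 1 + x ^ 2 ≤ M ^ 2 + x ^ 2 := by nlinarith
  have hqM : 1 / (M ^ 2 + x ^ 2) ≤ q := by
    rw [one_div]; exact inv_anti₀ p1 hM2
  have b1 : |x / (M ^ 2 + x ^ 2)| * |x| ≤ 1 := by
    rw [abs_div, abs_of_pos pM, div_mul_eq_mul_div, div_le_one pM, ← sq, sq_abs]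
    nlinarith
  have b1' : |x / (M ^ 2 + x ^ 2)| ≤ 1 := by
    rw [abs_div, abs_of_pos pM, div_le_one pM]
    nlinarith [sq_abs x, sq_nonneg (|x| - 1)]
  have b2 : |(M ^ 2 - x ^ 2) / (M ^ 2 + x ^ 2) ^ 2| ≤ q := by
    rw [abs_div, abs_of_pos (pow_pos pM 2)]
    refine le_trans ?_ hqM
    rw [div_le_div_iff₀ (pow_pos pM 2) pM]
    have : |M ^ 2 - x ^ 2| ≤ M ^ 2 + x ^ 2 := by
      rw [abs_le]; constructor <;> nlinarith [sq_nonneg x, sq_nonneg M]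
    nlinarith
  have b3 : |1 / Real.cosh x ^ 2| ≤ q := by
    rw [abs_of_nonneg (by positivity)]; exact one_div_cosh_sq_le x
  have b4 : |2 * s * x / (1 + x ^ 2) - 2 * (s + 1) * e * x / (1 + e * x ^ 2)|
      ≤ (4 * s + 2) * q * |x| := by
    -- The left side increases with e, so the value at e = 1 bounds it uniformly in the
    -- regularisation.
    have e1 : e / (1 + e * x ^ 2) ≤ q := by
      rw [hq, ← one_div, div_le_div_iff₀ p2 p1]; nlinarith
    refine (abs_sub _ _).trans ?_
    have e2 : |2 * s * x / (1 + x ^ 2)| = 2 * s * q * |x| := by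
      rw [abs_div, abs_mul, abs_of_pos p1, abs_of_pos (by linarith : 0 < 2 * s), hq]; ring
    have e3 : |2 * (s + 1) * e * x / (1 + e * x ^ 2)| =
        2 * (s + 1) * (e / (1 + e * x ^ 2)) * |x| := by
      rw [abs_div, abs_mul, abs_of_pos p2, abs_of_nonneg (by positivity : 0 ≤ 2 * (s + 1) * e)]
      ring
    rw [e2, e3]
    have : 2 * (s + 1) * (e / (1 + e * x ^ 2)) * |x| ≤ 2 * (s + 1) * q * |x| := by gcongr
    nlinarith
  have ht := abs_tanh_le_one x
  have hwq : w * q ≤ jw (2 * s - 2) x := by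
    have : jw (2 * s - 2) x = jw (2 * s) x * q := by
      rw [show 2 * s - 2 = 2 * s + -2 by ring, jw_add]
      congr 1
      rw [eq_inv_of_mul_eq_one_right (jw_mul_neg 2 x), jw_two]
    rw [this]
    have := regW_le (by linarith : 0 ≤ s) he x
    gcongr
  refine le_trans ?_ (mul_le_mul_of_nonneg_left hwq (by linarith : 0 ≤ 4 * s + 4))
  set B := |x / (M ^ 2 + x ^ 2)|
  calc _ ≤ (w * ((4 * s + 2) * q * |x|) * 1 + w * q) * B + w * 1 * q := by
        refine (abs_add_le _ _).trans ?_
        rw [Pi.mul_apply, ← hw, abs_mul, abs_mul (w * Real.tanh x), abs_mul w (Real.tanh x),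
          abs_of_pos hW]
        gcongr
        refine (abs_add_le _ _).trans ?_
        rw [abs_mul, abs_mul, abs_mul, abs_of_pos hW]
        gcongr
    _ = w * q * ((4 * s + 2) * (B * |x|) + B + 1) := by ring
    _ ≤ w * q * ((4 * s + 2) * 1 + 1 + 1) := by gcongr
    _ = _ := by ring

/-- Mean value inequality. Between x and y the modulus is at most max |x| |y|, and 2s − 2 ≥ 0 makes
the weight monotone in the modulus, so the end points control the derivative. -/
theorem abs_modA_sub_le {s e M : ℝ} (hs : 1 ≤ s) (he : 0 ≤ e) (he1 : e ≤ 1) (hM : 1 ≤ M)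
    (x y : ℝ) : |modA s e M y - modA s e M x| ≤
      (4 * s + 4) * (jw (2 * s - 2) x + jw (2 * s - 2) y) * |x - y| := by
  choose d hd hb using fun z => exists_hasDerivAt_modA hs he he1 hM z
  have h := Convex.norm_image_sub_le_of_norm_hasDerivWithin_le (f := modA s e M) (s := uIcc x y)
    (C := (4 * s + 4) * (jw (2 * s - 2) x + jw (2 * s - 2) y)) (f' := d)
    (fun z _ => (hd z).hasDerivWithinAt) (fun z hz => ?_) (convex_uIcc x y) left_mem_uIcc
    right_mem_uIcc
  · simpa [Real.norm_eq_abs, abs_sub_comm x y] using h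
  · refine (hb z).trans ?_
    gcongr
    have hz' : |z| ≤ max |x| |y| := by
      rcases mem_uIcc.1 hz with h | h
      · exact abs_le_max_abs_abs h.1 h.2
      · rw [max_comm]; exact abs_le_max_abs_abs h.1 h.2
    have p1 := jw_nonneg (2 * s - 2) x
    have p2 := jw_nonneg (2 * s - 2) y
    rcases le_max_iff.1 hz' with h | h
    · have := jw_le_of_abs_le (by linarith : 0 ≤ 2 * s - 2) h; linarith
    · have := jw_le_of_abs_le (by linarith : 0 ≤ 2 * s - 2) h; linarith

/-! ### Distribution of the weights in the commutator. -/

theorem rpow_mul_rpow_le_shift {A B p q r t : ℝ} (hA : 0 < A) (h : A ≤ B) (hr : r ≤ p)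
    (hsum : p + q = r + t) : A ^ p * B ^ q ≤ A ^ r * B ^ t := by
  have hB : 0 < B := hA.trans_le h
  have e1 : A ^ p = A ^ r * A ^ (p - r) := by rw [← Real.rpow_add hA]; congr 1; ring
  have e2 : B ^ t = B ^ (p - r) * B ^ q := by rw [← Real.rpow_add hB]; congr 1; linarith
  rw [e1, e2]
  have : A ^ (p - r) ≤ B ^ (p - r) := Real.rpow_le_rpow hA.le h (by linarith)
  calc A ^ r * A ^ (p - r) * B ^ q ≤ A ^ r * B ^ (p - r) * B ^ q := by gcongr
    _ = _ := by ring

/-- X, Y and D stand for the brackets of the output frequency (that of h), of the frequency of w and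
of that of η. The left side is the capillary weight X² times the mean value bound for the modified
symbol. On the right, w never carries more than s derivatives, nor h and η more than s + 1/2, and
every term can absorb the factor κ in norms that come with √κ. -/
theorem commutator_weight_le {s X Y D : ℝ} (hs : 2 ≤ s) (hX : 1 ≤ X) (hY : 1 ≤ Y) (hD : 1 ≤ D)
    (h1 : X ≤ Y + D) (h2 : Y ≤ X + D) (h3 : D ≤ X + Y) :
    D * (X ^ (2 * s - 2) + Y ^ (2 * s - 2)) * X ^ (2 : ℝ) ≤
      2 ^ (s + 2) * (X ^ s * Y ^ s * D + X ^ (s + 1 / 2) * D ^ (s + 1 / 2)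
        + Y ^ s * D ^ (s + 1 / 2) * X ^ (1 / 2 : ℝ)) := by
  have X0 : 0 < X := by linarith
  have Y0 : 0 < Y := by linarith
  have D0 : 0 < D := by linarith
  set T1 := X ^ s * Y ^ s * D with hT1
  set T2 := X ^ (s + 1 / 2) * D ^ (s + 1 / 2) with hT2
  set T3 := Y ^ s * D ^ (s + 1 / 2) * X ^ (1 / 2 : ℝ) with hT3
  have p1 : 0 < T1 := by positivity
  have p2 : 0 < T2 := by positivity
  have p3 : 0 < T3 := by positivity
  have mulD : ∀ p : ℝ, D * D ^ p = D ^ (p + 1) := fun p => by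
    rw [Real.rpow_add_one D0.ne']; ring
  -- One factor X^s is split by X ≤ Y + D. The part with D^{s+1} has half a derivative too much on
  -- η, and D^{1/2} is handed back to X and Y.
  have A1 : D * (X ^ (2 * s - 2) * X ^ (2 : ℝ)) ≤ 2 ^ s * (T1 + (4 * T2 + 2 * T3)) := by
    have hXs : X ^ s ≤ 2 ^ s * (Y ^ s + D ^ s) :=
      rpow_le_two_rpow_mul_add X0.le Y0.le D0.le h1 (by linarith)
    have e : X ^ (2 * s - 2) * X ^ (2 : ℝ) = X ^ s * X ^ s := by
      rw [← Real.rpow_add X0, ← Real.rpow_add X0]; congr 1; ring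
    have hDp : D ^ (1 / 2 : ℝ) ≤ 2 ^ (1 / 2 : ℝ) * (X ^ (1 / 2 : ℝ) + Y ^ (1 / 2 : ℝ)) :=
      rpow_le_two_rpow_mul_add D0.le X0.le Y0.le h3 (by norm_num)
    have h22 : (2 : ℝ) ^ (1 / 2 : ℝ) ≤ 2 := by
      calc (2 : ℝ) ^ (1 / 2 : ℝ) ≤ 2 ^ (1 : ℝ) :=
            Real.rpow_le_rpow_of_exponent_le (by norm_num) (by norm_num)
        _ = 2 := by norm_num
    have hB : X ^ s * (D * D ^ s) ≤ 4 * T2 + 2 * T3 := by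
      have e2 : D * D ^ s = D ^ (s + 1 / 2) * D ^ (1 / 2 : ℝ) := by
        rw [mulD, ← Real.rpow_add D0]; congr 1; ring
      have e3 : X ^ s * X ^ (1 / 2 : ℝ) = X ^ (s + 1 / 2) := by rw [← Real.rpow_add X0]
      have hXY : X ^ s * Y ^ (1 / 2 : ℝ) ≤ X ^ (s + 1 / 2) + X ^ (1 / 2 : ℝ) * Y ^ s := by
        rcases le_total Y X with h | h
        · have : Y ^ (1 / 2 : ℝ) ≤ X ^ (1 / 2 : ℝ) := by gcongr
          have : X ^ s * Y ^ (1 / 2 : ℝ) ≤ X ^ s * X ^ (1 / 2 : ℝ) := by gcongr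
          have : 0 ≤ X ^ (1 / 2 : ℝ) * Y ^ s := by positivity
          linarith
        · have := rpow_mul_rpow_le_shift X0 h (by linarith : 1 / 2 ≤ s)
            (by ring : s + 1 / 2 = 1 / 2 + s)
          have : 0 ≤ X ^ (s + 1 / 2) := by positivity
          linarith
      calc X ^ s * (D * D ^ s) = D ^ (s + 1 / 2) * (X ^ s * D ^ (1 / 2 : ℝ)) := by rw [e2]; ring
        _ ≤ D ^ (s + 1 / 2) * (X ^ s * (2 * (X ^ (1 / 2 : ℝ) + Y ^ (1 / 2 : ℝ)))) := by
            gcongr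
            exact hDp.trans (by gcongr)
        _ = D ^ (s + 1 / 2) * (2 * (X ^ (s + 1 / 2) + X ^ s * Y ^ (1 / 2 : ℝ))) := by
            rw [← e3]; ring
        _ ≤ D ^ (s + 1 / 2) *
            (2 * (X ^ (s + 1 / 2) + (X ^ (s + 1 / 2) + X ^ (1 / 2 : ℝ) * Y ^ s))) := by gcongr
        _ = _ := by rw [hT2, hT3]; ring
    calc D * (X ^ (2 * s - 2) * X ^ (2 : ℝ)) = D * X ^ s * X ^ s := by rw [e]; ring
      _ ≤ D * X ^ s * (2 ^ s * (Y ^ s + D ^ s)) := by gcongr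
      _ = 2 ^ s * (T1 + X ^ s * (D * D ^ s)) := by rw [hT1]; ring
      _ ≤ _ := by gcongr
  -- If Y ≤ X, the excess of 2s − 2 over s moves from Y to X. Otherwise Y^{s-2} is split by Y ≤ X +
  -- D. Both cases rely on s ≥ 2.
  have A2 : D * (Y ^ (2 * s - 2) * X ^ (2 : ℝ)) ≤ 2 ^ s * (T1 + (T1 + T3)) := by
    have h2s : (1 : ℝ) ≤ 2 ^ s := Real.one_le_rpow (by norm_num) (by linarith)
    rcases le_total Y X with h | h
    · have := rpow_mul_rpow_le_shift Y0 h (by linarith : s ≤ 2 * s - 2)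
        (by ring : 2 * s - 2 + 2 = s + s)
      calc D * (Y ^ (2 * s - 2) * X ^ (2 : ℝ)) ≤ D * (Y ^ s * X ^ s) := by gcongr
        _ = 1 * T1 := by rw [hT1]; ring
        _ ≤ 2 ^ s * (T1 + (T1 + T3)) := by gcongr; linarith
    · have e1 : Y ^ (2 * s - 2) = Y ^ s * Y ^ (s - 2) := by
        rw [← Real.rpow_add Y0]; congr 1; ring
      have e2 : X ^ (s - 2) * X ^ (2 : ℝ) = X ^ s := by rw [← Real.rpow_add X0]; congr 1; ring
      have hY2 : Y ^ (s - 2) ≤ 2 ^ (s - 2) * (X ^ (s - 2) + D ^ (s - 2)) :=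
        rpow_le_two_rpow_mul_add Y0.le X0.le D0.le h2 (by linarith)
      have h22 : (2 : ℝ) ^ (s - 2) ≤ 2 ^ s :=
        Real.rpow_le_rpow_of_exponent_le (by norm_num) (by linarith)
      have hB : Y ^ s * (D * D ^ (s - 2) * X ^ (2 : ℝ)) ≤ T1 + T3 := by
        rcases le_total D X with h' | h'
        · have : D ^ (s - 2) ≤ X ^ (s - 2) := Real.rpow_le_rpow D0.le h' (by linarith)
          calc Y ^ s * (D * D ^ (s - 2) * X ^ (2 : ℝ))
              ≤ Y ^ s * (D * X ^ (s - 2) * X ^ (2 : ℝ)) := by gcongr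
            _ = T1 := by rw [hT1, ← e2]; ring
            _ ≤ _ := by linarith
        · have := rpow_mul_rpow_le_shift X0 h' (by norm_num : (1 / 2 : ℝ) ≤ 2)
            (by ring : 2 + (s - 2 + 1) = 1 / 2 + (s + 1 / 2))
          calc Y ^ s * (D * D ^ (s - 2) * X ^ (2 : ℝ))
              = Y ^ s * (X ^ (2 : ℝ) * D ^ (s - 2 + 1)) := by rw [mulD]; ring
            _ ≤ Y ^ s * (X ^ (1 / 2 : ℝ) * D ^ (s + 1 / 2)) := by gcongr
            _ = T3 := by rw [hT3]; ring
            _ ≤ _ := by linarith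
      calc D * (Y ^ (2 * s - 2) * X ^ (2 : ℝ))
          = D * (Y ^ s * Y ^ (s - 2) * X ^ (2 : ℝ)) := by rw [e1]
        _ ≤ D * (Y ^ s * (2 ^ s * (X ^ (s - 2) + D ^ (s - 2))) * X ^ (2 : ℝ)) := by
            gcongr
            exact hY2.trans (by gcongr)
        _ = 2 ^ s * (Y ^ s * (X ^ (s - 2) * X ^ (2 : ℝ)) * D
              + Y ^ s * (D * D ^ (s - 2) * X ^ (2 : ℝ))) := by ring
        _ ≤ 2 ^ s * (T1 + (T1 + T3)) := by
            gcongr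
            rw [e2, hT1]; exact le_of_eq (by ring)
  have h4 : (2 : ℝ) ^ (s + 2) = 2 ^ s * 4 := by
    rw [Real.rpow_add (by norm_num)]; norm_num
  rw [h4]
  have h5 : (0 : ℝ) < 2 ^ s := by positivity
  calc _ = D * (X ^ (2 * s - 2) * X ^ (2 : ℝ)) + D * (Y ^ (2 * s - 2) * X ^ (2 : ℝ)) := by ring
    _ ≤ 2 ^ s * (T1 + (4 * T2 + 2 * T3)) + 2 ^ s * (T1 + (T1 + T3)) := add_le_add A1 A2
    _ = 2 ^ s * (3 * T1 + 4 * T2 + 3 * T3) := by ring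
    _ ≤ _ := by
      rw [mul_assoc]
      refine mul_le_mul_of_nonneg_left ?_ h5.le
      linarith

theorem commutator_symbol_le {s e M : ℝ} (hs : 2 ≤ s) (he : 0 ≤ e) (he1 : e ≤ 1) (hM : 1 ≤ M)
    (x y : ℝ) : x ^ 2 * |modA s e M y - modA s e M x| ≤
      (4 * s + 4) * 2 ^ (s + 2) * (jw s x * jw s y * jw 1 (x - y)
        + jw (s + 1 / 2) x * jw (s + 1 / 2) (x - y)
        + jw s y * jw (s + 1 / 2) (x - y) * jw (1 / 2) x) := by
  have h1 := abs_modA_sub_le (by linarith : 1 ≤ s) he he1 hM x y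
  have h2 := commutator_weight_le hs (one_le_jw zero_le_one x) (one_le_jw zero_le_one y)
    (one_le_jw zero_le_one (x - y)) ((jw_one_le_add x y).trans (by linarith))
    (jw_one_le_add' x y) (jw_one_sub_le x y)
  simp only [← jw_eq_rpow] at h2
  have h3 : x ^ 2 ≤ jw 2 x := by rw [jw_two]; linarith
  have h4 := abs_le_jw_one (x - y)
  have p1 := jw_nonneg (2 * s - 2) x
  have p2 := jw_nonneg (2 * s - 2) y
  have p3 := jw_nonneg 2 x
  calc x ^ 2 * |modA s e M y - modA s e M x|
      ≤ jw 2 x * ((4 * s + 4) * (jw (2 * s - 2) x + jw (2 * s - 2) y) * jw 1 (x - y)) := by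
        refine mul_le_mul h3 (h1.trans ?_) (abs_nonneg _) p3
        gcongr
    _ = (4 * s + 4) * (jw 1 (x - y) * (jw (2 * s - 2) x + jw (2 * s - 2) y) * jw 2 x) := by ring
    _ ≤ _ := by rw [mul_assoc (4 * s + 4)]; gcongr

@[fun_prop]
theorem measurable_regW (s e : ℝ) : Measurable (regW s e) := by
  unfold regW; fun_prop

@[fun_prop]
theorem measurable_modA (s e M : ℝ) : Measurable (modA s e M) := by
  unfold modA
  have := continuous_tanh.measurable
  fun_prop

/-! ### Weighted norms and convolutions -/

/-- The weighted norm `‖⟨2πξ⟩^σ F‖_{L²}`. -/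
noncomputable def sn (σ : ℝ) (F : ℝ → ℂ) : ℝ≥0∞ :=
  eLpNorm (fun ξ : ℝ => ((jw σ (2 * π * ξ) : ℝ) : ℂ) * F ξ) 2 volume

theorem sobolevENorm_eq_sn (σ : ℝ) (f : L2R) : sobolevENorm σ f = sn σ (𝓕 f : L2R) := rfl

/-- The nonnegative function `⟨2πξ⟩^σ |F|`. -/
noncomputable def wn (σ : ℝ) (F : ℝ → ℂ) (ξ : ℝ) : ℝ≥0∞ :=
  ENNReal.ofReal (jw σ (2 * π * ξ)) * ‖F ξ‖ₑ

theorem sn_eq_eLpNorm_wn (σ : ℝ) (F : ℝ → ℂ) : sn σ F = eLpNorm (wn σ F) 2 volume := by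
  unfold sn wn
  refine eLpNorm_congr_enorm_ae (ae_of_all _ fun ξ => ?_)
  rw [enorm_mul, enorm_eq_self, ← ofReal_norm (_ : ℂ), Complex.norm_real, Real.norm_eq_abs,
    abs_of_pos (jw_pos _ _)]

@[fun_prop]
theorem measurable_wn (σ : ℝ) {F : ℝ → ℂ} (hF : Measurable F) : Measurable (wn σ F) := by
  unfold wn
  have : Measurable fun ξ : ℝ => jw σ (2 * π * ξ) := by fun_prop
  fun_prop

theorem eLpNorm_two_eq_lintegral (f : ℝ → ℝ≥0∞) :
    eLpNorm f 2 volume = (∫⁻ ξ, f ξ ^ (2 : ℝ)) ^ (1 / 2 : ℝ) := by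
  rw [eLpNorm_eq_lintegral_rpow_enorm_toReal (by norm_num) (by norm_num)]
  simp

theorem lintegral_mul_le_eLpNorm_two {f g : ℝ → ℝ≥0∞} (hf : Measurable f) (hg : Measurable g) :
    ∫⁻ ξ, f ξ * g ξ ≤ eLpNorm f 2 volume * eLpNorm g 2 volume := by
  rw [eLpNorm_two_eq_lintegral, eLpNorm_two_eq_lintegral]
  exact ENNReal.lintegral_mul_le_Lp_mul_Lq volume Real.HolderConjugate.two_two hf.aemeasurable
    hg.aemeasurable

/-- Convolution of nonnegative functions. -/
noncomputable def lconv (f g : ℝ → ℝ≥0∞) (ξ : ℝ) : ℝ≥0∞ := ∫⁻ ζ, f (ξ - ζ) * g ζ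

@[fun_prop]
theorem measurable_lconv {f g : ℝ → ℝ≥0∞} (hf : Measurable f) (hg : Measurable g) :
    Measurable (lconv f g) := by
  unfold lconv
  exact Measurable.lintegral_prod_right' (f := fun p : ℝ × ℝ => f (p.1 - p.2) * g p.2) (by fun_prop)

theorem lconv_comm (f g : ℝ → ℝ≥0∞) : lconv f g = lconv g f := by
  ext ξ
  unfold lconv
  rw [← lintegral_sub_left_eq_self (fun ζ => f (ξ - ζ) * g ζ) ξ]
  simp [mul_comm]

theorem lintegral_lconv {f g : ℝ → ℝ≥0∞} (hf : Measurable f) (hg : Measurable g) :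
    ∫⁻ ξ, lconv f g ξ = (∫⁻ ξ, f ξ) * ∫⁻ ξ, g ξ := by
  unfold lconv
  rw [lintegral_lintegral_swap (by fun_prop)]
  have : ∀ ζ, ∫⁻ ξ, f (ξ - ζ) * g ζ = (∫⁻ ξ, f ξ) * g ζ := fun ζ => by
    rw [lintegral_mul_const _ (by fun_prop), lintegral_sub_right_eq_self f ζ]
  simp_rw [this]
  rw [lintegral_const_mul _ hg]

theorem lconv_le_eLpNorm_two {f g : ℝ → ℝ≥0∞} (hf : Measurable f) (hg : Measurable g) (ξ : ℝ) :
    lconv f g ξ ≤ eLpNorm f 2 volume * eLpNorm g 2 volume := by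
  refine (lintegral_mul_le_eLpNorm_two (f := fun ζ => f (ξ - ζ)) (by fun_prop) hg).trans_eq ?_
  congr 1
  rw [eLpNorm_two_eq_lintegral, eLpNorm_two_eq_lintegral,
    lintegral_sub_left_eq_self (fun ζ => f ζ ^ (2 : ℝ)) ξ]

/-- Young's inequality `‖f ⋆ g‖₂ ≤ ‖f‖₁ ‖g‖₂`. -/
theorem eLpNorm_lconv_le {f g : ℝ → ℝ≥0∞} (hf : Measurable f) (hg : Measurable g) :
    eLpNorm (lconv f g) 2 volume ≤ (∫⁻ ξ, f ξ) * eLpNorm g 2 volume := by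
  have hpt : ∀ ξ, lconv f g ξ ^ (2 : ℝ) ≤ (∫⁻ ξ, f ξ) * lconv f (fun ζ => g ζ ^ (2 : ℝ)) ξ := by
    intro ξ
    -- Cauchy–Schwarz for the measure f(ξ − ζ) dζ: each factor receives one square root of f.
    have e : lconv f g ξ = ∫⁻ ζ, f (ξ - ζ) ^ (1 / 2 : ℝ) * (f (ξ - ζ) ^ (1 / 2 : ℝ) * g ζ) := by
      unfold lconv
      refine lintegral_congr fun ζ => ?_
      rw [← mul_assoc, ← ENNReal.rpow_add_of_nonneg _ _ (by norm_num) (by norm_num)]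
      norm_num
    have h := lintegral_mul_le_eLpNorm_two (f := fun ζ => f (ξ - ζ) ^ (1 / 2 : ℝ))
      (g := fun ζ => f (ξ - ζ) ^ (1 / 2 : ℝ) * g ζ) (by fun_prop) (by fun_prop)
    rw [← e, eLpNorm_two_eq_lintegral, eLpNorm_two_eq_lintegral] at h
    have h' := ENNReal.rpow_le_rpow h (by norm_num : (0 : ℝ) ≤ 2)
    rw [ENNReal.mul_rpow_of_nonneg _ _ (by norm_num), ← ENNReal.rpow_mul, ← ENNReal.rpow_mul] at h'
    simp only [ENNReal.mul_rpow_of_nonneg _ _ (by norm_num : (0 : ℝ) ≤ 2),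
      ← ENNReal.rpow_mul] at h'
    norm_num at h'
    rw [lintegral_sub_left_eq_self f ξ] at h'
    exact_mod_cast h'
  rw [eLpNorm_two_eq_lintegral, eLpNorm_two_eq_lintegral]
  have h2 : ∫⁻ ξ, lconv f g ξ ^ (2 : ℝ) ≤ (∫⁻ ξ, f ξ) ^ (2 : ℝ) * ∫⁻ ξ, g ξ ^ (2 : ℝ) := by
    refine (lintegral_mono hpt).trans_eq ?_
    rw [lintegral_const_mul _ (by fun_prop), lintegral_lconv hf (by fun_prop), ← mul_assoc]
    congr 1
    rw [ENNReal.rpow_two, sq]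
  refine (ENNReal.rpow_le_rpow h2 (by norm_num)).trans_eq ?_
  rw [ENNReal.mul_rpow_of_nonneg _ _ (by norm_num), ← ENNReal.rpow_mul]
  norm_num

theorem eLpNorm_lconv_le' {f g : ℝ → ℝ≥0∞} (hf : Measurable f) (hg : Measurable g) :
    eLpNorm (lconv f g) 2 volume ≤ eLpNorm f 2 volume * ∫⁻ ξ, g ξ := by
  rw [lconv_comm, mul_comm]; exact eLpNorm_lconv_le hg hf

/-- This and the next two bounds differ in the factor that is put in L¹, the other two being in L².
The commutator needs all three, according to which factor has a derivative to spare. -/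
theorem lintegral_mul_lconv_le₁ {f g k : ℝ → ℝ≥0∞} (hf : Measurable f) (hg : Measurable g)
    (hk : Measurable k) : ∫⁻ ξ, f ξ * lconv g k ξ ≤
      eLpNorm f 2 volume * ((∫⁻ ξ, g ξ) * eLpNorm k 2 volume) :=
  (lintegral_mul_le_eLpNorm_two hf (by fun_prop)).trans (by gcongr; exact eLpNorm_lconv_le hg hk)

theorem lintegral_mul_lconv_le₂ {f g k : ℝ → ℝ≥0∞} (hf : Measurable f) (hg : Measurable g)
    (hk : Measurable k) : ∫⁻ ξ, f ξ * lconv g k ξ ≤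
      eLpNorm f 2 volume * (eLpNorm g 2 volume * ∫⁻ ξ, k ξ) :=
  (lintegral_mul_le_eLpNorm_two hf (by fun_prop)).trans (by gcongr; exact eLpNorm_lconv_le' hg hk)

theorem lintegral_mul_lconv_le₃ {f g k : ℝ → ℝ≥0∞} (hf : Measurable f) (hg : Measurable g)
    (hk : Measurable k) : ∫⁻ ξ, f ξ * lconv g k ξ ≤
      (∫⁻ ξ, f ξ) * (eLpNorm g 2 volume * eLpNorm k 2 volume) := by
  rw [← lintegral_mul_const _ hf]
  exact lintegral_mono fun ξ => by gcongr; exact lconv_le_eLpNorm_two hg hk ξ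

/-! ### Weighted norms -/

theorem eLpNorm_jw_neg_one_lt_top :
    eLpNorm (fun ξ : ℝ => ENNReal.ofReal (jw (-1) (2 * π * ξ))) 2 volume < ∞ := by
  rw [eLpNorm_two_eq_lintegral]
  refine ENNReal.rpow_lt_top_of_nonneg (by norm_num) (ne_of_lt ?_)
  have : ∀ ξ : ℝ, ENNReal.ofReal (jw (-1) (2 * π * ξ)) ^ (2 : ℝ)
      = ENNReal.ofReal ((1 + (2 * π * ξ) ^ 2)⁻¹) := fun ξ => by
    rw [ENNReal.rpow_two, ← ENNReal.ofReal_pow (jw_nonneg _ _), sq, ← jw_add,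
      show (-1 : ℝ) + -1 = -2 by norm_num, eq_inv_of_mul_eq_one_right (jw_mul_neg 2 _), jw_two]
  simp_rw [this]
  have h : Integrable fun ξ : ℝ => (1 + (2 * π * ξ) ^ 2)⁻¹ :=
    integrable_inv_one_add_sq.comp_mul_left' (R := 2 * π) (by positivity)
  exact (hasFiniteIntegral_iff_ofReal (ae_of_all _ fun ξ => by positivity)).1 h.2

/-- The norm of `⟨2πξ⟩^{-1}` in `L²`. -/
noncomputable def cJ : ℝ≥0 :=
  (eLpNorm (fun ξ : ℝ => ENNReal.ofReal (jw (-1) (2 * π * ξ))) 2 volume).toNNReal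

theorem coe_cJ : (cJ : ℝ≥0∞) =
    eLpNorm (fun ξ : ℝ => ENNReal.ofReal (jw (-1) (2 * π * ξ))) 2 volume :=
  ENNReal.coe_toNNReal eLpNorm_jw_neg_one_lt_top.ne

theorem wn_add (σ τ : ℝ) (F : ℝ → ℂ) (ξ : ℝ) :
    wn (σ + τ) F ξ = ENNReal.ofReal (jw σ (2 * π * ξ)) * wn τ F ξ := by
  unfold wn; rw [jw_add, ENNReal.ofReal_mul (jw_nonneg _ _), mul_assoc]

theorem sn_mono {σ τ : ℝ} (h : σ ≤ τ) (F : ℝ → ℂ) : sn σ F ≤ sn τ F := by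
  rw [sn_eq_eLpNorm_wn, sn_eq_eLpNorm_wn]
  refine eLpNorm_mono_enorm fun ξ => ?_
  simp only [enorm_eq_self, wn]
  gcongr
  exact jw_le_jw h _

theorem sn_zero_eq (F : ℝ → ℂ) : sn 0 F = eLpNorm F 2 volume := by
  unfold sn; simp [jw_zero]

/-- Cauchy–Schwarz against ⟨x⟩⁻¹, which is square integrable on the line. It replaces the Sobolev
embedding: one derivative in L² puts the Fourier transform in L¹. -/
theorem lintegral_wn_le {α β : ℝ} (h : α + 1 ≤ β) {F : ℝ → ℂ} (hF : Measurable F) :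
    ∫⁻ ξ, wn α F ξ ≤ cJ * sn β F := by
  have : ∀ ξ, wn α F ξ = ENNReal.ofReal (jw (-1) (2 * π * ξ)) * wn (α + 1) F ξ := fun ξ => by
    rw [← wn_add]; congr 1; ring
  simp_rw [this]
  refine (lintegral_mul_le_eLpNorm_two (by fun_prop) (by fun_prop)).trans ?_
  rw [← coe_cJ, ← sn_eq_eLpNorm_wn]
  gcongr
  exact sn_mono h F

/-- Cauchy–Schwarz with weights. -/
theorem lintegral_enorm_mul_le (α : ℝ) {F G : ℝ → ℂ} (hF : Measurable F) (hG : Measurable G) :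
    ∫⁻ ξ, ‖F ξ‖ₑ * ‖G ξ‖ₑ ≤ sn α F * sn (-α) G := by
  have : ∀ ξ, ‖F ξ‖ₑ * ‖G ξ‖ₑ = wn α F ξ * wn (-α) G ξ := fun ξ => by
    unfold wn
    have : ENNReal.ofReal (jw α (2 * π * ξ)) * ENNReal.ofReal (jw (-α) (2 * π * ξ)) = 1 := by
      rw [← ENNReal.ofReal_mul (jw_nonneg _ _), jw_mul_neg, ENNReal.ofReal_one]
    calc ‖F ξ‖ₑ * ‖G ξ‖ₑ = 1 * (‖F ξ‖ₑ * ‖G ξ‖ₑ) := by rw [one_mul]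
      _ = _ := by rw [← this]; ring
  simp_rw [this]
  rw [sn_eq_eLpNorm_wn, sn_eq_eLpNorm_wn]
  exact lintegral_mul_le_eLpNorm_two (by fun_prop) (by fun_prop)

theorem sn_le_of_ae_le {σ τ C : ℝ} {F G : ℝ → ℂ}
    (h : ∀ᵐ ξ, jw σ (2 * π * ξ) * ‖F ξ‖ ≤ C * (jw τ (2 * π * ξ) * ‖G ξ‖)) :
    sn σ F ≤ ENNReal.ofReal C * sn τ G := by
  unfold sn
  refine eLpNorm_le_mul_eLpNorm_of_ae_le_mul ?_ 2
  filter_upwards [h] with ξ hξ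
  simpa [abs_of_pos (jw_pos _ _)] using hξ

theorem sn_mul_le {σ τ C : ℝ} {m F : ℝ → ℂ} (h : ∀ ξ, ‖m ξ‖ ≤ C * jw τ (2 * π * ξ)) :
    sn σ (fun ξ => m ξ * F ξ) ≤ ENNReal.ofReal C * sn (σ + τ) F := by
  refine sn_le_of_ae_le (ae_of_all _ fun ξ => ?_)
  rw [jw_add, norm_mul]
  have := jw_nonneg σ (2 * π * ξ)
  calc jw σ (2 * π * ξ) * (‖m ξ‖ * ‖F ξ‖)
      ≤ jw σ (2 * π * ξ) * (C * jw τ (2 * π * ξ) * ‖F ξ‖) := by gcongr; exact h ξ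
    _ = _ := by ring

theorem sn_congr {σ : ℝ} {F G : ℝ → ℂ} (h : F =ᵐ[volume] G) : sn σ F = sn σ G := by
  unfold sn
  refine eLpNorm_congr_ae ?_
  filter_upwards [h] with ξ hξ
  rw [hξ]

theorem sn_add_le {σ : ℝ} {F G : ℝ → ℂ} (hF : Measurable F) (hG : Measurable G) :
    sn σ (fun ξ => F ξ + G ξ) ≤ sn σ F + sn σ G := by
  unfold sn
  have m : Measurable fun ξ : ℝ => ((jw σ (2 * π * ξ) : ℝ) : ℂ) := by fun_prop
  refine le_of_eq_of_le ?_ (eLpNorm_add_le (m.mul hF).aestronglyMeasurable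
    (m.mul hG).aestronglyMeasurable (by norm_num))
  congr 1
  ext ξ
  simp [mul_add]

theorem sn_neg {σ : ℝ} (F : ℝ → ℂ) : sn σ (fun ξ => - F ξ) = sn σ F := by
  unfold sn
  refine eLpNorm_congr_enorm_ae (ae_of_all _ fun ξ => by simp)

theorem sn_sub_le {σ : ℝ} {F G : ℝ → ℂ} (hF : Measurable F) (hG : Measurable G) :
    sn σ (fun ξ => F ξ - G ξ) ≤ sn σ F + sn σ G := by
  simp_rw [sub_eq_add_neg]
  rw [← sn_neg G]
  exact sn_add_le hF hG.neg

/-! ### Convolution of complex functions -/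

/-- The convolution `∫ F(ξ - ζ) G(ζ) dζ`. -/
noncomputable def conv (F G : ℝ → ℂ) (ξ : ℝ) : ℂ := ∫ ζ, F (ξ - ζ) * G ζ

@[fun_prop]
theorem measurable_conv {F G : ℝ → ℂ} (hF : Measurable F) (hG : Measurable G) :
    Measurable (conv F G) := by
  unfold conv
  refine StronglyMeasurable.measurable ?_
  exact StronglyMeasurable.integral_prod_right (f := fun ξ ζ => F (ξ - ζ) * G ζ)
    (Measurable.stronglyMeasurable (by fun_prop))

theorem enorm_conv_le (F G : ℝ → ℂ) (ξ : ℝ) :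
    ‖conv F G ξ‖ₑ ≤ lconv (fun ζ => ‖F ζ‖ₑ) (fun ζ => ‖G ζ‖ₑ) ξ := by
  unfold conv lconv
  refine (enorm_integral_le_lintegral_enorm _).trans_eq ?_
  simp only [enorm_mul]

theorem conv_comm (F G : ℝ → ℂ) : conv F G = conv G F := by
  ext ξ
  unfold conv
  rw [← integral_sub_left_eq_self (fun ζ => F (ξ - ζ) * G ζ) volume ξ]
  simp [mul_comm]

/-- Peetre's inequality under the integral plays the role of the Leibniz rule: the weight falls on
one factor or the other. -/
theorem wn_conv_le {σ : ℝ} (hσ : 0 ≤ σ) {F G : ℝ → ℂ} (hF : Measurable F) (hG : Measurable G)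
    (ξ : ℝ) : wn σ (conv F G) ξ ≤ ENNReal.ofReal (2 ^ σ) *
      (lconv (wn σ F) (wn 0 G) ξ + lconv (wn 0 F) (wn σ G) ξ) := by
  have hw : ∀ H, wn 0 H = fun ζ => ‖H ζ‖ₑ := fun H => by ext; simp [wn, jw_zero]
  rw [hw, hw]
  calc wn σ (conv F G) ξ ≤ ENNReal.ofReal (jw σ (2 * π * ξ)) *
        lconv (fun ζ => ‖F ζ‖ₑ) (fun ζ => ‖G ζ‖ₑ) ξ := by
        unfold wn; gcongr; exact enorm_conv_le F G ξ
    _ = ∫⁻ ζ, ENNReal.ofReal (jw σ (2 * π * ξ)) * (‖F (ξ - ζ)‖ₑ * ‖G ζ‖ₑ) := by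
        unfold lconv; rw [lintegral_const_mul _ (by fun_prop)]
    _ ≤ ∫⁻ ζ, ENNReal.ofReal (2 ^ σ) * (wn σ F (ξ - ζ) * ‖G ζ‖ₑ + ‖F (ξ - ζ)‖ₑ * wn σ G ζ) := by
        refine lintegral_mono fun ζ => ?_
        have h := jw_le_two_rpow_mul hσ (2 * π * ξ) (2 * π * ζ)
        rw [← mul_sub] at h
        have h' := ENNReal.ofReal_le_ofReal h
        rw [ENNReal.ofReal_mul (by positivity),
          ENNReal.ofReal_add (jw_nonneg _ _) (jw_nonneg _ _)] at h'
        unfold wn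
        calc _ ≤ _ := mul_le_mul_left h' _
          _ = _ := by ring
    _ = _ := by
        rw [lintegral_const_mul _ (by fun_prop), lintegral_add_left (by fun_prop)]
        rfl

/-- The constant in the product estimate. -/
noncomputable def cP (σ : ℝ) : ℝ≥0 := (2 : ℝ≥0) ^ σ * cJ

theorem coe_cP (σ : ℝ) : (cP σ : ℝ≥0∞) = ENNReal.ofReal (2 ^ σ) * cJ := by
  unfold cP
  rw [ENNReal.coe_mul]
  congr 1
  rw [← ENNReal.ofReal_coe_nnreal]; simp

/-- After the Leibniz rule, Young's inequality puts the factor without weight in L¹. The bound is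
linear in the high norms, so a single √κ can be attached to whichever factor carries s + 1/2
derivatives. -/
theorem sn_conv_le_tame {σ : ℝ} (hσ : 0 ≤ σ) {F G : ℝ → ℂ} (hF : Measurable F)
    (hG : Measurable G) : sn σ (conv F G) ≤ cP σ * (sn σ F * sn 1 G + sn 1 F * sn σ G) := by
  rw [sn_eq_eLpNorm_wn]
  calc eLpNorm (wn σ (conv F G)) 2 volume
      ≤ ENNReal.ofReal (2 ^ σ) *
        eLpNorm (fun ξ => lconv (wn σ F) (wn 0 G) ξ + lconv (wn 0 F) (wn σ G) ξ) 2 volume := by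
        have := eLpNorm_le_nnreal_smul_eLpNorm_of_ae_le_mul' (μ := volume)
          (f := wn σ (conv F G)) (c := Real.toNNReal (2 ^ σ))
          (g := fun ξ => lconv (wn σ F) (wn 0 G) ξ + lconv (wn 0 F) (wn σ G) ξ)
          (ae_of_all _ fun ξ => wn_conv_le hσ hF hG ξ) 2
        rwa [ENNReal.smul_def, smul_eq_mul] at this
    _ ≤ ENNReal.ofReal (2 ^ σ) * (eLpNorm (lconv (wn σ F) (wn 0 G)) 2 volume
          + eLpNorm (lconv (wn 0 F) (wn σ G)) 2 volume) := by
        gcongr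
        exact eLpNorm_add_le (by fun_prop) (by fun_prop) (by norm_num)
    _ ≤ ENNReal.ofReal (2 ^ σ) * (sn σ F * (cJ * sn 1 G) + (cJ * sn 1 F) * sn σ G) := by
        gcongr
        · refine (eLpNorm_lconv_le' (by fun_prop) (by fun_prop)).trans ?_
          rw [← sn_eq_eLpNorm_wn]
          gcongr
          exact lintegral_wn_le (by norm_num) hG
        · refine (eLpNorm_lconv_le (by fun_prop) (by fun_prop)).trans ?_
          rw [← sn_eq_eLpNorm_wn]
          gcongr
          exact lintegral_wn_le (by norm_num) hF
    _ = _ := by rw [coe_cP]; ring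

theorem sn_conv_le {σ : ℝ} (hσ : 1 ≤ σ) {F G : ℝ → ℂ} (hF : Measurable F)
    (hG : Measurable G) : sn σ (conv F G) ≤ 2 * cP σ * (sn σ F * sn σ G) := by
  refine (sn_conv_le_tame (by linarith) hF hG).trans ?_
  calc _ ≤ cP σ * (sn σ F * sn σ G + sn σ F * sn σ G) := by
        gcongr <;> exact sn_mono hσ _
    _ = _ := by ring

/-- The product estimate for a factor with one more derivative. -/
theorem sn_conv_le_left {σ : ℝ} (hσ : 0 ≤ σ) {F G : ℝ → ℂ} (hF : Measurable F)
    (hG : Measurable G) : sn σ (conv F G) ≤ 2 * cP σ * (sn (σ + 1) F * sn σ G) := by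
  rw [sn_eq_eLpNorm_wn]
  have hle : ∀ (H : ℝ → ℂ) ξ, wn 0 H ξ ≤ wn σ H ξ := fun H ξ => by
    unfold wn; gcongr; exact jw_le_jw hσ _
  have hpt : ∀ ξ, wn σ (conv F G) ξ ≤
      ((2 * (2 : ℝ≥0) ^ σ : ℝ≥0) : ℝ≥0∞) * lconv (wn σ F) (wn σ G) ξ := fun ξ => by
    refine (wn_conv_le hσ hF hG ξ).trans ?_
    calc _ ≤ ENNReal.ofReal (2 ^ σ) *
          (lconv (wn σ F) (wn σ G) ξ + lconv (wn σ F) (wn σ G) ξ) := by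
          unfold lconv
          gcongr <;> exact hle _ _
      _ = _ := by
          rw [ENNReal.coe_mul, ← two_mul]
          have : ENNReal.ofReal (2 ^ σ) = (((2 : ℝ≥0) ^ σ : ℝ≥0) : ℝ≥0∞) := by
            rw [← ENNReal.ofReal_coe_nnreal]; simp
          rw [this]; push_cast; ring
  have h := eLpNorm_le_nnreal_smul_eLpNorm_of_ae_le_mul' (μ := volume)
    (f := wn σ (conv F G)) (g := lconv (wn σ F) (wn σ G)) (ae_of_all _ hpt) 2
  rw [ENNReal.smul_def, smul_eq_mul] at h
  refine h.trans ?_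
  calc _ ≤ ((2 * (2 : ℝ≥0) ^ σ : ℝ≥0) : ℝ≥0∞) * ((cJ * sn (σ + 1) F) * sn σ G) := by
        gcongr
        refine (eLpNorm_lconv_le (by fun_prop) (by fun_prop)).trans ?_
        rw [← sn_eq_eLpNorm_wn]
        gcongr
        exact lintegral_wn_le le_rfl hF
    _ = _ := by unfold cP; push_cast; ring

theorem measurable_L2 (f : L2R) : Measurable (f : ℝ → ℂ) := (Lp.stronglyMeasurable f).measurable

theorem integrable_conv {F G : ℝ → ℂ} (hF : Measurable F) (hG : Measurable G)
    (h1 : sn 0 F < ∞) (h2 : sn 0 G < ∞) (ξ : ℝ) : Integrable fun ζ => F (ξ - ζ) * G ζ := by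
  refine ⟨(by fun_prop : Measurable _).aestronglyMeasurable, ?_⟩
  have h := lconv_le_eLpNorm_two (f := wn 0 F) (g := wn 0 G) (by fun_prop) (by fun_prop) ξ
  rw [← sn_eq_eLpNorm_wn, ← sn_eq_eLpNorm_wn] at h
  refine lt_of_le_of_lt (le_of_eq_of_le ?_ h) (ENNReal.mul_lt_top h1 h2)
  simp [lconv, wn, jw_zero]

theorem conv_congr {F F' G G' : ℝ → ℂ} (hF : F =ᵐ[volume] F') (hG : G =ᵐ[volume] G') :
    conv F G = conv F' G' := by
  ext ξ
  unfold conv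
  refine integral_congr_ae ?_
  have hF' : (fun ζ => F (ξ - ζ)) =ᵐ[volume] fun ζ => F' (ξ - ζ) :=
    (Measure.measurePreserving_sub_left volume ξ).quasiMeasurePreserving.ae_eq_comp hF
  filter_upwards [hF', hG] with ζ h1 h2
  rw [h1, h2]

theorem conv_add_left {F F' G : ℝ → ℂ} (hF : Measurable F) (hF' : Measurable F')
    (hG : Measurable G) (h1 : sn 0 F < ∞) (h1' : sn 0 F' < ∞) (h2 : sn 0 G < ∞) (ξ : ℝ) :
    conv (fun ζ => F ζ + F' ζ) G ξ = conv F G ξ + conv F' G ξ := by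
  unfold conv
  rw [← integral_add (integrable_conv hF hG h1 h2 ξ) (integrable_conv hF' hG h1' h2 ξ)]
  simp only [add_mul]

theorem conv_add_right {F G G' : ℝ → ℂ} (hF : Measurable F) (hG : Measurable G)
    (hG' : Measurable G') (h1 : sn 0 F < ∞) (h2 : sn 0 G < ∞) (h2' : sn 0 G' < ∞) (ξ : ℝ) :
    conv F (fun ζ => G ζ + G' ζ) ξ = conv F G ξ + conv F G' ξ := by
  rw [conv_comm, conv_add_left hG hG' hF h2 h2' h1, conv_comm G, conv_comm G']

theorem conv_const_mul_left (c : ℂ) (F G : ℝ → ℂ) (ξ : ℝ) :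
    conv (fun ζ => c * F ζ) G ξ = c * conv F G ξ := by
  unfold conv
  rw [← integral_const_mul]
  simp only [mul_assoc]

theorem conv_const_mul_right (c : ℂ) (F G : ℝ → ℂ) (ξ : ℝ) :
    conv F (fun ζ => c * G ζ) ξ = c * conv F G ξ := by
  rw [conv_comm, conv_const_mul_left, conv_comm]

theorem sn_zero_L2_lt_top (f : L2R) : sn 0 f < ∞ := by
  rw [sn_zero_eq]; exact (Lp.memLp f).2

theorem sn_zero_L2 (f : L2R) : sn 0 f = ‖f‖ₑ := by
  rw [sn_zero_eq, Lp.enorm_def]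

/-! ### Multiplication and convolution operators on `L²` -/

/-- A bounded measurable symbol. -/
structure BddSymbol (m : ℝ → ℂ) : Prop where
  meas : Measurable m
  bdd : ∃ C : ℝ, ∀ ξ, ‖m ξ‖ ≤ C

theorem memLp_mul_of_le {m : ℝ → ℂ} (hm : Measurable m) {C : ℝ} (hC : ∀ ξ, ‖m ξ‖ ≤ C)
    (f : L2R) : MemLp (fun ξ => m ξ * f ξ) 2 volume := by
  refine MemLp.of_le_mul (c := C) (Lp.memLp f)
    (hm.mul (measurable_L2 f)).aestronglyMeasurable (ae_of_all _ fun ξ => ?_)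
  rw [norm_mul]; gcongr; exact hC ξ

theorem BddSymbol.memLp {m : ℝ → ℂ} (hm : BddSymbol m) (f : L2R) :
    MemLp (fun ξ => m ξ * f ξ) 2 volume :=
  memLp_mul_of_le hm.meas hm.bdd.choose_spec f

theorem norm_toLp_mul_le {m : ℝ → ℂ} {C : ℝ} (hC : ∀ ξ, ‖m ξ‖ ≤ C) (f : L2R)
    (h : MemLp (fun ξ => m ξ * f ξ) 2 volume) : ‖h.toLp _‖ ≤ C * ‖f‖ := by
  refine Lp.norm_le_mul_norm_of_ae_le_mul ?_
  filter_upwards [h.coeFn_toLp] with ξ hξ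
  rw [hξ, norm_mul]; gcongr; exact hC ξ

theorem BddSymbol.measurable_mul {m : ℝ → ℂ} (hm : BddSymbol m) (f : L2R) :
    Measurable fun ξ => m ξ * f ξ := hm.meas.mul (measurable_L2 f)

/-- Multiplication by a bounded symbol. -/
noncomputable def mulCLM (m : ℝ → ℂ) (hm : BddSymbol m) : L2R →L[ℂ] L2R :=
  LinearMap.mkContinuous
    { toFun := fun f => (hm.memLp f).toLp _
      map_add' := fun f g => by
        apply Lp.ext
        filter_upwards [(hm.memLp (f + g)).coeFn_toLp, (hm.memLp f).coeFn_toLp,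
          (hm.memLp g).coeFn_toLp, Lp.coeFn_add f g,
          Lp.coeFn_add ((hm.memLp f).toLp _) ((hm.memLp g).toLp _)] with ξ h1 h2 h3 h4 h5
        rw [h1, h5, Pi.add_apply, h2, h3, h4, Pi.add_apply, mul_add]
      map_smul' := fun c f => by
        apply Lp.ext
        filter_upwards [(hm.memLp (c • f)).coeFn_toLp, (hm.memLp f).coeFn_toLp,
          Lp.coeFn_smul c f, Lp.coeFn_smul c ((hm.memLp f).toLp _)] with ξ h1 h2 h3 h4
        rw [h1, RingHom.id_apply, h4, Pi.smul_apply, h2, h3, Pi.smul_apply, smul_eq_mul,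
          smul_eq_mul]
        ring } hm.bdd.choose fun f =>
      norm_toLp_mul_le hm.bdd.choose_spec f (hm.memLp f)

theorem coeFn_mulCLM {m : ℝ → ℂ} (hm : BddSymbol m) (f : L2R) :
    mulCLM m hm f =ᵐ[volume] fun ξ => m ξ * f ξ := (hm.memLp f).coeFn_toLp

theorem norm_mulCLM_apply_le {m : ℝ → ℂ} (hm : BddSymbol m) {C : ℝ} (hC : ∀ ξ, ‖m ξ‖ ≤ C)
    (f : L2R) : ‖mulCLM m hm f‖ ≤ C * ‖f‖ := norm_toLp_mul_le hC f (hm.memLp f)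

theorem sn_mulCLM {m : ℝ → ℂ} (hm : BddSymbol m) (σ : ℝ) (f : L2R) :
    sn σ (mulCLM m hm f) = sn σ (fun ξ => m ξ * f ξ) := sn_congr (coeFn_mulCLM hm f)

theorem sn_L2_sub_le (σ : ℝ) (f g : L2R) : sn σ (f - g : L2R) ≤ sn σ f + sn σ g := by
  rw [sn_congr (Lp.coeFn_sub f g)]
  exact sn_sub_le (measurable_L2 f) (measurable_L2 g)

theorem sn_L2_add_le (σ : ℝ) (f g : L2R) : sn σ (f + g : L2R) ≤ sn σ f + sn σ g := by
  rw [sn_congr (Lp.coeFn_add f g)]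
  exact sn_add_le (measurable_L2 f) (measurable_L2 g)

theorem sn_zero_mul_lt_top {m : ℝ → ℂ} (hm : BddSymbol m) (f : L2R) :
    sn 0 (fun ξ => m ξ * f ξ) < ∞ := by
  rw [sn_zero_eq]; exact (hm.memLp f).2

theorem memLp_mul_conv {a b c : ℝ → ℂ} (ha : BddSymbol a) (hb : BddSymbol b)
    (hc : Measurable c) (C : ℝ≥0) (h : ∀ f g : L2R,
      eLpNorm (fun ξ => c ξ * conv (fun ζ => a ζ * f ζ) (fun ζ => b ζ * g ζ) ξ) 2 volume
        ≤ C * (‖f‖ₑ * ‖g‖ₑ)) (f g : L2R) :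
    MemLp (fun ξ => c ξ * conv (fun ζ => a ζ * f ζ) (fun ζ => b ζ * g ζ) ξ) 2 volume := by
  have m1 := ha.meas.mul (measurable_L2 f)
  have m2 := hb.meas.mul (measurable_L2 g)
  refine ⟨(hc.mul (measurable_conv m1 m2)).aestronglyMeasurable, (h f g).trans_lt ?_⟩
  exact ENNReal.mul_lt_top ENNReal.coe_lt_top (ENNReal.mul_lt_top enorm_lt_top enorm_lt_top)

/-- The bilinear operator `(f, g) ↦ c · ((a f) ⋆ (b g))` on `L²`. -/
noncomputable def convCLM {a b c : ℝ → ℂ} (ha : BddSymbol a) (hb : BddSymbol b)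
    (hc : Measurable c) (C : ℝ≥0) (h : ∀ f g : L2R,
      eLpNorm (fun ξ => c ξ * conv (fun ζ => a ζ * f ζ) (fun ζ => b ζ * g ζ) ξ) 2 volume
        ≤ C * (‖f‖ₑ * ‖g‖ₑ)) : L2R →L[ℂ] L2R →L[ℂ] L2R :=
  LinearMap.mkContinuous₂ (LinearMap.mk₂ ℂ
    (fun f g => (memLp_mul_conv ha hb hc C h f g).toLp _)
    (fun f f' g => by
      apply Lp.ext
      have e : (fun ζ => a ζ * (f + f' : L2R) ζ) =ᵐ[volume] fun ζ => a ζ * f ζ + a ζ * f' ζ := by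
        filter_upwards [Lp.coeFn_add f f'] with ζ hζ
        rw [hζ, Pi.add_apply, mul_add]
      filter_upwards [(memLp_mul_conv ha hb hc C h (f + f') g).coeFn_toLp,
        (memLp_mul_conv ha hb hc C h f g).coeFn_toLp,
        (memLp_mul_conv ha hb hc C h f' g).coeFn_toLp,
        Lp.coeFn_add ((memLp_mul_conv ha hb hc C h f g).toLp _)
          ((memLp_mul_conv ha hb hc C h f' g).toLp _)] with ξ h1 h2 h3 h4
      rw [h1, h4, Pi.add_apply, h2, h3, conv_congr e EventuallyEq.rfl,
        conv_add_left (ha.measurable_mul f) (ha.measurable_mul f')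
          (hb.measurable_mul g) (sn_zero_mul_lt_top ha f) (sn_zero_mul_lt_top ha f')
          (sn_zero_mul_lt_top hb g), mul_add])
    (fun k f g => by
      apply Lp.ext
      have e : (fun ζ => a ζ * (k • f : L2R) ζ) =ᵐ[volume] fun ζ => k * (a ζ * f ζ) := by
        filter_upwards [Lp.coeFn_smul k f] with ζ hζ
        rw [hζ, Pi.smul_apply, smul_eq_mul]; ring
      filter_upwards [(memLp_mul_conv ha hb hc C h (k • f) g).coeFn_toLp,
        (memLp_mul_conv ha hb hc C h f g).coeFn_toLp,
        Lp.coeFn_smul k ((memLp_mul_conv ha hb hc C h f g).toLp _)] with ξ h1 h2 h3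
      rw [h1, h3, Pi.smul_apply, h2, conv_congr e EventuallyEq.rfl, conv_const_mul_left,
        smul_eq_mul]
      ring)
    (fun f g g' => by
      apply Lp.ext
      have e : (fun ζ => b ζ * (g + g' : L2R) ζ) =ᵐ[volume] fun ζ => b ζ * g ζ + b ζ * g' ζ := by
        filter_upwards [Lp.coeFn_add g g'] with ζ hζ
        rw [hζ, Pi.add_apply, mul_add]
      filter_upwards [(memLp_mul_conv ha hb hc C h f (g + g')).coeFn_toLp,
        (memLp_mul_conv ha hb hc C h f g).coeFn_toLp,
        (memLp_mul_conv ha hb hc C h f g').coeFn_toLp,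
        Lp.coeFn_add ((memLp_mul_conv ha hb hc C h f g).toLp _)
          ((memLp_mul_conv ha hb hc C h f g').toLp _)] with ξ h1 h2 h3 h4
      rw [h1, h4, Pi.add_apply, h2, h3, conv_congr EventuallyEq.rfl e,
        conv_add_right (ha.measurable_mul f) (hb.measurable_mul g)
          (hb.measurable_mul g') (sn_zero_mul_lt_top ha f) (sn_zero_mul_lt_top hb g)
          (sn_zero_mul_lt_top hb g'), mul_add])
    (fun k f g => by
      apply Lp.ext
      have e : (fun ζ => b ζ * (k • g : L2R) ζ) =ᵐ[volume] fun ζ => k * (b ζ * g ζ) := by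
        filter_upwards [Lp.coeFn_smul k g] with ζ hζ
        rw [hζ, Pi.smul_apply, smul_eq_mul]; ring
      filter_upwards [(memLp_mul_conv ha hb hc C h f (k • g)).coeFn_toLp,
        (memLp_mul_conv ha hb hc C h f g).coeFn_toLp,
        Lp.coeFn_smul k ((memLp_mul_conv ha hb hc C h f g).toLp _)] with ξ h1 h2 h3
      rw [h1, h3, Pi.smul_apply, h2, conv_congr EventuallyEq.rfl e, conv_const_mul_right,
        smul_eq_mul]
      ring)) C
    (fun f g => by
      change ‖(memLp_mul_conv ha hb hc C h f g).toLp _‖ ≤ _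
      rw [Lp.norm_toLp]
      have := ENNReal.toReal_mono (by
        exact (ENNReal.mul_lt_top ENNReal.coe_lt_top
          (ENNReal.mul_lt_top enorm_lt_top enorm_lt_top)).ne) (h f g)
      simpa [mul_assoc] using this)

theorem coeFn_convCLM {a b c : ℝ → ℂ} (ha : BddSymbol a) (hb : BddSymbol b)
    (hc : Measurable c) (C : ℝ≥0) (h : ∀ f g : L2R,
      eLpNorm (fun ξ => c ξ * conv (fun ζ => a ζ * f ζ) (fun ζ => b ζ * g ζ) ξ) 2 volume
        ≤ C * (‖f‖ₑ * ‖g‖ₑ)) (f g : L2R) : convCLM ha hb hc C h f g =ᵐ[volume]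
    fun ξ => c ξ * conv (fun ζ => a ζ * f ζ) (fun ζ => b ζ * g ζ) ξ :=
  (memLp_mul_conv ha hb hc C h f g).coeFn_toLp

/-- Lower semicontinuity: a weighted norm is bounded if it is so on bounded frequencies. -/
theorem sn_le_of_forall_indicator {σ : ℝ} {F : ℝ → ℂ} (hF : Measurable F) {c : ℝ≥0∞}
    (h : ∀ n : ℕ, sn σ ((Icc (-(n : ℝ)) n).indicator F) ≤ c) : sn σ F ≤ c := by
  unfold sn at *
  have m : Measurable fun ξ : ℝ => ((jw σ (2 * π * ξ) : ℝ) : ℂ) := by fun_prop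
  refine (Lp.eLpNorm_lim_le_liminf_eLpNorm (f := fun (n : ℕ) (ξ : ℝ) =>
    ((jw σ (2 * π * ξ) : ℝ) : ℂ) * (Icc (-(n : ℝ)) n).indicator F ξ) (fun n => ?_) _
    (ae_of_all _ fun ξ => ?_)).trans ?_
  · exact (m.mul (hF.indicator measurableSet_Icc)).aestronglyMeasurable
  · refine tendsto_const_nhds.congr' ?_
    obtain ⟨N, hN⟩ := exists_nat_ge |ξ|
    filter_upwards [eventually_ge_atTop N] with n hn
    have : ξ ∈ Icc (-(n : ℝ)) n := by
      exact abs_le.1 (hN.trans (by exact_mod_cast hn))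
    rw [indicator_of_mem this]
  · exact (liminf_le_liminf (Eventually.of_forall h)).trans (by simp)

/-! ### Fourier transforms of products and of real functions -/

theorem continuous_integral_mul {G : ℝ → ℂ} (hG : MemLp G 2 volume) :
    Continuous fun f : L2R => ∫ x, f x * G x := by
  have h : (fun f : L2R => ∫ x, f x * G x) = fun f : L2R => inner ℂ (hG.star.toLp _ : L2R) f := by
    ext f
    rw [L2.inner_def]
    refine integral_congr_ae ?_
    filter_upwards [hG.star.coeFn_toLp] with x hx
    rw [hx]
    simp
  rw [h]
  exact continuous_const.inner continuous_id

theorem memLp_comp_sub_left {G : ℝ → ℂ} (hG : MemLp G 2 volume) (ξ : ℝ) :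
    MemLp (fun ζ => G (ξ - ζ)) 2 volume :=
  hG.comp_measurePreserving (Measure.measurePreserving_sub_left volume ξ)

theorem continuous_conv_left (g : L2R) (ξ : ℝ) : Continuous fun f : L2R => conv f g ξ := by
  simp_rw [conv_comm _ (g : ℝ → ℂ)]
  have := continuous_integral_mul (memLp_comp_sub_left (Lp.memLp g) ξ)
  simp_rw [mul_comm] at this
  exact this

theorem continuous_conv_right (f : L2R) (ξ : ℝ) : Continuous fun g : L2R => conv f g ξ := by
  simp_rw [conv_comm (f : ℝ → ℂ)]
  exact continuous_conv_left f ξ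

theorem continuous_fourier_mul_right (f : L2R) (ξ : ℝ) :
    Continuous fun g : L2R => 𝓕 (fun x : ℝ => (f x * g x : ℂ)) ξ := by
  have hm : MemLp (fun x : ℝ => (Real.fourierChar (-(x * ξ)) : ℂ) * f x) 2 volume := by
    refine (Lp.memLp f).of_le (AEStronglyMeasurable.mul ?_ (Lp.aestronglyMeasurable f))
      (ae_of_all _ fun x => by simp [Circle.norm_coe])
    exact (by fun_prop : Continuous fun x : ℝ =>
      (Real.fourierChar (-(x * ξ)) : ℂ)).aestronglyMeasurable
  refine (continuous_integral_mul hm).congr fun g => ?_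
  rw [Real.fourier_real_eq]
  refine integral_congr_ae (ae_of_all _ fun x => ?_)
  simp only [Circle.smul_def, smul_eq_mul]
  ring

theorem continuous_fourier_mul_left (g : L2R) (ξ : ℝ) :
    Continuous fun f : L2R => 𝓕 (fun x : ℝ => (f x * g x : ℂ)) ξ := by
  simp_rw [mul_comm _ (g _)]
  exact continuous_fourier_mul_right g ξ

/-- The convolution of Schwartz functions is the inverse transform of the product of the transforms.
Applied to 𝓕 f and 𝓕 g it produces double transforms, which are reflections, and these cancel
against the reflection relating 𝓕⁻ to 𝓕. -/
theorem SchwartzMap.fourier_mul_eq_conv (f g : 𝓢(ℝ, ℂ)) (ξ : ℝ) :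
    𝓕 (fun x : ℝ => (f x * g x : ℂ)) ξ = conv (𝓕 f : 𝓢(ℝ, ℂ)) (𝓕 g : 𝓢(ℝ, ℂ)) ξ := by
  have h := SchwartzMap.convolution_apply (ContinuousLinearMap.mul ℂ ℂ) (𝓕 g : 𝓢(ℝ, ℂ))
    (𝓕 f : 𝓢(ℝ, ℂ)) ξ
  have e1 : conv (𝓕 f : 𝓢(ℝ, ℂ)) (𝓕 g : 𝓢(ℝ, ℂ)) ξ =
      SchwartzMap.convolution (ContinuousLinearMap.mul ℂ ℂ) (𝓕 g : 𝓢(ℝ, ℂ)) (𝓕 f : 𝓢(ℝ, ℂ)) ξ := by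
    rw [h]
    unfold conv MeasureTheory.convolution
    refine integral_congr_ae (ae_of_all _ fun ζ => ?_)
    simp [mul_comm]
  have hFF : ∀ (k : 𝓢(ℝ, ℂ)) (y : ℝ), (𝓕 (𝓕 k : 𝓢(ℝ, ℂ)) : 𝓢(ℝ, ℂ)) y = k (-y) := fun k y => by
    have h1 : (𝓕⁻ (𝓕 k : 𝓢(ℝ, ℂ)) : 𝓢(ℝ, ℂ)) (-y) = k (-y) := by
      rw [FourierTransform.fourierInv_fourier_eq]
    rw [← h1, SchwartzMap.fourierInv_coe, Real.fourierInv_eq_fourier_neg, neg_neg,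
      SchwartzMap.fourier_coe]
  rw [e1, SchwartzMap.convolution]
  change _ = (𝓕⁻ (SchwartzMap.pairing (ContinuousLinearMap.mul ℂ ℂ) (𝓕 (𝓕 g : 𝓢(ℝ, ℂ)) : 𝓢(ℝ, ℂ))
    (𝓕 (𝓕 f : 𝓢(ℝ, ℂ)) : 𝓢(ℝ, ℂ))) : 𝓢(ℝ, ℂ)) ξ
  rw [SchwartzMap.fourierInv_coe, Real.fourierInv_eq_fourier_neg, Real.fourier_real_eq,
    Real.fourier_real_eq, ← integral_neg_eq_self]
  refine integral_congr_ae (ae_of_all _ fun x => ?_)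
  simp only [SchwartzMap.pairing_apply_apply, hFF, ContinuousLinearMap.mul_apply']
  rw [mul_comm (f (-x))]
  congr 3
  ring

/-- The Fourier transform turns products of `L²` functions into convolutions. -/
theorem fourier_mul_eq_conv (f g : L2R) (ξ : ℝ) :
    𝓕 (fun x : ℝ => (f x * g x : ℂ)) ξ = conv (𝓕 f : L2R) (𝓕 g : L2R) ξ := by
  have cF : Continuous fun f : L2R => (𝓕 f : L2R) := (Lp.fourierTransformₗᵢ ℝ ℂ).continuous
  -- At fixed ξ both sides are continuous in f and in g separately, so it suffices to treat Schwartz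
  -- functions, one variable at a time.
  refine DenseRange.induction_on (SchwartzMap.denseRange_toLpCLM (p := 2) (F := ℂ) (E := ℝ)
    (μ := volume) ENNReal.ofNat_ne_top) f
    (isClosed_eq (continuous_fourier_mul_left g ξ) ((continuous_conv_left _ ξ).comp cF)) fun f => ?_
  refine DenseRange.induction_on (SchwartzMap.denseRange_toLpCLM (p := 2) (F := ℂ) (E := ℝ)
    (μ := volume) ENNReal.ofNat_ne_top) g
    (isClosed_eq (continuous_fourier_mul_right _ ξ) ((continuous_conv_right _ ξ).comp cF))
    fun g => ?_
  simp only [SchwartzMap.toLpCLM_apply, SchwartzMap.toLp_fourier_eq]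
  rw [conv_congr (SchwartzMap.coeFn_toLp (𝓕 f : 𝓢(ℝ, ℂ)) 2 volume)
      (SchwartzMap.coeFn_toLp (𝓕 g : 𝓢(ℝ, ℂ)) 2 volume),
    ← SchwartzMap.fourier_mul_eq_conv, Real.fourier_real_eq, Real.fourier_real_eq]
  refine integral_congr_ae ?_
  filter_upwards [SchwartzMap.coeFn_toLp f 2 volume, SchwartzMap.coeFn_toLp g 2 volume]
    with x h1 h2
  rw [h1, h2]

/-! ### Conjugation and reality on the Fourier side. -/

/-- Complex conjugation on `L²`. -/
noncomputable def conjL2 : L2R →L[ℝ] L2R :=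
  (Complex.conjCLE : ℂ →L[ℝ] ℂ).compLpL 2 volume

theorem coeFn_conjL2 (f : L2R) : conjL2 f =ᵐ[volume] fun x => (starRingEnd ℂ) (f x) :=
  (Complex.conjCLE : ℂ →L[ℝ] ℂ).coeFn_compLp f

/-- The map `f ↦ conj f(-ξ)`, conjugation on the Fourier side. -/
noncomputable def hermL2 : L2R →L[ℝ] L2R :=
  conjL2 ∘L (Lp.compMeasurePreservingₗᵢ ℝ Neg.neg
    (Measure.measurePreserving_neg (volume : Measure ℝ))).toContinuousLinearMap

theorem coeFn_hermL2 (f : L2R) : hermL2 f =ᵐ[volume] fun ξ => (starRingEnd ℂ) (f (-ξ)) := by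
  filter_upwards [coeFn_conjL2 (Lp.compMeasurePreservingₗᵢ ℝ Neg.neg
    (Measure.measurePreserving_neg (volume : Measure ℝ)) f),
    Lp.coeFn_compMeasurePreserving f (Measure.measurePreserving_neg (volume : Measure ℝ))]
    with ξ h1 h2
  exact h1.trans (congrArg _ h2)

theorem fourier_conjL2 (f : L2R) : (𝓕 (conjL2 f) : L2R) = hermL2 (𝓕 f : L2R) := by
  have cF : Continuous fun f : L2R => (𝓕 f : L2R) := (Lp.fourierTransformₗᵢ ℝ ℂ).continuous
  refine DenseRange.induction_on (SchwartzMap.denseRange_toLpCLM (p := 2) (F := ℂ) (E := ℝ)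
    (μ := volume) ENNReal.ofNat_ne_top) f
    (isClosed_eq (cF.comp conjL2.continuous) (hermL2.continuous.comp cF)) fun f => ?_
  have e : conjL2 (f.toLp 2) = (f.postcompCLM (Complex.conjCLE : ℂ →L[ℝ] ℂ)).toLp 2 := by
    apply Lp.ext
    filter_upwards [coeFn_conjL2 (f.toLp 2), SchwartzMap.coeFn_toLp f 2 volume,
      SchwartzMap.coeFn_toLp (f.postcompCLM (Complex.conjCLE : ℂ →L[ℝ] ℂ)) 2 volume]
      with x h1 h2 h3
    rw [h1, h2, h3]; simp
  simp only [SchwartzMap.toLpCLM_apply]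
  rw [e, SchwartzMap.toLp_fourier_eq, SchwartzMap.toLp_fourier_eq]
  apply Lp.ext
  have h4 := (Measure.measurePreserving_neg (volume : Measure ℝ)).quasiMeasurePreserving.ae_eq_comp
    (SchwartzMap.coeFn_toLp (𝓕 f : 𝓢(ℝ, ℂ)) 2 volume)
  filter_upwards [SchwartzMap.coeFn_toLp
    (𝓕 (f.postcompCLM (Complex.conjCLE : ℂ →L[ℝ] ℂ)) : 𝓢(ℝ, ℂ)) 2 volume,
    coeFn_hermL2 ((𝓕 f : 𝓢(ℝ, ℂ)).toLp 2), h4] with ξ h1 h2 h3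
  simp only [Function.comp_apply] at h3
  rw [h1, h2, h3, SchwartzMap.fourier_coe, SchwartzMap.fourier_coe, Real.fourier_real_eq,
    Real.fourier_real_eq, ← integral_conj]
  refine integral_congr_ae (ae_of_all _ fun x => ?_)
  simp [Circle.smul_def, ← Circle.coe_inv_eq_conj, ← AddChar.map_neg_eq_inv]

/-- The transform is injective and intertwines conjugation with `hermL2`. Reality thus becomes a
fixed point condition for a bounded operator, which an ODE with that symmetry preserves. -/
theorem isRealValued_iff_hermL2 (f : L2R) :
    IsRealValued f ↔ hermL2 (𝓕 f : L2R) = (𝓕 f : L2R) := by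
  have h1 : IsRealValued f ↔ conjL2 f = f := by
    constructor
    · intro h
      apply Lp.ext
      filter_upwards [h, coeFn_conjL2 f] with x h1 h2
      rw [h2, Complex.conj_eq_iff_im.2 h1]
    · intro h
      have := coeFn_conjL2 f
      rw [h] at this
      filter_upwards [this] with x hx
      exact Complex.conj_eq_iff_im.1 hx.symm
  rw [h1, ← fourier_conjL2]
  exact ⟨fun h => by rw [h], fun h => (Lp.fourierTransformₗᵢ ℝ ℂ).injective h⟩

/-! ### Trilinear estimates -/

/-- A symbol of order α + β is shared between the two factors, and Cauchy–Schwarz pairs the weight α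
with −α. -/
theorem lintegral_symbol_mul_le {α β C : ℝ} {m F G : ℝ → ℂ} (hm : Measurable m)
    (hF : Measurable F) (hG : Measurable G) (h : ∀ ξ, ‖m ξ‖ ≤ C * jw (α + β) (2 * π * ξ)) :
    ∫⁻ ξ, ‖m ξ * ((starRingEnd ℂ) (F ξ) * G ξ)‖ₑ ≤ ENNReal.ofReal C * (sn α F * sn β G) := by
  calc ∫⁻ ξ, ‖m ξ * ((starRingEnd ℂ) (F ξ) * G ξ)‖ₑ = ∫⁻ ξ, ‖F ξ‖ₑ * ‖m ξ * G ξ‖ₑ := by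
        refine lintegral_congr fun ξ => ?_
        rw [enorm_mul, enorm_mul, enorm_mul, RCLike.enorm_conj]; ring
    _ ≤ sn α F * sn (-α) (fun ξ => m ξ * G ξ) := lintegral_enorm_mul_le α hF (hm.mul hG)
    _ ≤ sn α F * (ENNReal.ofReal C * sn (-α + (α + β)) G) := by gcongr; exact sn_mul_le h
    _ = _ := by rw [show -α + (α + β) = β by ring]; ring

theorem integrable_of_lintegral_le {F : ℝ → ℂ} (hF : Measurable F) {c : ℝ≥0∞} (hc : c < ∞)
    (h : ∫⁻ ξ, ‖F ξ‖ₑ ≤ c) : Integrable F :=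
  ⟨hF.aestronglyMeasurable, h.trans_lt hc⟩

theorem re_integral_le_of_lintegral_le {F : ℝ → ℂ} {c : ℝ≥0} (h : ∫⁻ ξ, ‖F ξ‖ₑ ≤ c) :
    (∫ ξ, F ξ).re ≤ c := by
  refine (Complex.re_le_norm _).trans ?_
  have := (enorm_integral_le_lintegral_enorm F).trans h
  rw [← ofReal_norm] at this
  simpa using ENNReal.toReal_mono ENNReal.coe_ne_top this

/-- Convolution with a Hermitian function is symmetric. -/
theorem integral_conj_mul_conv_swap {A N L : ℝ → ℂ} (hA : Measurable A) (hN : Measurable N)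
    (hL : Measurable L) (h1 : sn 0 A < ∞) (h2 : sn 1 N < ∞) (h3 : sn 0 L < ∞)
    (herm : ∀ᵐ ξ, N (-ξ) = (starRingEnd ℂ) (N ξ)) :
    ∫ ξ, (starRingEnd ℂ) (A ξ) * conv N L ξ = ∫ ξ, L ξ * (starRingEnd ℂ) (conv N A ξ) := by
  have hAL : Integrable (Function.uncurry fun ξ ζ => (starRingEnd ℂ) (A ξ) * (N (ξ - ζ) * L ζ))
      (volume.prod volume) := by
    have cc : Measurable (starRingEnd ℂ : ℂ → ℂ) := Complex.continuous_conj.measurable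
    have hmeas : Measurable (Function.uncurry fun ξ ζ =>
        (starRingEnd ℂ) (A ξ) * (N (ξ - ζ) * L ζ)) := by
      simp only [Function.uncurry_def]
      exact (cc.comp (hA.comp measurable_fst)).mul (by fun_prop)
    refine ⟨hmeas.aestronglyMeasurable, ?_⟩
    unfold HasFiniteIntegral
    rw [lintegral_prod _ (by fun_prop)]
    have : ∀ ξ, ∫⁻ ζ, ‖Function.uncurry (fun ξ ζ => (starRingEnd ℂ) (A ξ) * (N (ξ - ζ) * L ζ))
        (ξ, ζ)‖ₑ = wn 0 A ξ * lconv (wn 0 N) (wn 0 L) ξ := fun ξ => by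
      simp only [Function.uncurry, enorm_mul, RCLike.enorm_conj, wn, jw_zero, ENNReal.ofReal_one,
        one_mul, lconv]
      rw [lintegral_const_mul _ (by fun_prop)]
    simp_rw [this]
    refine (lintegral_mul_lconv_le₁ (by fun_prop) (by fun_prop) (by fun_prop)).trans_lt ?_
    rw [← sn_eq_eLpNorm_wn, ← sn_eq_eLpNorm_wn]
    refine ENNReal.mul_lt_top h1 (ENNReal.mul_lt_top ?_ h3)
    exact (lintegral_wn_le (by norm_num) hN).trans_lt (ENNReal.mul_lt_top ENNReal.coe_lt_top h2)
  calc ∫ ξ, (starRingEnd ℂ) (A ξ) * conv N L ξ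
      = ∫ ξ, ∫ ζ, (starRingEnd ℂ) (A ξ) * (N (ξ - ζ) * L ζ) := by
        refine integral_congr_ae (ae_of_all _ fun ξ => ?_)
        simp only [conv]
        rw [← integral_const_mul]
    _ = ∫ ζ, ∫ ξ, (starRingEnd ℂ) (A ξ) * (N (ξ - ζ) * L ζ) := integral_integral_swap hAL
    _ = _ := by
        refine integral_congr_ae (ae_of_all _ fun ζ => ?_)
        simp only [conv]
        rw [← integral_conj, ← integral_const_mul]
        refine integral_congr_ae ?_
        -- The Hermitian relation at ζ − ξ turns N(ξ − ζ) into the conjugate of N(ζ − ξ), which is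
        -- the kernel of the convolution at ζ.
        have hh := (Measure.measurePreserving_sub_left volume ζ).quasiMeasurePreserving.ae herm
        filter_upwards [hh] with ξ hξ
        rw [neg_sub] at hξ
        rw [hξ, map_mul]
        ring

/-- The commutator of convolution with `N` and the multiplier of the modified energy. -/
theorem lintegral_commutator_le {s e M : ℝ} (hs : 2 ≤ s) (he : 0 ≤ e) (he1 : e ≤ 1) (hM : 1 ≤ M)
    {H N W : ℝ → ℂ} (hH : Measurable H) (hN : Measurable N) (hW : Measurable W)
    (hN0 : sn 0 N < ∞) (hW1 : sn 0 W < ∞)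
    (haW : sn 0 (fun ξ => (modA s e M (2 * π * ξ) : ℂ) * W ξ) < ∞) :
    ∫⁻ ξ, ‖(((2 * π * ξ) ^ 2 * Real.tanh (2 * π * ξ) : ℝ) : ℂ) * ((starRingEnd ℂ) (H ξ) *
      (conv N (fun ζ => (modA s e M (2 * π * ζ) : ℂ) * W ζ) ξ
        - (modA s e M (2 * π * ξ) : ℂ) * conv N W ξ))‖ₑ ≤
    ENNReal.ofReal ((4 * s + 4) * 2 ^ (s + 2)) * (cJ * (sn s H * (sn 2 N * sn s W))
      + cJ * (sn (s + 1 / 2) H * (sn (s + 1 / 2) N * sn 1 W))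
      + cJ * (sn (3 / 2) H * (sn (s + 1 / 2) N * sn s W))) := by
  set a : ℝ → ℝ := fun ξ => modA s e M (2 * π * ξ) with ha
  set c0 := ENNReal.ofReal ((4 * s + 4) * 2 ^ (s + 2)) with hc0
  -- The commutator has kernel N(ξ − ζ)(a(ζ) − a(ξ)), so only differences of the symbol occur.
  have hcm : ∀ ξ, conv N (fun ζ => (a ζ : ℂ) * W ζ) ξ - (a ξ : ℂ) * conv N W ξ =
      ∫ ζ, N (ξ - ζ) * (((a ζ - a ξ : ℝ) : ℂ) * W ζ) := fun ξ => by
    have ma : Measurable fun ζ => (a ζ : ℂ) * W ζ := by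
      refine Measurable.mul ?_ hW
      have : Measurable a := (measurable_modA s e M).comp (by fun_prop)
      exact Complex.measurable_ofReal.comp this
    unfold conv
    rw [← integral_const_mul, ← integral_sub (integrable_conv hN ma hN0 haW ξ)
      ((integrable_conv hN hW hN0 hW1 ξ).const_mul _)]
    refine integral_congr_ae (ae_of_all _ fun ζ => ?_)
    push_cast
    ring
  have hpt : ∀ ξ, ‖(((2 * π * ξ) ^ 2 * Real.tanh (2 * π * ξ) : ℝ) : ℂ) * ((starRingEnd ℂ) (H ξ) *
      (conv N (fun ζ => (a ζ : ℂ) * W ζ) ξ - (a ξ : ℂ) * conv N W ξ))‖ₑ ≤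
      c0 * (wn s H ξ * lconv (wn 1 N) (wn s W) ξ
        + wn (s + 1 / 2) H ξ * lconv (wn (s + 1 / 2) N) (wn 0 W) ξ
        + wn (1 / 2) H ξ * lconv (wn (s + 1 / 2) N) (wn s W) ξ) := by
    intro ξ
    have h1 : ‖(((2 * π * ξ) ^ 2 * Real.tanh (2 * π * ξ) : ℝ) : ℂ)‖ₑ ≤
        ENNReal.ofReal ((2 * π * ξ) ^ 2) := by
      rw [← ofReal_norm, Complex.norm_real, Real.norm_eq_abs, abs_mul,
        abs_of_nonneg (sq_nonneg _)]
      exact ENNReal.ofReal_le_ofReal (mul_le_of_le_one_right (sq_nonneg _) (abs_tanh_le_one _))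
    rw [enorm_mul, enorm_mul, RCLike.enorm_conj, hcm]
    calc _ ≤ ENNReal.ofReal ((2 * π * ξ) ^ 2) * (‖H ξ‖ₑ *
          ∫⁻ ζ, ‖N (ξ - ζ)‖ₑ * (ENNReal.ofReal |a ζ - a ξ| * ‖W ζ‖ₑ)) := by
          gcongr
          refine (enorm_integral_le_lintegral_enorm _).trans_eq ?_
          refine lintegral_congr fun ζ => ?_
          rw [enorm_mul, enorm_mul, ← ofReal_norm ((a ζ - a ξ : ℝ) : ℂ), Complex.norm_real,
            Real.norm_eq_abs]
      _ ≤ ∫⁻ ζ, c0 * (wn s H ξ * (wn 1 N (ξ - ζ) * wn s W ζ)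
          + wn (s + 1 / 2) H ξ * (wn (s + 1 / 2) N (ξ - ζ) * wn 0 W ζ)
          + wn (1 / 2) H ξ * (wn (s + 1 / 2) N (ξ - ζ) * wn s W ζ)) := by
          rw [← mul_assoc]
          refine (lintegral_const_mul_le _ _).trans (lintegral_mono fun ζ => ?_)
          have h := commutator_symbol_le hs he he1 hM (2 * π * ξ) (2 * π * ζ)
          have h' := ENNReal.ofReal_le_ofReal h
          rw [ENNReal.ofReal_mul (sq_nonneg _), ENNReal.ofReal_mul (by positivity)] at h'
          have j := fun σ x => jw_nonneg σ x
          rw [ENNReal.ofReal_add (add_nonneg (mul_nonneg (mul_nonneg (j _ _) (j _ _)) (j _ _))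
              (mul_nonneg (j _ _) (j _ _)))
              (mul_nonneg (mul_nonneg (j _ _) (j _ _)) (j _ _)),
            ENNReal.ofReal_add (mul_nonneg (mul_nonneg (j _ _) (j _ _)) (j _ _))
              (mul_nonneg (j _ _) (j _ _)), ENNReal.ofReal_mul (mul_nonneg (j _ _) (j _ _)),
            ENNReal.ofReal_mul (j _ _), ENNReal.ofReal_mul (j _ _),
            ENNReal.ofReal_mul (mul_nonneg (j _ _) (j _ _)), ENNReal.ofReal_mul (j _ _),
            ← mul_sub] at h'
          unfold wn
          rw [jw_zero, ENNReal.ofReal_one]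
          calc _ = (ENNReal.ofReal ((2 * π * ξ) ^ 2) * ENNReal.ofReal |a ζ - a ξ|) *
                (‖H ξ‖ₑ * ‖N (ξ - ζ)‖ₑ * ‖W ζ‖ₑ) := by ring
            _ ≤ _ := mul_le_mul_left h' _
            _ = _ := by ring
      _ = _ := by
          rw [lintegral_const_mul _ (by fun_prop), lintegral_add_left (by fun_prop),
            lintegral_add_left (by fun_prop), lintegral_const_mul _ (by fun_prop),
            lintegral_const_mul _ (by fun_prop), lintegral_const_mul _ (by fun_prop)]
          rfl
  refine (lintegral_mono hpt).trans ?_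
  rw [lintegral_const_mul _ (by fun_prop), lintegral_add_left (by fun_prop),
    lintegral_add_left (by fun_prop)]
  gcongr
  -- The factor placed in L¹ is the one with a derivative to spare: η in the first term, w in the
  -- second, h in the third.
  · refine (lintegral_mul_lconv_le₁ (by fun_prop) (by fun_prop) (by fun_prop)).trans ?_
    rw [← sn_eq_eLpNorm_wn, ← sn_eq_eLpNorm_wn]
    calc _ ≤ sn s H * (cJ * sn 2 N * sn s W) := by
          gcongr; exact lintegral_wn_le (by norm_num) hN
      _ = _ := by ring
  · refine (lintegral_mul_lconv_le₂ (by fun_prop) (by fun_prop) (by fun_prop)).trans ?_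
    rw [← sn_eq_eLpNorm_wn, ← sn_eq_eLpNorm_wn]
    calc _ ≤ sn (s + 1 / 2) H * (sn (s + 1 / 2) N * (cJ * sn 1 W)) := by
          gcongr; exact lintegral_wn_le (by norm_num) hW
      _ = _ := by ring
  · refine (lintegral_mul_lconv_le₃ (by fun_prop) (by fun_prop) (by fun_prop)).trans ?_
    rw [← sn_eq_eLpNorm_wn, ← sn_eq_eLpNorm_wn]
    calc _ ≤ (cJ * sn (3 / 2) H) * (sn (s + 1 / 2) N * sn s W) := by
          gcongr; exact lintegral_wn_le (by norm_num) hH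
      _ = _ := by ring

/-! ### The rate of change of the energy -/

/-- The symbol `tanh D` on the Fourier side. -/
noncomputable def th (ξ : ℝ) : ℂ := ((Real.tanh (2 * π * ξ) : ℝ) : ℂ)

@[fun_prop]
theorem measurable_th : Measurable th := by
  unfold th
  have := continuous_tanh.measurable
  fun_prop

theorem norm_th_le (ξ : ℝ) : ‖th ξ‖ ≤ 1 := by
  rw [th, Complex.norm_real]; exact abs_tanh_le_one _

theorem sn_I_th_mul_le (σ : ℝ) (F : ℝ → ℂ) :
    sn σ (fun ξ => Complex.I * th ξ * F ξ) ≤ sn σ F := by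
  have := sn_mul_le (σ := σ) (τ := 0) (C := 1) (m := fun ξ => Complex.I * th ξ) (F := F)
    (fun ξ => by simpa [jw_zero] using norm_th_le ξ)
  simpa using this

/-- The right hand side of the linearised equation for the elevation. -/
noncomputable def rhsH (H W N V E : ℝ → ℂ) (ξ : ℝ) : ℂ :=
  -(Complex.I * ((2 * π * ξ : ℝ) : ℂ) * W ξ) - Complex.I * th ξ * (conv H V ξ + conv N W ξ) + E ξ

/-- The right hand side of the linearised equation for the velocity. -/
noncomputable def rhsW (κ : ℝ) (H W U F : ℝ → ℂ) (ξ : ℝ) : ℂ :=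
  -(Complex.I * ((Real.tanh (2 * π * ξ) * (1 + κ * (2 * π * ξ) ^ 2) : ℝ) : ℂ) * H ξ)
    - Complex.I * th ξ * conv U W ξ + F ξ

/-- Bounds for the unknowns, the coefficients and the forcing of the linearised system. -/
structure EnergyBounds (s κ : ℝ) (B z : ℝ≥0) (H W N N' V U E F : ℝ → ℂ) : Prop where
  mH : Measurable H
  mW : Measurable W
  mN : Measurable N
  mN' : Measurable N'
  mV : Measurable V
  mU : Measurable U
  mE : Measurable E
  mF : Measurable F
  H_le : sn (s - 1 / 2) H ≤ z
  H_top : ENNReal.ofReal √κ * sn (s + 1 / 2) H ≤ z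
  W_le : sn s W ≤ z
  E_le : sn (s - 1 / 2) E ≤ z
  E_top : ENNReal.ofReal √κ * sn (s + 1 / 2) E ≤ z
  F_le : sn s F ≤ z
  N_le : sn (s - 1 / 2) N ≤ B
  N_top : ENNReal.ofReal √κ * sn (s + 1 / 2) N ≤ B
  N'_le : sn (s - 1) N' ≤ B
  V_le : sn s V ≤ B
  V_top : ENNReal.ofReal √κ * sn (s + 1 / 2) V ≤ B
  U_le : sn s U ≤ B

theorem lt_top_of_ofReal_mul_le {k : ℝ} (hk : 0 < k) {a : ℝ≥0∞} {z : ℝ≥0}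
    (h : ENNReal.ofReal k * a ≤ z) : a < ∞ := by
  by_contra hn
  rw [not_lt_top_iff] at hn
  rw [hn, ENNReal.mul_top (by simpa using hk)] at h
  exact absurd h (by simp)

section Static

variable {s κ : ℝ} {B z : ℝ≥0} {H W N N' V U E F : ℝ → ℂ}

theorem EnergyBounds.sn_conv_NW (hs : 2 ≤ s) (h : EnergyBounds s κ B z H W N N' V U E F) :
    sn (s - 1 / 2) (conv N W) ≤ (2 * cP (s - 1 / 2) * (B * z) : ℝ≥0) := by
  refine (sn_conv_le (by linarith) h.mN h.mW).trans ?_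
  push_cast
  gcongr
  · exact h.N_le
  · exact (sn_mono (by linarith) _).trans h.W_le

theorem EnergyBounds.sn_source (hs : 2 ≤ s) (h : EnergyBounds s κ B z H W N N' V U E F) :
    sn (s - 1 / 2) (fun ξ => -(Complex.I * th ξ * (conv H V ξ + conv N W ξ)) + E ξ) ≤
      ((4 * cP (s - 1 / 2) * B + 1) * z : ℝ≥0) := by
  obtain ⟨mH, mW, mN, mN', mV, mU, mE, mF, hHl, hHt, hWl, hEl, hEt, hFl, hNl, hNt, hN'l, hVl,
    hVt, hUl⟩ := id h
  refine (sn_add_le (by fun_prop) mE).trans ?_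
  rw [sn_neg]
  have h1 : sn (s - 1 / 2) (conv H V) ≤ 2 * cP (s - 1 / 2) * (z * B) := by
    refine (sn_conv_le (by linarith) mH mV).trans ?_
    gcongr
    exact (sn_mono (by linarith) _).trans h.V_le
  calc _ ≤ (sn (s - 1 / 2) (conv H V) + sn (s - 1 / 2) (conv N W)) + z := by
        gcongr
        exact (sn_I_th_mul_le _ _).trans (sn_add_le (by fun_prop) (by fun_prop))
    _ ≤ (2 * cP (s - 1 / 2) * (z * B) + (2 * cP (s - 1 / 2) * (B * z) : ℝ≥0)) + z := by
        gcongr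
        exact h.sn_conv_NW hs
    _ = _ := by push_cast; ring

/-- The product N ⋆ W is left out on purpose: W has only s derivatives, so this product cannot be
placed in H^{s+1/2}. It is the term that the modified energy removes. -/
theorem EnergyBounds.sn_source_top (hs : 2 ≤ s) (h : EnergyBounds s κ B z H W N N' V U E F) :
    ENNReal.ofReal √κ * sn (s + 1 / 2) (fun ξ => -(Complex.I * th ξ * conv H V ξ) + E ξ) ≤
      ((2 * cP (s + 1 / 2) * B + 1) * z : ℝ≥0) := by
  obtain ⟨mH, mW, mN, mN', mV, mU, mE, mF, hHl, hHt, hWl, hEl, hEt, hFl, hNl, hNt, hN'l, hVl,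
    hVt, hUl⟩ := id h
  calc _ ≤ ENNReal.ofReal √κ * (sn (s + 1 / 2) (conv H V) + sn (s + 1 / 2) E) := by
        gcongr
        refine (sn_add_le (by fun_prop) mE).trans ?_
        rw [sn_neg]
        gcongr
        exact sn_I_th_mul_le _ _
    _ ≤ ENNReal.ofReal √κ * (cP (s + 1 / 2) * (sn (s + 1 / 2) H * sn 1 V
          + sn 1 H * sn (s + 1 / 2) V) + sn (s + 1 / 2) E) := by
        gcongr; exact sn_conv_le_tame (by linarith) mH mV
    _ = cP (s + 1 / 2) * (ENNReal.ofReal √κ * sn (s + 1 / 2) H * sn 1 V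
          + sn 1 H * (ENNReal.ofReal √κ * sn (s + 1 / 2) V))
          + ENNReal.ofReal √κ * sn (s + 1 / 2) E := by ring
    _ ≤ cP (s + 1 / 2) * (z * B + z * B) + z := by
        have hV1 : sn 1 V ≤ B := (sn_mono (by linarith) _).trans h.V_le
        have hH1 : sn 1 H ≤ z := (sn_mono (by linarith) _).trans h.H_le
        gcongr
    _ = _ := by push_cast; ring

theorem EnergyBounds.sn_velocity_source (hs : 2 ≤ s)
    (h : EnergyBounds s κ B z H W N N' V U E F) :
    sn s (fun ξ => -(Complex.I * th ξ * conv U W ξ) + F ξ) ≤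
      ((2 * cP s * B + 1) * z : ℝ≥0) := by
  obtain ⟨mH, mW, mN, mN', mV, mU, mE, mF, hHl, hHt, hWl, hEl, hEt, hFl, hNl, hNt, hN'l, hVl,
    hVt, hUl⟩ := id h
  refine (sn_add_le (by fun_prop) mF).trans ?_
  rw [sn_neg]
  calc _ ≤ 2 * (cP s : ℝ≥0∞) * (B * z) + z := by
        gcongr
        refine (sn_I_th_mul_le _ _).trans ((sn_conv_le (by linarith) mU mW).trans ?_)
        gcongr
    _ = _ := by push_cast; ring

/-- This is the velocity equation without its capillary part. It is estimated with s − 1/2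
derivatives because H has no more uniformly in κ. -/
theorem EnergyBounds.sn_velocity_low (hs : 2 ≤ s) (h : EnergyBounds s κ B z H W N N' V U E F) :
    sn (s - 1 / 2) (fun ξ => -(Complex.I * th ξ * H ξ)
      + (-(Complex.I * th ξ * conv U W ξ) + F ξ)) ≤ ((2 * cP s * B + 2) * z : ℝ≥0) := by
  obtain ⟨mH, mW, mN, mN', mV, mU, mE, mF, hHl, hHt, hWl, hEl, hEt, hFl, hNl, hNt, hN'l, hVl,
    hVt, hUl⟩ := id h
  refine (sn_add_le (by fun_prop) (by fun_prop)).trans ?_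
  rw [sn_neg]
  calc _ ≤ (z : ℝ≥0∞) + ((2 * cP s * B + 1) * z : ℝ≥0) := by
        gcongr
        · exact (sn_I_th_mul_le _ _).trans h.H_le
        · exact (sn_mono (by linarith) _).trans (h.sn_velocity_source hs)
    _ = _ := by push_cast; ring

end Static

/-- The constant in the energy inequality. -/
noncomputable def cE (s M : ℝ) (B : ℝ≥0) : ℝ≥0 :=
  2 * (4 * cP (s - 1 / 2) * B + 1) + 2 * (2 * cP (s + 1 / 2) * B + 1) + (2 * cP s * B + 1)
    + (2 * cP s * B + 2) * (2 * cP (s - 1 / 2) * B) + 2 * cP (s - 1) * B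
    + 2 * cP (s - 1) * B * (2 * cP s * B + 2) + (M ^ 2).toNNReal * (2 * cP (s - 1 / 2) * B)
    + ((4 * s + 4) * 2 ^ (s + 2)).toNNReal * (3 * cJ * B)

/-- Write b = x² tanh x. Testing the elevation equation with the capillary weight gives −iκ w x
tanh² H̄ (N ⋆ W), where W would need s + 1/2 derivatives. The capillary part of the velocity
equation, inserted in the correction, gives ½ iκ a b H̄ (N ⋆ W) and, after transposing the
convolution with the Hermitian N, ½ iκ b H̄ (N ⋆ aW). The two agree up to a commutator. Since w x
tanh² = a b + w x tanh² q with q = M²/(M² + x²), their sum cancels the bad term up to lower order.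
All that remains is bounded with constants independent of e and κ. -/
theorem energy_rate_le {s κ e M : ℝ} {B z : ℝ≥0} {H W N N' V U E F : ℝ → ℂ} (hs : 2 ≤ s)
    (hκ : 0 < κ) (hκ1 : κ ≤ 1) (he : 0 < e) (he1 : e ≤ 1) (hM : 1 ≤ M)
    (h : EnergyBounds s κ B z H W N N' V U E F)
    (herm : ∀ᵐ ξ, N (-ξ) = (starRingEnd ℂ) (N ξ)) :
    (∫ ξ, ((regW s e (2 * π * ξ) * ((1 + κ * (2 * π * ξ) ^ 2) * kap (2 * π * ξ)) : ℝ) : ℂ) *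
        ((starRingEnd ℂ) (H ξ) * rhsH H W N V E ξ)).re
      + (∫ ξ, ((regW s e (2 * π * ξ) : ℝ) : ℂ) *
        ((starRingEnd ℂ) (W ξ) * rhsW κ H W U F ξ)).re
      + 1 / 2 * ((∫ ξ, ((modA s e M (2 * π * ξ) : ℝ) : ℂ) *
          ((starRingEnd ℂ) (rhsW κ H W U F ξ) * conv N W ξ)).re
        + (∫ ξ, ((modA s e M (2 * π * ξ) : ℝ) : ℂ) * ((starRingEnd ℂ) (W ξ) * conv N' W ξ)).re
        + (∫ ξ, ((modA s e M (2 * π * ξ) : ℝ) : ℂ) *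
          ((starRingEnd ℂ) (W ξ) * conv N (rhsW κ H W U F) ξ)).re)
      ≤ cE s M B * (z : ℝ) ^ 2 := by
  obtain ⟨mH, mW, mN, mN', mV, mU, mE, mF, hHl, hHt, hWl, hEl, hEt, hFl, hNl, hNt, hN'l, hVl,
    hVt, hUl⟩ := id h
  have cc : Measurable (starRingEnd ℂ : ℂ → ℂ) := Complex.continuous_conj.measurable
  have sκ : 0 < √κ := Real.sqrt_pos.2 hκ
  have sκ1 : ENNReal.ofReal √κ ≤ 1 := by
    rw [ENNReal.ofReal_le_one]; exact Real.sqrt_le_one.2 hκ1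
  have hκk : ENNReal.ofReal κ = ENNReal.ofReal √κ * ENNReal.ofReal √κ := by
    rw [← ENNReal.ofReal_mul sκ.le, Real.mul_self_sqrt hκ.le]
  have hHfin : sn (s + 1 / 2) H < ∞ := lt_top_of_ofReal_mul_le sκ hHt
  have fin_le : ∀ {a : ℝ≥0∞} {c : ℝ≥0}, a ≤ c → a < ∞ := fun h => h.trans_lt ENNReal.coe_lt_top
  have hGl := h.sn_conv_NW hs
  -- the pieces of the right hand sides
  set X₁ : ℝ → ℂ := fun ξ => -(Complex.I * th ξ * (conv H V ξ + conv N W ξ)) + E ξ with hX₁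
  -- X₁ is the source tested with the symbol of order 2s − 1. X₂, tested with the capillary symbol,
  -- omits N ⋆ W, whose contribution is handled by cancellation.
  set X₂ : ℝ → ℂ := fun ξ => -(Complex.I * th ξ * conv H V ξ) + E ξ with hX₂
  set R : ℝ → ℂ := fun ξ => -(Complex.I * th ξ * conv U W ξ) + F ξ with hR
  set R' : ℝ → ℂ := fun ξ => -(Complex.I * th ξ * H ξ)
    + (-(Complex.I * th ξ * conv U W ξ) + F ξ) with hR'
  have hX₁l : sn (s - 1 / 2) X₁ ≤ _ := h.sn_source hs
  have hX₂l : ENNReal.ofReal √κ * sn (s + 1 / 2) X₂ ≤ _ := h.sn_source_top hs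
  have hRl : sn s R ≤ _ := h.sn_velocity_source hs
  have hR'l : sn (s - 1 / 2) R' ≤ _ := h.sn_velocity_low hs
  have mX₁ : Measurable X₁ := by fun_prop
  have mX₂ : Measurable X₂ := by fun_prop
  have mR : Measurable R := by fun_prop
  have mR' : Measurable R' := by fun_prop
  have mG : Measurable (conv N W) := by fun_prop
  -- the symbols
  set w : ℝ → ℂ := fun ξ => ((regW s e (2 * π * ξ) : ℝ) : ℂ) with hw
  set a : ℝ → ℂ := fun ξ => ((modA s e M (2 * π * ξ) : ℝ) : ℂ) with ha
  set b : ℝ → ℂ := fun ξ => (((2 * π * ξ) ^ 2 * Real.tanh (2 * π * ξ) : ℝ) : ℂ) with hb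
  set k : ℝ → ℂ := fun ξ => ((kap (2 * π * ξ) : ℝ) : ℂ) with hk
  set x : ℝ → ℂ := fun ξ => ((2 * π * ξ : ℝ) : ℂ) with hx
  set q : ℝ → ℂ := fun ξ => ((M ^ 2 / (M ^ 2 + (2 * π * ξ) ^ 2) : ℝ) : ℂ) with hq
  have mw : Measurable w := by fun_prop
  have ma : Measurable a := by fun_prop
  have mb : Measurable b := by have := continuous_tanh.measurable; fun_prop
  have mk : Measurable k := by fun_prop
  have mx : Measurable x := by fun_prop
  have mq : Measurable q := by fun_prop
  have kx : ∀ ξ, k ξ * x ξ = th ξ := fun ξ => by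
    simp only [hk, hx, th]; rw [← Complex.ofReal_mul, kap_mul_self]
  have bx : ∀ ξ, b ξ = x ξ ^ 2 * th ξ := fun ξ => by simp only [hb, hx, th]; push_cast; ring
  -- The identity behind the cancellation: the modified symbol times b is the symbol of the bad term
  -- up to the factor 1 − q.
  have aq : ∀ ξ, w ξ * (x ξ * th ξ ^ 2) = a ξ * b ξ + w ξ * x ξ * th ξ ^ 2 * q ξ := fun ξ => by
    have hne : M ^ 2 + (2 * π * ξ) ^ 2 ≠ 0 := by positivity
    simp only [hw, ha, hb, hx, hq, th, modA]
    norm_cast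
    field_simp
    ring
  -- L is the capillary part of the velocity equation and R' the rest; only L is too rough to be
  -- estimated directly in the correction.
  set L : ℝ → ℂ := fun ξ => -(Complex.I * (κ * b ξ) * H ξ) with hL
  have mL : Measurable L := by fun_prop
  set A : ℝ → ℂ := fun ζ => a ζ * W ζ with hA
  have mA : Measurable A := by fun_prop
  have cb : ∀ ξ, (starRingEnd ℂ) (b ξ) = b ξ := fun ξ => Complex.conj_ofReal _
  have ca : ∀ ξ, (starRingEnd ℂ) (a ξ) = a ξ := fun ξ => Complex.conj_ofReal _
  have hrW : ∀ ξ, rhsW κ H W U F ξ = R' ξ + L ξ := fun ξ => by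
    simp only [rhsW, hR', hL, hb, th]; push_cast; ring
  have cL : ∀ ξ, (starRingEnd ℂ) (L ξ) = Complex.I * (κ * b ξ) * (starRingEnd ℂ) (H ξ) := fun ξ => by
    simp only [hL, map_neg, map_mul, Complex.conj_I, Complex.conj_ofReal, cb]; ring
  -- pointwise bounds of the symbols
  set Ce : ℝ := e ^ (-(s + 1)) with hCe
  have nw : ∀ ξ, ‖w ξ‖ = regW s e (2 * π * ξ) := fun ξ => by
    rw [hw, Complex.norm_real, Real.norm_eq_abs, abs_of_pos (regW_pos he.le _)]
  have nk : ∀ ξ, ‖k ξ‖ = kap (2 * π * ξ) := fun ξ => by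
    rw [hk, Complex.norm_real, Real.norm_eq_abs, abs_of_pos (kap_pos _)]
  have nx : ∀ ξ, ‖x ξ‖ = |2 * π * ξ| := fun ξ => by
    rw [hx, Complex.norm_real, Real.norm_eq_abs]
  have nx2 : ∀ ξ, ‖x ξ‖ ^ 2 ≤ jw 2 (2 * π * ξ) := fun ξ => by
    rw [nx, sq_abs, jw_two]; linarith
  have nb : ∀ ξ, ‖b ξ‖ ≤ jw 2 (2 * π * ξ) := fun ξ => by
    rw [bx, norm_mul, norm_pow]
    exact (mul_le_of_le_one_right (by positivity) (norm_th_le ξ)).trans (nx2 ξ)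
  have na : ∀ ξ, ‖a ξ‖ ≤ jw (2 * s - 1) (2 * π * ξ) := fun ξ => by
    rw [ha, Complex.norm_real]; exact abs_modA_le' (by linarith) he.le hM _
  have nae : ∀ ξ, ‖a ξ‖ * jw 2 (2 * π * ξ) ≤ Ce := fun ξ => by
    rw [ha, Complex.norm_real]
    refine le_trans ?_ (regW_mul_le (by linarith : 0 ≤ s) he he1 (2 * π * ξ))
    have h1 := abs_modA_le (s := s) he.le hM (2 * π * ξ)
    have h2 := jw_le_one (by norm_num : (-1 : ℝ) ≤ 0) (2 * π * ξ)
    have h3 := jw_nonneg 2 (2 * π * ξ)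
    have h4 := (regW_pos (s := s) he.le (2 * π * ξ)).le
    refine mul_le_mul_of_nonneg_right (h1.trans ?_) h3
    exact mul_le_of_le_one_right h4 h2
  have nwe : ∀ ξ, ‖w ξ‖ * jw 2 (2 * π * ξ) ≤ Ce := fun ξ => by
    rw [nw]; exact regW_mul_le (by linarith) he he1 _
  have nwl : ∀ ξ, ‖w ξ‖ ≤ jw (2 * s) (2 * π * ξ) := fun ξ => by
    rw [nw]; exact regW_le (by linarith) he.le _
  have nwk : ∀ ξ, ‖w ξ‖ * ‖k ξ‖ ≤ 2 * jw (2 * s - 1) (2 * π * ξ) := fun ξ => by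
    have h1 := nwl ξ
    have h2 := kap_le (2 * π * ξ)
    rw [← nk] at h2
    calc ‖w ξ‖ * ‖k ξ‖ ≤ jw (2 * s) (2 * π * ξ) * (2 * jw (-1) (2 * π * ξ)) := by
          have := jw_nonneg (2 * s) (2 * π * ξ)
          gcongr
      _ = _ := by rw [show 2 * s - 1 = 2 * s + -1 by ring, jw_add]; ring
  have nκ : ‖(κ : ℂ)‖ = κ := by rw [Complex.norm_real, Real.norm_eq_abs, abs_of_pos hκ]
  have nlin : ∀ ξ, ‖w ξ * (1 + κ * x ξ ^ 2) * th ξ‖ ≤ Ce * jw (0 + 0) (2 * π * ξ) := fun ξ => by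
    rw [norm_mul, norm_mul, add_zero, jw_zero, mul_one]
    have h1 : ‖(1 + κ * x ξ ^ 2 : ℂ)‖ ≤ jw 2 (2 * π * ξ) := by
      refine (norm_add_le _ _).trans ?_
      rw [norm_one, norm_mul, norm_pow, nκ, nx, sq_abs, jw_two]
      nlinarith [sq_nonneg (2 * π * ξ)]
    calc ‖w ξ‖ * ‖(1 + κ * x ξ ^ 2 : ℂ)‖ * ‖th ξ‖ ≤ ‖w ξ‖ * jw 2 (2 * π * ξ) * 1 := by
          have := jw_nonneg 2 (2 * π * ξ)
          have := norm_th_le ξ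
          gcongr
      _ ≤ Ce := by rw [mul_one]; exact nwe ξ
  -- finiteness
  have hH0 : sn 0 H < ∞ := (sn_mono (by linarith) _).trans_lt hHfin
  have hH2 : sn 2 H < ∞ := (sn_mono (by linarith) _).trans_lt hHfin
  have hW0 : sn 0 W < ∞ := (sn_mono (by linarith) _).trans_lt (fin_le hWl)
  have hN0 : sn 0 N < ∞ := (sn_mono (by linarith) _).trans_lt (fin_le hNl)
  have hN1 : sn 1 N < ∞ := (sn_mono (by linarith) _).trans_lt (fin_le hNl)
  have hG0 : sn 0 (conv N W) < ∞ := (sn_mono (by linarith) _).trans_lt (fin_le hGl)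
  have hR'0 : sn 0 R' < ∞ := (sn_mono (by linarith) _).trans_lt (fin_le hR'l)
  -- Two derivatives of H are available because κ > 0. This finiteness is not uniform in κ and
  -- serves only to split integrals.
  have hL0 : sn 0 L < ∞ := by
    have : sn 0 L ≤ ENNReal.ofReal 1 * sn (0 + 2) H := by
      simp only [hL]
      rw [sn_neg]
      refine sn_mul_le (m := fun ξ => Complex.I * (κ * b ξ)) fun ξ => ?_
      rw [norm_mul, norm_mul, Complex.norm_I, nκ, one_mul, one_mul]
      have := nb ξ
      nlinarith [norm_nonneg (b ξ)]
    refine this.trans_lt (ENNReal.mul_lt_top ENNReal.ofReal_lt_top (by simpa using hH2))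
  have hA0 : sn 0 A < ∞ := by
    have : sn 0 A ≤ ENNReal.ofReal Ce * sn (0 + 0) W := by
      refine sn_mul_le fun ξ => ?_
      rw [jw_zero, mul_one]
      refine le_trans ?_ (nae ξ)
      exact le_mul_of_one_le_right (norm_nonneg _) (one_le_jw (by norm_num) _)
    exact this.trans_lt (ENNReal.mul_lt_top ENNReal.ofReal_lt_top (by simpa using hW0))
  have hNA0 : sn 0 (conv N A) < ∞ :=
    (sn_conv_le_left le_rfl mN mA).trans_lt (ENNReal.mul_lt_top
      (ENNReal.mul_lt_top (by simp) ENNReal.coe_lt_top)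
      (ENNReal.mul_lt_top (by simpa using hN1) hA0))
  have hNL0 : sn 0 (conv N L) < ∞ :=
    (sn_conv_le_left le_rfl mN mL).trans_lt (ENNReal.mul_lt_top
      (ENNReal.mul_lt_top (by simp) ENNReal.coe_lt_top)
      (ENNReal.mul_lt_top (by simpa using hN1) hL0))
  -- the terms that only need to be integrable
  have iT0a : Integrable fun ξ => (w ξ * (1 + κ * x ξ ^ 2) * th ξ * (-Complex.I)) *
      ((starRingEnd ℂ) (H ξ) * W ξ) :=
    integrable_of_lintegral_le (by fun_prop) (ENNReal.mul_lt_top ENNReal.ofReal_lt_top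
      (ENNReal.mul_lt_top hH0 hW0)) (lintegral_symbol_mul_le (by fun_prop) mH mW fun ξ => by
        rw [norm_mul _ (-Complex.I), norm_neg, Complex.norm_I, mul_one]; exact nlin ξ)
  have iT0b : Integrable fun ξ => (w ξ * (1 + κ * x ξ ^ 2) * th ξ * (-Complex.I)) *
      ((starRingEnd ℂ) (W ξ) * H ξ) :=
    integrable_of_lintegral_le (by fun_prop) (ENNReal.mul_lt_top ENNReal.ofReal_lt_top
      (ENNReal.mul_lt_top hW0 hH0)) (lintegral_symbol_mul_le (by fun_prop) mW mH fun ξ => by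
        rw [norm_mul _ (-Complex.I), norm_neg, Complex.norm_I, mul_one]; exact nlin ξ)
  have iJ1b : Integrable fun ξ => (Complex.I * κ * a ξ * b ξ) *
      ((starRingEnd ℂ) (H ξ) * conv N W ξ) :=
    integrable_of_lintegral_le (by fun_prop) (ENNReal.mul_lt_top ENNReal.ofReal_lt_top
      (ENNReal.mul_lt_top hH0 hG0)) (lintegral_symbol_mul_le (C := Ce) (by fun_prop) mH mG
      fun ξ => by
        rw [add_zero, jw_zero, mul_one, norm_mul, norm_mul, norm_mul, Complex.norm_I, nκ, one_mul]
        calc κ * ‖a ξ‖ * ‖b ξ‖ ≤ 1 * ‖a ξ‖ * jw 2 (2 * π * ξ) := by gcongr; exact nb ξ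
          _ ≤ Ce := by rw [one_mul]; exact nae ξ)
  have iJ3b : Integrable fun ξ => a ξ * ((starRingEnd ℂ) (W ξ) * conv N L ξ) :=
    integrable_of_lintegral_le (by fun_prop) (ENNReal.mul_lt_top ENNReal.ofReal_lt_top
      (ENNReal.mul_lt_top hW0 hNL0)) (lintegral_symbol_mul_le (C := Ce) ma mW (by fun_prop)
      fun ξ => by
        rw [add_zero, jw_zero, mul_one]
        refine le_trans ?_ (nae ξ)
        exact le_mul_of_one_le_right (norm_nonneg _) (one_le_jw (by norm_num) _))
  have iJ3c : Integrable fun ξ => (Complex.I * κ * b ξ) *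
      ((starRingEnd ℂ) (H ξ) * conv N A ξ) :=
    integrable_of_lintegral_le (by fun_prop) (ENNReal.mul_lt_top ENNReal.ofReal_lt_top
      (ENNReal.mul_lt_top hH2 hNA0)) (lintegral_symbol_mul_le (C := 1) (by fun_prop) mH
      (by fun_prop) fun ξ => by
        rw [add_zero, one_mul, norm_mul, norm_mul, Complex.norm_I, nκ, one_mul]
        have := nb ξ
        nlinarith [norm_nonneg (b ξ)])
  -- the terms that are estimated
  have t1 : ∫⁻ ξ, ‖(w ξ * k ξ) * ((starRingEnd ℂ) (H ξ) * X₁ ξ)‖ₑ ≤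
      (2 * (z * ((4 * cP (s - 1 / 2) * B + 1) * z)) : ℝ≥0) := by
    refine (lintegral_symbol_mul_le (α := s - 1 / 2) (β := s - 1 / 2) (C := 2) (by fun_prop) mH mX₁
      fun ξ => ?_).trans ?_
    · rw [norm_mul, show s - 1 / 2 + (s - 1 / 2) = 2 * s - 1 by ring]; exact nwk ξ
    · rw [ENNReal.ofReal_ofNat, ENNReal.coe_mul, ENNReal.coe_mul]; gcongr; rfl
  have t2 : ∫⁻ ξ, ‖(κ * x ξ ^ 2 * w ξ * k ξ) * ((starRingEnd ℂ) (H ξ) * X₂ ξ)‖ₑ ≤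
      (2 * (z * ((2 * cP (s + 1 / 2) * B + 1) * z)) : ℝ≥0) := by
    refine (lintegral_symbol_mul_le (α := s + 1 / 2) (β := s + 1 / 2) (C := κ * 2) (by fun_prop) mH
      mX₂ fun ξ => ?_).trans ?_
    · rw [norm_mul, norm_mul, norm_mul, norm_pow, nκ,
        show s + 1 / 2 + (s + 1 / 2) = 2 + (2 * s - 1) by ring, jw_add]
      have h1 := nwk ξ
      have h2 := nx2 ξ
      calc κ * ‖x ξ‖ ^ 2 * ‖w ξ‖ * ‖k ξ‖ = κ * (‖x ξ‖ ^ 2 * (‖w ξ‖ * ‖k ξ‖)) := by ring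
        _ ≤ κ * (jw 2 (2 * π * ξ) * (2 * jw (2 * s - 1) (2 * π * ξ))) := by
            have := jw_nonneg 2 (2 * π * ξ)
            gcongr
        _ = _ := by ring
    · rw [ENNReal.ofReal_mul hκ.le, hκk, ENNReal.ofReal_ofNat]
      calc _ = 2 * ((ENNReal.ofReal √κ * sn (s + 1 / 2) H) *
            (ENNReal.ofReal √κ * sn (s + 1 / 2) X₂)) := by ring
        _ ≤ _ := by rw [ENNReal.coe_mul, ENNReal.coe_mul]; gcongr; rfl
  have t3 : ∫⁻ ξ, ‖w ξ * ((starRingEnd ℂ) (W ξ) * R ξ)‖ₑ ≤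
      (z * ((2 * cP s * B + 1) * z) : ℝ≥0) := by
    refine (lintegral_symbol_mul_le (α := s) (β := s) (C := 1) mw mW mR fun ξ => ?_).trans ?_
    · rw [one_mul, ← two_mul]; exact nwl ξ
    · rw [ENNReal.ofReal_one, one_mul, ENNReal.coe_mul]; gcongr
  have t4 : ∫⁻ ξ, ‖a ξ * ((starRingEnd ℂ) (R' ξ) * conv N W ξ)‖ₑ ≤
      ((2 * cP s * B + 2) * z * (2 * cP (s - 1 / 2) * (B * z)) : ℝ≥0) := by
    refine (lintegral_symbol_mul_le (α := s - 1 / 2) (β := s - 1 / 2) (C := 1) ma mR' mG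
      fun ξ => ?_).trans ?_
    · rw [one_mul, show s - 1 / 2 + (s - 1 / 2) = 2 * s - 1 by ring]; exact na ξ
    · rw [ENNReal.ofReal_one, one_mul, ENNReal.coe_mul]; gcongr
  have t5 : ∫⁻ ξ, ‖a ξ * ((starRingEnd ℂ) (W ξ) * conv N' W ξ)‖ₑ ≤
      (z * (2 * cP (s - 1) * (B * z)) : ℝ≥0) := by
    refine (lintegral_symbol_mul_le (α := s) (β := s - 1) (C := 1) ma mW (by fun_prop)
      fun ξ => ?_).trans ?_
    · rw [one_mul, show s + (s - 1) = 2 * s - 1 by ring]; exact na ξ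
    · rw [ENNReal.ofReal_one, one_mul, ENNReal.coe_mul]
      gcongr
      refine (sn_conv_le (by linarith) mN' mW).trans ?_
      push_cast
      have : sn (s - 1) W ≤ z := (sn_mono (by linarith) _).trans hWl
      gcongr
  have t6 : ∫⁻ ξ, ‖a ξ * ((starRingEnd ℂ) (W ξ) * conv N R' ξ)‖ₑ ≤
      (z * (2 * cP (s - 1) * (B * ((2 * cP s * B + 2) * z))) : ℝ≥0) := by
    refine (lintegral_symbol_mul_le (α := s) (β := s - 1) (C := 1) ma mW (by fun_prop)
      fun ξ => ?_).trans ?_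
    · rw [one_mul, show s + (s - 1) = 2 * s - 1 by ring]; exact na ξ
    · rw [ENNReal.ofReal_one, one_mul, ENNReal.coe_mul]
      gcongr
      refine (sn_conv_le (by linarith) mN mR').trans ?_
      have h1 : sn (s - 1) N ≤ B := (sn_mono (by linarith) _).trans hNl
      have h2 := (sn_mono (by linarith : s - 1 ≤ s - 1 / 2) R').trans hR'l
      rw [ENNReal.coe_mul, ENNReal.coe_mul, ENNReal.coe_mul]
      gcongr
      rfl
  have t7 : ∫⁻ ξ, ‖(-Complex.I * κ * (w ξ * x ξ * th ξ ^ 2 * q ξ)) *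
      ((starRingEnd ℂ) (H ξ) * conv N W ξ)‖ₑ ≤
      ((M ^ 2).toNNReal * (z * (2 * cP (s - 1 / 2) * (B * z))) : ℝ≥0) := by
    refine (lintegral_symbol_mul_le (α := s - 1 / 2) (β := s - 1 / 2) (C := M ^ 2) (by fun_prop) mH
      mG fun ξ => ?_).trans ?_
    -- In the remainder of the cancellation x q has order −1, at the price of the factor M².
    · have h1 : ‖x ξ‖ * ‖q ξ‖ ≤ M ^ 2 * jw (-1) (2 * π * ξ) := by
        have hp : 0 < M ^ 2 + (2 * π * ξ) ^ 2 := by positivity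
        rw [nx, hq, Complex.norm_real, Real.norm_eq_abs,
          abs_of_nonneg (by positivity : 0 ≤ M ^ 2 / (M ^ 2 + (2 * π * ξ) ^ 2)),
          eq_inv_of_mul_eq_one_right (jw_mul_neg 1 (2 * π * ξ)), ← div_eq_mul_inv, ← mul_div_assoc,
          div_le_div_iff₀ hp (jw_pos 1 _)]
        have h2 := abs_le_jw_one (2 * π * ξ)
        have h3 := jw_one_sq (2 * π * ξ)
        have h4 := jw_pos 1 (2 * π * ξ)
        have h5 : |2 * π * ξ| * jw 1 (2 * π * ξ) ≤ M ^ 2 + (2 * π * ξ) ^ 2 := by nlinarith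
        calc |2 * π * ξ| * M ^ 2 * jw 1 (2 * π * ξ)
            = M ^ 2 * (|2 * π * ξ| * jw 1 (2 * π * ξ)) := by ring
          _ ≤ _ := by gcongr
      have h2 := norm_th_le ξ
      have h3 := nwl ξ
      rw [show s - 1 / 2 + (s - 1 / 2) = 2 * s + -1 by ring, jw_add]
      simp only [norm_mul, norm_neg, norm_pow, Complex.norm_I, nκ, one_mul]
      have := jw_nonneg (2 * s) (2 * π * ξ)
      calc κ * (‖w ξ‖ * ‖x ξ‖ * ‖th ξ‖ ^ 2 * ‖q ξ‖)
          = κ * ‖th ξ‖ ^ 2 * (‖w ξ‖ * (‖x ξ‖ * ‖q ξ‖)) := by ring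
        _ ≤ 1 * 1 ^ 2 * (jw (2 * s) (2 * π * ξ) * (M ^ 2 * jw (-1) (2 * π * ξ))) := by
            gcongr
        _ = _ := by ring
    · rw [ENNReal.coe_mul, ENNReal.coe_mul]; gcongr; rfl
  have t8 : ∫⁻ ξ, ‖(Complex.I * κ * b ξ) * ((starRingEnd ℂ) (H ξ) *
      (conv N A ξ - a ξ * conv N W ξ))‖ₑ ≤
      (((4 * s + 4) * 2 ^ (s + 2)).toNNReal * (3 * cJ * (z * (B * z))) : ℝ≥0) := by
    have hc := lintegral_commutator_le hs he.le he1 hM mH mN mW hN0 hW0 hA0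
    have e1 : ∀ ξ, ‖(Complex.I * κ * b ξ) * ((starRingEnd ℂ) (H ξ) *
        (conv N A ξ - a ξ * conv N W ξ))‖ₑ = ENNReal.ofReal κ * ‖b ξ * ((starRingEnd ℂ) (H ξ) *
        (conv N A ξ - a ξ * conv N W ξ))‖ₑ := fun ξ => by
      rw [mul_assoc, mul_assoc, enorm_mul, enorm_mul, ← ofReal_norm Complex.I, Complex.norm_I,
        ENNReal.ofReal_one, one_mul, ← ofReal_norm (κ : ℂ), nκ]
    simp_rw [e1]
    rw [lintegral_const_mul _ (by fun_prop), hκk]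
    have g1 : ENNReal.ofReal √κ * sn s H ≤ z :=
      (mul_le_mul_right (sn_mono (by linarith) _) _).trans hHt
    have g2 : ENNReal.ofReal √κ * sn 2 N ≤ B :=
      (mul_le_mul_right (sn_mono (by linarith) _) _).trans hNt
    have g3 : sn 1 W ≤ z := (sn_mono (by linarith) _).trans hWl
    have g4 : sn (3 / 2) H ≤ z := (sn_mono (by linarith) _).trans hHl
    -- In the first two terms H and N take one √κ each. In the third N takes one and the other is
    -- bounded by 1.
    calc _ ≤ ENNReal.ofReal √κ * ENNReal.ofReal √κ * (ENNReal.ofReal ((4 * s + 4) * 2 ^ (s + 2)) *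
          (cJ * (sn s H * (sn 2 N * sn s W))
            + cJ * (sn (s + 1 / 2) H * (sn (s + 1 / 2) N * sn 1 W))
            + cJ * (sn (3 / 2) H * (sn (s + 1 / 2) N * sn s W)))) := by gcongr
      _ = ENNReal.ofReal ((4 * s + 4) * 2 ^ (s + 2)) *
          (cJ * ((ENNReal.ofReal √κ * sn s H) * ((ENNReal.ofReal √κ * sn 2 N) * sn s W))
            + cJ * ((ENNReal.ofReal √κ * sn (s + 1 / 2) H) *
              ((ENNReal.ofReal √κ * sn (s + 1 / 2) N) * sn 1 W))
            + ENNReal.ofReal √κ * (cJ * (sn (3 / 2) H *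
              ((ENNReal.ofReal √κ * sn (s + 1 / 2) N) * sn s W)))) := by ring
      _ ≤ ENNReal.ofReal ((4 * s + 4) * 2 ^ (s + 2)) *
          (cJ * (z * (B * z)) + cJ * (z * (B * z)) + 1 * (cJ * (z * (B * z)))) := by gcongr
      _ = _ := by rw [ENNReal.ofReal]; push_cast; ring
  have iOf : ∀ {F : ℝ → ℂ} {c : ℝ≥0}, Measurable F → ∫⁻ ξ, ‖F ξ‖ₑ ≤ c → Integrable F :=
    fun hF h => integrable_of_lintegral_le hF ENNReal.coe_lt_top h
  have i1 := iOf (by fun_prop) t1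
  have i2 := iOf (by fun_prop) t2
  have i3 := iOf (by fun_prop) t3
  have i4 := iOf (by fun_prop) t4
  have i6 := iOf (by fun_prop) t6
  have i7 := iOf (by fun_prop) t7
  -- decomposition of the integrals
  have I1 : ∫ ξ, ((regW s e (2 * π * ξ) * ((1 + κ * (2 * π * ξ) ^ 2) * kap (2 * π * ξ)) : ℝ) : ℂ) *
      ((starRingEnd ℂ) (H ξ) * rhsH H W N V E ξ) = _ :=
    (integral_congr_ae (ae_of_all _ fun ξ => by
      have h1 := kx ξ
      have h2 := aq ξ
      have e0 : ((regW s e (2 * π * ξ) * ((1 + κ * (2 * π * ξ) ^ 2) * kap (2 * π * ξ)) : ℝ) : ℂ) =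
          w ξ * ((1 + κ * x ξ ^ 2) * k ξ) := by
        simp only [hw, hx, hk]; push_cast; ring
      have e1 : rhsH H W N V E ξ = -(Complex.I * x ξ * W ξ)
        - Complex.I * th ξ * (conv H V ξ + conv N W ξ) + E ξ := rfl
      have e2 : X₁ ξ = -(Complex.I * th ξ * (conv H V ξ + conv N W ξ)) + E ξ := rfl
      have e3 : X₂ ξ = -(Complex.I * th ξ * conv H V ξ) + E ξ := rfl
      change _ = (w ξ * (1 + κ * x ξ ^ 2) * th ξ * (-Complex.I)) * ((starRingEnd ℂ) (H ξ) * W ξ)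
        + (w ξ * k ξ) * ((starRingEnd ℂ) (H ξ) * X₁ ξ)
        + (κ * x ξ ^ 2 * w ξ * k ξ) * ((starRingEnd ℂ) (H ξ) * X₂ ξ)
        + ((-Complex.I * κ * (w ξ * x ξ * th ξ ^ 2 * q ξ)) *
            ((starRingEnd ℂ) (H ξ) * conv N W ξ)
          - (Complex.I * κ * a ξ * b ξ) * ((starRingEnd ℂ) (H ξ) * conv N W ξ))
      simp only [e0, e1, e2, e3]
      linear_combination (-(Complex.I * w ξ * (1 + κ * x ξ ^ 2) * (starRingEnd ℂ) (H ξ) * W ξ)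
        - Complex.I * κ * (starRingEnd ℂ) (H ξ) * conv N W ξ * w ξ * x ξ * th ξ) * h1
        - Complex.I * κ * (starRingEnd ℂ) (H ξ) * conv N W ξ * h2)).trans
    ((integral_add ((iT0a.add i1).add i2) (i7.sub iJ1b)).trans
      (congrArg₂ _ ((integral_add (iT0a.add i1) i2).trans
        (congrArg₂ _ (integral_add iT0a i1) rfl)) (integral_sub i7 iJ1b)))
  have I2 : ∫ ξ, w ξ * ((starRingEnd ℂ) (W ξ) * rhsW κ H W U F ξ) = _ :=
    (integral_congr_ae (ae_of_all _ fun ξ => by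
      have e1 : R ξ = -(Complex.I * th ξ * conv U W ξ) + F ξ := rfl
      have h1 := bx ξ
      have e2 : L ξ = -(Complex.I * (κ * b ξ) * H ξ) := rfl
      have e3 : R' ξ = -(Complex.I * th ξ * H ξ) + (-(Complex.I * th ξ * conv U W ξ) + F ξ) := rfl
      simp only [hrW, e1, e2, e3, h1]
      ring)).trans (integral_add iT0b i3)
  have J1 : ∫ ξ, a ξ * ((starRingEnd ℂ) (rhsW κ H W U F ξ) * conv N W ξ) = _ :=
    (integral_congr_ae (ae_of_all _ fun ξ => by
      change _ = a ξ * ((starRingEnd ℂ) (R' ξ) * conv N W ξ)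
        + (Complex.I * κ * a ξ * b ξ) * ((starRingEnd ℂ) (H ξ) * conv N W ξ)
      simp only [hrW, map_add, cL]
      ring)).trans (integral_add i4 iJ1b)
  have J3 : ∫ ξ, a ξ * ((starRingEnd ℂ) (W ξ) * conv N (rhsW κ H W U F) ξ) = _ :=
    (integral_congr_ae (ae_of_all _ fun ξ => by
      change _ = a ξ * ((starRingEnd ℂ) (W ξ) * conv N R' ξ)
        + a ξ * ((starRingEnd ℂ) (W ξ) * conv N L ξ)
      have e1 : rhsW κ H W U F = fun ξ => R' ξ + L ξ := funext hrW
      simp only [e1]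
      rw [conv_add_right mN mR' mL hN0 hR'0 hL0]
      ring)).trans (integral_add i6 iJ3b)
  -- Transposition moves the capillary symbol b out of the convolution and onto H, next to N ⋆ aW.
  have J3' : (∫ ξ, a ξ * ((starRingEnd ℂ) (W ξ) * conv N L ξ)).re =
      (∫ ξ, (Complex.I * κ * b ξ) * ((starRingEnd ℂ) (H ξ) * conv N A ξ)).re := by
    have e1 : ∫ ξ, a ξ * ((starRingEnd ℂ) (W ξ) * conv N L ξ) =
        ∫ ξ, (starRingEnd ℂ) (A ξ) * conv N L ξ :=
      integral_congr_ae (ae_of_all _ fun ξ => by simp only [hA, map_mul, ca]; ring)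
    rw [e1, integral_conj_mul_conv_swap mA mN mL hA0 hN1 hL0 herm, ← Complex.conj_re,
      ← integral_conj]
    congr 2
    ext ξ
    simp only [map_mul, Complex.conj_conj, cL]
    ring
  -- The linear coupling is skew: the two cross terms are negative conjugates of each other.
  have T0 : (∫ ξ, (w ξ * (1 + κ * x ξ ^ 2) * th ξ * (-Complex.I)) *
      ((starRingEnd ℂ) (W ξ) * H ξ)).re = -(∫ ξ, (w ξ * (1 + κ * x ξ ^ 2) * th ξ * (-Complex.I)) *
      ((starRingEnd ℂ) (H ξ) * W ξ)).re := by
    rw [← Complex.conj_re (∫ ξ, _ * ((starRingEnd ℂ) (H ξ) * W ξ)), ← integral_conj,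
      ← Complex.neg_re, ← integral_neg]
    congr 2
    ext ξ
    simp only [hw, hx, th, map_mul, map_neg, map_add, map_one, map_pow, Complex.conj_ofReal,
      Complex.conj_I, Complex.conj_conj]
    ring
  have C8 : ∫ ξ, (Complex.I * κ * b ξ) * ((starRingEnd ℂ) (H ξ) *
      (conv N A ξ - a ξ * conv N W ξ)) = _ :=
    (integral_congr_ae (ae_of_all _ fun ξ => by
      change _ = (Complex.I * κ * b ξ) * ((starRingEnd ℂ) (H ξ) * conv N A ξ)
        - (Complex.I * κ * a ξ * b ξ) * ((starRingEnd ℂ) (H ξ) * conv N W ξ)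
      ring)).trans (integral_sub iJ3c iJ1b)
  have r1 := re_integral_le_of_lintegral_le t1
  have r2 := re_integral_le_of_lintegral_le t2
  have r3 := re_integral_le_of_lintegral_le t3
  have r4 := re_integral_le_of_lintegral_le t4
  have r5 := re_integral_le_of_lintegral_le t5
  have r6 := re_integral_le_of_lintegral_le t6
  have r7 := re_integral_le_of_lintegral_le t7
  have r8 := re_integral_le_of_lintegral_le t8
  -- The integral of iκ a b H̄ (N ⋆ W) has coefficient −1 in `I1` and 1/2 in `J1`. The missing 1/2
  -- comes from `J3'`, once `C8` exchanges N ⋆ aW for a (N ⋆ W).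
  rw [I1, I2, J1, J3]
  rw [C8] at r8
  simp only [Complex.add_re, Complex.sub_re] at r8 ⊢
  rw [J3', T0]
  have hfin : (cE s M B : ℝ) * (z : ℝ) ^ 2 = ((cE s M B * z ^ 2 : ℝ≥0) : ℝ) := by push_cast; ring
  rw [hfin]
  have hsum : cE s M B * z ^ 2 = 2 * (z * ((4 * cP (s - 1 / 2) * B + 1) * z))
      + 2 * (z * ((2 * cP (s + 1 / 2) * B + 1) * z)) + z * ((2 * cP s * B + 1) * z)
      + (2 * cP s * B + 2) * z * (2 * cP (s - 1 / 2) * (B * z)) + z * (2 * cP (s - 1) * (B * z))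
      + z * (2 * cP (s - 1) * (B * ((2 * cP s * B + 2) * z)))
      + (M ^ 2).toNNReal * (z * (2 * cP (s - 1 / 2) * (B * z)))
      + ((4 * s + 4) * 2 ^ (s + 2)).toNNReal * (3 * cJ * (z * (B * z))) := by
    unfold cE; ring
  rw [hsum]
  simp only [NNReal.coe_add]
  have p4 := NNReal.coe_nonneg ((2 * cP s * B + 2) * z * (2 * cP (s - 1 / 2) * (B * z)))
  have p5 := NNReal.coe_nonneg (z * (2 * cP (s - 1) * (B * z)))
  have p6 := NNReal.coe_nonneg (z * (2 * cP (s - 1) * (B * ((2 * cP s * B + 2) * z))))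
  have p8 := NNReal.coe_nonneg (((4 * s + 4) * 2 ^ (s + 2)).toNNReal * (3 * cJ * (z * (B * z))))
  linarith

/-! ### The energy functional -/

theorem regW_mul_kap_le {s e κ : ℝ} (hs : 0 ≤ s) (hκ : 0 ≤ κ) (he : 0 ≤ e) (x : ℝ) :
    regW s e x * ((1 + κ * x ^ 2) * kap x) ≤ 2 * (jw (2 * s - 1) x + κ * jw (2 * s + 1) x) := by
  have h1 := regW_le hs he x
  have h2 := kap_le x
  have h3 := (regW_pos (s := s) he x).le
  have h4 := jw_nonneg (2 * s) x
  have h5 : x ^ 2 ≤ jw 2 x := by rw [jw_two]; linarith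
  have h6 := jw_nonneg (-1) x
  calc regW s e x * ((1 + κ * x ^ 2) * kap x)
      ≤ jw (2 * s) x * ((1 + κ * jw 2 x) * (2 * jw (-1) x)) := by
        have := (kap_pos x).le
        have := jw_nonneg 2 x
        have : 0 ≤ 1 + κ * jw 2 x := by positivity
        gcongr
    _ = 2 * (jw (2 * s) x * jw (-1) x + κ * (jw (2 * s) x * jw (-1) x * jw 2 x)) := by ring
    _ = _ := by
        rw [show 2 * s + 1 = 2 * s + -1 + 2 by ring, show 2 * s - 1 = 2 * s + -1 by ring,
          jw_add (2 * s + -1), jw_add (2 * s)]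

theorem regW_mul_kap_le_const {s e κ : ℝ} (hs : 0 ≤ s) (hκ : 0 ≤ κ) (hκ1 : κ ≤ 1) (he : 0 < e)
    (he1 : e ≤ 1) (x : ℝ) : regW s e x * ((1 + κ * x ^ 2) * kap x) ≤ 2 * e ^ (-(s + 1)) := by
  have h1 := regW_mul_le hs he he1 x
  have h2 : kap x ≤ 2 := (kap_le x).trans (by
    have := jw_le_one (by norm_num : (-1 : ℝ) ≤ 0) x; linarith)
  have h3 := (regW_pos (s := s) he.le x).le
  have h4 : 1 + κ * x ^ 2 ≤ jw 2 x := by rw [jw_two]; nlinarith [sq_nonneg x]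
  have h5 := jw_nonneg 2 x
  calc regW s e x * ((1 + κ * x ^ 2) * kap x) ≤ regW s e x * (jw 2 x * 2) := by
        have := (kap_pos x).le
        gcongr
    _ = 2 * (regW s e x * jw 2 x) := by ring
    _ ≤ _ := by gcongr

theorem regW_le_const {s e : ℝ} (hs : 0 ≤ s) (he : 0 < e) (he1 : e ≤ 1) (x : ℝ) :
    regW s e x ≤ e ^ (-(s + 1)) := by
  refine le_trans ?_ (regW_mul_le hs he he1 x)
  exact le_mul_of_one_le_right (regW_pos he.le x).le (one_le_jw (by norm_num) x)

/-- The square root of the symbol of the elevation part of the energy. -/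
noncomputable def symA (s e κ ξ : ℝ) : ℂ :=
  ((√(regW s e (2 * π * ξ) * ((1 + κ * (2 * π * ξ) ^ 2) * kap (2 * π * ξ))) : ℝ) : ℂ)

/-- The square root of the symbol of the velocity part of the energy. -/
noncomputable def symB (s e ξ : ℝ) : ℂ := ((√(regW s e (2 * π * ξ)) : ℝ) : ℂ)

/-- The symbol of the modified part of the energy. -/
noncomputable def symM (s e M ξ : ℝ) : ℂ := ((modA s e M (2 * π * ξ) : ℝ) : ℂ)

theorem bddSymbol_one : BddSymbol fun _ => (1 : ℂ) := ⟨measurable_const, 1, fun _ => by simp⟩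

theorem bddSymbol_symA {s e κ : ℝ} (hs : 0 ≤ s) (hκ : 0 ≤ κ) (hκ1 : κ ≤ 1) (he : 0 < e)
    (he1 : e ≤ 1) : BddSymbol (symA s e κ) := by
  refine ⟨by unfold symA; fun_prop, √(2 * e ^ (-(s + 1))), fun ξ => ?_⟩
  rw [symA, Complex.norm_real, Real.norm_eq_abs, abs_of_nonneg (Real.sqrt_nonneg _)]
  exact Real.sqrt_le_sqrt (regW_mul_kap_le_const hs hκ hκ1 he he1 _)

theorem bddSymbol_symB {s e : ℝ} (hs : 0 ≤ s) (he : 0 < e) (he1 : e ≤ 1) :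
    BddSymbol (symB s e) := by
  refine ⟨by unfold symB; fun_prop, √(e ^ (-(s + 1))), fun ξ => ?_⟩
  rw [symB, Complex.norm_real, Real.norm_eq_abs, abs_of_nonneg (Real.sqrt_nonneg _)]
  exact Real.sqrt_le_sqrt (regW_le_const hs he he1 _)

theorem measurable_symM (s e M : ℝ) : Measurable (symM s e M) := by unfold symM; fun_prop

/-- The convolution of two L² functions is a bounded function, and for fixed e the modified symbol
is dominated by ⟨x⟩⁻¹, which is square integrable. So the correction is a bounded trilinear form on
L². -/
theorem eLpNorm_symM_mul_conv_le {s e M : ℝ} (hs : 0 ≤ s) (he : 0 < e) (he1 : e ≤ 1) (hM : 1 ≤ M)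
    (f g : L2R) : eLpNorm (fun ξ => symM s e M ξ *
      conv (fun ζ => 1 * f ζ) (fun ζ => 1 * g ζ) ξ) 2 volume ≤
      ((e ^ (-(s + 1))).toNNReal * cJ : ℝ≥0) * (‖f‖ₑ * ‖g‖ₑ) := by
  simp only [one_mul]
  have hpt : ∀ ξ, ‖symM s e M ξ * conv f g ξ‖ₑ ≤
      (((e ^ (-(s + 1))).toNNReal * (‖f‖₊ * ‖g‖₊) : ℝ≥0) : ℝ≥0∞) *
        ‖ENNReal.ofReal (jw (-1) (2 * π * ξ))‖ₑ := fun ξ => by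
    rw [enorm_mul, enorm_eq_self]
    have h1 : ‖symM s e M ξ‖ₑ ≤
        ENNReal.ofReal (e ^ (-(s + 1))) * ENNReal.ofReal (jw (-1) (2 * π * ξ)) := by
      rw [symM, ← ofReal_norm, Complex.norm_real, ← ENNReal.ofReal_mul (by positivity)]
      refine ENNReal.ofReal_le_ofReal ((abs_modA_le he.le hM _).trans ?_)
      gcongr
      · exact jw_nonneg _ _
      · exact regW_le_const hs he he1 _
    have h2 : ‖conv f g ξ‖ₑ ≤ ‖f‖ₑ * ‖g‖ₑ := by
      refine (enorm_conv_le _ _ ξ).trans ((lconv_le_eLpNorm_two (measurable_L2 f).enorm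
        (measurable_L2 g).enorm ξ).trans_eq ?_)
      rw [Lp.enorm_def, Lp.enorm_def, eLpNorm_enorm, eLpNorm_enorm]
    calc _ ≤ _ := mul_le_mul' h1 h2
      _ = _ := by
        push_cast
        rw [← enorm_eq_nnnorm, ← enorm_eq_nnnorm, ENNReal.ofReal]; ring
  have h := eLpNorm_le_nnreal_smul_eLpNorm_of_ae_le_mul' (μ := volume) (ae_of_all _ hpt) 2
  rw [ENNReal.smul_def, smul_eq_mul, ← coe_cJ] at h
  refine h.trans_eq ?_
  push_cast
  rw [← enorm_eq_nnnorm, ← enorm_eq_nnnorm]; ring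

section Energy

variable {s e κ M : ℝ} (hs : 0 ≤ s) (hκ : 0 ≤ κ) (hκ1 : κ ≤ 1) (he : 0 < e) (he1 : e ≤ 1)
  (hM : 1 ≤ M)

/-- The bilinear map of the modified part of the energy. -/
noncomputable def modBilin : L2R →L[ℂ] L2R →L[ℂ] L2R :=
  convCLM bddSymbol_one bddSymbol_one (measurable_symM s e M) _
    (eLpNorm_symM_mul_conv_le hs he he1 hM)

theorem coeFn_modBilin (f g : L2R) : modBilin hs he he1 hM f g =ᵐ[volume]
    fun ξ => symM s e M ξ * conv f g ξ := by
  have := coeFn_convCLM bddSymbol_one bddSymbol_one (measurable_symM s e M) _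
    (eLpNorm_symM_mul_conv_le hs he he1 hM) f g
  simp only [one_mul] at this
  exact this

/-- The modified energy (before taking real parts). -/
noncomputable def energyC (h w η : L2R) : ℂ :=
  1 / 2 * (inner ℂ (mulCLM _ (bddSymbol_symA hs hκ hκ1 he he1) h)
      (mulCLM _ (bddSymbol_symA hs hκ hκ1 he he1) h)
    + inner ℂ (mulCLM _ (bddSymbol_symB hs he he1) w) (mulCLM _ (bddSymbol_symB hs he he1) w)
    + inner ℂ w (modBilin hs he he1 hM η w))

theorem inner_mulCLM_symA (f g : L2R) : inner ℂ (mulCLM _ (bddSymbol_symA hs hκ hκ1 he he1) f)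
    (mulCLM _ (bddSymbol_symA hs hκ hκ1 he he1) g) =
    ∫ ξ, ((regW s e (2 * π * ξ) * ((1 + κ * (2 * π * ξ) ^ 2) * kap (2 * π * ξ)) : ℝ) : ℂ) *
      ((starRingEnd ℂ) (f ξ) * g ξ) := by
  rw [L2.inner_def]
  refine integral_congr_ae ?_
  filter_upwards [coeFn_mulCLM (bddSymbol_symA hs hκ hκ1 he he1) f,
    coeFn_mulCLM (bddSymbol_symA hs hκ hκ1 he he1) g] with ξ h1 h2
  rw [h1, h2, RCLike.inner_apply, symA, map_mul, Complex.conj_ofReal]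
  have p : 0 ≤ regW s e (2 * π * ξ) * ((1 + κ * (2 * π * ξ) ^ 2) * kap (2 * π * ξ)) := by
    have := (regW_pos (s := s) he.le (2 * π * ξ)).le
    have := (kap_pos (2 * π * ξ)).le
    positivity
  have := congrArg (fun r : ℝ => (r : ℂ)) (Real.mul_self_sqrt p)
  simp only [Complex.ofReal_mul] at this
  push_cast at this ⊢
  linear_combination ((starRingEnd ℂ) (f ξ) * g ξ) * this

theorem inner_mulCLM_symB (f g : L2R) : inner ℂ (mulCLM _ (bddSymbol_symB hs he he1) f)
    (mulCLM _ (bddSymbol_symB hs he he1) g) =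
    ∫ ξ, ((regW s e (2 * π * ξ) : ℝ) : ℂ) * ((starRingEnd ℂ) (f ξ) * g ξ) := by
  rw [L2.inner_def]
  refine integral_congr_ae ?_
  filter_upwards [coeFn_mulCLM (bddSymbol_symB hs he he1) f,
    coeFn_mulCLM (bddSymbol_symB hs he he1) g] with ξ h1 h2
  rw [h1, h2, RCLike.inner_apply, symB, map_mul, Complex.conj_ofReal]
  have := congrArg (fun r : ℝ => (r : ℂ)) (Real.mul_self_sqrt (regW_pos (s := s) he.le
    (2 * π * ξ)).le)
  simp only [Complex.ofReal_mul] at this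
  linear_combination ((starRingEnd ℂ) (f ξ) * g ξ) * this

theorem inner_modBilin (f g k : L2R) : inner ℂ f (modBilin hs he he1 hM g k) =
    ∫ ξ, ((modA s e M (2 * π * ξ) : ℝ) : ℂ) * ((starRingEnd ℂ) (f ξ) * conv g k ξ) := by
  rw [L2.inner_def]
  refine integral_congr_ae ?_
  filter_upwards [coeFn_modBilin hs he he1 hM g k] with ξ h1
  rw [h1, RCLike.inner_apply, symM]; ring

theorem hasDerivAt_modBilin {f g : ℝ → L2R} {f' g' : L2R} {t : ℝ} (hf : HasDerivAt f f' t)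
    (hg : HasDerivAt g g' t) : HasDerivAt (fun t => modBilin hs he he1 hM (f t) (g t))
      (modBilin hs he he1 hM f' (g t) + modBilin hs he he1 hM (f t) g') t := by
  have hb := ((modBilin hs he he1 hM).bilinearRestrictScalars ℝ).isBoundedBilinearMap
  have := (hb.hasFDerivAt (f t, g t)).comp_hasDerivAt t (hf.prodMk hg)
  refine this.congr_deriv ?_
  simp [IsBoundedBilinearMap.deriv, add_comm]

/-- For e > 0 every operator in the energy is bounded on L², so the product rule needs
differentiability in L² only. -/
theorem hasDerivAt_re_energyC {h w η : ℝ → L2R} {h' w' η' : L2R} {t : ℝ}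
    (hh : HasDerivAt h h' t) (hw : HasDerivAt w w' t) (hη : HasDerivAt η η' t) :
    HasDerivAt (fun t => (energyC hs hκ hκ1 he he1 hM (h t) (w t) (η t)).re)
    ((∫ ξ, ((regW s e (2 * π * ξ) * ((1 + κ * (2 * π * ξ) ^ 2) * kap (2 * π * ξ)) : ℝ) : ℂ) *
        ((starRingEnd ℂ) (h t ξ) * h' ξ)).re
      + (∫ ξ, ((regW s e (2 * π * ξ) : ℝ) : ℂ) * ((starRingEnd ℂ) (w t ξ) * w' ξ)).re
      + 1 / 2 * ((∫ ξ, ((modA s e M (2 * π * ξ) : ℝ) : ℂ) *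
          ((starRingEnd ℂ) (w' ξ) * conv (η t) (w t) ξ)).re
        + (∫ ξ, ((modA s e M (2 * π * ξ) : ℝ) : ℂ) *
          ((starRingEnd ℂ) (w t ξ) * conv η' (w t) ξ)).re
        + (∫ ξ, ((modA s e M (2 * π * ξ) : ℝ) : ℂ) *
          ((starRingEnd ℂ) (w t ξ) * conv (η t) w' ξ)).re)) t := by
  have dA : HasDerivAt (fun t => mulCLM _ (bddSymbol_symA hs hκ hκ1 he he1) (h t))
      (mulCLM _ (bddSymbol_symA hs hκ hκ1 he he1) h') t :=
    ((mulCLM _ (bddSymbol_symA hs hκ hκ1 he he1)).restrictScalars ℝ).hasFDerivAt.comp_hasDerivAt t hh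
  have dB : HasDerivAt (fun t => mulCLM _ (bddSymbol_symB hs he he1) (w t))
      (mulCLM _ (bddSymbol_symB hs he he1) w') t :=
    ((mulCLM _ (bddSymbol_symB hs he he1)).restrictScalars ℝ).hasFDerivAt.comp_hasDerivAt t hw
  have d := (((dA.inner ℂ dA).add (dB.inner ℂ dB)).add
    (hw.inner ℂ (hasDerivAt_modBilin hs he he1 hM hη hw))).const_mul (1 / 2 : ℂ)
  have d' := (Complex.reCLM.hasFDerivAt.comp_hasDerivAt t d)
  refine d'.congr_deriv ?_
  rw [← inner_mulCLM_symA hs hκ hκ1 he he1, ← inner_mulCLM_symB hs he he1,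
    ← inner_modBilin hs he he1 hM, ← inner_modBilin hs he he1 hM, ← inner_modBilin hs he he1 hM,
    inner_add_right]
  have c1 := inner_re_symm (𝕜 := ℂ) (mulCLM _ (bddSymbol_symA hs hκ hκ1 he he1) h')
    (mulCLM _ (bddSymbol_symA hs hκ hκ1 he he1) (h t))
  have c2 := inner_re_symm (𝕜 := ℂ) (mulCLM _ (bddSymbol_symB hs he he1) w')
    (mulCLM _ (bddSymbol_symB hs he he1) (w t))
  simp only [RCLike.re_to_complex] at c1 c2
  simp only [Complex.reCLM_apply, Complex.mul_re, Complex.add_re, c1, c2]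
  norm_num
  ring

end Energy

/-! ### Continuity in time with values in weighted spaces -/

/-- Continuity with values in the weighted space of exponent `σ`. -/
def SnContOn (σ : ℝ) (I : Set ℝ) (f : ℝ → L2R) : Prop :=
  ∀ t ∈ I, sn σ (f t) < ∞ ∧ Tendsto (fun τ => sn σ (f τ - f t : L2R)) (𝓝[I] t) (𝓝 0)

theorem SnContOn.lt_top {σ : ℝ} {I : Set ℝ} {f : ℝ → L2R} (h : SnContOn σ I f) {t : ℝ}
    (ht : t ∈ I) : sn σ (f t) < ∞ := (h t ht).1

theorem SnContOn.mono_exp {σ τ : ℝ} (hστ : σ ≤ τ) {I : Set ℝ} {f : ℝ → L2R}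
    (h : SnContOn τ I f) : SnContOn σ I f := fun t ht =>
  ⟨(sn_mono hστ _).trans_lt (h t ht).1,
    tendsto_of_tendsto_of_tendsto_of_le_of_le tendsto_const_nhds (h t ht).2
      (fun _ => zero_le) (fun _ => sn_mono hστ _)⟩

theorem SnContOn.mono {σ : ℝ} {I J : Set ℝ} (hIJ : J ⊆ I) {f : ℝ → L2R}
    (h : SnContOn σ I f) : SnContOn σ J f := fun t ht =>
  ⟨(h t (hIJ ht)).1, (h t (hIJ ht)).2.mono_left (nhdsWithin_mono _ hIJ)⟩

theorem SnContOn.continuousOn_sn {σ : ℝ} {I : Set ℝ} {f : ℝ → L2R} (h : SnContOn σ I f) :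
    ContinuousOn (fun t => sn σ (f t)) I := by
  intro t ht
  obtain ⟨h1, h2⟩ := h t ht
  have u : Tendsto (fun τ => sn σ (f t) + sn σ (f τ - f t : L2R)) (𝓝[I] t) (𝓝 (sn σ (f t))) := by
    simpa using tendsto_const_nhds.add h2
  have l : Tendsto (fun τ => sn σ (f t) - sn σ (f τ - f t : L2R)) (𝓝[I] t) (𝓝 (sn σ (f t))) := by
    simpa using ENNReal.Tendsto.sub (tendsto_const_nhds (x := sn σ (f t))) h2 (Or.inl h1.ne)
  refine tendsto_of_tendsto_of_tendsto_of_le_of_le l u (fun τ => ?_) (fun τ => ?_)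
  · refine tsub_le_iff_right.2 ?_
    have := sn_L2_sub_le σ (f τ) (f τ - f t)
    simpa using this
  · have := sn_L2_add_le σ (f t) (f τ - f t)
    simpa using this

theorem SnContOn.continuousOn {σ : ℝ} (hσ : 0 ≤ σ) {I : Set ℝ} {f : ℝ → L2R}
    (h : SnContOn σ I f) : ContinuousOn f I := by
  intro t ht
  have := ((h.mono_exp hσ) t ht).2
  simp only [sn_zero_L2] at this
  rw [ContinuousWithinAt, tendsto_iff_edist_tendsto_0]
  simpa only [edist_eq_enorm_sub] using this

/-! ### Gronwall's inequality in integral form -/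

theorem le_mul_exp_of_le_add_integral {f : ℝ → ℝ} {T a c : ℝ} (hc : 0 ≤ c)
    (hf : ContinuousOn f (Icc 0 T)) (h : ∀ t ∈ Icc 0 T, f t ≤ a + c * ∫ τ in (0 : ℝ)..t, f τ) :
    ∀ t ∈ Icc 0 T, f t ≤ a * Real.exp (c * t) := by
  intro t ht
  have hT : (0 : ℝ) ≤ T := ht.1.trans ht.2
  -- The extension is continuous on the whole line, so its primitive is differentiable everywhere,
  -- and the integrals over [0, t] do not change.
  set g : ℝ → ℝ := IccExtend hT ((Icc 0 T).domRestrict f) with hg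
  have gc : Continuous g := (continuousOn_iff_continuous_domRestrict.1 hf).Icc_extend'
  have ge : ∀ τ ∈ Icc 0 T, g τ = f τ := fun τ hτ => by rw [hg, IccExtend_of_mem _ _ hτ]; rfl
  have gi : ∀ t ∈ Icc 0 T, ∫ τ in (0 : ℝ)..t, f τ = ∫ τ in (0 : ℝ)..t, g τ := fun t ht => by
    refine intervalIntegral.integral_congr fun τ hτ => ?_
    rw [uIcc_of_le ht.1] at hτ
    exact (ge τ ⟨hτ.1, hτ.2.trans ht.2⟩).symm
  -- The right side of the assumed inequality times its integrating factor; the inequality says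
  -- exactly that G does not increase.
  set G : ℝ → ℝ := fun t => Real.exp (-(c * t)) * (a + c * ∫ τ in (0 : ℝ)..t, g τ)
  have dG : ∀ t, HasDerivAt G (Real.exp (-(c * t)) * (-(c * 1)) * (a + c * ∫ τ in (0 : ℝ)..t, g τ)
      + Real.exp (-(c * t)) * (c * g t)) t := fun t =>
    (((hasDerivAt_id t).const_mul c).neg.exp).mul
      (((gc.integral_hasStrictDerivAt 0 t).hasDerivAt.const_mul c).const_add a)
  have anti : AntitoneOn G (Icc 0 T) := by
    refine antitoneOn_of_deriv_nonpos (convex_Icc 0 T)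
      (fun t _ => (dG t).continuousAt.continuousWithinAt)
      (fun t _ => (dG t).differentiableAt.differentiableWithinAt) fun t ht => ?_
    rw [interior_Icc] at ht
    have ht' := Ioo_subset_Icc_self ht
    rw [(dG t).deriv]
    have := h t ht'
    rw [gi t ht', ← ge t ht'] at this
    have e := Real.exp_pos (-(c * t))
    have : 0 ≤ c * (Real.exp (-(c * t)) * ((a + c * ∫ τ in (0 : ℝ)..t, g τ) - g t)) := by
      have := sub_nonneg.2 this
      positivity
    linarith
  have key := anti (left_mem_Icc.2 hT) ht ht.1
  simp only [G, mul_zero, neg_zero, Real.exp_zero, intervalIntegral.integral_same, add_zero,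
    one_mul] at key
  have e := Real.exp_pos (c * t)
  calc f t ≤ a + c * ∫ τ in (0 : ℝ)..t, g τ := by rw [← gi t ht]; exact h t ht
    _ = (Real.exp (-(c * t)) * (a + c * ∫ τ in (0 : ℝ)..t, g τ)) * Real.exp (c * t) := by
        rw [Real.exp_neg]; field_simp
    _ ≤ _ := by gcongr

/-! ### Coercivity of the energy -/

/-- The norm of the energy space with surface tension `κ`. -/
noncomputable def xn (s κ : ℝ) (h w : ℝ → ℂ) : ℝ≥0∞ :=
  sn (s - 1 / 2) h + ENNReal.ofReal √κ * sn (s + 1 / 2) h + sn s w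

theorem le_xn₁ (s κ : ℝ) (h w : ℝ → ℂ) : sn (s - 1 / 2) h ≤ xn s κ h w :=
  le_self_add.trans le_self_add

theorem le_xn₂ (s κ : ℝ) (h w : ℝ → ℂ) : ENNReal.ofReal √κ * sn (s + 1 / 2) h ≤ xn s κ h w :=
  le_add_self.trans le_self_add

theorem le_xn₃ (s κ : ℝ) (h w : ℝ → ℂ) : sn s w ≤ xn s κ h w := le_add_self

theorem enorm_mulCLM {m : ℝ → ℂ} (hm : BddSymbol m) (f : L2R) :
    ‖mulCLM m hm f‖ₑ = eLpNorm (fun ξ => m ξ * f ξ) 2 volume := by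
  rw [← sn_zero_L2, sn_mulCLM, sn_zero_eq]

theorem norm_symA_le {s e κ : ℝ} (hs : 0 ≤ s) (hκ : 0 ≤ κ) (he : 0 ≤ e) (ξ : ℝ) :
    ‖symA s e κ ξ‖ ≤ 2 * jw (s - 1 / 2) (2 * π * ξ) + 2 * √κ * jw (s + 1 / 2) (2 * π * ξ) := by
  rw [symA, Complex.norm_real, Real.norm_eq_abs, abs_of_nonneg (Real.sqrt_nonneg _)]
  have p1 := jw_nonneg (s - 1 / 2) (2 * π * ξ)
  have p2 := jw_nonneg (s + 1 / 2) (2 * π * ξ)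
  refine Real.sqrt_le_iff.2 ⟨by positivity, (regW_mul_kap_le hs hκ he _).trans ?_⟩
  rw [show 2 * s - 1 = (s - 1 / 2) + (s - 1 / 2) by ring,
    show 2 * s + 1 = (s + 1 / 2) + (s + 1 / 2) by ring, jw_add, jw_add]
  have := Real.mul_self_sqrt hκ
  generalize jw (s - 1 / 2) (2 * π * ξ) = p at *
  generalize jw (s + 1 / 2) (2 * π * ξ) = q at *
  have : 0 ≤ p * (√κ * q) := by positivity
  have h2 : κ * (q * q) = (√κ * q) ^ 2 := by rw [mul_pow, Real.sq_sqrt hκ]; ring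
  rw [h2]
  nlinarith [sq_nonneg p, sq_nonneg (√κ * q)]

section Coercive

variable {s e κ M : ℝ} (hs : 2 ≤ s) (hκ : 0 ≤ κ) (hκ1 : κ ≤ 1) (he : 0 < e) (he1 : e ≤ 1)
  (hM : 1 ≤ M)

theorem norm_mulCLM_symA_le (hs : 0 ≤ s) {y : ℝ≥0} {h : L2R} {w : ℝ → ℂ}
    (hy : xn s κ h w ≤ y) :
    ‖mulCLM _ (bddSymbol_symA hs hκ hκ1 he he1) h‖ ≤ 2 * y := by
  have key : ‖mulCLM _ (bddSymbol_symA hs hκ hκ1 he he1) h‖ₑ ≤ ((2 * y : ℝ≥0) : ℝ≥0∞) := by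
    rw [enorm_mulCLM, ← sn_zero_eq]
    have mj : ∀ σ, Measurable fun ξ : ℝ => ((jw σ (2 * π * ξ) : ℝ) : ℂ) := fun σ => by fun_prop
    have mh := measurable_L2 h
    calc sn 0 (fun ξ => symA s e κ ξ * h ξ)
        ≤ sn 0 (fun ξ => ((2 * jw (s - 1 / 2) (2 * π * ξ) : ℝ) : ℂ) * h ξ
            + ((2 * √κ * jw (s + 1 / 2) (2 * π * ξ) : ℝ) : ℂ) * h ξ) := by
          rw [sn_zero_eq, sn_zero_eq]
          refine eLpNorm_mono fun ξ => ?_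
          have p1 := jw_nonneg (s - 1 / 2) (2 * π * ξ)
          have p2 := jw_nonneg (s + 1 / 2) (2 * π * ξ)
          rw [← add_mul, norm_mul, norm_mul, ← Complex.ofReal_add, Complex.norm_real,
            Real.norm_of_nonneg (by positivity)]
          gcongr
          exact norm_symA_le hs hκ he.le ξ
      _ ≤ sn 0 (fun ξ => ((2 * jw (s - 1 / 2) (2 * π * ξ) : ℝ) : ℂ) * h ξ)
            + sn 0 (fun ξ => ((2 * √κ * jw (s + 1 / 2) (2 * π * ξ) : ℝ) : ℂ) * h ξ) := by
          apply sn_add_le <;> fun_prop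
      _ ≤ ENNReal.ofReal 2 * sn (0 + (s - 1 / 2)) h
            + ENNReal.ofReal (2 * √κ) * sn (0 + (s + 1 / 2)) h := by
          gcongr <;>
          · refine sn_mul_le fun ξ => ?_
            rw [Complex.norm_real, Real.norm_of_nonneg]
            have p1 := jw_nonneg (s - 1 / 2) (2 * π * ξ)
            have p2 := jw_nonneg (s + 1 / 2) (2 * π * ξ)
            positivity
      _ = 2 * (sn (s - 1 / 2) h + ENNReal.ofReal √κ * sn (s + 1 / 2) h) := by
          rw [ENNReal.ofReal_mul (by norm_num), zero_add, zero_add]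
          norm_num; ring
      _ ≤ 2 * y := by gcongr; exact le_self_add.trans hy
      _ = _ := by push_cast; rfl
  rw [← ofReal_norm] at key
  simpa using ENNReal.toReal_mono ENNReal.coe_ne_top key

theorem norm_mulCLM_symB_le (hs : 0 ≤ s) {y : ℝ≥0} {h : ℝ → ℂ} {w : L2R}
    (hy : xn s κ h w ≤ y) : ‖mulCLM _ (bddSymbol_symB hs he he1) w‖ ≤ y := by
  have key : ‖mulCLM _ (bddSymbol_symB hs he he1) w‖ₑ ≤ (y : ℝ≥0∞) := by
    rw [enorm_mulCLM]
    refine le_trans (eLpNorm_mono fun ξ => ?_) ((le_xn₃ s κ h w).trans hy)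
    rw [norm_mul, norm_mul, symB, Complex.norm_real, Complex.norm_real,
      Real.norm_of_nonneg (Real.sqrt_nonneg _), Real.norm_of_nonneg (jw_nonneg _ _)]
    gcongr
    refine Real.sqrt_le_iff.2 ⟨jw_nonneg _ _, (regW_le hs he.le _).trans_eq ?_⟩
    rw [sq, ← jw_add]; congr 1; ring
  rw [← ofReal_norm] at key
  simpa using ENNReal.toReal_mono ENNReal.coe_ne_top key

theorem one_le_sq_of_one_le (hM : 1 ≤ M) : 1 ≤ M ^ 2 := one_le_pow₀ hM

/-- The symbol is used with M² as its parameter. With s derivatives on w and s − 1/2 on η ⋆ w, half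
a derivative less than its order would allow is left over and is traded for the factor M⁻¹. Only the
H^{s-1/2} norm of η enters, so the choice of M will not depend on κ. -/
theorem norm_inner_modBilin_le {B y : ℝ≥0} {h : ℝ → ℂ} {w η : L2R}
    (hη : sn (s - 1 / 2) η ≤ B) (hy : xn s κ h w ≤ y) :
    ‖inner ℂ w (modBilin (by linarith : 0 ≤ s) he he1 (one_le_sq_of_one_le hM) η w)‖ ≤
      2 * cP (s - 1 / 2) * B * M⁻¹ * (y : ℝ) ^ 2 := by
  rw [inner_modBilin]
  have hw := (le_xn₃ s κ h w).trans hy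
  have mw := measurable_L2 w
  have mη := measurable_L2 η
  have b : sn (s - 1 / 2) (conv η w) ≤ 2 * cP (s - 1 / 2) * (B * y) := by
    refine (sn_conv_le (by linarith) mη mw).trans ?_
    gcongr
    exact (sn_mono (by linarith) _).trans hw
  have hM' : (0 : ℝ) ≤ M⁻¹ := by positivity
  have key := (enorm_integral_le_lintegral_enorm _).trans
    (lintegral_symbol_mul_le (α := s) (β := s - 1 / 2) (C := M⁻¹) (F := w) (G := conv η w)
      (m := fun ξ => ((modA s e (M ^ 2) (2 * π * ξ) : ℝ) : ℂ)) (by fun_prop) mw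
      (measurable_conv mη mw) fun ξ => by
        rw [Complex.norm_real, show s + (s - 1 / 2) = 2 * s - 1 / 2 by ring]
        exact abs_modA_le_gain (by linarith) he.le hM _)
  have key2 := key.trans (b := ENNReal.ofReal M⁻¹ * (sn s w * sn (s - 1 / 2) (conv η w)))
    (c := ((M⁻¹.toNNReal * (y * (2 * cP (s - 1 / 2) * (B * y))) : ℝ≥0) : ℝ≥0∞)) (by
      push_cast
      rw [ENNReal.ofReal]
      gcongr)
  rw [← ofReal_norm] at key2
  have := ENNReal.toReal_mono ENNReal.coe_ne_top key2
  rw [ENNReal.toReal_ofReal (norm_nonneg _), ENNReal.coe_toReal] at this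
  refine this.trans_eq ?_
  push_cast
  rw [Real.coe_toNNReal _ hM']
  ring

theorem re_energyC_le {B y : ℝ≥0} {h w η : L2R} (hη : sn (s - 1 / 2) η ≤ B)
    (hy : xn s κ h w ≤ y) :
    (energyC (by linarith : 0 ≤ s) hκ hκ1 he he1 (one_le_sq_of_one_le hM) h w η).re ≤
      (3 + cP (s - 1 / 2) * B) * (y : ℝ) ^ 2 := by
  have h1 := norm_mulCLM_symA_le hκ hκ1 he he1 (by linarith : 0 ≤ s) hy
  have h2 := norm_mulCLM_symB_le he he1 (by linarith : 0 ≤ s) hy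
  have h3 := (Complex.re_le_norm _).trans (norm_inner_modBilin_le hs he he1 hM hη hy)
  have c1 : 2 * cP (s - 1 / 2) * B * M⁻¹ * (y : ℝ) ^ 2 ≤ 2 * cP (s - 1 / 2) * B * 1 * (y : ℝ) ^ 2 := by
    gcongr
    exact inv_le_one_of_one_le₀ hM
  rw [energyC, inner_self_eq_norm_sq_to_K, inner_self_eq_norm_sq_to_K]
  simp only [← Complex.ofReal_pow, Complex.mul_re, Complex.add_re, Complex.coe_algebraMap,
    Complex.ofReal_re]
  norm_num
  have q1 := pow_le_pow_left₀ (norm_nonneg _) h1 2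
  have q2 := pow_le_pow_left₀ (norm_nonneg _) h2 2
  nlinarith

/-- Coercivity up to the correction, which carries M⁻¹ and is absorbed once e has been sent to 0. It
cannot be absorbed earlier, since y is the norm without regularisation. -/
theorem le_re_energyC {B y : ℝ≥0} {h w η : L2R} (hη : sn (s - 1 / 2) η ≤ B)
    (hy : xn s κ h w ≤ y) :
    ‖mulCLM _ (bddSymbol_symA (by linarith : 0 ≤ s) hκ hκ1 he he1) h‖ ^ 2 +
        ‖mulCLM _ (bddSymbol_symB (by linarith : 0 ≤ s) he he1) w‖ ^ 2 ≤
      2 * (energyC (by linarith : 0 ≤ s) hκ hκ1 he he1 (one_le_sq_of_one_le hM) h w η).re +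
      2 * cP (s - 1 / 2) * B * M⁻¹ * (y : ℝ) ^ 2 := by
  have h3 := ((abs_le.1 (Complex.abs_re_le_norm _)).1.trans' (neg_le_neg
    (norm_inner_modBilin_le hs he he1 hM hη hy)))
  rw [energyC, inner_self_eq_norm_sq_to_K, inner_self_eq_norm_sq_to_K]
  simp only [← Complex.ofReal_pow, Complex.mul_re, Complex.add_re, Complex.coe_algebraMap,
    Complex.ofReal_re]
  norm_num
  linarith

end Coercive

/-! ### The energy estimate -/

theorem tendsto_regW (s x : ℝ) :
    Tendsto (fun n : ℕ => regW s (1 / ((n : ℝ) + 1)) x) atTop (𝓝 (jw (2 * s) x)) := by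
  have h : Tendsto (fun n : ℕ => 1 + 1 / ((n : ℝ) + 1) * x ^ 2) atTop (𝓝 (1 + 0 * x ^ 2)) :=
    tendsto_const_nhds.add (tendsto_one_div_add_atTop_nhds_zero_nat.mul_const _)
  have h2 := h.rpow_const (p := -(s + 1)) (Or.inl (by norm_num))
  have := h2.const_mul ((1 + x ^ 2) ^ s)
  simpa [regW, jw] using this

theorem eLpNorm_mul_le_of_tendsto {m : ℕ → ℝ → ℂ} {m' : ℝ → ℂ} (hm : ∀ n, Measurable (m n))
    (h : ∀ ξ, Tendsto (fun n => m n ξ) atTop (𝓝 (m' ξ))) (f : L2R) {c : ℝ≥0∞}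
    (hc : ∀ n, eLpNorm (fun ξ => m n ξ * f ξ) 2 volume ≤ c) :
    eLpNorm (fun ξ => m' ξ * f ξ) 2 volume ≤ c := by
  refine (Lp.eLpNorm_lim_le_liminf_eLpNorm (f := fun n ξ => m n ξ * f ξ)
    (fun n => ((hm n).mul (measurable_L2 f)).aestronglyMeasurable) _
    (ae_of_all _ fun ξ => (h ξ).mul_const _)).trans ?_
  exact (liminf_le_liminf (Eventually.of_forall hc)).trans_eq (by simp)

theorem jw_le_sqrt {s κ : ℝ} (hκ : 0 ≤ κ) (hκ1 : κ ≤ 1) (x : ℝ) :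
    jw (s - 1 / 2) x ≤ 2 * √(jw (2 * s) x * ((1 + κ * x ^ 2) * kap x)) ∧
    √κ * jw (s + 1 / 2) x ≤ 2 * √(jw (2 * s) x * ((1 + κ * x ^ 2) * kap x)) := by
  have p1 := jw_nonneg (s - 1 / 2) x
  have p2 := jw_nonneg (s + 1 / 2) x
  have p0 := jw_nonneg (2 * s) x
  have k := inv_le_kap x
  have kp := (kap_pos x).le
  have e1 : jw (s - 1 / 2) x ^ 2 = jw (2 * s) x * jw (-1) x := by
    rw [sq, ← jw_add, ← jw_add]; congr 1; ring
  have e2 : jw (s + 1 / 2) x ^ 2 = jw (2 * s) x * jw (-1) x * (1 + x ^ 2) := by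
    rw [sq, ← jw_add, ← jw_add, ← jw_two, ← jw_add]; congr 1; ring
  have q : jw (2 * s) x * jw (-1) x ≤ jw (2 * s) x * (2 * kap x) := by gcongr
  have q0 : 0 ≤ jw (2 * s) x * kap x := by positivity
  have r0 : 0 ≤ jw (2 * s) x * ((1 + κ * x ^ 2) * kap x) := by positivity
  have r1 : 0 ≤ κ * x ^ 2 * (jw (2 * s) x * kap x) := by positivity
  constructor
  · refine abs_le_of_sq_le_sq' ?_ (by positivity) |>.2
    rw [mul_pow, Real.sq_sqrt r0, e1]
    nlinarith
  · refine abs_le_of_sq_le_sq' ?_ (by positivity) |>.2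
    rw [mul_pow, mul_pow, Real.sq_sqrt r0, Real.sq_sqrt hκ, e2]
    have : κ * (jw (2 * s) x * jw (-1) x * (1 + x ^ 2)) ≤
        κ * (jw (2 * s) x * (2 * kap x) * (1 + x ^ 2)) := by gcongr
    nlinarith [mul_le_mul_of_nonneg_right hκ1 q0]

/-- Fatou's lemma along e = 1/(n + 1) restores the weights without regularisation. Each elevation
norm then costs 2 and the velocity norm costs 1, which makes 5. -/
theorem xn_le_of_forall {s κ : ℝ} (hs : 0 ≤ s) (hκ : 0 ≤ κ) (hκ1 : κ ≤ 1) {h w : L2R} {ρ : ℝ≥0}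
    (H : ∀ (e : ℝ) (he : 0 < e) (he1 : e ≤ 1),
      ‖mulCLM _ (bddSymbol_symA hs hκ hκ1 he he1) h‖ ^ 2 +
        ‖mulCLM _ (bddSymbol_symB hs he he1) w‖ ^ 2 ≤ (ρ : ℝ) ^ 2) :
    xn s κ h w ≤ 5 * ρ := by
  have en : ∀ n : ℕ, (0 : ℝ) < 1 / ((n : ℝ) + 1) ∧ 1 / ((n : ℝ) + 1) ≤ 1 := fun n =>
    ⟨by positivity, by rw [div_le_one (by positivity)]; linarith [Nat.cast_nonneg (α := ℝ) n]⟩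
  have conv_norm : ∀ g : L2R, ‖g‖ ^ 2 ≤ (ρ : ℝ) ^ 2 → ‖g‖ₑ ≤ ρ := fun g hg => by
    have := (abs_le_of_sq_le_sq' hg ρ.2).2
    exact_mod_cast this
  set G : ℝ → ℂ := fun ξ => ((√(jw (2 * s) (2 * π * ξ) * ((1 + κ * (2 * π * ξ) ^ 2) *
      kap (2 * π * ξ))) : ℝ) : ℂ) * h ξ with hG
  have hA : eLpNorm G 2 volume ≤ ρ := by
    refine eLpNorm_mul_le_of_tendsto (m := fun n => symA s (1 / ((n : ℝ) + 1)) κ)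
      (fun n => by unfold symA; fun_prop) (fun ξ => ?_) h fun n => ?_
    · refine (Complex.continuous_ofReal.tendsto _).comp
        ((Real.continuous_sqrt.tendsto _).comp ((tendsto_regW s _).mul_const _))
    · rw [← enorm_mulCLM (bddSymbol_symA hs hκ hκ1 (en n).1 (en n).2)]
      refine conv_norm _ ((H _ (en n).1 (en n).2).trans' ?_)
      exact le_add_of_nonneg_right (by positivity)
  have hB : eLpNorm (fun ξ => ((√(jw (2 * s) (2 * π * ξ)) : ℝ) : ℂ) * w ξ) 2 volume ≤ ρ := by
    refine eLpNorm_mul_le_of_tendsto (m := fun n => symB s (1 / ((n : ℝ) + 1)))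
      (fun n => by unfold symB; fun_prop) (fun ξ => ?_) w fun n => ?_
    · refine (Complex.continuous_ofReal.tendsto _).comp
        ((Real.continuous_sqrt.tendsto _).comp (tendsto_regW s _))
    · rw [← enorm_mulCLM (bddSymbol_symB hs (en n).1 (en n).2)]
      refine conv_norm _ ((H _ (en n).1 (en n).2).trans' ?_)
      exact le_add_of_nonneg_left (by positivity)
  have b1 : sn (s - 1 / 2) h ≤ 2 * ρ := by
    refine (eLpNorm_le_mul_eLpNorm_of_ae_le_mul (c := 2) (g := G) (ae_of_all _ fun ξ => ?_)
      2).trans ?_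
    · have := (jw_le_sqrt (s := s) hκ hκ1 (2 * π * ξ)).1
      rw [hG, norm_mul, norm_mul, Complex.norm_real, Complex.norm_real, Real.norm_of_nonneg
        (jw_nonneg _ _), Real.norm_of_nonneg (Real.sqrt_nonneg _), ← mul_assoc]
      gcongr
    · exact (mul_le_mul_right hA (ENNReal.ofReal 2)).trans_eq (by norm_num)
  have b2 : ENNReal.ofReal √κ * sn (s + 1 / 2) h ≤ 2 * ρ := by
    have : ENNReal.ofReal √κ * sn (s + 1 / 2) h =
        eLpNorm (fun ξ => ((√κ * jw (s + 1 / 2) (2 * π * ξ) : ℝ) : ℂ) * h ξ) 2 volume := by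
      rw [sn, ← Real.enorm_of_nonneg (Real.sqrt_nonneg κ), ← eLpNorm_const_smul]
      congr 1; ext ξ; simp [mul_assoc]
    rw [this]
    refine (eLpNorm_le_mul_eLpNorm_of_ae_le_mul (c := 2) (g := G) (ae_of_all _ fun ξ => ?_)
      2).trans ?_
    · have := (jw_le_sqrt (s := s) hκ hκ1 (2 * π * ξ)).2
      have p := jw_nonneg (s + 1 / 2) (2 * π * ξ)
      rw [hG, norm_mul, norm_mul, Complex.norm_real, Complex.norm_real, Real.norm_of_nonneg
        (by positivity), Real.norm_of_nonneg (Real.sqrt_nonneg _), ← mul_assoc]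
      gcongr
    · exact (mul_le_mul_right hA (ENNReal.ofReal 2)).trans_eq (by norm_num)
  have b3 : sn s w ≤ ρ := by
    refine le_of_eq_of_le ?_ hB
    rw [sn]
    congr 1; ext ξ
    congr 3
    rw [show 2 * s = s + s by ring, jw_add, Real.sqrt_mul_self (jw_nonneg _ _)]
  calc xn s κ h w ≤ 2 * ρ + 2 * ρ + ρ := by unfold xn; gcongr
    _ = _ := by ring

theorem xn_lt_top {s κ : ℝ} {h w : ℝ → ℂ} (hh : sn (s + 1 / 2) h < ∞) (hw : sn s w < ∞) :
    xn s κ h w < ∞ :=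
  ENNReal.add_lt_top.2 ⟨ENNReal.add_lt_top.2 ⟨(sn_mono (by linarith) _).trans_lt hh,
    ENNReal.mul_lt_top ENNReal.ofReal_lt_top hh⟩, hw⟩

theorem continuousOn_xn {s κ : ℝ} {I : Set ℝ} {h w : ℝ → L2R} (hh : SnContOn (s + 1 / 2) I h)
    (hw : SnContOn s I w) : ContinuousOn (fun t => (xn s κ (h t) (w t)).toReal) I := by
  have : ContinuousOn (fun t => xn s κ (h t) (w t)) I :=
    (((hh.mono_exp (by linarith)).continuousOn_sn).add
      (ENNReal.continuous_const_mul ENNReal.ofReal_ne_top |>.comp_continuousOn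
        hh.continuousOn_sn)).add hw.continuousOn_sn
  exact fun t ht => (ENNReal.tendsto_toReal (xn_lt_top (hh.lt_top ht) (hw.lt_top ht)).ne).comp
    (this t ht)

theorem continuous_re_energyC {s e κ M : ℝ} (hs : 0 ≤ s) (hκ : 0 ≤ κ) (hκ1 : κ ≤ 1) (he : 0 < e)
    (he1 : e ≤ 1) (hM : 1 ≤ M) {I : Set ℝ} {h w η : ℝ → L2R} (ch : ContinuousOn h I)
    (cw : ContinuousOn w I) (cη : ContinuousOn η I) :
    ContinuousOn (fun t => (energyC hs hκ hκ1 he he1 hM (h t) (w t) (η t)).re) I := by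
  have c1 := (mulCLM _ (bddSymbol_symA hs hκ hκ1 he he1)).continuous.comp_continuousOn ch
  have c2 := (mulCLM _ (bddSymbol_symB hs he he1)).continuous.comp_continuousOn cw
  have c3 : ContinuousOn (fun t => modBilin hs he he1 hM (η t) (w t)) I :=
    ((modBilin hs he he1 hM).continuous.comp_continuousOn cη).clm_apply cw
  exact Complex.continuous_re.comp_continuousOn (continuousOn_const.mul
    (((c1.inner c1).add (c2.inner c2)).add (cw.inner c3)))

/-- M is fixed by s and B, and the energy inequality is integrated for every e. The limit e → 0 is
taken at each time, before Gronwall's inequality is applied to the true norm. Hence C depends on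
neither κ nor e. The number ε measures the sources. -/
theorem energy_gronwall {s : ℝ} (hs : 2 ≤ s) (T : ℝ) (B : ℝ≥0) : ∃ C : ℝ≥0,
    ∀ {κ T₁ : ℝ} {ε : ℝ≥0} {h w η h' w' η' : ℝ → L2R} {V U E F : ℝ → ℝ → ℂ},
    0 < κ → κ ≤ 1 → T₁ ≤ T → SnContOn (s + 1 / 2) (Icc 0 T₁) h → SnContOn s (Icc 0 T₁) w →
    ContinuousOn η (Icc 0 T₁) → (∀ t ∈ Icc 0 T₁, sn (s - 1 / 2) (η t) ≤ B) →
    (∀ t ∈ Ioo 0 T₁, HasDerivAt h (h' t) t ∧ HasDerivAt w (w' t) t ∧ HasDerivAt η (η' t) t) →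
    (∀ t ∈ Ioo 0 T₁, h' t =ᵐ[volume] rhsH (h t) (w t) (η t) (V t) (E t)) →
    (∀ t ∈ Ioo 0 T₁, w' t =ᵐ[volume] rhsW κ (h t) (w t) (U t) (F t)) →
    (∀ t ∈ Ioo 0 T₁, ∀ᵐ ξ, η t (-ξ) = (starRingEnd ℂ) (η t ξ)) →
    (∀ t ∈ Ioo 0 T₁, EnergyBounds s κ B ((xn s κ (h t) (w t)).toNNReal + ε)
      (h t) (w t) (η t) (η' t) (V t) (U t) (E t) (F t)) →
    ∀ t ∈ Icc 0 T₁, xn s κ (h t) (w t) ≤ C * (xn s κ (h 0) (w 0) + ε) := by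
  have hs0 : 0 ≤ s := by linarith
  set p : ℝ≥0 := cP (s - 1 / 2) with hp
  -- Large enough for the correction to cost at most y²/50, that is, half of y² after the factor 5²
  -- from `xn_le_of_forall`.
  set M : ℝ := 100 * p * B + 1 with hMdef
  have hM : 1 ≤ M := by simp [hMdef]; positivity
  obtain ⟨k, hk⟩ : ∃ k : ℝ, k = (cE s (M ^ 2) B : ℝ≥0) := ⟨_, rfl⟩
  have k0 : 0 ≤ k := hk ▸ NNReal.coe_nonneg _
  -- constants of the Gronwall argument
  set c : ℝ := 200 * k with hc
  set a : ℝ := 200 * (3 + p * B) + 2 with ha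
  have a0 : 0 ≤ a := by positivity
  have c0 : 0 ≤ c := by positivity
  refine ⟨(a * Real.exp (c * |T|) + 1).toNNReal, ?_⟩
  intro κ T₁ ε h w η h' w' η' V U E F hκ hκ1 hT₁ ch cw cη bη hd heh hew herm hE t ht
  have hT0 : 0 ≤ T₁ := ht.1.trans ht.2
  set y : ℝ → ℝ := fun t => (xn s κ (h t) (w t)).toReal with hy
  have fin : ∀ t ∈ Icc 0 T₁, xn s κ (h t) (w t) < ∞ := fun t ht =>
    xn_lt_top (ch.lt_top ht) (cw.lt_top ht)
  have hyN : ∀ t ∈ Icc 0 T₁, xn s κ (h t) (w t) ≤ ((xn s κ (h t) (w t)).toNNReal : ℝ≥0) :=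
    fun t ht => (ENNReal.coe_toNNReal (fin t ht).ne).ge
  have yc : ContinuousOn y (Icc 0 T₁) := continuousOn_xn ch cw
  have y0 : ∀ t, 0 ≤ y t := fun t => ENNReal.toReal_nonneg
  set z : ℝ → ℝ := fun t => (y t + ε) ^ 2 with hz
  have zc : ContinuousOn z (Icc 0 T₁) := (yc.add continuousOn_const).pow 2
  have h0m : (0 : ℝ) ∈ Icc 0 T₁ := ⟨le_rfl, hT0⟩
  have step : ∀ t ∈ Icc 0 T₁, y t ^ 2 ≤ 100 * (3 + p * B) * y 0 ^ 2 +
      100 * (k * ∫ τ in (0 : ℝ)..t, z τ) := by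
    intro t ht
    have rate : ∀ (e : ℝ) (he : 0 < e) (he1 : e ≤ 1),
        (energyC hs0 hκ.le hκ1 he he1 (one_le_sq_of_one_le hM) (h t) (w t) (η t)).re ≤
        (3 + p * B) * y 0 ^ 2 + k * ∫ τ in (0 : ℝ)..t, z τ := by
      intro e he he1
      have sub : Icc 0 t ⊆ Icc 0 T₁ := Icc_subset_Icc_right ht.2
      have ce := (continuous_re_energyC hs0 hκ.le hκ1 he he1 (one_le_sq_of_one_le hM)
        (ch.continuousOn (by linarith)) (cw.continuousOn hs0) cη).mono sub
      have start := re_energyC_le hs hκ.le hκ1 he he1 hM (bη 0 h0m) (hyN 0 h0m)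
      have int := intervalIntegral.sub_le_integral_of_hasDeriv_right_of_le ht.1 ce
        (fun τ hτ => by
          obtain ⟨d1, d2, d3⟩ := hd τ ⟨hτ.1, hτ.2.trans_le ht.2⟩
          exact (hasDerivAt_re_energyC hs0 hκ.le hκ1 he he1 (one_le_sq_of_one_le hM)
            d1 d2 d3).hasDerivWithinAt)
        (φ := fun τ => k * z τ)
        ((continuousOn_const.mul (zc.mono sub)).integrableOn_Icc) (fun τ hτ => by
          have hτ' : τ ∈ Ioo 0 T₁ := ⟨hτ.1, hτ.2.trans_le ht.2⟩
          have := energy_rate_le hs hκ hκ1 he he1 (one_le_sq_of_one_le hM) (hE τ hτ')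
            (herm τ hτ')
          rw [← hk] at this
          refine le_of_eq_of_le ?_ this
          have w1 := hew τ hτ'
          congr 1
          · congr 1
            · congr 1
              refine integral_congr_ae ?_
              filter_upwards [heh τ hτ'] with ξ hξ
              rw [hξ]
            · congr 1
              refine integral_congr_ae ?_
              filter_upwards [w1] with ξ hξ
              rw [hξ]
          · congr 2
            · congr 1
              congr 1
              refine integral_congr_ae ?_
              filter_upwards [w1] with ξ hξ
              rw [hξ]
            · congr 1
              refine integral_congr_ae (ae_of_all _ fun ξ => ?_)
              simp only
              rw [conv_congr (EventuallyEq.refl _ (η τ : ℝ → ℂ)) w1])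
      rw [intervalIntegral.integral_const_mul] at int
      have : ((xn s κ (h 0) (w 0)).toNNReal : ℝ) = y 0 := rfl
      rw [this] at start
      linarith
    set R : ℝ := (3 + p * B) * y 0 ^ 2 + k * ∫ τ in (0 : ℝ)..t, z τ with hR
    have Ii : 0 ≤ ∫ τ in (0 : ℝ)..t, z τ :=
      intervalIntegral.integral_nonneg ht.1 fun τ _ => by positivity
    have R0 : 0 ≤ R := by positivity
    set ρ : ℝ≥0 := (√(2 * R + 2 * p * B * M⁻¹ * y t ^ 2)).toNNReal with hρ
    have hM0 : 0 < M := by linarith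
    have ρ2 : (ρ : ℝ) ^ 2 = 2 * R + 2 * p * B * M⁻¹ * y t ^ 2 := by
      rw [hρ, Real.coe_toNNReal _ (Real.sqrt_nonneg _), Real.sq_sqrt (by positivity)]
    have low := xn_le_of_forall hs0 hκ.le hκ1 (h := h t) (w := w t) (ρ := ρ)
      fun e he he1 => by
        have := le_re_energyC hs hκ.le hκ1 he he1 hM (bη t ht) (hyN t ht)
        have e2 : ((xn s κ (h t) (w t)).toNNReal : ℝ) = y t := rfl
        rw [e2] at this
        rw [ρ2]
        have := rate e he he1
        linarith
    have low' : y t ≤ 5 * ρ := by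
      have := ENNReal.toReal_mono (b := ((5 * ρ : ℝ≥0) : ℝ≥0∞)) ENNReal.coe_ne_top
        (low.trans_eq (by push_cast; rfl))
      simpa using this
    have sm : 2 * p * B * M⁻¹ ≤ 1 / 50 := by
      rw [← div_eq_mul_inv, div_le_iff₀ hM0, hMdef]
      nlinarith
    -- From y ≤ 5ρ one gets y² ≤ 50R + y²/2, and therefore y² ≤ 100R.
    have sq := pow_le_pow_left₀ (y0 t) low' 2
    rw [mul_pow, ρ2] at sq
    have : 2 * p * B * M⁻¹ * y t ^ 2 ≤ 1 / 50 * y t ^ 2 := by gcongr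
    rw [show 100 * (3 + (p : ℝ) * B) * y 0 ^ 2 + 100 * (k * ∫ τ in (0 : ℝ)..t, z τ) = 100 * R by
      rw [hR]; ring]
    linarith
  -- Since z ≤ 2y² + 2ε², the constants of `step` are doubled: this is the origin of c = 200k and a
  -- = 200(3 + pB) + 2.
  have gr := le_mul_exp_of_le_add_integral (f := z) (a := a * (y 0 + ε) ^ 2) c0 zc
    (fun t ht => by
      have := step t ht
      have e0 : (0 : ℝ) ≤ ε := ε.2
      have m1 : y 0 ^ 2 ≤ (y 0 + ε) ^ 2 := by gcongr; linarith
      have m2 : (ε : ℝ) ^ 2 ≤ (y 0 + ε) ^ 2 := by gcongr; linarith [y0 0]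
      have m3 : (3 + (p : ℝ) * B) * y 0 ^ 2 ≤ (3 + (p : ℝ) * B) * (y 0 + ε) ^ 2 := by gcongr
      have m4 : z t ≤ 2 * y t ^ 2 + 2 * (ε : ℝ) ^ 2 := by
        simp only [hz]; nlinarith [sq_nonneg (y t - ε)]
      rw [ha, hc]
      linarith) t ht
  have fin' : y t ≤ (a * Real.exp (c * |T|) + 1) * (y 0 + ε) := by
    have e0 : (0 : ℝ) ≤ ε := ε.2
    -- The inequality q ≤ (q + 1)² for q ≥ 0 avoids the square root of the Gronwall constant.
    have b : (y t + ε) ^ 2 ≤ ((a * Real.exp (c * |T|) + 1) * (y 0 + ε)) ^ 2 := by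
      refine gr.trans ?_
      rw [mul_pow]
      have mono : Real.exp (c * t) ≤ Real.exp (c * |T|) := by
        gcongr
        exact (ht.2.trans hT₁).trans (le_abs_self _)
      have q : 0 ≤ a * Real.exp (c * |T|) := by positivity
      have : a * Real.exp (c * t) ≤ (a * Real.exp (c * |T|) + 1) ^ 2 := by
        have : a * Real.exp (c * t) ≤ a * Real.exp (c * |T|) := by gcongr
        nlinarith
      calc a * (y 0 + ε) ^ 2 * Real.exp (c * t) = a * Real.exp (c * t) * (y 0 + ε) ^ 2 := by ring
        _ ≤ _ := by gcongr
    have := (abs_le_of_sq_le_sq' b (by have := y0 0; positivity)).2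
    linarith
  rw [← ENNReal.ofReal_toReal (fin t ht).ne, ← ENNReal.ofReal_toReal (fin 0 h0m).ne]
  have e0 : (0 : ℝ) ≤ ε := ε.2
  refine (ENNReal.ofReal_le_ofReal fin').trans_eq ?_
  rw [ENNReal.ofReal_mul (by positivity), ENNReal.ofReal_add (y0 0) e0, ENNReal.ofReal_coe_nnreal]
  rfl

/-! ### The energy estimate at the lowest regularity -/

theorem inner_mulCLM_ofReal {r : ℝ → ℝ} (hm : BddSymbol fun ξ => (r ξ : ℂ)) (f g : L2R) :
    inner ℂ (mulCLM _ hm f) (mulCLM _ hm g) =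
      ∫ ξ, ((r ξ ^ 2 : ℝ) : ℂ) * ((starRingEnd ℂ) (f ξ) * g ξ) := by
  rw [L2.inner_def]
  refine integral_congr_ae ?_
  filter_upwards [coeFn_mulCLM hm f, coeFn_mulCLM hm g] with ξ h1 h2
  rw [h1, h2, RCLike.inner_apply, map_mul, Complex.conj_ofReal]
  push_cast; ring

theorem integrable_symbol_mul {r : ℝ → ℝ} (hm : BddSymbol fun ξ => (r ξ : ℂ)) (f g : L2R) :
    Integrable fun ξ => ((r ξ ^ 2 : ℝ) : ℂ) * ((starRingEnd ℂ) (f ξ) * g ξ) := by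
  refine (L2.integrable_inner (𝕜 := ℂ) (mulCLM _ hm f) (mulCLM _ hm g)).congr ?_
  filter_upwards [coeFn_mulCLM hm f, coeFn_mulCLM hm g] with ξ h1 h2
  rw [h1, h2, RCLike.inner_apply, map_mul, Complex.conj_ofReal]
  push_cast; ring

theorem hasDerivAt_norm_sq_mulCLM {r : ℝ → ℝ} (hm : BddSymbol fun ξ => (r ξ : ℂ)) {f : ℝ → L2R}
    {f' : L2R} {t : ℝ} (hf : HasDerivAt f f' t) :
    HasDerivAt (fun t => ‖mulCLM _ hm (f t)‖ ^ 2)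
      (2 * (∫ ξ, ((r ξ ^ 2 : ℝ) : ℂ) * ((starRingEnd ℂ) (f t ξ) * f' ξ)).re) t := by
  have d : HasDerivAt (fun t => mulCLM _ hm (f t)) (mulCLM _ hm f') t :=
    ((mulCLM _ hm).restrictScalars ℝ).hasFDerivAt.comp_hasDerivAt t hf
  have d' := Complex.reCLM.hasFDerivAt.comp_hasDerivAt t (d.inner ℂ d)
  have e : (fun t => ‖mulCLM _ hm (f t)‖ ^ 2) =
      Complex.reCLM ∘ fun t => inner ℂ (mulCLM _ hm (f t)) (mulCLM _ hm (f t)) := by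
    ext t
    simp only [Function.comp, Complex.reCLM_apply]
    exact norm_sq_eq_re_inner (𝕜 := ℂ) _
  rw [e]
  refine d'.congr_deriv ?_
  rw [← inner_mulCLM_ofReal hm]
  have c1 := inner_re_symm (𝕜 := ℂ) (mulCLM _ hm f') (mulCLM _ hm (f t))
  simp only [RCLike.re_to_complex] at c1
  simp only [Complex.reCLM_apply, Complex.add_re, c1]
  ring

/-- The truncated weights of the elevation at the lowest regularity. -/
noncomputable def lowA (n : ℕ) (ξ : ℝ) : ℝ :=
  (Icc (-(n : ℝ)) n).indicator (fun ξ => √(jw 1 (2 * π * ξ) * kap (2 * π * ξ))) ξ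

/-- The truncated weights of the velocity at the lowest regularity. -/
noncomputable def lowB (n : ℕ) (ξ : ℝ) : ℝ :=
  (Icc (-(n : ℝ)) n).indicator (fun ξ => jw (1 / 2) (2 * π * ξ)) ξ

theorem jw_one_mul_kap_le (x : ℝ) : jw 1 x * kap x ≤ 2 := by
  have h1 := kap_le x
  have h2 := jw_mul_neg 1 x
  have h3 := jw_nonneg 1 x
  nlinarith

theorem one_le_jw_one_mul_kap (x : ℝ) : 1 ≤ 2 * (jw 1 x * kap x) := by
  have h1 := inv_le_kap x
  have h2 := jw_mul_neg 1 x
  have h3 := jw_nonneg 1 x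
  nlinarith

theorem lowA_sq (n : ℕ) (ξ : ℝ) : lowA n ξ ^ 2 =
    (Icc (-(n : ℝ)) n).indicator (fun ξ => jw 1 (2 * π * ξ) * kap (2 * π * ξ)) ξ := by
  unfold lowA
  by_cases h : ξ ∈ Icc (-(n : ℝ)) n
  · simp only [indicator_of_mem h]
    have := (kap_pos (2 * π * ξ)).le
    have := jw_nonneg 1 (2 * π * ξ)
    rw [Real.sq_sqrt (by positivity)]
  · simp [indicator_of_notMem h]

theorem lowB_sq (n : ℕ) (ξ : ℝ) : lowB n ξ ^ 2 =
    (Icc (-(n : ℝ)) n).indicator (fun ξ => jw 1 (2 * π * ξ)) ξ := by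
  unfold lowB
  by_cases h : ξ ∈ Icc (-(n : ℝ)) n
  · simp only [indicator_of_mem h]
    rw [sq, ← jw_add]; norm_num
  · simp [indicator_of_notMem h]

@[fun_prop]
theorem measurable_lowA (n : ℕ) : Measurable (lowA n) := by
  unfold lowA; exact Measurable.indicator (by fun_prop) measurableSet_Icc

@[fun_prop]
theorem measurable_lowB (n : ℕ) : Measurable (lowB n) := by
  unfold lowB; exact Measurable.indicator (by fun_prop) measurableSet_Icc

theorem lowA_sq_le (n : ℕ) (ξ : ℝ) : lowA n ξ ^ 2 ≤ 2 := by
  rw [lowA_sq]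
  exact indicator_apply_le' (fun _ => jw_one_mul_kap_le _) (fun _ => by norm_num)

theorem lowB_sq_le (n : ℕ) (ξ : ℝ) : lowB n ξ ^ 2 ≤ jw 1 (2 * π * ξ) := by
  rw [lowB_sq]
  exact indicator_apply_le' (fun _ => le_rfl) (fun _ => jw_nonneg _ _)

theorem bddSymbol_lowA (n : ℕ) : BddSymbol fun ξ => (lowA n ξ : ℂ) := by
  refine ⟨by fun_prop, 2, fun ξ => ?_⟩
  rw [Complex.norm_real]
  have := lowA_sq_le n ξ
  exact abs_le_of_sq_le_sq (by linarith) (by norm_num)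

theorem bddSymbol_lowB (n : ℕ) : BddSymbol fun ξ => (lowB n ξ : ℂ) := by
  refine ⟨by fun_prop, jw (1 / 2) (2 * π * n), fun ξ => ?_⟩
  rw [Complex.norm_real, lowB, Real.norm_eq_abs]
  by_cases h : ξ ∈ Icc (-(n : ℝ)) n
  · rw [indicator_of_mem h, abs_of_nonneg (jw_nonneg _ _)]
    refine jw_le_of_abs_le (by norm_num) ?_
    rw [abs_mul, abs_mul _ (n : ℝ), Nat.abs_cast]
    gcongr
    exact abs_le.2 h
  · rw [indicator_of_notMem h, abs_zero]; exact jw_nonneg _ _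

/-- Here the weight of the elevation has order 0 and there is no capillary term, so conv N w is
needed only in L² and no derivative is lost: no correction is required. Truncating the weights plays
the role of the regularisation, and the bound does not depend on n. -/
theorem low_energy_rate_le {B z : ℝ≥0} {h w h' w' : L2R} {N V U F : ℝ → ℂ} (n : ℕ)
    (mN : Measurable N) (mV : Measurable V) (mU : Measurable U) (mF : Measurable F)
    (hh : sn 0 h ≤ z) (hw : sn (1 / 2) w ≤ z) (hF : sn (1 / 2) F ≤ z) (hN : sn 1 N ≤ B)
    (hV : sn 1 V ≤ B) (hU : sn (3 / 2) U ≤ B)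
    (eh : h' =ᵐ[volume] rhsH h w N V 0) (ew : w' =ᵐ[volume] rhsW 0 h w U F) :
    (∫ ξ, ((lowA n ξ ^ 2 : ℝ) : ℂ) * ((starRingEnd ℂ) (h ξ) * h' ξ)).re
      + (∫ ξ, ((lowB n ξ ^ 2 : ℝ) : ℂ) * ((starRingEnd ℂ) (w ξ) * w' ξ)).re
      ≤ (8 * cP 0 * B + 2 * cP (1 / 2) * B + 1 : ℝ≥0) * (z : ℝ) ^ 2 := by
  have mh := measurable_L2 h
  have mw := measurable_L2 w
  set X : ℝ → ℂ := fun ξ => -(Complex.I * th ξ * (conv h V ξ + conv N w ξ)) with hX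
  set Y : ℝ → ℂ := fun ξ => -(Complex.I * th ξ * conv U w ξ) + F ξ with hY
  have mX : Measurable X := by fun_prop
  have mY : Measurable Y := by fun_prop
  have hw0 : sn 0 w ≤ z := (sn_mono (by norm_num) _).trans hw
  have bX : sn 0 X ≤ 4 * cP 0 * (B * z) := by
    rw [hX, sn_neg]
    refine (sn_I_th_mul_le _ _).trans ((sn_add_le (by fun_prop) (by fun_prop)).trans ?_)
    rw [conv_comm (h : ℝ → ℂ) V]
    calc _ ≤ 2 * (cP 0 : ℝ≥0∞) * (sn (0 + 1) V * sn 0 h) + 2 * cP 0 * (sn (0 + 1) N * sn 0 w) :=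
          add_le_add (sn_conv_le_left le_rfl mV mh) (sn_conv_le_left le_rfl mN mw)
      _ ≤ 2 * (cP 0 : ℝ≥0∞) * (B * z) + 2 * cP 0 * (B * z) := by
          rw [zero_add]; gcongr
      _ = _ := by ring
  have bY : sn (1 / 2) Y ≤ (2 * cP (1 / 2) * B + 1) * z := by
    refine (sn_add_le (by fun_prop) mF).trans ?_
    rw [sn_neg]
    calc _ ≤ 2 * (cP (1 / 2) : ℝ≥0∞) * (sn (1 / 2 + 1) U * sn (1 / 2) w) + z :=
          add_le_add ((sn_I_th_mul_le _ _).trans (sn_conv_le_left (by norm_num) mU mw)) hF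
      _ ≤ 2 * (cP (1 / 2) : ℝ≥0∞) * (B * z) + z := by
          rw [show (1 / 2 + 1 : ℝ) = 3 / 2 by norm_num]; gcongr
      _ = _ := by ring
  have l1 := lintegral_symbol_mul_le (α := 0) (β := 0) (C := 2)
    (m := fun ξ => ((lowA n ξ ^ 2 : ℝ) : ℂ)) (by fun_prop) mh mX fun ξ => by
      rw [Complex.norm_real, Real.norm_of_nonneg (sq_nonneg _), add_zero, jw_zero, mul_one]
      exact lowA_sq_le n ξ
  have l2 := lintegral_symbol_mul_le (α := 1 / 2) (β := 1 / 2) (C := 1)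
    (m := fun ξ => ((lowB n ξ ^ 2 : ℝ) : ℂ)) (by fun_prop) mw mY fun ξ => by
      rw [Complex.norm_real, Real.norm_of_nonneg (sq_nonneg _), one_mul]
      norm_num
      exact lowB_sq_le n ξ
  have l1' := l1.trans (c := ((2 * (z * (4 * cP 0 * (B * z))) : ℝ≥0) : ℝ≥0∞)) (by
    push_cast
    rw [show ENNReal.ofReal 2 = 2 by norm_num]
    gcongr)
  have l2' := l2.trans (c := ((z * ((2 * cP (1 / 2) * B + 1) * z) : ℝ≥0) : ℝ≥0∞)) (by
    push_cast
    rw [ENNReal.ofReal_one, one_mul]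
    gcongr)
  have i1 := integrable_of_lintegral_le (by fun_prop (disch := skip)) ENNReal.coe_lt_top l1'
  have i2 := integrable_of_lintegral_le (by fun_prop (disch := skip)) ENNReal.coe_lt_top l2'
  have r1 := re_integral_le_of_lintegral_le l1'
  have r2 := re_integral_le_of_lintegral_le l2'
  have eq : (∫ ξ, ((lowA n ξ ^ 2 : ℝ) : ℂ) * ((starRingEnd ℂ) (h ξ) * h' ξ)).re
      + (∫ ξ, ((lowB n ξ ^ 2 : ℝ) : ℂ) * ((starRingEnd ℂ) (w ξ) * w' ξ)).re =
      (∫ ξ, ((lowA n ξ ^ 2 : ℝ) : ℂ) * ((starRingEnd ℂ) (h ξ) * X ξ)).re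
      + (∫ ξ, ((lowB n ξ ^ 2 : ℝ) : ℂ) * ((starRingEnd ℂ) (w ξ) * Y ξ)).re := by
    rw [← Complex.add_re, ← Complex.add_re,
      ← integral_add (integrable_symbol_mul (bddSymbol_lowA n) h h')
        (integrable_symbol_mul (bddSymbol_lowB n) w w'), ← integral_add i1 i2]
    have re_int : ∀ {f : ℝ → ℂ}, Integrable f → (∫ ξ, f ξ).re = ∫ ξ, (f ξ).re := fun hf =>
      (integral_re hf).symm
    refine (re_int ((integrable_symbol_mul (bddSymbol_lowA n) h h').add
      (integrable_symbol_mul (bddSymbol_lowB n) w w'))).trans (Eq.trans ?_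
        (re_int (i1.add i2)).symm)
    refine integral_congr_ae ?_
    filter_upwards [eh, ew] with ξ e1 e2
    simp only [Pi.add_apply]
    rw [e1, e2]
    -- The two weights differ by the factor tanh x / x, so the linear terms are skew at each
    -- frequency.
    have k : lowA n ξ ^ 2 * (2 * π * ξ) = lowB n ξ ^ 2 * Real.tanh (2 * π * ξ) := by
      rw [lowA_sq, lowB_sq]
      by_cases hm : ξ ∈ Icc (-(n : ℝ)) n
      · simp only [indicator_of_mem hm]
        rw [mul_assoc, kap_mul_self]
      · simp [indicator_of_notMem hm]
    have hre : (rhsH h w N V 0 ξ) = -(Complex.I * ((2 * π * ξ : ℝ) : ℂ) * w ξ) + X ξ := by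
      simp only [rhsH, hX, Pi.zero_apply]; ring
    have hre' : (rhsW 0 h w U F ξ) =
        -(Complex.I * ((Real.tanh (2 * π * ξ) : ℝ) : ℂ) * h ξ) + Y ξ := by
      simp only [rhsW, hY, zero_mul, add_zero, mul_one]; ring
    rw [hre, hre', mul_add, mul_add, mul_add, mul_add]
    have zero : (((lowA n ξ ^ 2 : ℝ) : ℂ) * ((starRingEnd ℂ) (h ξ) *
          -(Complex.I * ((2 * π * ξ : ℝ) : ℂ) * w ξ)) +
        ((lowB n ξ ^ 2 : ℝ) : ℂ) * ((starRingEnd ℂ) (w ξ) *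
          -(Complex.I * ((Real.tanh (2 * π * ξ) : ℝ) : ℂ) * h ξ))).re = 0 := by
      have e1 : ((lowA n ξ ^ 2 : ℝ) : ℂ) * ((starRingEnd ℂ) (h ξ) *
          -(Complex.I * ((2 * π * ξ : ℝ) : ℂ) * w ξ)) =
          ((lowA n ξ ^ 2 * (2 * π * ξ) : ℝ) : ℂ) * (-Complex.I * ((starRingEnd ℂ) (h ξ) * w ξ)) := by
        push_cast; ring
      have e2 : ((lowB n ξ ^ 2 : ℝ) : ℂ) * ((starRingEnd ℂ) (w ξ) *
          -(Complex.I * ((Real.tanh (2 * π * ξ) : ℝ) : ℂ) * h ξ)) =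
          ((lowB n ξ ^ 2 * Real.tanh (2 * π * ξ) : ℝ) : ℂ) *
            (-Complex.I * ((starRingEnd ℂ) (w ξ) * h ξ)) := by
        push_cast; ring
      rw [e1, e2, k]
      simp only [Complex.add_re, Complex.mul_re, Complex.mul_im, Complex.neg_re, Complex.neg_im,
        Complex.I_re, Complex.I_im, Complex.conj_re, Complex.conj_im, Complex.ofReal_re,
        Complex.ofReal_im]
      ring
    rw [Complex.add_re] at zero
    simp only [Complex.add_re]
    linarith
  rw [eq]
  refine (add_le_add r1 r2).trans_eq ?_
  push_cast
  ring

/-- With zero data the truncated energy is at most ρ² for every n, where ρ² = 2k ∫ z. Letting n grow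
bounds the two norms by 2ρ and ρ, so y² ≤ 9ρ² = 18k ∫ z. The exponent 36k is twice this, because z ≤
2y² + 2ε². -/
theorem low_energy_gronwall (T : ℝ) (B : ℝ≥0) : ∃ C : ℝ≥0,
    ∀ {T₁ : ℝ} {ε : ℝ≥0} {h w h' w' : ℝ → L2R} {N V U F : ℝ → ℝ → ℂ},
    T₁ ≤ T → ContinuousOn h (Icc 0 T₁) → SnContOn (1 / 2) (Icc 0 T₁) w → h 0 = 0 → w 0 = 0 →
    (∀ t ∈ Ioo 0 T₁, HasDerivAt h (h' t) t ∧ HasDerivAt w (w' t) t) →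
    (∀ t ∈ Ioo 0 T₁, h' t =ᵐ[volume] rhsH (h t) (w t) (N t) (V t) 0) →
    (∀ t ∈ Ioo 0 T₁, w' t =ᵐ[volume] rhsW 0 (h t) (w t) (U t) (F t)) →
    (∀ t ∈ Ioo 0 T₁, Measurable (N t) ∧ Measurable (V t) ∧ Measurable (U t) ∧
      Measurable (F t)) →
    (∀ t ∈ Ioo 0 T₁, sn 1 (N t) ≤ B ∧ sn 1 (V t) ≤ B ∧ sn (3 / 2) (U t) ≤ B ∧
      sn (1 / 2) (F t) ≤ ε) →
    ∀ t ∈ Icc 0 T₁, sn 0 (h t) + sn (1 / 2) (w t) ≤ C * ε := by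
  obtain ⟨k, hk⟩ : ∃ k : ℝ≥0, k = 8 * cP 0 * B + 2 * cP (1 / 2) * B + 1 := ⟨_, rfl⟩
  refine ⟨(2 * Real.exp (36 * k * |T|)).toNNReal, ?_⟩
  intro T₁ ε h w h' w' N V U F hT₁ ch cw h0 w0 hd heh hew hmeas hb t ht
  have hT0 : 0 ≤ T₁ := ht.1.trans ht.2
  have fh : ∀ t, sn 0 (h t) < ∞ := fun t => sn_zero_L2_lt_top _
  have fw : ∀ t ∈ Icc 0 T₁, sn (1 / 2) (w t) < ∞ := fun t ht => cw.lt_top ht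
  set y : ℝ → ℝ := fun t => ‖h t‖ + (sn (1 / 2) (w t)).toReal with hy
  have ych : ∀ t, (sn 0 (h t)).toReal = ‖h t‖ := fun t => by rw [sn_zero_L2]; simp
  have yeq : ∀ t ∈ Icc 0 T₁, sn 0 (h t) + sn (1 / 2) (w t) = ENNReal.ofReal (y t) :=
    fun t ht => by
      rw [show y t = ‖h t‖ + (sn (1 / 2) (w t)).toReal from rfl, ← ych, ENNReal.ofReal_add ENNReal.toReal_nonneg ENNReal.toReal_nonneg,
        ENNReal.ofReal_toReal (fh t).ne, ENNReal.ofReal_toReal (fw t ht).ne]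
  have yc : ContinuousOn y (Icc 0 T₁) := ch.norm.add fun t ht =>
    (ENNReal.tendsto_toReal (fw t ht).ne).comp (cw.continuousOn_sn t ht)
  have y0 : ∀ t, 0 ≤ y t := fun t => by positivity
  set z : ℝ → ℝ := fun t => (y t + ε) ^ 2 with hz
  have zc : ContinuousOn z (Icc 0 T₁) := (yc.add continuousOn_const).pow 2
  have step : ∀ t ∈ Icc 0 T₁, y t ^ 2 ≤ 18 * (k * ∫ τ in (0 : ℝ)..t, z τ) := by
    intro t ht
    have sub : Icc 0 t ⊆ Icc 0 T₁ := Icc_subset_Icc_right ht.2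
    have Ii : 0 ≤ ∫ τ in (0 : ℝ)..t, z τ :=
      intervalIntegral.integral_nonneg ht.1 fun τ _ => by positivity
    set ρ : ℝ := √(2 * (k * ∫ τ in (0 : ℝ)..t, z τ)) with hρ
    have ρ2 : ρ ^ 2 = 2 * (k * ∫ τ in (0 : ℝ)..t, z τ) := Real.sq_sqrt (by positivity)
    have ρ0 : 0 ≤ ρ := Real.sqrt_nonneg _
    have rate : ∀ n : ℕ, ‖mulCLM _ (bddSymbol_lowA n) (h t)‖ ^ 2 +
        ‖mulCLM _ (bddSymbol_lowB n) (w t)‖ ^ 2 ≤ ρ ^ 2 := by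
      intro n
      have cc : ContinuousOn (fun t => ‖mulCLM _ (bddSymbol_lowA n) (h t)‖ ^ 2 +
          ‖mulCLM _ (bddSymbol_lowB n) (w t)‖ ^ 2) (Icc 0 t) :=
        ((((mulCLM _ (bddSymbol_lowA n)).continuous.comp_continuousOn ch).norm.pow 2).add
          (((mulCLM _ (bddSymbol_lowB n)).continuous.comp_continuousOn
            (cw.continuousOn (by norm_num))).norm.pow 2)).mono sub
      have int := intervalIntegral.sub_le_integral_of_hasDeriv_right_of_le ht.1 cc
        (fun τ hτ => by
          obtain ⟨d1, d2⟩ := hd τ ⟨hτ.1, hτ.2.trans_le ht.2⟩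
          exact ((hasDerivAt_norm_sq_mulCLM (bddSymbol_lowA n) d1).add
            (hasDerivAt_norm_sq_mulCLM (bddSymbol_lowB n) d2)).hasDerivWithinAt)
        (φ := fun τ => 2 * k * z τ)
        ((continuousOn_const.mul (zc.mono sub)).integrableOn_Icc) (fun τ hτ => by
          have hτ' : τ ∈ Ioo 0 T₁ := ⟨hτ.1, hτ.2.trans_le ht.2⟩
          have hτ'' := Ioo_subset_Icc_self hτ'
          obtain ⟨b1, b2, b3, b4⟩ := hb τ hτ'
          obtain ⟨m1, m2, m3, m4⟩ := hmeas τ hτ'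
          have zz : ((y τ).toNNReal + ε : ℝ≥0) = y τ + ε := by
            rw [NNReal.coe_add, Real.coe_toNNReal _ (y0 τ)]
          have ye := yeq τ hτ''
          have le_z : ∀ {a : ℝ≥0∞}, a ≤ ENNReal.ofReal (y τ) + ε →
              a ≤ (((y τ).toNNReal + ε : ℝ≥0) : ℝ≥0∞) := fun ha => by
            rw [ENNReal.coe_add]; exact ha
          have := low_energy_rate_le (z := (y τ).toNNReal + ε) n m1 m2 m3 m4
            (le_z ((le_self_add.trans ye.le).trans le_self_add))
            (le_z ((le_add_self.trans ye.le).trans le_self_add))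
            (le_z (b4.trans le_add_self)) b1 b2 b3 (heh τ hτ') (hew τ hτ')
          rw [zz, ← hk] at this
          simp only [hz]
          linarith)
      rw [intervalIntegral.integral_const_mul, h0, w0] at int
      simp only [map_zero, norm_zero] at int
      rw [ρ2]
      linarith
    have bh : sn 0 (h t) ≤ ENNReal.ofReal (2 * ρ) := by
      refine sn_le_of_forall_indicator (measurable_L2 _) fun n => ?_
      have r1 : ‖mulCLM _ (bddSymbol_lowA n) (h t)‖ ≤ ρ :=
        (abs_le_of_sq_le_sq' ((rate n).trans' (le_add_of_nonneg_right (by positivity))) ρ0).2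
      have : sn 0 ((Icc (-(n : ℝ)) n).indicator (h t : ℝ → ℂ)) ≤
          ENNReal.ofReal 2 * sn 0 (fun ξ => (lowA n ξ : ℂ) * h t ξ) := by
        refine sn_le_of_ae_le (ae_of_all _ fun ξ => ?_)
        rw [jw_zero, one_mul, one_mul, norm_mul, Complex.norm_real,
          Real.norm_eq_abs, ← mul_assoc]
        by_cases hm : ξ ∈ Icc (-(n : ℝ)) n
        · rw [indicator_of_mem hm]
          refine le_mul_of_one_le_left (norm_nonneg _) ?_
          have q := lowA_sq n ξ
          rw [indicator_of_mem hm] at q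
          have q2 := one_le_jw_one_mul_kap (2 * π * ξ)
          rw [← q, ← sq_abs] at q2
          nlinarith [abs_nonneg (lowA n ξ)]
        · rw [indicator_of_notMem hm, norm_zero]; positivity
      refine this.trans ?_
      rw [ENNReal.ofReal_mul (by norm_num), ← sn_mulCLM (bddSymbol_lowA n), sn_zero_L2, ← ofReal_norm]
      gcongr
    have bw : sn (1 / 2) (w t) ≤ ENNReal.ofReal ρ := by
      refine sn_le_of_forall_indicator (measurable_L2 _) fun n => ?_
      have r1 : ‖mulCLM _ (bddSymbol_lowB n) (w t)‖ ≤ ρ :=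
        (abs_le_of_sq_le_sq' ((rate n).trans' (le_add_of_nonneg_left (by positivity))) ρ0).2
      refine le_trans (le_of_eq ?_) (ENNReal.ofReal_le_ofReal r1)
      rw [ofReal_norm, enorm_mulCLM, sn]
      congr 1; ext ξ
      by_cases hm : ξ ∈ Icc (-(n : ℝ)) n
      · simp [lowB, indicator_of_mem hm]
      · simp [lowB, indicator_of_notMem hm]
    have yρ : y t ≤ 3 * ρ := by
      have := (yeq t ht).symm.trans_le (add_le_add bh bw)
      rw [← ENNReal.ofReal_add (by positivity) ρ0, ENNReal.ofReal_le_ofReal_iff (by positivity)]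
        at this
      linarith
    have := pow_le_pow_left₀ (y0 t) yρ 2
    rw [mul_pow, ρ2] at this
    linarith
  have gr := le_mul_exp_of_le_add_integral (f := z) (a := 2 * (ε : ℝ) ^ 2)
    (by positivity : (0 : ℝ) ≤ 36 * k) zc (fun t ht => by
      have := step t ht
      have m4 : z t ≤ 2 * y t ^ 2 + 2 * (ε : ℝ) ^ 2 := by
        simp only [hz]; nlinarith [sq_nonneg (y t - ε)]
      linarith) t ht
  have fin' : y t ≤ 2 * Real.exp (36 * k * |T|) * ε := by
    have b : (y t + ε) ^ 2 ≤ (2 * Real.exp (36 * k * |T|) * ε) ^ 2 := by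
      refine gr.trans ?_
      have mono : Real.exp (36 * k * t) ≤ Real.exp (36 * k * |T|) := by
        gcongr
        exact (ht.2.trans hT₁).trans (le_abs_self _)
      have one : 1 ≤ Real.exp (36 * k * |T|) := Real.one_le_exp (by positivity)
      rw [mul_pow]
      have : 2 * Real.exp (36 * k * t) ≤ (2 * Real.exp (36 * k * |T|)) ^ 2 := by nlinarith
      calc 2 * (ε : ℝ) ^ 2 * Real.exp (36 * k * t) = 2 * Real.exp (36 * k * t) * (ε : ℝ) ^ 2 := by
            ring
        _ ≤ _ := by gcongr
    have := (abs_le_of_sq_le_sq' b (by positivity)).2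
    linarith [ε.2]
  rw [yeq t ht]
  refine (ENNReal.ofReal_le_ofReal fin').trans_eq ?_
  rw [ENNReal.ofReal_mul (by positivity), ENNReal.ofReal_coe_nnreal]
  rfl

/-! ### Solutions on the Fourier side -/

theorem SnContOn.exists_le {σ T : ℝ} {f : ℝ → L2R} (h : SnContOn σ (Icc 0 T) f) :
    ∃ B : ℝ≥0, ∀ t ∈ Icc 0 T, sn σ (f t) ≤ B := by
  rcases (Icc (0 : ℝ) T).eq_empty_or_nonempty with he | hne
  · exact ⟨0, by simp [he]⟩
  · obtain ⟨t, ht, hmax⟩ := isCompact_Icc.exists_isMaxOn hne h.continuousOn_sn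
    exact ⟨(sn σ (f t)).toNNReal, fun τ hτ => by
      rw [ENNReal.coe_toNNReal (h.lt_top ht).ne]; exact hmax hτ⟩

theorem SnContOn.sub {σ : ℝ} {I : Set ℝ} {f g : ℝ → L2R} (hf : SnContOn σ I f)
    (hg : SnContOn σ I g) : SnContOn σ I fun t => f t - g t := fun t ht => by
  refine ⟨(sn_L2_sub_le _ _ _).trans_lt (ENNReal.add_lt_top.2 ⟨hf.lt_top ht, hg.lt_top ht⟩), ?_⟩
  have := (hf t ht).2.add (hg t ht).2
  rw [add_zero] at this
  refine tendsto_of_tendsto_of_tendsto_of_le_of_le tendsto_const_nhds this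
    (fun _ => zero_le) (fun τ => ?_)
  have e : f τ - g τ - (f t - g t) = (f τ - f t) - (g τ - g t) := by abel
  simp only [e]
  exact sn_L2_sub_le _ _ _

theorem conv_add_left_L2 (f g k : L2R) (ξ : ℝ) :
    conv (f + g : L2R) k ξ = conv f k ξ + conv g k ξ := by
  rw [conv_congr (Lp.coeFn_add f g) (EventuallyEq.refl _ (k : ℝ → ℂ))]
  exact conv_add_left (measurable_L2 f) (measurable_L2 g) (measurable_L2 k)
    (sn_zero_L2_lt_top f) (sn_zero_L2_lt_top g) (sn_zero_L2_lt_top k) ξ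

theorem conv_smul_left_L2 (c : ℂ) (f k : L2R) (ξ : ℝ) :
    conv (c • f : L2R) k ξ = c * conv f k ξ := by
  rw [conv_congr (Lp.coeFn_smul c f) (EventuallyEq.refl _ (k : ℝ → ℂ))]
  exact conv_const_mul_left c f k ξ

theorem conv_sub_left_L2 (f g k : L2R) (ξ : ℝ) :
    conv (f - g : L2R) k ξ = conv f k ξ - conv g k ξ := by
  have := conv_add_left_L2 (f - g) g k ξ
  rw [sub_add_cancel] at this
  rw [this]; ring

theorem conv_sub_right_L2 (f g k : L2R) (ξ : ℝ) :
    conv f (g - k : L2R) ξ = conv f g ξ - conv f k ξ := by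
  rw [conv_comm, conv_sub_left_L2, conv_comm (g : ℝ → ℂ), conv_comm (k : ℝ → ℂ)]

/-- Solutions of the Whitham–Boussinesq system on the Fourier side. -/
structure FourierSolution (κ r s T : ℝ) (h w h' w' : ℝ → L2R) : Prop where
  cont_h : SnContOn r (Icc 0 T) h
  cont_w : SnContOn s (Icc 0 T) w
  deriv_h : ∀ t ∈ Ioo 0 T, HasDerivAt h (h' t) t
  deriv_w : ∀ t ∈ Ioo 0 T, HasDerivAt w (w' t) t
  eq_h : ∀ t ∈ Ioo 0 T, h' t =ᵐ[volume] fun ξ =>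
    -(Complex.I * ((2 * π * ξ : ℝ) : ℂ) * w t ξ) - Complex.I * th ξ * conv (h t) (w t) ξ
  eq_w : ∀ t ∈ Ioo 0 T, w' t =ᵐ[volume] fun ξ =>
    -(Complex.I * ((Real.tanh (2 * π * ξ) * (1 + κ * (2 * π * ξ) ^ 2) : ℝ) : ℂ) * h t ξ)
      - Complex.I * th ξ * (1 / 2 * conv (w t) (w t) ξ)
  herm_h : ∀ t ∈ Icc 0 T, hermL2 (h t) = h t

theorem fourier_sub_L2 (f g : L2R) : (𝓕 (f - g) : L2R) = 𝓕 f - 𝓕 g :=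
  (Lp.fourierTransformₗᵢ ℝ ℂ).map_sub f g

theorem fourier_L2_sq_div_two (f : L2R) (ξ : ℝ) :
    (𝓕 (fun x : ℝ => (f x ^ 2 / 2 : ℂ)) : ℝ → ℂ) ξ = 1 / 2 * conv (𝓕 f : L2R) (𝓕 f : L2R) ξ := by
  rw [← fourier_mul_eq_conv, Real.fourier_real_eq, Real.fourier_real_eq, ← integral_const_mul]
  refine integral_congr_ae (ae_of_all _ fun x => ?_)
  simp only [Circle.smul_def, smul_eq_mul]
  ring

theorem SobolevContinuousOn.snContOn {σ : ℝ} {I : Set ℝ} {f : ℝ → L2R}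
    (h : SobolevContinuousOn σ I f) : SnContOn σ I fun t => (𝓕 (f t) : L2R) := fun t ht => by
  refine ⟨(h t ht).1, ?_⟩
  have := (h t ht).2
  simpa only [sobolevENorm_eq_sn, fourier_sub_L2] using this

theorem SobolevC1On.hasDerivAt {σ : ℝ} (hσ : 0 ≤ σ) {I : Set ℝ} {f f' : ℝ → L2R}
    (h : SobolevC1On σ I f f') {t : ℝ} (ht : t ∈ I) :
    HasDerivAt (fun t => (𝓕 (f t) : L2R)) (𝓕 (f' t) : L2R) t := by
  have d : HasDerivAt f (f' t) t := by
    rw [hasDerivAt_iff_tendsto_slope, tendsto_iff_edist_tendsto_0]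
    refine tendsto_of_tendsto_of_tendsto_of_le_of_le tendsto_const_nhds (h.2.2 t ht)
      (fun _ => zero_le) (fun τ => ?_)
    rw [edist_eq_enorm_sub, sobolevENorm_eq_sn, slope]
    refine le_trans (le_of_eq ?_) (sn_mono hσ _)
    rw [sn_zero_L2, ← ofReal_norm, ← ofReal_norm, Lp.norm_fourier_eq, vsub_eq_sub]
  exact ((Lp.fourierTransformₗᵢ ℝ ℂ).toContinuousLinearEquiv.toContinuousLinearMap.restrictScalars
    ℝ).hasFDerivAt.comp_hasDerivAt t d

theorem IsSolution.exists_fourierSolution {κ r s T : ℝ} {η₀ v₀ : L2R} {η v : ℝ → L2R} (hs : 2 ≤ s)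
    (h : IsSolution κ r s T η₀ v₀ η v) : ∃ h' w' : ℝ → L2R,
      FourierSolution κ r s T (fun t => 𝓕 (η t)) (fun t => 𝓕 (v t)) h' w' := by
  obtain ⟨η', v', h1, h2, h3⟩ := h.equation
  refine ⟨fun t => 𝓕 (η' t), fun t => 𝓕 (v' t), h.continuous_η.snContOn, h.continuous_v.snContOn,
    fun t ht => h1.hasDerivAt (by linarith) ht, fun t ht => h2.hasDerivAt (by linarith) ht,
    fun t ht => ?_, fun t ht => ?_, fun t ht => (isRealValued_iff_hermL2 _).1 (h.real t ht).1⟩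
  · filter_upwards [(h3 t ht).1] with ξ hξ
    rw [hξ, fourier_mul_eq_conv]; rfl
  · filter_upwards [(h3 t ht).2] with ξ hξ
    rw [hξ, fourier_L2_sq_div_two]; rfl

theorem FourierSolution.mono {κ r s T T' : ℝ} {h w h' w' : ℝ → L2R}
    (S : FourierSolution κ r s T h w h' w') (hT : T' ≤ T) : FourierSolution κ r s T' h w h' w' :=
  have i : Icc 0 T' ⊆ Icc 0 T := Icc_subset_Icc_right hT
  have o : Ioo 0 T' ⊆ Ioo 0 T := Ioo_subset_Ioo_right hT
  ⟨S.cont_h.mono i, S.cont_w.mono i, fun t ht => S.deriv_h t (o ht), fun t ht => S.deriv_w t (o ht),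
    fun t ht => S.eq_h t (o ht), fun t ht => S.eq_w t (o ht), fun t ht => S.herm_h t (i ht)⟩

/-! ### Stability at the lowest regularity -/

/-- The mean of two velocities is the coefficient of the linearised equation, because w² − v² = (w +
v)(w − v). -/
theorem sn_half_smul_add_le {σ : ℝ} {f g : L2R} {b : ℝ≥0∞} (hf : sn σ f ≤ b) (hg : sn σ g ≤ b) :
    sn σ ((1 / 2 : ℂ) • (f + g) : L2R) ≤ b := by
  calc sn σ ((1 / 2 : ℂ) • (f + g) : L2R)
      = sn σ (fun ξ => (1 / 2 : ℂ) * (f + g : L2R) ξ) := sn_congr (Lp.coeFn_smul _ _)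
    _ ≤ ENNReal.ofReal (1 / 2) * sn (σ + 0) (f + g : L2R) :=
        sn_mul_le fun ξ => by simp [jw_zero]
    _ ≤ ENNReal.ofReal (1 / 2) * (b + b) := by
        rw [add_zero]
        gcongr
        exact (sn_L2_add_le _ _ _).trans (add_le_add hf hg)
    _ = b := by
        rw [← two_mul, ← mul_assoc, show (2 : ℝ≥0∞) = ENNReal.ofReal 2 by norm_num,
          ← ENNReal.ofReal_mul (by norm_num)]
        norm_num

theorem sn_capillary_le {σ κ : ℝ} (hκ : 0 ≤ κ) (F : ℝ → ℂ) :
    sn σ (fun ξ => -(Complex.I * ((Real.tanh (2 * π * ξ) * (κ * (2 * π * ξ) ^ 2) : ℝ) : ℂ)) * F ξ)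
      ≤ ENNReal.ofReal κ * sn (σ + 2) F := by
  refine sn_mul_le (m := fun ξ => -(Complex.I * ((Real.tanh (2 * π * ξ) *
    (κ * (2 * π * ξ) ^ 2) : ℝ) : ℂ))) fun ξ => ?_
  rw [norm_neg, norm_mul, Complex.norm_I, one_mul, Complex.norm_real, Real.norm_eq_abs, abs_mul,
    jw_two]
  have := abs_tanh_le_one (2 * π * ξ)
  rw [abs_of_nonneg (by positivity : 0 ≤ κ * (2 * π * ξ) ^ 2)]
  have : 0 ≤ κ * (2 * π * ξ) ^ 2 := by positivity
  nlinarith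

/-- By h ⋆ w − k ⋆ v = (h − k) ⋆ v + h ⋆ (w − v) and the same factoring of the squares, the
difference solves the linearised system without surface tension. The whole capillary term of h is
the source; it has order 2, so its H^{1/2} norm is at most κ times the H^{5/2} norm of h. -/
theorem FourierSolution.low_stability (T : ℝ) (B : ℝ≥0) : ∃ C : ℝ≥0,
    ∀ {κ r r' s : ℝ} {ε : ℝ≥0} {h w h' w' k v k' v' : ℝ → L2R}, 0 ≤ κ → 2 ≤ s → 1 ≤ r → 1 ≤ r' →
    FourierSolution κ r s T h w h' w' → FourierSolution 0 r' s T k v k' v' →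
    h 0 = k 0 → w 0 = v 0 → (∀ t ∈ Icc 0 T, sn 1 (h t) ≤ B) → (∀ t ∈ Icc 0 T, sn 2 (w t) ≤ B) →
    (∀ t ∈ Icc 0 T, sn 2 (v t) ≤ B) →
    (∀ t ∈ Icc 0 T, ENNReal.ofReal κ * sn (5 / 2) (h t) ≤ ε) →
    ∀ t ∈ Icc 0 T, sn 0 (h t - k t : L2R) + sn (1 / 2) (w t - v t : L2R) ≤ C * ε := by
  obtain ⟨C, hC⟩ := low_energy_gronwall T B
  refine ⟨C, ?_⟩
  intro κ r r' s ε h w h' w' k v k' v' hκ hs hr hr' S S' h0 w0 bh bw bv bε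
  have sub : Ioo 0 T ⊆ Icc 0 T := Ioo_subset_Icc_self
  refine hC (T₁ := T) (h := fun t => h t - k t) (w := fun t => w t - v t)
    (h' := fun t => h' t - k' t) (w' := fun t => w' t - v' t)
    (N := fun t => h t) (V := fun t => v t) (U := fun t => ((1 / 2 : ℂ) • (w t + v t) : L2R))
    (F := fun t ξ => -(Complex.I * ((Real.tanh (2 * π * ξ) * (κ * (2 * π * ξ) ^ 2) : ℝ) : ℂ)) * h t ξ)
    le_rfl ?_ ?_ ?_ ?_ ?_ ?_ ?_ ?_ ?_
  · exact (S.cont_h.continuousOn (by linarith)).sub (S'.cont_h.continuousOn (by linarith))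
  · exact (S.cont_w.mono_exp (by linarith)).sub (S'.cont_w.mono_exp (by linarith))
  · simp [h0]
  · simp [w0]
  · exact fun t ht => ⟨(S.deriv_h t ht).sub (S'.deriv_h t ht),
      (S.deriv_w t ht).sub (S'.deriv_w t ht)⟩
  · intro t ht
    filter_upwards [S.eq_h t ht, S'.eq_h t ht, Lp.coeFn_sub (h' t) (k' t),
      Lp.coeFn_sub (w t) (v t)] with ξ e1 e2 e3 e4
    rw [e3, Pi.sub_apply, e1, e2, rhsH, e4, Pi.sub_apply, conv_sub_left_L2, conv_sub_right_L2]
    simp only [Pi.zero_apply]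
    ring
  · intro t ht
    filter_upwards [S.eq_w t ht, S'.eq_w t ht, Lp.coeFn_sub (w' t) (v' t),
      Lp.coeFn_sub (h t) (k t)] with ξ e1 e2 e3 e4
    rw [e3, Pi.sub_apply, e1, e2, rhsW, e4, Pi.sub_apply, conv_sub_right_L2, conv_smul_left_L2,
      conv_smul_left_L2, conv_add_left_L2, conv_add_left_L2, conv_comm (v t : ℝ → ℂ) (w t)]
    push_cast
    ring
  · intro t ht
    have := measurable_L2 (h t)
    have := continuous_tanh.measurable
    exact ⟨measurable_L2 _, measurable_L2 _, measurable_L2 _, by fun_prop⟩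
  · intro t ht
    have ht' := sub ht
    refine ⟨bh t ht', (sn_mono (by norm_num) _).trans (bv t ht'), ?_, ?_⟩
    · exact sn_half_smul_add_le ((sn_mono (by norm_num) _).trans (bw t ht'))
        ((sn_mono (by norm_num) _).trans (bv t ht'))
    · refine le_trans (sn_capillary_le hκ _) (le_of_eq_of_le ?_ (bε t ht'))
      norm_num

/-- The stability estimate for two solutions with κ = 0, where the source vanishes and ε = 0 is
allowed. -/
theorem FourierSolution.unique {r s T : ℝ} (hs : 2 ≤ s) (hr : 1 ≤ r) {h w h' w' k v k' v' : ℝ → L2R}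
    (S : FourierSolution 0 r s T h w h' w') (S' : FourierSolution 0 r s T k v k' v')
    (h0 : h 0 = k 0) (w0 : w 0 = v 0) : ∀ t ∈ Icc 0 T, h t = k t ∧ w t = v t := by
  obtain ⟨B₁, b1⟩ := (S.cont_h.mono_exp hr).exists_le
  obtain ⟨B₂, b2⟩ := (S.cont_w.mono_exp hs).exists_le
  obtain ⟨B₃, b3⟩ := (S'.cont_w.mono_exp hs).exists_le
  obtain ⟨C, hC⟩ := FourierSolution.low_stability T (B₁ + B₂ + B₃)
  intro t ht
  have key := hC le_rfl hs hr hr S S' h0 w0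
    (fun t ht => (b1 t ht).trans (by push_cast; exact le_self_add.trans le_self_add))
    (fun t ht => (b2 t ht).trans (by push_cast; exact le_add_self.trans le_self_add))
    (fun t ht => (b3 t ht).trans (by push_cast; exact le_add_self)) (ε := 0)
    (fun t ht => by simp) t ht
  simp only [ENNReal.coe_zero, mul_zero, nonpos_iff_eq_zero, add_eq_zero] at key
  refine ⟨?_, ?_⟩
  · have := key.1
    rw [sn_zero_L2] at this
    exact sub_eq_zero.1 (by simpa using this)
  · have : sn 0 (w t - v t : L2R) = 0 := le_antisymm ((sn_mono (by norm_num) _).trans key.2.le) zero_le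
    rw [sn_zero_L2] at this
    exact sub_eq_zero.1 (by simpa using this)

/-! ### Frequency cutoffs -/

/-- The bounded frequencies. -/
def cut (n : ℕ) : Set ℝ := Icc (-(n : ℝ)) n

theorem measurableSet_cut (n : ℕ) : MeasurableSet (cut n) := measurableSet_Icc

theorem notMem_cut {n : ℕ} {ξ : ℝ} (h : (n : ℝ) < |ξ|) : ξ ∉ cut n := fun hm =>
  absurd (abs_le.2 hm) (not_le.2 h)

theorem bddSymbol_cut (n : ℕ) : BddSymbol ((cut n).indicator fun _ => (1 : ℂ)) := by
  refine ⟨measurable_const.indicator (measurableSet_cut n), 1, fun ξ => ?_⟩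
  by_cases h : ξ ∈ cut n <;> simp [h]

/-- The sharp frequency cutoff. -/
noncomputable def cutL (n : ℕ) : L2R →L[ℂ] L2R := mulCLM _ (bddSymbol_cut n)

theorem coeFn_cutL (n : ℕ) (f : L2R) : cutL n f =ᵐ[volume] (cut n).indicator f := by
  filter_upwards [coeFn_mulCLM (bddSymbol_cut n) f] with ξ h
  rw [cutL, h]
  by_cases hm : ξ ∈ cut n <;> simp [hm]

theorem coeFn_sub_cutL (n : ℕ) (f : L2R) :
    (f - cutL n f : L2R) =ᵐ[volume] (cut n)ᶜ.indicator f := by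
  filter_upwards [coeFn_cutL n f, Lp.coeFn_sub f (cutL n f)] with ξ h1 h2
  rw [h2, Pi.sub_apply, h1]
  by_cases hm : ξ ∈ cut n <;> simp [hm]

theorem sn_indicator_le (σ : ℝ) (A : Set ℝ) (F : ℝ → ℂ) : sn σ (A.indicator F) ≤ sn σ F := by
  have := sn_le_of_ae_le (σ := σ) (τ := σ) (C := 1) (F := A.indicator F) (G := F)
    (ae_of_all _ fun ξ => by
      rw [one_mul]
      have := jw_nonneg σ (2 * π * ξ)
      gcongr
      exact norm_indicator_le_norm_self _ _)
  simpa using this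

theorem sn_cutL_le (σ : ℝ) (n : ℕ) (f : L2R) : sn σ (cutL n f) ≤ sn σ f := by
  rw [sn_congr (coeFn_cutL n f)]; exact sn_indicator_le _ _ _

theorem sn_sub_cutL_le (σ : ℝ) (n : ℕ) (f : L2R) : sn σ (f - cutL n f : L2R) ≤ sn σ f := by
  rw [sn_congr (coeFn_sub_cutL n f)]; exact sn_indicator_le _ _ _

/-- Bernstein's inequality. -/
theorem sn_le_of_support {σ τ R : ℝ} {F : ℝ → ℂ} (hR : 0 ≤ R) (h : ∀ ξ, R < |ξ| → F ξ = 0)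
    (hτ : τ ≤ σ + 5 / 2) : sn τ F ≤ ENNReal.ofReal (jw (5 / 2) (2 * π * R)) * sn σ F := by
  refine sn_le_of_ae_le (ae_of_all _ fun ξ => ?_)
  rcases lt_or_ge R |ξ| with hξ | hξ
  · rw [h ξ hξ]; simp
  · have h1 : jw τ (2 * π * ξ) ≤ jw (5 / 2) (2 * π * ξ) * jw σ (2 * π * ξ) := by
      rw [← jw_add]; exact jw_le_jw (by linarith) _
    have h2 : jw (5 / 2) (2 * π * ξ) ≤ jw (5 / 2) (2 * π * R) := by
      refine jw_le_of_abs_le (by norm_num) ?_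
      rw [abs_mul, abs_mul _ R, abs_of_nonneg hR]
      gcongr
    have := jw_nonneg σ (2 * π * ξ)
    calc jw τ (2 * π * ξ) * ‖F ξ‖ ≤ jw (5 / 2) (2 * π * ξ) * jw σ (2 * π * ξ) * ‖F ξ‖ := by gcongr
      _ ≤ jw (5 / 2) (2 * π * R) * jw σ (2 * π * ξ) * ‖F ξ‖ := by gcongr
      _ = _ := by ring

/-- The gain of the cutoff. -/
noncomputable def cutGain (n : ℕ) : ℝ≥0 := (jw (5 / 2) (2 * π * (2 * n))).toNNReal

/-- The gain is taken at radius 2n, although n would do here, so that one constant also serves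
products of truncated functions. The exponent 5/2 is what leads from s − 1/2 to s + 2, as the
capillary term of the truncated elevation requires. -/
theorem sn_cutL_le_gain {σ τ : ℝ} (hτ : τ ≤ σ + 5 / 2) (n : ℕ) (f : L2R) :
    sn τ (cutL n f) ≤ cutGain n * sn σ f := by
  rw [sn_congr (coeFn_cutL n f)]
  have h := sn_le_of_support (σ := σ) (τ := τ) (R := 2 * n) (F := (cut n).indicator f)
    (by positivity) (fun ξ hξ => indicator_of_notMem (notMem_cut (by
      have : (0 : ℝ) ≤ n := Nat.cast_nonneg n
      linarith)) _) hτ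
  exact h.trans (mul_le_mul_right (sn_indicator_le _ _ _) _)

/-- The commutator of the cutoff with the product. -/
noncomputable def cutErr (n : ℕ) (f g : L2R) (ξ : ℝ) : ℂ :=
  (cut n).indicator (conv f g) ξ - conv (cutL n f) (cutL n g) ξ

@[fun_prop]
theorem measurable_cutErr (n : ℕ) (f g : L2R) : Measurable (cutErr n f g) :=
  ((measurable_conv (measurable_L2 f) (measurable_L2 g)).indicator (measurableSet_cut n)).sub
    (measurable_conv (measurable_L2 _) (measurable_L2 _))

/-- Two frequencies of size at most n add up to at most 2n. -/
theorem cutErr_eq_zero {n : ℕ} (f g : L2R) {ξ : ℝ} (hξ : 2 * (n : ℝ) < |ξ|) :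
    cutErr n f g ξ = 0 := by
  have n0 : (0 : ℝ) ≤ n := Nat.cast_nonneg n
  rw [cutErr, indicator_of_notMem (notMem_cut (by linarith)), zero_sub, neg_eq_zero,
    conv_congr (coeFn_cutL n f) (coeFn_cutL n g), conv]
  refine integral_eq_zero_of_ae (ae_of_all _ fun ζ => ?_)
  rcases lt_or_ge (n : ℝ) |ζ| with h | h
  · simp [indicator_of_notMem (notMem_cut h)]
  · have : (n : ℝ) < |ξ - ζ| := by
      have := abs_sub_abs_le_abs_sub ξ ζ
      linarith
    simp [indicator_of_notMem (notMem_cut this)]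

theorem sn_cutErr_le_gain {σ τ : ℝ} (hτ : τ ≤ σ + 5 / 2) (n : ℕ) (f g : L2R) :
    sn τ (cutErr n f g) ≤ cutGain n * sn σ (cutErr n f g) :=
  sn_le_of_support (by positivity) (fun _ hξ => cutErr_eq_zero f g hξ) hτ

/-- With P the truncation, fg − Pf Pg = (f − Pf) g + Pf (g − Pg), and P(fg) differs from fg by its
tail. Every term thus contains a high frequency tail. -/
theorem sn_cutErr_le {σ : ℝ} (hσ : 1 ≤ σ) (n : ℕ) (f g : L2R) :
    sn σ (cutErr n f g) ≤ sn σ ((cut n)ᶜ.indicator (conv f g)) + 2 * cP σ *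
      (sn σ (f - cutL n f : L2R) * sn σ g + sn σ f * sn σ (g - cutL n g : L2R)) := by
  have mc := measurable_conv (measurable_L2 f) (measurable_L2 g)
  have e : cutErr n f g = fun ξ => -(cut n)ᶜ.indicator (conv f g) ξ +
      (conv (f - cutL n f : L2R) g ξ + conv (cutL n f) (g - cutL n g : L2R) ξ) := by
    ext ξ
    rw [cutErr, conv_sub_left_L2, conv_sub_right_L2]
    by_cases hm : ξ ∈ cut n
    · simp [hm]
    · simp only [hm, mem_compl_iff, not_false_eq_true, indicator_of_mem, indicator_of_notMem]
      ring
  have m1 := measurable_conv (measurable_L2 (f - cutL n f)) (measurable_L2 g)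
  have m2 := measurable_conv (measurable_L2 (cutL n f)) (measurable_L2 (g - cutL n g))
  rw [e]
  refine (sn_add_le (mc.indicator (measurableSet_cut n).compl).neg (m1.add m2)).trans ?_
  refine add_le_add (sn_neg _).le ((sn_add_le m1 m2).trans ?_)
  calc _ ≤ 2 * (cP σ : ℝ≥0∞) * (sn σ (f - cutL n f : L2R) * sn σ g)
        + 2 * cP σ * (sn σ (cutL n f) * sn σ (g - cutL n g : L2R)) :=
        add_le_add (sn_conv_le hσ (measurable_L2 _) (measurable_L2 _))
          (sn_conv_le hσ (measurable_L2 _) (measurable_L2 _))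
    _ ≤ 2 * (cP σ : ℝ≥0∞) * (sn σ (f - cutL n f : L2R) * sn σ g)
        + 2 * cP σ * (sn σ f * sn σ (g - cutL n g : L2R)) := by
        gcongr; exact sn_cutL_le _ _ _
    _ = _ := by ring

/-! ### Uniform smallness of high frequencies -/

theorem tendsto_sn_compl_cut {σ : ℝ} {F : ℝ → ℂ} (hF : Measurable F) (h : sn σ F < ∞) :
    Tendsto (fun n : ℕ => sn σ ((cut n)ᶜ.indicator F)) atTop (𝓝 0) := by
  have mw : Measurable (wn σ F) := by unfold wn; fun_prop
  have e : ∀ n : ℕ, sn σ ((cut n)ᶜ.indicator F) =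
      (∫⁻ ξ, (cut n)ᶜ.indicator (fun ξ => wn σ F ξ ^ (2 : ℝ)) ξ) ^ (1 / 2 : ℝ) := fun n => by
    rw [sn_eq_eLpNorm_wn, eLpNorm_two_eq_lintegral]
    congr 1
    refine lintegral_congr fun ξ => ?_
    by_cases hm : ξ ∈ cut n <;> simp [wn, hm]
  have fin : ∫⁻ ξ, wn σ F ξ ^ (2 : ℝ) ≠ ∞ := by
    intro ht
    rw [sn_eq_eLpNorm_wn, eLpNorm_two_eq_lintegral, ht] at h
    simp at h
  have lim : Tendsto (fun n : ℕ => ∫⁻ ξ, (cut n)ᶜ.indicator (fun ξ => wn σ F ξ ^ (2 : ℝ)) ξ) atTop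
      (𝓝 (∫⁻ _ : ℝ, 0)) := by
    refine tendsto_lintegral_of_dominated_convergence (fun ξ => wn σ F ξ ^ (2 : ℝ))
      (fun n => (mw.pow_const (2 : ℝ)).indicator (measurableSet_cut n).compl)
      (fun n => ae_of_all _ fun ξ => indicator_le_self' (fun _ _ => zero_le) ξ) fin
      (ae_of_all _ fun ξ => ?_)
    refine tendsto_const_nhds.congr' ?_
    obtain ⟨N, hN⟩ := exists_nat_ge |ξ|
    filter_upwards [eventually_ge_atTop N] with n hn
    have : ξ ∈ cut n := abs_le.1 (hN.trans (by exact_mod_cast hn))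
    simp [this]
  simp_rw [e]
  have := (ENNReal.continuous_rpow_const (y := (1 / 2 : ℝ))).tendsto (∫⁻ _ : ℝ, 0) |>.comp lim
  simpa [Function.comp_def] using this

/-- A cutoff index that works at one time works nearby, by continuity in the weighted norm;
compactness of the time interval makes it uniform. -/
theorem exists_uniform_tail {σ T : ℝ} {f : ℝ → ℝ → ℂ} (mf : ∀ t, Measurable (f t))
    (fin : ∀ t ∈ Icc 0 T, sn σ (f t) < ∞)
    (cont : ∀ t ∈ Icc 0 T, Tendsto (fun τ => sn σ (fun ξ => f τ ξ - f t ξ)) (𝓝[Icc 0 T] t) (𝓝 0))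
    {ε : ℝ≥0∞} (hε : 0 < ε) :
    ∃ n₀ : ℕ, ∀ n ≥ n₀, ∀ t ∈ Icc 0 T, sn σ ((cut n)ᶜ.indicator (f t)) ≤ ε := by
  refine isCompact_Icc.induction_on
    (p := fun S => ∃ n₀ : ℕ, ∀ n ≥ n₀, ∀ t ∈ S, sn σ ((cut n)ᶜ.indicator (f t)) ≤ ε)
    ⟨0, by simp⟩ ?_ ?_ ?_
  · rintro S S' hSS' ⟨n₀, h⟩
    exact ⟨n₀, fun n hn t ht => h n hn t (hSS' ht)⟩
  · rintro S S' ⟨n₀, h⟩ ⟨n₁, h'⟩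
    exact ⟨max n₀ n₁, fun n hn t ht => ht.elim (h n ((le_max_left _ _).trans hn) t)
      (h' n ((le_max_right _ _).trans hn) t)⟩
  · intro t ht
    have hε2 : 0 < ε / 2 := ENNReal.half_pos hε.ne'
    obtain ⟨n₀, hn₀⟩ := eventually_atTop.1
      ((tendsto_sn_compl_cut (mf t) (fin t ht)).eventually_le_const hε2)
    refine ⟨_, (cont t ht).eventually_le_const hε2, n₀, fun n hn τ hτ => ?_⟩
    have e : (cut n)ᶜ.indicator (f τ) = fun ξ => (cut n)ᶜ.indicator (fun ξ => f τ ξ - f t ξ) ξ +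
        (cut n)ᶜ.indicator (f t) ξ := by
      ext ξ
      by_cases hm : ξ ∈ cut n <;> simp [hm]
    rw [e]
    refine (sn_add_le (((mf τ).sub (mf t)).indicator (measurableSet_cut n).compl)
      ((mf t).indicator (measurableSet_cut n).compl)).trans ?_
    refine (add_le_add ((sn_indicator_le _ _ _).trans hτ) (hn₀ n hn)).trans_eq ?_
    exact ENNReal.add_halves ε

theorem SnContOn.exists_uniform_tail {σ T : ℝ} {f : ℝ → L2R} (h : SnContOn σ (Icc 0 T) f)
    {ε : ℝ≥0∞} (hε : 0 < ε) :
    ∃ n₀ : ℕ, ∀ n ≥ n₀, ∀ t ∈ Icc 0 T, sn σ (f t - cutL n (f t) : L2R) ≤ ε := by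
  obtain ⟨n₀, h₀⟩ := _root_.exists_uniform_tail (σ := σ) (f := fun t => f t)
    (fun t => measurable_L2 _) (fun t ht => h.lt_top ht)
    (fun t ht => (h t ht).2.congr fun τ => sn_congr (Lp.coeFn_sub _ _)) hε
  exact ⟨n₀, fun n hn t ht => by rw [sn_congr (coeFn_sub_cutL n (f t))]; exact h₀ n hn t ht⟩

theorem SnContOn.tendsto_conv {σ : ℝ} (hσ : 1 ≤ σ) {I : Set ℝ} {f g : ℝ → L2R}
    (hf : SnContOn σ I f) (hg : SnContOn σ I g) {t : ℝ} (ht : t ∈ I) :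
    Tendsto (fun τ => sn σ (fun ξ => conv (f τ) (g τ) ξ - conv (f t) (g t) ξ)) (𝓝[I] t) (𝓝 0) := by
  have lim : Tendsto (fun τ => 2 * (cP σ : ℝ≥0∞) * (sn σ (f τ - f t : L2R) * sn σ (g τ)
      + sn σ (f t) * sn σ (g τ - g t : L2R))) (𝓝[I] t)
      (𝓝 (2 * (cP σ : ℝ≥0∞) * (0 * sn σ (g t) + sn σ (f t) * 0))) := by
    refine ENNReal.Tendsto.const_mul (Tendsto.add ?_ ?_) (Or.inr (by finiteness))
    · exact ENNReal.Tendsto.mul (hf t ht).2 (Or.inr (hg.lt_top ht).ne)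
        (hg.continuousOn_sn t ht) (Or.inr (by simp))
    · exact ENNReal.Tendsto.const_mul (hg t ht).2 (Or.inr (hf.lt_top ht).ne)
  simp only [zero_mul, mul_zero, add_zero] at lim
  refine tendsto_of_tendsto_of_tendsto_of_le_of_le tendsto_const_nhds lim
    (fun _ => zero_le) (fun τ => ?_)
  have e : (fun ξ => conv (f τ) (g τ) ξ - conv (f t) (g t) ξ) = fun ξ =>
      conv (f τ - f t : L2R) (g τ) ξ + conv (f t) (g τ - g t : L2R) ξ := by
    ext ξ
    rw [conv_sub_left_L2, conv_sub_right_L2]; ring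
  simp only [e]
  refine (sn_add_le (measurable_conv (measurable_L2 _) (measurable_L2 _))
    (measurable_conv (measurable_L2 _) (measurable_L2 _))).trans ?_
  rw [mul_add]
  exact add_le_add (sn_conv_le hσ (measurable_L2 _) (measurable_L2 _))
    (sn_conv_le hσ (measurable_L2 _) (measurable_L2 _))

theorem SnContOn.conv_lt_top {σ : ℝ} (hσ : 1 ≤ σ) {I : Set ℝ} {f g : ℝ → L2R}
    (hf : SnContOn σ I f) (hg : SnContOn σ I g) {t : ℝ} (ht : t ∈ I) :
    sn σ (conv (f t) (g t)) < ∞ := by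
  refine (sn_conv_le hσ (measurable_L2 _) (measurable_L2 _)).trans_lt ?_
  exact ENNReal.mul_lt_top (by finiteness) (ENNReal.mul_lt_top (hf.lt_top ht) (hg.lt_top ht))

theorem SnContOn.exists_uniform_tail_conv {σ T : ℝ} (hσ : 1 ≤ σ) {f g : ℝ → L2R}
    (hf : SnContOn σ (Icc 0 T) f) (hg : SnContOn σ (Icc 0 T) g) {ε : ℝ≥0∞} (hε : 0 < ε) :
    ∃ n₀ : ℕ, ∀ n ≥ n₀, ∀ t ∈ Icc 0 T, sn σ ((cut n)ᶜ.indicator (conv (f t) (g t))) ≤ ε :=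
  _root_.exists_uniform_tail (f := fun t => conv (f t) (g t))
    (fun _ => measurable_conv (measurable_L2 _) (measurable_L2 _))
    (fun _ ht => hf.conv_lt_top hσ hg ht) (fun _ ht => hf.tendsto_conv hσ hg ht) hε

theorem SnContOn.cutL {σ τ : ℝ} (hτ : τ ≤ σ + 5 / 2) {I : Set ℝ} {f : ℝ → L2R}
    (h : SnContOn σ I f) (n : ℕ) : SnContOn τ I fun t => cutL n (f t) := fun t ht => by
  refine ⟨(sn_cutL_le_gain hτ n _).trans_lt (ENNReal.mul_lt_top ENNReal.coe_lt_top
    (h.lt_top ht)), ?_⟩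
  have lim := ENNReal.Tendsto.const_mul (a := (cutGain n : ℝ≥0∞)) (h t ht).2
    (Or.inr ENNReal.coe_ne_top)
  rw [mul_zero] at lim
  refine tendsto_of_tendsto_of_tendsto_of_le_of_le tendsto_const_nhds lim
    (fun _ => zero_le) (fun τ' => ?_)
  simp only [← map_sub]
  exact sn_cutL_le_gain hτ n _

/-! ### Continuous induction -/

theorem bootstrap {y : ℝ → ℝ} {T θ : ℝ} (hθ : θ < 1) (hy : ContinuousOn y (Icc 0 T))
    (h0 : y 0 ≤ θ) (h : ∀ T₁ ∈ Icc 0 T, (∀ t ∈ Icc 0 T₁, y t ≤ 1) → ∀ t ∈ Icc 0 T₁, y t ≤ θ) :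
    ∀ t ∈ Icc 0 T, y t ≤ θ := by
  intro t ht
  by_contra hn
  rw [not_le] at hn
  -- A level above θ and at most 1 that y reaches. Up to the first time of reaching it the a priori
  -- bound holds, so y ≤ θ < c there, a contradiction.
  obtain ⟨c, hc1, hc2, hc3⟩ : ∃ c, θ < c ∧ c ≤ 1 ∧ c ≤ y t :=
    ⟨min 1 (y t), lt_min hθ hn, min_le_left _ _, min_le_right _ _⟩
  have hyt := hy.mono (Icc_subset_Icc_right ht.2 : Icc 0 t ⊆ Icc 0 T)
  set A : Set ℝ := Icc 0 t ∩ y ⁻¹' Ici c with hA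
  have Ac : IsClosed A := hyt.preimage_isClosed_of_isClosed isClosed_Icc isClosed_Ici
  have An : A.Nonempty := ⟨t, ⟨ht.1, le_rfl⟩, hc3⟩
  have Ab : BddBelow A := ⟨0, fun x hx => hx.1.1⟩
  have hs := Ac.csInf_mem An Ab
  set t₁ := sInf A
  have ht₁ : t₁ ∈ Icc 0 T := ⟨hs.1.1, hs.1.2.trans ht.2⟩
  have lt : ∀ τ ∈ Icc 0 t₁, τ < t₁ → y τ < c := fun τ hτ hlt => by
    by_contra hcon
    exact absurd (csInf_le Ab (⟨⟨hτ.1, hτ.2.trans hs.1.2⟩, not_lt.1 hcon⟩ : τ ∈ A)) (not_le.2 hlt)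
  have yt₁ : y t₁ = c := by
    obtain ⟨τ, hτ, hτc⟩ := intermediate_value_Icc hs.1.1
      (hyt.mono (Icc_subset_Icc_right hs.1.2)) ⟨h0.trans hc1.le, hs.2⟩
    rcases hτ.2.lt_or_eq with hlt | heq
    · exact absurd (lt τ hτ hlt) (by rw [hτc]; exact lt_irrefl _)
    · rwa [heq] at hτc
  have := h t₁ ht₁ (fun τ hτ => by
    rcases hτ.2.lt_or_eq with hlt | heq
    · exact (lt τ hτ hlt).le.trans hc2
    · rw [heq, yt₁]; exact hc2) t₁ ⟨ht₁.1, le_rfl⟩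
  linarith

/-! ### Convergence to the solution without surface tension -/

/-- The elevation equation does not contain κ and loses one derivative on the velocity only. So the
time derivative of the coefficient N is bounded uniformly in κ. -/
theorem FourierSolution.sn_deriv_le {κ r s T : ℝ} (hs : 2 ≤ s) {h w h' w' : ℝ → L2R} {b : ℝ≥0}
    (S : FourierSolution κ r s T h w h' w') {t : ℝ} (ht : t ∈ Ioo 0 T)
    (bh : sn (s - 1) (h t) ≤ b) (bw : sn s (w t) ≤ b) :
    sn (s - 1) (h' t) ≤ (b + 2 * cP (s - 1) * (b * b) : ℝ≥0) := by
  rw [sn_congr (S.eq_h t ht)]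
  have mh := measurable_L2 (h t)
  have mw := measurable_L2 (w t)
  refine (sn_sub_le (by fun_prop) (by fun_prop)).trans ?_
  refine (add_le_add (b := (b : ℝ≥0∞)) (d := 2 * cP (s - 1) * (b * b)) ?_ ((sn_I_th_mul_le _ _).trans
    ((sn_conv_le (by linarith) mh mw).trans ?_))).trans_eq (by push_cast; rfl)
  · rw [sn_neg]
    have := sn_mul_le (σ := s - 1) (τ := 1) (C := 1) (F := w t)
      (m := fun ξ => Complex.I * ((2 * π * ξ : ℝ) : ℂ)) fun ξ => by
        rw [norm_mul, Complex.norm_I, one_mul, one_mul, Complex.norm_real]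
        exact abs_le_jw_one _
    rw [ENNReal.ofReal_one, one_mul, sub_add_cancel] at this
    exact this.trans bw
  · gcongr
    exact (sn_mono (by linarith) _).trans bw

/-- Stability of the truncated solution without surface tension. -/
theorem FourierSolution.cutoff_stability {s : ℝ} (hs : 2 ≤ s) (T : ℝ) (b : ℝ≥0) : ∃ C : ℝ≥0,
    ∀ {κ T₁ : ℝ} {n : ℕ} {ε : ℝ≥0} {h w h' w' k v k' v' : ℝ → L2R}, 0 < κ → κ ≤ 1 → T₁ ≤ T →
    FourierSolution κ (s + 1 / 2) s T₁ h w h' w' → FourierSolution 0 (s - 1 / 2) s T₁ k v k' v' →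
    (∀ t ∈ Icc 0 T₁, sn (s - 1 / 2) (k t) ≤ b) → (∀ t ∈ Icc 0 T₁, sn s (v t) ≤ b) →
    (∀ t ∈ Icc 0 T₁, xn s κ (h t - cutL n (k t) : L2R) (w t - cutL n (v t) : L2R) ≤ 1) →
    (∀ t ∈ Icc 0 T₁, sn (s - 1 / 2) (cutErr n (k t) (v t)) ≤ ε) →
    (∀ t ∈ Icc 0 T₁, sn s (cutErr n (v t) (v t)) ≤ ε) →
    ENNReal.ofReal √κ * cutGain n ≤ 1 → ENNReal.ofReal √κ * (cutGain n * b) ≤ 1 →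
    ENNReal.ofReal √κ * (cutGain n * b) ≤ ε →
    ∀ t ∈ Icc 0 T₁, xn s κ (h t - cutL n (k t) : L2R) (w t - cutL n (v t) : L2R) ≤
      C * (xn s κ (h 0 - cutL n (k 0) : L2R) (w 0 - cutL n (v 0) : L2R) + 2 * ε) := by
  -- The 2 bounds √κ ‖h‖_{s+1/2}; 1 + b bounds h and w, which are within 1 of truncations of size b;
  -- the last summand bounds h'.
  obtain ⟨C, hC⟩ := energy_gronwall hs T (2 + b + ((1 + b) + 2 * cP (s - 1) * ((1 + b) * (1 + b))))
  refine ⟨C, ?_⟩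
  intro κ T₁ n ε h w h' w' k v k' v' hκ hκ1 hT₁ S S' bk bv bx bE bF g1 g2 g3
  have sub : Ioo 0 T₁ ⊆ Icc 0 T₁ := Ioo_subset_Icc_self
  have sκ1 : ENNReal.ofReal √κ ≤ 1 := by
    rw [ENNReal.ofReal_le_one]; exact Real.sqrt_le_one.2 hκ1
  have hκk : ENNReal.ofReal κ = ENNReal.ofReal √κ * ENNReal.ofReal √κ := by
    rw [← ENNReal.ofReal_mul (Real.sqrt_nonneg _), Real.mul_self_sqrt hκ.le]
  have split : ∀ (σ : ℝ) (f g : L2R), sn σ f ≤ sn σ (f - g : L2R) + sn σ g := fun σ f g => by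
    have := sn_L2_add_le σ (f - g) g
    rwa [sub_add_cancel] at this
  have bh : ∀ t ∈ Icc 0 T₁, sn (s - 1 / 2) (h t) ≤ (1 + b : ℝ≥0) := fun t ht => by
    refine (split _ _ (cutL n (k t))).trans ?_
    push_cast
    exact add_le_add ((le_xn₁ _ _ _ _).trans (bx t ht)) ((sn_cutL_le _ _ _).trans (bk t ht))
  have bw : ∀ t ∈ Icc 0 T₁, sn s (w t) ≤ (1 + b : ℝ≥0) := fun t ht => by
    refine (split _ _ (cutL n (v t))).trans ?_
    push_cast
    exact add_le_add ((le_xn₃ s κ _ _).trans (bx t ht)) ((sn_cutL_le _ _ _).trans (bv t ht))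
  have cutk : ∀ t ∈ Icc 0 T₁, ENNReal.ofReal √κ * sn (s + 1 / 2) (cutL n (k t)) ≤ 1 :=
    fun t ht => by
      refine le_trans ?_ g2
      gcongr
      refine (sn_cutL_le_gain (by linarith) n (k t) (σ := s - 1 / 2)).trans ?_
      gcongr
      exact bk t ht
  have toB : ∀ {x : ℝ≥0∞} {c : ℝ≥0}, x ≤ c →
      c ≤ 2 + b + ((1 + b) + 2 * cP (s - 1) * ((1 + b) * (1 + b))) →
      x ≤ ((2 + b + ((1 + b) + 2 * cP (s - 1) * ((1 + b) * (1 + b))) : ℝ≥0) : ℝ≥0∞) :=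
    fun hx hc => hx.trans (ENNReal.coe_le_coe.2 hc)
  have c1 : 1 + b ≤ 2 + b + ((1 + b) + 2 * cP (s - 1) * ((1 + b) * (1 + b))) :=
    le_add_of_le_of_nonneg (by gcongr; norm_num) zero_le
  have c2 : b ≤ 2 + b + ((1 + b) + 2 * cP (s - 1) * ((1 + b) * (1 + b))) :=
    le_add_of_le_of_nonneg le_add_self zero_le
  have c3 : (2 : ℝ≥0) ≤ 2 + b + ((1 + b) + 2 * cP (s - 1) * ((1 + b) * (1 + b))) :=
    le_add_of_le_of_nonneg le_self_add zero_le
  -- With P the truncation, h ⋆ w − Pk ⋆ Pv = (h − Pk) ⋆ Pv + h ⋆ (w − Pv). The rough h becomes the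
  -- coefficient N, the only one that multiplies the loss term, and the smooth Pv becomes V. The
  -- sources are the truncation errors and the capillary term of Pk.
  have key := hC (ε := 2 * ε) (h := fun t => h t - cutL n (k t)) (w := fun t => w t - cutL n (v t))
    (η := h) (h' := fun t => h' t - cutL n (k' t)) (w' := fun t => w' t - cutL n (v' t)) (η' := h')
    (V := fun t => cutL n (v t)) (U := fun t => ((1 / 2 : ℂ) • (w t + cutL n (v t)) : L2R))
    (E := fun t ξ => Complex.I * th ξ * cutErr n (k t) (v t) ξ)
    (F := fun t ξ => Complex.I * th ξ * ((1 / 2 : ℂ) * cutErr n (v t) (v t) ξ) +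
      -(Complex.I * ((Real.tanh (2 * π * ξ) * (κ * (2 * π * ξ) ^ 2) : ℝ) : ℂ)) * cutL n (k t) ξ)
    hκ hκ1 hT₁ (S.cont_h.sub (S'.cont_h.cutL (by linarith) n))
    (S.cont_w.sub (S'.cont_w.cutL (by linarith) n)) (S.cont_h.continuousOn (by linarith))
    (fun t ht => toB (bh t ht) c1) ?_ ?_ ?_ ?_ ?_
  · push_cast at key; exact key
  · refine fun t ht => ⟨(S.deriv_h t ht).sub ?_, (S.deriv_w t ht).sub ?_, S.deriv_h t ht⟩
    · exact ((cutL n).restrictScalars ℝ).hasFDerivAt.comp_hasDerivAt t (S'.deriv_h t ht)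
    · exact ((cutL n).restrictScalars ℝ).hasFDerivAt.comp_hasDerivAt t (S'.deriv_w t ht)
  · intro t ht
    filter_upwards [S.eq_h t ht, S'.eq_h t ht, Lp.coeFn_sub (h' t) (cutL n (k' t)),
      coeFn_cutL n (k' t), coeFn_cutL n (v t), Lp.coeFn_sub (w t) (cutL n (v t))]
      with ξ e1 e2 e3 e4 e5 e6
    rw [e3, Pi.sub_apply, e1, e4, rhsH, e6, Pi.sub_apply, e5, conv_sub_left_L2, conv_sub_right_L2,
      cutErr]
    by_cases hm : ξ ∈ cut n
    · simp only [indicator_of_mem hm, e2]; ring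
    · simp only [indicator_of_notMem hm]; ring
  · intro t ht
    filter_upwards [S.eq_w t ht, S'.eq_w t ht, Lp.coeFn_sub (w' t) (cutL n (v' t)),
      coeFn_cutL n (v' t), coeFn_cutL n (k t), Lp.coeFn_sub (h t) (cutL n (k t))]
      with ξ e1 e2 e3 e4 e5 e6
    rw [e3, Pi.sub_apply, e1, e4, rhsW, e6, Pi.sub_apply, e5, conv_sub_right_L2, conv_smul_left_L2,
      conv_smul_left_L2, conv_add_left_L2, conv_add_left_L2,
      conv_comm (cutL n (v t) : ℝ → ℂ) (w t), cutErr]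
    by_cases hm : ξ ∈ cut n
    · simp only [indicator_of_mem hm, e2]
      simp only [th]
      push_cast; ring
    · simp only [indicator_of_notMem hm]; push_cast; ring
  · intro t ht
    have := S.herm_h t (sub ht)
    have e := coeFn_hermL2 (h t)
    rw [this] at e
    filter_upwards [e] with ξ hξ
    rw [hξ, Complex.conj_conj]
  · intro t ht
    have ht' := sub ht
    have fx : xn s κ (h t - cutL n (k t) : L2R) (w t - cutL n (v t) : L2R) ≠ ∞ :=
      ((bx t ht').trans_lt ENNReal.one_lt_top).ne
    have lez : ∀ {x : ℝ≥0∞}, x ≤ xn s κ (h t - cutL n (k t) : L2R) (w t - cutL n (v t) : L2R) →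
        x ≤ (((xn s κ (h t - cutL n (k t) : L2R) (w t - cutL n (v t) : L2R)).toNNReal + 2 * ε :
          ℝ≥0) : ℝ≥0∞) := fun hx => by
      rw [ENNReal.coe_add, ENNReal.coe_toNNReal fx]
      exact hx.trans le_self_add
    have lez' : ∀ {x : ℝ≥0∞}, x ≤ 2 * ε →
        x ≤ (((xn s κ (h t - cutL n (k t) : L2R) (w t - cutL n (v t) : L2R)).toNNReal + 2 * ε :
          ℝ≥0) : ℝ≥0∞) := fun hx => by
      rw [ENNReal.coe_add]
      refine hx.trans ?_
      push_cast
      exact le_add_self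
    have two_ε : (ε : ℝ≥0∞) ≤ 2 * ε := by rw [two_mul]; exact le_self_add
    have mt := continuous_tanh.measurable
    have mk := measurable_L2 (cutL n (k t))
    refine ⟨measurable_L2 _, measurable_L2 _, measurable_L2 _, measurable_L2 _, measurable_L2 _,
      measurable_L2 _, by fun_prop, by fun_prop, lez (le_xn₁ _ _ _ _), lez (le_xn₂ _ _ _ _),
      lez (le_xn₃ _ _ _ _), ?_, ?_, ?_, toB (bh t ht') c1, ?_, ?_, ?_, ?_, ?_⟩
    · exact lez' ((sn_I_th_mul_le _ _).trans ((bE t ht').trans two_ε))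
    · refine lez' (le_trans ?_ two_ε)
      calc ENNReal.ofReal √κ * sn (s + 1 / 2) (fun ξ => Complex.I * th ξ * cutErr n (k t) (v t) ξ)
          ≤ ENNReal.ofReal √κ * (cutGain n * sn (s - 1 / 2) (cutErr n (k t) (v t))) := by
            gcongr
            exact (sn_I_th_mul_le _ _).trans (sn_cutErr_le_gain (by linarith) _ _ _)
        _ ≤ ENNReal.ofReal √κ * (cutGain n * ε) := by
            gcongr; exact bE t ht'
        _ = ENNReal.ofReal √κ * cutGain n * ε := by ring
        _ ≤ 1 * ε := by gcongr
        _ = ε := one_mul _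
    · have f1 : sn s (fun ξ => Complex.I * th ξ * ((1 / 2 : ℂ) * cutErr n (v t) (v t) ξ)) ≤ ε := by
        refine (sn_I_th_mul_le s fun ξ => (1 / 2 : ℂ) * cutErr n (v t) (v t) ξ).trans ?_
        have := sn_mul_le (σ := s) (τ := 0) (C := 1) (F := cutErr n (v t) (v t))
          (m := fun _ => (1 / 2 : ℂ)) fun ξ => by rw [jw_zero]; norm_num
        rw [ENNReal.ofReal_one, one_mul, add_zero] at this
        exact this.trans (bF t ht')
      -- Raising Pk from H^{s-1/2} to H^{s+2} costs `cutGain n`. One of the two factors √κ pays for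
      -- it and the other is at most 1.
      have f2 : sn s (fun ξ => -(Complex.I * ((Real.tanh (2 * π * ξ) * (κ * (2 * π * ξ) ^ 2) : ℝ) :
          ℂ)) * cutL n (k t) ξ) ≤ ε := by
        refine (sn_capillary_le hκ.le _).trans ?_
        calc ENNReal.ofReal κ * sn (s + 2) (cutL n (k t))
            ≤ ENNReal.ofReal κ * (cutGain n * b) := by
              gcongr
              refine (sn_cutL_le_gain (by linarith) n (k t) (σ := s - 1 / 2)).trans ?_
              gcongr
              exact bk t ht'
          _ = ENNReal.ofReal √κ * (ENNReal.ofReal √κ * (cutGain n * b)) := by rw [hκk]; ring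
          _ ≤ 1 * ε := by gcongr
          _ = ε := one_mul _
      refine lez' (le_trans (sn_add_le ?_ ?_) ((add_le_add f1 f2).trans_eq (two_mul _).symm)) <;>
        fun_prop
    · refine toB (c := 2) ?_ c3
      calc ENNReal.ofReal √κ * sn (s + 1 / 2) (h t)
          ≤ ENNReal.ofReal √κ * (sn (s + 1 / 2) (h t - cutL n (k t) : L2R)
              + sn (s + 1 / 2) (cutL n (k t))) := by gcongr; exact split _ _ _
        _ = ENNReal.ofReal √κ * sn (s + 1 / 2) (h t - cutL n (k t) : L2R)
              + ENNReal.ofReal √κ * sn (s + 1 / 2) (cutL n (k t)) := mul_add _ _ _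
        _ ≤ 1 + 1 := add_le_add ((le_xn₂ _ _ _ _).trans (bx t ht')) (cutk t ht')
        _ = _ := by norm_num
    · refine toB (S.sn_deriv_le hs ht (b := 1 + b) ((sn_mono (by linarith) _).trans (bh t ht'))
        (bw t ht')) ?_
      exact le_add_self
    · exact toB ((sn_cutL_le _ _ _).trans (bv t ht')) c2
    · refine toB (c := b) ?_ c2
      calc ENNReal.ofReal √κ * sn (s + 1 / 2) (cutL n (v t))
          ≤ ENNReal.ofReal √κ * (cutGain n * b) := by
            gcongr
            refine (sn_cutL_le_gain (by linarith) n (v t) (σ := s)).trans ?_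
            gcongr
            exact bv t ht'
        _ = ENNReal.ofReal √κ * cutGain n * b := by ring
        _ ≤ 1 * b := by gcongr
        _ = b := one_mul _
    · refine toB (sn_half_smul_add_le (bw t ht') ?_) c1
      exact ((sn_cutL_le _ _ _).trans (bv t ht')).trans (by push_cast; exact le_add_self)

theorem sn_cutErr_le_of_le {σ : ℝ} (hσ : 1 ≤ σ) {n : ℕ} {f g : L2R} {b δ : ℝ≥0} (hf : sn σ f ≤ b)
    (hg : sn σ g ≤ b) (tf : sn σ (f - cutL n f : L2R) ≤ δ) (tg : sn σ (g - cutL n g : L2R) ≤ δ)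
    (tc : sn σ ((cut n)ᶜ.indicator (conv f g)) ≤ δ) :
    sn σ (cutErr n f g) ≤ ((1 + 4 * cP σ * b) * δ : ℝ≥0) := by
  refine (sn_cutErr_le hσ n f g).trans ?_
  calc _ ≤ (δ : ℝ≥0∞) + 2 * cP σ * (δ * b + b * δ) := by gcongr
    _ = _ := by push_cast; ring

/-- The order of choices is θ, δ, n, κ₀. First n makes all tails of the limit solution and of its
products smaller than δ on the whole interval; then κ is small enough to beat the powers of n. The
extra half derivative of the initial elevation is used only together with √κ. -/
theorem FourierSolution.convergence {s T : ℝ} (hs : 2 ≤ s) (hT : 0 ≤ T) {k v k' v' : ℝ → L2R}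
    (S' : FourierSolution 0 (s - 1 / 2) s T k v k' v') (h0 : sn (s + 1 / 2) (k 0) < ∞) {θ : ℝ≥0}
    (hθ : 0 < θ) (hθ1 : θ ≤ 1) : ∃ κ₀ > (0 : ℝ), ∀ κ ∈ Ioo 0 κ₀, κ ≤ 1 →
      ∀ h w h' w' : ℝ → L2R, FourierSolution κ (s + 1 / 2) s T h w h' w' → h 0 = k 0 → w 0 = v 0 →
      ∀ t ∈ Icc 0 T, sn (s - 1 / 2) (h t - k t : L2R) + sn s (w t - v t : L2R) ≤ θ ∧
        ENNReal.ofReal √κ * sn (s + 1 / 2) (h t) ≤ 2 := by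
  obtain ⟨b₁, hb₁⟩ := S'.cont_h.exists_le
  obtain ⟨b₂, hb₂⟩ := S'.cont_w.exists_le
  set b : ℝ≥0 := b₁ + b₂ with hb
  have bk : ∀ t ∈ Icc 0 T, sn (s - 1 / 2) (k t) ≤ b := fun t ht =>
    (hb₁ t ht).trans (by rw [hb]; push_cast; exact le_self_add)
  have bv : ∀ t ∈ Icc 0 T, sn s (v t) ≤ b := fun t ht =>
    (hb₂ t ht).trans (by rw [hb]; push_cast; exact le_add_self)
  obtain ⟨C, hC⟩ := FourierSolution.cutoff_stability hs T b
  set q : ℝ≥0 := 1 + 4 * cP (s - 1 / 2) * b + 4 * cP s * b with hq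
  -- Chosen so that 4δ and C(3δ + 2qδ) are both at most θ/2. Here 3δ bounds the initial difference,
  -- qδ the truncation errors, and 2δ the two tails at the end.
  set δ : ℝ≥0 := θ / (8 + 2 * C * (3 + 2 * q)) with hδ
  have δ0 : 0 < δ := by positivity
  have δeq : (8 + 2 * C * (3 + 2 * q)) * δ = θ := mul_div_cancel₀ _ (by positivity)
  have δE : (0 : ℝ≥0∞) < δ := by exact_mod_cast δ0
  obtain ⟨n₁, t1⟩ := S'.cont_h.exists_uniform_tail δE
  obtain ⟨n₂, t2⟩ := S'.cont_w.exists_uniform_tail δE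
  obtain ⟨n₃, t3⟩ := S'.cont_h.exists_uniform_tail_conv (by linarith)
    (S'.cont_w.mono_exp (by linarith)) δE
  obtain ⟨n₄, t4⟩ := S'.cont_w.exists_uniform_tail_conv (by linarith) S'.cont_w δE
  set n := n₁ + n₂ + n₃ + n₄ with hn
  replace t1 := t1 n (by omega)
  replace t2 := t2 n (by omega)
  replace t3 := t3 n (by omega)
  replace t4 := t4 n (by omega)
  have bE : ∀ t ∈ Icc 0 T, sn (s - 1 / 2) (cutErr n (k t) (v t)) ≤ (q * δ : ℝ≥0) := fun t ht => by
    refine (sn_cutErr_le_of_le (by linarith) (bk t ht) ((sn_mono (by linarith) _).trans (bv t ht))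
      (t1 t ht) ((sn_mono (by linarith) _).trans (t2 t ht)) (t3 t ht)).trans ?_
    rw [ENNReal.coe_le_coe]
    gcongr
    rw [hq]; exact le_self_add
  have bF : ∀ t ∈ Icc 0 T, sn s (cutErr n (v t) (v t)) ≤ (q * δ : ℝ≥0) := fun t ht => by
    refine (sn_cutErr_le_of_le (by linarith) (bv t ht) (bv t ht) (t2 t ht) (t2 t ht)
      (t4 t ht)).trans ?_
    rw [ENNReal.coe_le_coe]
    gcongr
    rw [hq]; gcongr; exact le_self_add
  set m : ℝ≥0 := (sn (s + 1 / 2) (k 0)).toNNReal with hm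
  have hm' : sn (s + 1 / 2) (k 0) = m := (ENNReal.coe_toNNReal h0.ne).symm
  -- K dominates each quantity that √κ has to absorb, so √κ ≤ μ makes every such product at most min
  -- 1 δ. The summand m serves the √κ part of the initial difference.
  set K : ℝ≥0 := cutGain n + cutGain n * b + m + 1 with hK
  have K0 : 0 < K := by positivity
  set μ : ℝ≥0 := min 1 δ / K with hμ
  have μ0 : 0 < μ := by positivity
  refine ⟨(μ : ℝ) ^ 2, by positivity, ?_⟩
  intro κ hκ hκ1 h w h' w' S i0 j0
  have sκ : ENNReal.ofReal √κ ≤ μ := by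
    rw [ENNReal.ofReal_le_iff_le_toReal ENNReal.coe_ne_top, ENNReal.coe_toReal]
    exact Real.sqrt_le_iff.2 ⟨μ.2, hκ.2.le⟩
  have small : ∀ x : ℝ≥0, x ≤ K → ENNReal.ofReal √κ * x ≤ (min 1 δ : ℝ≥0) := fun x hx => by
    refine (mul_le_mul' sκ (ENNReal.coe_le_coe.2 hx)).trans_eq ?_
    rw [← ENNReal.coe_mul, hμ, div_mul_cancel₀ _ K0.ne']
  have l1 : (((min 1 δ : ℝ≥0)) : ℝ≥0∞) ≤ 1 := by exact_mod_cast min_le_left _ _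
  have l2 : (((min 1 δ : ℝ≥0)) : ℝ≥0∞) ≤ δ := by exact_mod_cast min_le_right _ _
  have s1 := small (cutGain n) (by
    rw [hK, add_assoc, add_assoc]; exact le_self_add)
  have s2 := small (cutGain n * b) (by
    rw [hK, add_assoc]; exact le_add_self.trans le_self_add)
  have s3 := small m (by rw [hK]; exact le_add_self.trans le_self_add)
  rw [ENNReal.coe_mul] at s2
  have q1 : (δ : ℝ≥0∞) ≤ (q * δ : ℝ≥0) := by
    rw [ENNReal.coe_le_coe]
    refine le_mul_of_one_le_left zero_le ?_
    rw [hq, add_assoc]; exact le_self_add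
  have zT : (0 : ℝ) ∈ Icc 0 T := ⟨le_rfl, hT⟩
  have hdC := S.cont_h.sub (S'.cont_h.cutL (τ := s + 1 / 2) (by linarith) n)
  have wdC := S.cont_w.sub (S'.cont_w.cutL (τ := s) (by linarith) n)
  have fin : ∀ t ∈ Icc 0 T,
      xn s κ (h t - cutL n (k t) : L2R) (w t - cutL n (v t) : L2R) < ∞ := fun t ht =>
    xn_lt_top (hdC.lt_top ht) (wdC.lt_top ht)
  have start : xn s κ (h 0 - cutL n (k 0) : L2R) (w 0 - cutL n (v 0) : L2R) ≤
      ((3 * δ : ℝ≥0) : ℝ≥0∞) := by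
    rw [i0, j0]
    calc xn s κ (k 0 - cutL n (k 0) : L2R) (v 0 - cutL n (v 0) : L2R) ≤ (δ : ℝ≥0∞) + δ + δ := by
          unfold xn
          gcongr
          · exact t1 0 zT
          · refine le_trans ?_ (s3.trans l2)
            gcongr
            rw [← hm']
            exact sn_sub_cutL_le _ _ _
          · exact t2 0 zT
      _ = _ := by push_cast; ring
  have θ2 : C * (3 + 2 * q) * δ ≤ θ / 2 := by
    rw [← δeq, le_div_iff₀ (by norm_num)]
    have : C * (3 + 2 * q) * δ * 2 = (2 * C * (3 + 2 * q)) * δ := by ring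
    rw [this]; gcongr; exact le_add_self
  have θ3 : 4 * δ ≤ θ / 2 := by
    rw [← δeq, le_div_iff₀ (by norm_num)]
    have : 4 * δ * 2 = 8 * δ := by ring
    rw [this]; gcongr; exact le_self_add
  -- As long as the difference is at most 1 the stability estimate applies and returns θ/2 < 1.
  have boot : ∀ t ∈ Icc 0 T,
      (xn s κ (h t - cutL n (k t) : L2R) (w t - cutL n (v t) : L2R)).toReal ≤ (θ / 2 : ℝ≥0) := by
    refine bootstrap ?_ (continuousOn_xn hdC wdC) ?_ ?_
    · rw [NNReal.coe_div]
      have : (θ : ℝ) ≤ 1 := hθ1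
      norm_num
      linarith
    · refine ENNReal.toReal_le_of_le_ofReal (NNReal.coe_nonneg _) ?_
      rw [ENNReal.ofReal_coe_nnreal]
      refine start.trans (ENNReal.coe_le_coe.2 (le_trans ?_ θ3))
      gcongr; norm_num
    · intro T₁ hT₁ hle t ht
      have sub : Icc 0 T₁ ⊆ Icc 0 T := Icc_subset_Icc_right hT₁.2
      have := hC (ε := q * δ) hκ.1 hκ1 hT₁.2 (S.mono hT₁.2) (S'.mono hT₁.2)
        (fun t ht => bk t (sub ht)) (fun t ht => bv t (sub ht)) (fun t ht => by
          rw [← ENNReal.ofReal_toReal (fin t (sub ht)).ne, ENNReal.ofReal_le_one]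
          exact hle t ht) (fun t ht => bE t (sub ht)) (fun t ht => bF t (sub ht)) (s1.trans l1)
        (s2.trans l1) ((s2.trans l2).trans q1) t ht
      refine ENNReal.toReal_le_of_le_ofReal (NNReal.coe_nonneg _) ?_
      rw [ENNReal.ofReal_coe_nnreal]
      refine this.trans (le_trans (b := ((C * (3 + 2 * q) * δ : ℝ≥0) : ℝ≥0∞)) ?_
        (ENNReal.coe_le_coe.2 θ2))
      calc _ ≤ (C : ℝ≥0∞) * (((3 * δ : ℝ≥0) : ℝ≥0∞) + 2 * ((q * δ : ℝ≥0) : ℝ≥0∞)) := by gcongr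
        _ = _ := by push_cast; ring
  intro t ht
  have xle : xn s κ (h t - cutL n (k t) : L2R) (w t - cutL n (v t) : L2R) ≤
      ((θ / 2 : ℝ≥0) : ℝ≥0∞) := by
    rw [← ENNReal.ofReal_toReal (fin t ht).ne, ← ENNReal.ofReal_coe_nnreal]
    exact ENNReal.ofReal_le_ofReal (boot t ht)
  constructor
  · have tri : ∀ (σ : ℝ) (f g : L2R), sn σ (f - g : L2R) ≤
        sn σ (f - cutL n g : L2R) + sn σ (g - cutL n g : L2R) := fun σ f g => by
      have := sn_L2_sub_le σ (f - cutL n g) (g - cutL n g)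
      rwa [sub_sub_sub_cancel_right] at this
    calc sn (s - 1 / 2) (h t - k t : L2R) + sn s (w t - v t : L2R)
        ≤ (sn (s - 1 / 2) (h t - cutL n (k t) : L2R) + δ) +
          (sn s (w t - cutL n (v t) : L2R) + δ) := by
          gcongr
          · exact (tri _ _ _).trans (add_le_add le_rfl (t1 t ht))
          · exact (tri _ _ _).trans (add_le_add le_rfl (t2 t ht))
      _ = (sn (s - 1 / 2) (h t - cutL n (k t) : L2R) + sn s (w t - cutL n (v t) : L2R))
          + 2 * δ := by ring
      _ ≤ ((θ / 2 : ℝ≥0) : ℝ≥0∞) + ((θ / 2 : ℝ≥0) : ℝ≥0∞) := by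
          refine add_le_add (le_trans ?_ xle) ?_
          · unfold xn; gcongr; exact le_self_add
          · rw [← ENNReal.coe_ofNat, ← ENNReal.coe_mul, ENNReal.coe_le_coe]
            refine le_trans ?_ θ3
            gcongr; norm_num
      _ = θ := by rw [← ENNReal.coe_add, add_halves]
  · have split := sn_L2_add_le (s + 1 / 2) (h t - cutL n (k t)) (cutL n (k t))
    rw [sub_add_cancel] at split
    calc ENNReal.ofReal √κ * sn (s + 1 / 2) (h t)
        ≤ ENNReal.ofReal √κ * (sn (s + 1 / 2) (h t - cutL n (k t) : L2R)
            + sn (s + 1 / 2) (cutL n (k t))) := by gcongr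
      _ = ENNReal.ofReal √κ * sn (s + 1 / 2) (h t - cutL n (k t) : L2R)
            + ENNReal.ofReal √κ * sn (s + 1 / 2) (cutL n (k t)) := mul_add _ _ _
      _ ≤ 1 + 1 := by
          refine add_le_add (((le_xn₂ _ _ _ _).trans xle).trans ?_) (le_trans ?_ (s2.trans l1))
          · rw [ENNReal.coe_le_one_iff]
            exact (half_le_self zero_le).trans hθ1
          · gcongr
            refine (sn_cutL_le_gain (by linarith) n (k t) (σ := s - 1 / 2)).trans ?_
            gcongr
            exact bk t ht
      _ = _ := by norm_num

/-! ### Semilinear equations with a quadratic nonlinearity -/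

section Semilinear

variable {E : Type*} [NormedAddCommGroup E] [NormedSpace ℝ E]

/-- A strongly continuous family need not be continuous in operator norm; the uniform bound on the
family compensates. -/
theorem continuousOn_strong_apply {U : ℝ → E →L[ℝ] E} (hU : ∀ t z, ‖U t z‖ ≤ ‖z‖)
    (cU : ∀ z, Continuous fun t => U t z) {I : Set ℝ} {z : ℝ → E} (hz : ContinuousOn z I) :
    ContinuousOn (fun t => U t (z t)) I := by
  intro t ht
  rw [ContinuousWithinAt, tendsto_iff_norm_sub_tendsto_zero]
  have h1 : Tendsto (fun τ => ‖z τ - z t‖) (𝓝[I] t) (𝓝 0) :=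
    tendsto_iff_norm_sub_tendsto_zero.1 (hz t ht)
  have h2 : Tendsto (fun τ => ‖U τ (z t) - U t (z t)‖) (𝓝[I] t) (𝓝 0) :=
    tendsto_iff_norm_sub_tendsto_zero.1 ((cU (z t)).continuousWithinAt)
  have h3 := h1.add h2
  rw [add_zero] at h3
  refine squeeze_zero (fun _ => norm_nonneg _) (fun τ => ?_) h3
  calc ‖U τ (z τ) - U t (z t)‖ = ‖U τ (z τ - z t) + (U τ (z t) - U t (z t))‖ := by
        rw [map_sub]; congr 1; abel
    _ ≤ _ := (norm_add_le _ _).trans (add_le_add (hU _ _) le_rfl)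

/-- The vector field of a semilinear equation in the interaction picture. -/
noncomputable def interactionField (U : ℝ → E →L[ℝ] E) (N : E →L[ℝ] E →L[ℝ] E) (t : ℝ) (z : E) : E :=
  U (-t) (N (U t z) (U t z))

theorem norm_interactionField_sub_le {U : ℝ → E →L[ℝ] E} (hU : ∀ t z, ‖U t z‖ ≤ ‖z‖)
    (N : E →L[ℝ] E →L[ℝ] E) {R : ℝ} {z z' : E} (hz : ‖z‖ ≤ R) (hz' : ‖z'‖ ≤ R) (t : ℝ) :
    ‖interactionField U N t z - interactionField U N t z'‖ ≤ 2 * ‖N‖ * R * ‖z - z'‖ := by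
  unfold interactionField
  have R0 : 0 ≤ R := (norm_nonneg _).trans hz
  rw [← map_sub]
  refine (hU _ _).trans ?_
  have e : N (U t z) (U t z) - N (U t z') (U t z') =
      N (U t (z - z')) (U t z) + N (U t z') (U t (z - z')) := by
    simp only [map_sub, sub_apply]; abel
  rw [e]
  calc _ ≤ ‖N‖ * ‖U t (z - z')‖ * ‖U t z‖ + ‖N‖ * ‖U t z'‖ * ‖U t (z - z')‖ :=
        (norm_add_le _ _).trans (add_le_add (N.le_opNorm₂ _ _) (N.le_opNorm₂ _ _))
    _ ≤ ‖N‖ * ‖z - z'‖ * R + ‖N‖ * R * ‖z - z'‖ := by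
        have h1 := hU t (z - z')
        have h2 := (hU t z).trans hz
        have h3 := (hU t z').trans hz'
        gcongr
    _ = _ := by ring

/-- Removing the free evolution removes the unbounded generator: the remaining field is locally
Lipschitz uniformly in time, because U does not increase norms, and continuous in time by strong
continuity. -/
theorem exists_interaction_solution [CompleteSpace E] {U : ℝ → E →L[ℝ] E}
    (hU : ∀ t z, ‖U t z‖ ≤ ‖z‖) (cU : ∀ z, Continuous fun t => U t z)
    (N : E →L[ℝ] E →L[ℝ] E) (z₀ : E) {T : ℝ} (hT : 0 < T) : ∃ T₀ ∈ Ioc 0 T, ∃ ζ : ℝ → E,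
      ζ 0 = z₀ ∧ ∀ t ∈ Icc 0 T₀,
        HasDerivWithinAt ζ (interactionField U N t (ζ t)) (Icc 0 T₀) t := by
  -- R bounds the norm on the unit ball around the datum and L bounds the field there, so up to time
  -- 1/(L + 1) the solution cannot leave the ball.
  set R : ℝ≥0 := ‖z₀‖₊ + 1 with hR
  set L : ℝ≥0 := ‖N‖₊ * R ^ 2 with hL
  set T₀ : ℝ := min T (1 / (L + 1)) with hT₀
  have T₀pos : 0 < T₀ := lt_min hT (by positivity)
  have inR : ∀ z ∈ Metric.closedBall z₀ (1 : ℝ≥0), ‖z‖ ≤ R := fun z hz => by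
    rw [mem_closedBall_iff_norm] at hz
    have := norm_le_norm_add_norm_sub' z z₀
    rw [hR]; push_cast at hz ⊢; linarith
  have pl : IsPicardLindelof (interactionField U N) (tmin := 0) (tmax := T₀)
      ⟨0, le_rfl, T₀pos.le⟩ z₀ 1 0 L (2 * ‖N‖₊ * R) := by
    refine ⟨fun t _ => ?_, fun z _ => ?_, fun t _ z hz => ?_, ?_⟩
    · refine LipschitzOnWith.of_dist_le_mul fun z hz z' hz' => ?_
      rw [dist_eq_norm, dist_eq_norm]
      exact norm_interactionField_sub_le hU N (inR z hz) (inR z' hz') t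
    · have c1 : Continuous fun t => N (U t z) (U t z) :=
        (N.continuous.comp (cU z)).clm_apply (cU z)
      have := (continuousOn_strong_apply (U := fun t => U (-t)) (fun t => hU (-t))
        (fun z => (cU z).comp continuous_neg) c1.continuousOn (I := univ))
      exact this.mono (subset_univ _)
    · refine (hU _ _).trans ((N.le_opNorm₂ _ _).trans ?_)
      have h1 := (hU t z).trans (inR z hz)
      rw [hL]; push_cast
      calc ‖N‖ * ‖U t z‖ * ‖U t z‖ ≤ ‖N‖ * R * R := by gcongr
        _ = _ := by ring
    · simp only [sub_zero, NNReal.coe_one, NNReal.coe_zero, sub_self, max_eq_left T₀pos.le]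
      calc (L : ℝ) * T₀ ≤ L * (1 / (L + 1)) := by gcongr; exact min_le_right _ _
        _ ≤ 1 := by rw [mul_one_div, div_le_one (by positivity)]; linarith
  obtain ⟨ζ, h0, h⟩ := pl.exists_eq_forall_mem_Icc_hasDerivWithinAt₀
  exact ⟨T₀, ⟨T₀pos, min_le_left _ _⟩, ζ, h0, h⟩

/-- Symmetries of the equation and of the initial value are symmetries of the solution. -/
theorem interaction_solution_symm {U : ℝ → E →L[ℝ] E}
    (hU : ∀ t z, ‖U t z‖ ≤ ‖z‖) {N : E →L[ℝ] E →L[ℝ] E} {J : E →L[ℝ] E}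
    (hJU : ∀ t z, J (U t z) = U t (J z)) (hJN : ∀ z z', J (N z z') = N (J z) (J z'))
    {T₀ : ℝ} {ζ : ℝ → E} (h0 : J (ζ 0) = ζ 0) (h : ∀ t ∈ Icc 0 T₀,
        HasDerivWithinAt ζ (interactionField U N t (ζ t)) (Icc 0 T₀) t) :
    ∀ t ∈ Icc 0 T₀, J (ζ t) = ζ t := by
  have cζ : ContinuousOn ζ (Icc 0 T₀) := fun t ht => (h t ht).continuousWithinAt
  have hJF : ∀ t z, J (interactionField U N t z) = interactionField U N t (J z) := fun t z => by
    unfold interactionField; rw [hJU, hJN, hJU]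
  obtain ⟨R₁, hR₁⟩ := isCompact_Icc.exists_bound_of_continuousOn cζ
  obtain ⟨R₂, hR₂⟩ := isCompact_Icc.exists_bound_of_continuousOn (J.continuous.comp_continuousOn cζ)
  -- The image under J solves the same equation with the same datum, so Gronwall's inequality
  -- applies to the difference.
  have key := eq_zero_of_abs_deriv_le_mul_abs_self_of_eq_zero_right (f := fun t => J (ζ t) - ζ t)
    (f' := fun t => J (interactionField U N t (ζ t)) - interactionField U N t (ζ t))
    (K := 2 * ‖N‖ * max R₂ R₁) ((J.continuous.comp_continuousOn cζ).sub cζ)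
    (fun t ht => by
      have d := (h t ⟨ht.1, ht.2.le⟩).mono_of_mem_nhdsWithin
        (Icc_mem_nhdsGE_of_mem ht)
      exact (J.hasFDerivAt.comp_hasDerivWithinAt t d).sub d)
    (by rw [h0, sub_self])
    (fun t ht => by
      have ht' : t ∈ Icc 0 T₀ := ⟨ht.1, ht.2.le⟩
      rw [hJF]
      exact norm_interactionField_sub_le hU N ((hR₂ t ht').trans (le_max_left _ _))
        ((hR₁ t ht').trans (le_max_right _ _)) t)
  exact fun t ht => sub_eq_zero.1 (key t ht)

end Semilinear

/-! ### Oscillating multipliers -/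

/-- The symbol `μ e^{itφ}`. -/
noncomputable def oscS (μ : ℝ → ℂ) (φ : ℝ → ℝ) (t ξ : ℝ) : ℂ :=
  μ ξ * Complex.exp (Complex.I * ((t * φ ξ : ℝ) : ℂ))

theorem norm_oscS (μ : ℝ → ℂ) (φ : ℝ → ℝ) (t ξ : ℝ) : ‖oscS μ φ t ξ‖ = ‖μ ξ‖ := by
  rw [oscS, norm_mul, Complex.norm_exp_I_mul_ofReal, mul_one]

theorem BddSymbol.oscS {μ : ℝ → ℂ} (hμ : BddSymbol μ) {φ : ℝ → ℝ} (hφ : Measurable φ) (t : ℝ) :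
    BddSymbol (oscS μ φ t) := by
  obtain ⟨m, C, hC⟩ := hμ
  exact ⟨by unfold _root_.oscS; fun_prop, C, fun ξ => by rw [norm_oscS]; exact hC ξ⟩

theorem norm_exp_I_sub_one_sub_le (θ : ℝ) :
    ‖Complex.exp (Complex.I * (θ : ℂ)) - 1 - Complex.I * (θ : ℂ)‖ ≤ 3 * θ ^ 2 := by
  have e : ‖Complex.I * (θ : ℂ)‖ = |θ| := by simp
  rcases le_or_gt |θ| 1 with h | h
  · have := Complex.norm_exp_sub_one_sub_id_le (x := Complex.I * (θ : ℂ)) (by rwa [e])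
    rw [e, sq_abs] at this
    nlinarith [sq_nonneg θ]
  · calc _ ≤ ‖Complex.exp (Complex.I * (θ : ℂ))‖ + ‖(1 : ℂ)‖ + ‖Complex.I * (θ : ℂ)‖ :=
          (norm_sub_le _ _).trans (add_le_add (norm_sub_le _ _) le_rfl)
      _ = 2 + |θ| := by rw [Complex.norm_exp_I_mul_ofReal, e, norm_one]; ring
      _ ≤ _ := by rw [← sq_abs]; nlinarith

theorem hasDerivAt_of_norm_sub_le_sq {F : Type*} [NormedAddCommGroup F] [NormedSpace ℝ F]
    {f : ℝ → F} {f' : F} {t C : ℝ} (h : ∀ τ, ‖f τ - f t - (τ - t) • f'‖ ≤ C * ‖τ - t‖ ^ 2) :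
    HasDerivAt f f' t := by
  rw [hasDerivAt_iff_isLittleO]
  refine (Asymptotics.IsBigO.of_bound C (g := fun τ => ‖τ - t‖ ^ 2)
    (Eventually.of_forall fun τ => ?_)).trans_isLittleO
    (Asymptotics.isLittleO_pow_sub_sub t one_lt_two)
  simpa using h τ

/-- The operator with symbol `μ e^{itφ}`, as a real operator. -/
noncomputable def oscL {μ : ℝ → ℂ} (hμ : BddSymbol μ) {φ : ℝ → ℝ} (hφ : Measurable φ) (t : ℝ) :
    L2R →L[ℝ] L2R := (mulCLM _ (hμ.oscS hφ t)).restrictScalars ℝ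

theorem coeFn_oscL {μ : ℝ → ℂ} (hμ : BddSymbol μ) {φ : ℝ → ℝ} (hφ : Measurable φ) (t : ℝ)
    (f : L2R) : oscL hμ hφ t f =ᵐ[volume]
      fun ξ => μ ξ * Complex.exp (Complex.I * ((t * φ ξ : ℝ) : ℂ)) * f ξ :=
  coeFn_mulCLM (hμ.oscS hφ t) f

/-- The Taylor remainder of the exponential is quadratic in φ, and the bound on μφ² makes it uniform
in frequency. The derivative exists therefore in operator norm, although φ may be unbounded. -/
theorem hasDerivAt_oscL {μ : ℝ → ℂ} (hμ : BddSymbol μ) {φ : ℝ → ℝ} (hφ : Measurable φ)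
    (hμ' : BddSymbol fun ξ => Complex.I * (φ ξ : ℂ) * μ ξ) {C : ℝ}
    (hC : ∀ ξ, ‖μ ξ‖ * φ ξ ^ 2 ≤ C) (t : ℝ) : HasDerivAt (oscL hμ hφ) (oscL hμ' hφ t) t := by
  have C0 : 0 ≤ C := le_trans (by positivity) (hC 0)
  refine hasDerivAt_of_norm_sub_le_sq (C := 3 * C) fun τ => ?_
  refine ContinuousLinearMap.opNorm_le_bound _ (by positivity) fun f => ?_
  refine Lp.norm_le_mul_norm_of_ae_le_mul ?_
  simp only [sub_apply, smul_apply]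
  filter_upwards [Lp.coeFn_sub (oscL hμ hφ τ f - oscL hμ hφ t f) ((τ - t) • oscL hμ' hφ t f),
    Lp.coeFn_sub (oscL hμ hφ τ f) (oscL hμ hφ t f), Lp.coeFn_smul (τ - t) (oscL hμ' hφ t f),
    coeFn_oscL hμ hφ τ f, coeFn_oscL hμ hφ t f, coeFn_oscL hμ' hφ t f] with ξ h1 h2 h3 h4 h5 h6
  rw [h1, Pi.sub_apply, h2, Pi.sub_apply, h3, Pi.smul_apply, h4, h5, h6, Complex.real_smul]
  have e : Complex.exp (Complex.I * ((τ * φ ξ : ℝ) : ℂ)) =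
      Complex.exp (Complex.I * ((t * φ ξ : ℝ) : ℂ)) *
        Complex.exp (Complex.I * (((τ - t) * φ ξ : ℝ) : ℂ)) := by
    rw [← Complex.exp_add]; congr 1; push_cast; ring
  have k := norm_exp_I_sub_one_sub_le ((τ - t) * φ ξ)
  rw [e, show μ ξ * (Complex.exp (Complex.I * ((t * φ ξ : ℝ) : ℂ)) *
        Complex.exp (Complex.I * (((τ - t) * φ ξ : ℝ) : ℂ))) * f ξ -
      μ ξ * Complex.exp (Complex.I * ((t * φ ξ : ℝ) : ℂ)) * f ξ -
      ((τ - t : ℝ) : ℂ) * (Complex.I * (φ ξ : ℂ) * μ ξ *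
        Complex.exp (Complex.I * ((t * φ ξ : ℝ) : ℂ)) * f ξ) =
      μ ξ * Complex.exp (Complex.I * ((t * φ ξ : ℝ) : ℂ)) *
        (Complex.exp (Complex.I * (((τ - t) * φ ξ : ℝ) : ℂ)) - 1 -
          Complex.I * (((τ - t) * φ ξ : ℝ) : ℂ)) * f ξ by push_cast; ring,
    norm_mul, norm_mul, norm_mul, Complex.norm_exp_I_mul_ofReal, mul_one]
  refine mul_le_mul_of_nonneg_right ?_ (norm_nonneg _)
  calc _ ≤ ‖μ ξ‖ * (3 * ((τ - t) * φ ξ) ^ 2) := by gcongr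
    _ = 3 * (‖μ ξ‖ * φ ξ ^ 2) * (τ - t) ^ 2 := by ring
    _ ≤ 3 * C * (τ - t) ^ 2 := by gcongr; exact hC ξ
    _ = _ := by rw [Real.norm_eq_abs, sq_abs]

theorem norm_oscL_le {μ : ℝ → ℂ} (hμ : BddSymbol μ) (h1 : ∀ ξ, ‖μ ξ‖ ≤ 1) {φ : ℝ → ℝ}
    (hφ : Measurable φ) (t : ℝ) (f : L2R) : ‖oscL hμ hφ t f‖ ≤ ‖f‖ := by
  have := norm_mulCLM_apply_le (hμ.oscS hφ t) (fun ξ => (norm_oscS μ φ t ξ).trans_le (h1 ξ)) f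
  rwa [one_mul] at this

/-- For unbounded φ only strong continuity can be expected; it follows by dominated convergence in
frequency. -/
theorem continuous_oscL {μ : ℝ → ℂ} (hμ : BddSymbol μ) (h1 : ∀ ξ, ‖μ ξ‖ ≤ 1) {φ : ℝ → ℝ}
    (hφ : Measurable φ) (f : L2R) : Continuous fun t => oscL hμ hφ t f := by
  rw [continuous_iff_continuousAt]
  intro t
  rw [ContinuousAt, tendsto_iff_edist_tendsto_0]
  have mμ := hμ.meas
  have mf := measurable_L2 f
  have mo : ∀ τ, Measurable (oscS μ φ τ) := fun τ => (hμ.oscS hφ τ).meas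
  have e : ∀ τ, edist (oscL hμ hφ τ f) (oscL hμ hφ t f) =
      (∫⁻ ξ, ‖(oscS μ φ τ ξ - oscS μ φ t ξ) * f ξ‖ₑ ^ (2 : ℝ)) ^ (1 / 2 : ℝ) := fun τ => by
    rw [edist_eq_enorm_sub, Lp.enorm_def, ← eLpNorm_two_eq_lintegral (fun ξ =>
      ‖(oscS μ φ τ ξ - oscS μ φ t ξ) * f ξ‖ₑ), eLpNorm_enorm]
    refine eLpNorm_congr_ae ?_
    filter_upwards [Lp.coeFn_sub (oscL hμ hφ τ f) (oscL hμ hφ t f), coeFn_oscL hμ hφ τ f,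
      coeFn_oscL hμ hφ t f] with ξ h2 h3 h4
    rw [h2, Pi.sub_apply, h3, h4, oscS, oscS]; ring
  simp_rw [e]
  have lim : Tendsto (fun τ => ∫⁻ ξ, ‖(oscS μ φ τ ξ - oscS μ φ t ξ) * f ξ‖ₑ ^ (2 : ℝ)) (𝓝 t)
      (𝓝 (∫⁻ _ : ℝ, 0)) := by
    refine tendsto_lintegral_filter_of_dominated_convergence
      (fun ξ => (2 * ‖f ξ‖ₑ) ^ (2 : ℝ)) (Eventually.of_forall fun τ => ?_)
      (Eventually.of_forall fun τ => ae_of_all _ fun ξ => ?_) ?_ (ae_of_all _ fun ξ => ?_)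
    · have := mo τ
      have := mo t
      fun_prop
    · gcongr
      rw [enorm_mul]
      gcongr
      rw [← ofReal_norm, show (2 : ℝ≥0∞) = ENNReal.ofReal 2 by norm_num]
      refine ENNReal.ofReal_le_ofReal ((norm_sub_le _ _).trans ?_)
      rw [norm_oscS, norm_oscS]
      linarith [h1 ξ]
    · have hf : eLpNorm (fun ξ => 2 * ‖f ξ‖ₑ) 2 volume ≠ ∞ := by
        have h := eLpNorm_le_nnreal_smul_eLpNorm_of_ae_le_mul' (μ := volume) (p := 2) (c := 2)
          (f := fun ξ => 2 * ‖f ξ‖ₑ) (g := f) (ae_of_all _ fun ξ => by simp)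
        refine (h.trans_lt ?_).ne
        rw [ENNReal.smul_def, smul_eq_mul]
        exact ENNReal.mul_lt_top ENNReal.coe_lt_top (Lp.memLp f).2
      rw [eLpNorm_two_eq_lintegral] at hf
      intro ht
      rw [ht] at hf
      simp at hf
    · have c : Continuous fun τ => ‖(oscS μ φ τ ξ - oscS μ φ t ξ) * f ξ‖ₑ ^ (2 : ℝ) := by
        unfold oscS
        exact (ENNReal.continuous_rpow_const).comp (by fun_prop)
      have := c.tendsto t
      simpa using this
  have := (ENNReal.continuous_rpow_const (y := (1 / 2 : ℝ))).tendsto (∫⁻ _ : ℝ, 0) |>.comp lim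
  simpa [Function.comp_def] using this

/-! ### Hermitian symmetry -/

/-- Multipliers with this symmetry preserve reality. The linear and bilinear operators of the
diagonal system all have it, which makes `hermL2` a symmetry of the ODE. -/
theorem hermL2_mulCLM {m : ℝ → ℂ} (hm : BddSymbol m) (h : ∀ ξ, (starRingEnd ℂ) (m (-ξ)) = m ξ)
    (f : L2R) : hermL2 (mulCLM m hm f) = mulCLM m hm (hermL2 f) := by
  apply Lp.ext
  have e := (Measure.measurePreserving_neg (volume : Measure ℝ)).quasiMeasurePreserving.ae_eq_comp
    (coeFn_mulCLM hm f)
  filter_upwards [coeFn_hermL2 (mulCLM m hm f), coeFn_mulCLM hm (hermL2 f), coeFn_hermL2 f, e]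
    with ξ h1 h2 h3 h4
  simp only [Function.comp_apply] at h4
  rw [h1, h2, h3, h4, map_mul, h]

theorem conj_conv_neg (F G : ℝ → ℂ) (ξ : ℝ) : (starRingEnd ℂ) (conv F G (-ξ)) =
    conv (fun ζ => (starRingEnd ℂ) (F (-ζ))) (fun ζ => (starRingEnd ℂ) (G (-ζ))) ξ := by
  unfold conv
  rw [← integral_conj, ← integral_neg_eq_self]
  refine integral_congr_ae (ae_of_all _ fun ζ => ?_)
  simp only [map_mul]
  congr 3
  ring

theorem hermL2_convCLM {a b c : ℝ → ℂ} (ha : BddSymbol a) (hb : BddSymbol b)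
    (hc : Measurable c) (C : ℝ≥0) (h : ∀ f g : L2R,
      eLpNorm (fun ξ => c ξ * conv (fun ζ => a ζ * f ζ) (fun ζ => b ζ * g ζ) ξ) 2 volume
        ≤ C * (‖f‖ₑ * ‖g‖ₑ)) (sa : ∀ ξ, (starRingEnd ℂ) (a (-ξ)) = a ξ)
    (sb : ∀ ξ, (starRingEnd ℂ) (b (-ξ)) = b ξ) (sc : ∀ ξ, (starRingEnd ℂ) (c (-ξ)) = c ξ)
    (f g : L2R) : hermL2 (convCLM ha hb hc C h f g) =
      convCLM ha hb hc C h (hermL2 f) (hermL2 g) := by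
  apply Lp.ext
  have e := (Measure.measurePreserving_neg (volume : Measure ℝ)).quasiMeasurePreserving.ae_eq_comp
    (coeFn_convCLM ha hb hc C h f g)
  filter_upwards [coeFn_hermL2 (convCLM ha hb hc C h f g), e,
    coeFn_convCLM ha hb hc C h (hermL2 f) (hermL2 g)] with ξ h1 h2 h3
  simp only [Function.comp_apply] at h2
  rw [h1, h2, h3, map_mul, sc, conj_conv_neg]
  refine congrArg (c ξ * ·) (congrFun (conv_congr ?_ ?_) ξ)
  · filter_upwards [coeFn_hermL2 f] with ζ hζ
    rw [hζ, map_mul, sa]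
  · filter_upwards [coeFn_hermL2 g] with ζ hζ
    rw [hζ, map_mul, sb]

/-! ### The system without surface tension in diagonal form -/

theorem sqrt_kap_le (x : ℝ) : √(kap x) ≤ 2 * jw (-(1 / 2)) x := by
  have p := jw_nonneg (-(1 / 2)) x
  refine Real.sqrt_le_iff.2 ⟨by positivity, (kap_le x).trans ?_⟩
  have e : jw (-(1 / 2)) x ^ 2 = jw (-1) x := by rw [sq, ← jw_add]; norm_num
  rw [mul_pow, e]
  linarith [jw_nonneg (-1) x]

theorem inv_sqrt_kap_le (x : ℝ) : (√(kap x))⁻¹ ≤ 2 * jw (1 / 2) x := by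
  have p := jw_pos (1 / 2) x
  have q := Real.sqrt_pos.2 (kap_pos x)
  rw [inv_le_comm₀ q (by positivity)]
  refine Real.le_sqrt_of_sq_le ?_
  have e : jw (1 / 2) x ^ 2 = jw 1 x := by rw [sq, ← jw_add]; norm_num
  have h := one_le_jw_one_mul_kap x
  rw [inv_pow, mul_pow, e, inv_le_iff_one_le_mul₀ (by have := jw_pos 1 x; positivity)]
  nlinarith

/-- The symbol that recovers the elevation from the diagonal variables. -/
noncomputable def symH (s ξ : ℝ) : ℂ := ((jw (-s) (2 * π * ξ) * (√(kap (2 * π * ξ)))⁻¹ : ℝ) : ℂ)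

/-- The symbol that recovers the velocity from the diagonal variables. -/
noncomputable def symW (s ξ : ℝ) : ℂ := ((jw (-s) (2 * π * ξ) : ℝ) : ℂ)

/-- The dispersion relation. -/
noncomputable def disp (ξ : ℝ) : ℝ := 2 * π * ξ * √(kap (2 * π * ξ))

@[fun_prop]
theorem measurable_disp : Measurable disp := by unfold disp; fun_prop

theorem measurable_neg_disp : Measurable fun ξ => -disp ξ := measurable_disp.neg

theorem disp_neg (ξ : ℝ) : disp (-ξ) = -disp ξ := by
  unfold disp
  rw [show 2 * π * -ξ = -(2 * π * ξ) by ring, kap_even]; ring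

theorem norm_symH_le (s ξ : ℝ) : ‖symH s ξ‖ ≤ 2 * jw (1 / 2 - s) (2 * π * ξ) := by
  have p := jw_nonneg (-s) (2 * π * ξ)
  rw [symH, Complex.norm_real, Real.norm_of_nonneg (by positivity)]
  calc _ ≤ jw (-s) (2 * π * ξ) * (2 * jw (1 / 2) (2 * π * ξ)) := by
        gcongr; exact inv_sqrt_kap_le _
    _ = _ := by rw [sub_eq_add_neg, jw_add]; ring

theorem norm_symW (s ξ : ℝ) : ‖symW s ξ‖ = jw (-s) (2 * π * ξ) := by
  rw [symW, Complex.norm_real, Real.norm_of_nonneg (jw_nonneg _ _)]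

theorem bddSymbol_symH {s : ℝ} (hs : 2 ≤ s) : BddSymbol (symH s) :=
  ⟨by unfold symH; fun_prop, 2, fun ξ => (norm_symH_le s ξ).trans (by
    have := jw_le_one (by linarith : 1 / 2 - s ≤ 0) (2 * π * ξ); linarith)⟩

theorem bddSymbol_symW {s : ℝ} (hs : 2 ≤ s) : BddSymbol (symW s) :=
  ⟨by unfold symW; fun_prop, 1, fun ξ => (norm_symW s ξ).trans_le
    (jw_le_one (by linarith) _)⟩

theorem abs_disp_le (ξ : ℝ) : |disp ξ| ≤ 2 * jw (1 / 2) (2 * π * ξ) := by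
  rw [disp, abs_mul, abs_of_nonneg (Real.sqrt_nonneg _)]
  calc _ ≤ jw 1 (2 * π * ξ) * (2 * jw (-(1 / 2)) (2 * π * ξ)) := by
        have := jw_nonneg 1 (2 * π * ξ)
        gcongr
        · exact abs_le_jw_one _
        · exact sqrt_kap_le _
    _ = _ := by
        rw [mul_left_comm, ← jw_add]; norm_num

theorem norm_mul_disp_sq_le {s : ℝ} (hs : 2 ≤ s) {μ : ℝ → ℂ}
    (h : ∀ ξ, ‖μ ξ‖ ≤ 2 * jw (1 / 2 - s) (2 * π * ξ)) (ξ : ℝ) : ‖μ ξ‖ * disp ξ ^ 2 ≤ 8 := by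
  have h1 := h ξ
  have h2 := abs_disp_le ξ
  have p := jw_nonneg (1 / 2) (2 * π * ξ)
  have p' := jw_nonneg (1 / 2 - s) (2 * π * ξ)
  calc ‖μ ξ‖ * disp ξ ^ 2 = ‖μ ξ‖ * |disp ξ| ^ 2 := by rw [sq_abs]
    _ ≤ 2 * jw (1 / 2 - s) (2 * π * ξ) * (2 * jw (1 / 2) (2 * π * ξ)) ^ 2 := by gcongr
    _ = 8 * jw (1 / 2 - s + (1 / 2 + 1 / 2)) (2 * π * ξ) := by rw [jw_add, jw_add]; ring
    _ ≤ 8 * 1 := by gcongr; exact jw_le_one (by linarith) _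
    _ = 8 := by norm_num

theorem norm_symW_le {s : ℝ} (ξ : ℝ) : ‖symW s ξ‖ ≤ 2 * jw (1 / 2 - s) (2 * π * ξ) := by
  rw [norm_symW]
  have := jw_le_jw (by linarith : -s ≤ 1 / 2 - s) (2 * π * ξ)
  have := jw_nonneg (1 / 2 - s) (2 * π * ξ)
  linarith

theorem bddSymbol_disp_mul {s : ℝ} (hs : 2 ≤ s) {μ : ℝ → ℂ} (mμ : Measurable μ)
    (h : ∀ ξ, ‖μ ξ‖ ≤ 2 * jw (1 / 2 - s) (2 * π * ξ)) {φ : ℝ → ℝ} (mφ : Measurable φ)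
    (hφ : ∀ ξ, |φ ξ| = |disp ξ|) : BddSymbol fun ξ => Complex.I * (φ ξ : ℂ) * μ ξ := by
  refine ⟨by fun_prop, 4, fun ξ => ?_⟩
  rw [norm_mul, norm_mul, Complex.norm_I, one_mul, Complex.norm_real, Real.norm_eq_abs, hφ]
  have h1 := h ξ
  have h2 := abs_disp_le ξ
  have p := jw_nonneg (1 / 2) (2 * π * ξ)
  have p' := jw_nonneg (1 / 2 - s) (2 * π * ξ)
  calc |disp ξ| * ‖μ ξ‖ ≤ 2 * jw (1 / 2) (2 * π * ξ) * (2 * jw (1 / 2 - s) (2 * π * ξ)) := by gcongr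
    _ = 4 * jw (1 / 2 + (1 / 2 - s)) (2 * π * ξ) := by rw [jw_add]; ring
    _ ≤ 4 * 1 := by gcongr; exact jw_le_one (by linarith) _
    _ = 4 := by norm_num

/-- The symbol in front of the product in the equation of the elevation. -/
noncomputable def symQH (s ξ : ℝ) : ℂ :=
  ((jw s (2 * π * ξ) * √(kap (2 * π * ξ)) : ℝ) : ℂ) * (-(Complex.I * th ξ))

/-- The symbol in front of the product in the equation of the velocity. -/
noncomputable def symQW (s ξ : ℝ) : ℂ := ((jw s (2 * π * ξ) : ℝ) : ℂ) * (-(Complex.I * th ξ))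

theorem measurable_symQH (s : ℝ) : Measurable (symQH s) := by unfold symQH; fun_prop

theorem measurable_symQW (s : ℝ) : Measurable (symQW s) := by unfold symQW; fun_prop

theorem norm_symQH_le (s ξ : ℝ) : ‖symQH s ξ‖ ≤ 2 * jw (s - 1 / 2) (2 * π * ξ) := by
  have p := jw_nonneg s (2 * π * ξ)
  rw [symQH, norm_mul, norm_neg, norm_mul, Complex.norm_I, one_mul, Complex.norm_real,
    Real.norm_of_nonneg (by positivity)]
  calc _ ≤ jw s (2 * π * ξ) * (2 * jw (-(1 / 2)) (2 * π * ξ)) * 1 := by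
        have := jw_nonneg (-(1 / 2)) (2 * π * ξ)
        gcongr
        · exact sqrt_kap_le _
        · exact norm_th_le _
    _ = _ := by rw [sub_eq_add_neg, jw_add]; ring

theorem norm_symQW_le (s ξ : ℝ) : ‖symQW s ξ‖ ≤ 1 * jw s (2 * π * ξ) := by
  have p := jw_nonneg s (2 * π * ξ)
  rw [symQW, norm_mul, norm_neg, norm_mul, Complex.norm_I, one_mul, Complex.norm_real,
    Real.norm_of_nonneg p, mul_comm]
  gcongr
  exact norm_th_le _

/-- Without surface tension the nonlinearity loses nothing: in the original variables it maps
H^{s-1/2} × H^s into H^{s-1/2}, an algebra, and tanh D has order zero. The equation is therefore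
semilinear. -/
theorem eLpNorm_symQH_mul_conv_le {s : ℝ} (hs : 2 ≤ s) (f g : L2R) :
    eLpNorm (fun ξ => symQH s ξ * conv (fun ζ => symH s ζ * f ζ) (fun ζ => symW s ζ * g ζ) ξ) 2
      volume ≤ (8 * cP (s - 1 / 2) : ℝ≥0) * (‖f‖ₑ * ‖g‖ₑ) := by
  have mf := (bddSymbol_symH hs).measurable_mul f
  have mg := (bddSymbol_symW hs).measurable_mul g
  rw [← sn_zero_eq]
  calc _ ≤ ENNReal.ofReal 2 * sn (0 + (s - 1 / 2)) (conv (fun ζ => symH s ζ * f ζ)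
          (fun ζ => symW s ζ * g ζ)) := sn_mul_le (norm_symQH_le s)
    _ ≤ ENNReal.ofReal 2 * (2 * cP (s - 1 / 2) * (sn (s - 1 / 2) (fun ζ => symH s ζ * f ζ) *
          sn (s - 1 / 2) (fun ζ => symW s ζ * g ζ))) := by
        rw [zero_add]; gcongr; exact sn_conv_le (by linarith) mf mg
    _ ≤ ENNReal.ofReal 2 * (2 * cP (s - 1 / 2) * ((ENNReal.ofReal 2 * ‖f‖ₑ) *
          (ENNReal.ofReal 1 * ‖g‖ₑ))) := by
        gcongr
        · refine (sn_mul_le (norm_symH_le s)).trans_eq ?_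
          rw [← sn_zero_L2]; congr 2; ring
        · refine (sn_mul_le (C := 1) (τ := -s) fun ξ => by rw [norm_symW, one_mul]).trans ?_
          rw [← sn_zero_L2]
          gcongr
          exact sn_mono (by linarith) _
    _ = _ := by
        rw [ENNReal.ofReal_one, show ENNReal.ofReal 2 = 2 by norm_num]; push_cast; ring

theorem eLpNorm_symQW_mul_conv_le {s : ℝ} (hs : 2 ≤ s) (f g : L2R) :
    eLpNorm (fun ξ => symQW s ξ * conv (fun ζ => symW s ζ * f ζ) (fun ζ => symW s ζ * g ζ) ξ) 2
      volume ≤ (2 * cP s : ℝ≥0) * (‖f‖ₑ * ‖g‖ₑ) := by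
  have mf := (bddSymbol_symW hs).measurable_mul f
  have mg := (bddSymbol_symW hs).measurable_mul g
  have b : ∀ f : L2R, sn s (fun ζ => symW s ζ * f ζ) ≤ ‖f‖ₑ := fun f => by
    refine (sn_mul_le (C := 1) (τ := -s) fun ξ => by rw [norm_symW, one_mul]).trans_eq ?_
    rw [← sn_zero_L2, add_neg_cancel, ENNReal.ofReal_one, one_mul]
  rw [← sn_zero_eq]
  calc _ ≤ ENNReal.ofReal 1 * sn (0 + s) (conv (fun ζ => symW s ζ * f ζ)
          (fun ζ => symW s ζ * g ζ)) := sn_mul_le (norm_symQW_le s)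
    _ ≤ ENNReal.ofReal 1 * (2 * cP s * (sn s (fun ζ => symW s ζ * f ζ) *
          sn s (fun ζ => symW s ζ * g ζ))) := by
        rw [zero_add]; gcongr; exact sn_conv_le (by linarith) mf mg
    _ ≤ ENNReal.ofReal 1 * (2 * cP s * (‖f‖ₑ * ‖g‖ₑ)) := by
        gcongr
        · exact b f
        · exact b g
    _ = _ := by
        rw [ENNReal.ofReal_one]; push_cast; ring

/-- The product in the equation of the elevation. -/
noncomputable def prodH {s : ℝ} (hs : 2 ≤ s) : L2R →L[ℂ] L2R →L[ℂ] L2R :=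
  convCLM (bddSymbol_symH hs) (bddSymbol_symW hs) (measurable_symQH s) _
    (eLpNorm_symQH_mul_conv_le hs)

/-- The product in the equation of the velocity. -/
noncomputable def prodW {s : ℝ} (hs : 2 ≤ s) : L2R →L[ℂ] L2R →L[ℂ] L2R :=
  convCLM (bddSymbol_symW hs) (bddSymbol_symW hs) (measurable_symQW s) _
    (eLpNorm_symQW_mul_conv_le hs)

theorem conj_symH_neg (s ξ : ℝ) : (starRingEnd ℂ) (symH s (-ξ)) = symH s ξ := by
  rw [symH, Complex.conj_ofReal, symH, show 2 * π * -ξ = -(2 * π * ξ) by ring, kap_even, jw_even]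

theorem conj_symW_neg (s ξ : ℝ) : (starRingEnd ℂ) (symW s (-ξ)) = symW s ξ := by
  rw [symW, Complex.conj_ofReal, symW, show 2 * π * -ξ = -(2 * π * ξ) by ring, jw_even]

theorem conj_I_th_neg (ξ : ℝ) :
    (starRingEnd ℂ) (-(Complex.I * th (-ξ))) = -(Complex.I * th ξ) := by
  rw [th, th, map_neg, map_mul, Complex.conj_I, Complex.conj_ofReal,
    show 2 * π * -ξ = -(2 * π * ξ) by ring, Real.tanh_neg]
  push_cast; ring

theorem conj_symQH_neg (s ξ : ℝ) : (starRingEnd ℂ) (symQH s (-ξ)) = symQH s ξ := by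
  rw [symQH, map_mul, conj_I_th_neg, Complex.conj_ofReal, symQH,
    show 2 * π * -ξ = -(2 * π * ξ) by ring, kap_even, jw_even]

theorem conj_symQW_neg (s ξ : ℝ) : (starRingEnd ℂ) (symQW s (-ξ)) = symQW s ξ := by
  rw [symQW, map_mul, conj_I_th_neg, Complex.conj_ofReal, symQW,
    show 2 * π * -ξ = -(2 * π * ξ) by ring, jw_even]

theorem hermL2_prodH {s : ℝ} (hs : 2 ≤ s) (f g : L2R) :
    hermL2 (prodH hs f g) = prodH hs (hermL2 f) (hermL2 g) :=
  hermL2_convCLM _ _ _ _ _ (conj_symH_neg s) (conj_symW_neg s) (conj_symQH_neg s) f g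

theorem hermL2_prodW {s : ℝ} (hs : 2 ≤ s) (f g : L2R) :
    hermL2 (prodW hs f g) = prodW hs (hermL2 f) (hermL2 g) :=
  hermL2_convCLM _ _ _ _ _ (conj_symW_neg s) (conj_symW_neg s) (conj_symQW_neg s) f g

/-- The average of the diagonal variables. -/
noncomputable def diagF : L2R × L2R →L[ℝ] L2R :=
  (1 / 2 : ℝ) • (ContinuousLinearMap.fst ℝ L2R L2R + ContinuousLinearMap.snd ℝ L2R L2R)

/-- Half of the difference of the diagonal variables. -/
noncomputable def diagG : L2R × L2R →L[ℝ] L2R :=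
  (1 / 2 : ℝ) • (ContinuousLinearMap.fst ℝ L2R L2R - ContinuousLinearMap.snd ℝ L2R L2R)

theorem diagF_apply (z : L2R × L2R) : diagF z = (1 / 2 : ℝ) • (z.1 + z.2) := rfl

theorem diagG_apply (z : L2R × L2R) : diagG z = (1 / 2 : ℝ) • (z.1 - z.2) := rfl

/-- The quadratic nonlinearity in diagonal form. -/
noncomputable def diagN {s : ℝ} (hs : 2 ≤ s) : L2R × L2R →L[ℝ] L2R × L2R →L[ℝ] L2R × L2R :=
  (ContinuousLinearMap.compL ℝ (L2R × L2R) L2R (L2R × L2R)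
      (ContinuousLinearMap.inl ℝ L2R L2R)).comp
    (((prodH hs).bilinearRestrictScalars ℝ).bilinearComp diagF diagG +
      (1 / 2 : ℝ) • ((prodW hs).bilinearRestrictScalars ℝ).bilinearComp diagG diagG) +
  (ContinuousLinearMap.compL ℝ (L2R × L2R) L2R (L2R × L2R)
      (ContinuousLinearMap.inr ℝ L2R L2R)).comp
    (((prodH hs).bilinearRestrictScalars ℝ).bilinearComp diagF diagG -
      (1 / 2 : ℝ) • ((prodW hs).bilinearRestrictScalars ℝ).bilinearComp diagG diagG)

theorem diagN_apply {s : ℝ} (hs : 2 ≤ s) (z z' : L2R × L2R) : diagN hs z z' =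
    (prodH hs (diagF z) (diagG z') + (1 / 2 : ℝ) • prodW hs (diagG z) (diagG z'),
      prodH hs (diagF z) (diagG z') - (1 / 2 : ℝ) • prodW hs (diagG z) (diagG z')) := by
  unfold diagN
  ext1
  · simp
  · simp

/-- The free evolution in diagonal form. -/
noncomputable def diagU (t : ℝ) : L2R × L2R →L[ℝ] L2R × L2R :=
  (oscL bddSymbol_one measurable_neg_disp t).prodMap (oscL bddSymbol_one measurable_disp t)

theorem diagU_apply (t : ℝ) (z : L2R × L2R) : diagU t z =
    (oscL bddSymbol_one measurable_neg_disp t z.1, oscL bddSymbol_one measurable_disp t z.2) := rfl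

theorem norm_diagU_le (t : ℝ) (z : L2R × L2R) : ‖diagU t z‖ ≤ ‖z‖ := by
  rw [diagU_apply, Prod.norm_def, Prod.norm_def]
  exact max_le_max (norm_oscL_le _ (fun _ => by simp) _ _ _)
    (norm_oscL_le _ (fun _ => by simp) _ _ _)

theorem continuous_diagU (z : L2R × L2R) : Continuous fun t => diagU t z :=
  (continuous_oscL bddSymbol_one (fun _ => by simp) measurable_neg_disp z.1).prodMk
    (continuous_oscL bddSymbol_one (fun _ => by simp) measurable_disp z.2)

theorem hermL2_oscL_one {φ : ℝ → ℝ} (hφ : Measurable φ) (odd : ∀ ξ, φ (-ξ) = -φ ξ) (t : ℝ)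
    (f : L2R) : hermL2 (oscL bddSymbol_one hφ t f) = oscL bddSymbol_one hφ t (hermL2 f) := by
  refine hermL2_mulCLM (bddSymbol_one.oscS hφ t) (fun ξ => ?_) f
  rw [oscS, oscS, map_mul, map_one, ← Complex.exp_conj, map_mul, Complex.conj_I,
    Complex.conj_ofReal, odd]
  push_cast
  congr 2
  ring

theorem hermL2_diagU (t : ℝ) (z : L2R × L2R) :
    hermL2.prodMap hermL2 (diagU t z) = diagU t (hermL2.prodMap hermL2 z) := by
  rw [diagU_apply, diagU_apply]
  ext1
  · exact hermL2_oscL_one _ (fun ξ => by simp [disp_neg]) t _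
  · exact hermL2_oscL_one _ disp_neg t _

theorem hermL2_diagF (z : L2R × L2R) : hermL2 (diagF z) = diagF (hermL2.prodMap hermL2 z) := by
  simp [diagF_apply, map_add, map_smul]

theorem hermL2_diagG (z : L2R × L2R) : hermL2 (diagG z) = diagG (hermL2.prodMap hermL2 z) := by
  simp [diagG_apply, map_sub, map_smul]

theorem hermL2_diagN {s : ℝ} (hs : 2 ≤ s) (z z' : L2R × L2R) : hermL2.prodMap hermL2 (diagN hs z z') =
    diagN hs (hermL2.prodMap hermL2 z) (hermL2.prodMap hermL2 z') := by
  rw [diagN_apply, diagN_apply, ← hermL2_diagF, ← hermL2_diagG, ← hermL2_diagG, ← hermL2_prodH,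
    ← hermL2_prodW]
  ext1
  · simp [map_add, map_smul]
  · simp [map_sub, map_smul]

/-! ### Local existence without surface tension -/

theorem symH_mul_symQH (s ξ : ℝ) : symH s ξ * symQH s ξ = -(Complex.I * th ξ) := by
  have q := (Real.sqrt_pos.2 (kap_pos (2 * π * ξ))).ne'
  have e : (jw (-s) (2 * π * ξ) * (√(kap (2 * π * ξ)))⁻¹) *
      (jw s (2 * π * ξ) * √(kap (2 * π * ξ))) = 1 := by
    have := jw_mul_neg s (2 * π * ξ)
    field_simp
    linarith
  rw [symH, symQH, ← mul_assoc, ← Complex.ofReal_mul, e, Complex.ofReal_one, one_mul]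

theorem symW_mul_symQW (s ξ : ℝ) : symW s ξ * symQW s ξ = -(Complex.I * th ξ) := by
  rw [symW, symQW, ← mul_assoc, ← Complex.ofReal_mul, mul_comm (jw (-s) _), jw_mul_neg,
    Complex.ofReal_one, one_mul]

/-- Let Ω be the dispersion relation, with Ω² = x tanh x, and let f, g be the variables behind h and
w. This identity and `disp_mul_symW` turn the linear part into f′ = −iΩg, g′ = −iΩf, so that f ± g
evolve by e^{∓itΩ}. -/
theorem disp_mul_symH (s ξ : ℝ) :
    (disp ξ : ℂ) * symH s ξ = ((2 * π * ξ : ℝ) : ℂ) * symW s ξ := by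
  have q := (Real.sqrt_pos.2 (kap_pos (2 * π * ξ))).ne'
  rw [symH, symW, ← Complex.ofReal_mul, ← Complex.ofReal_mul, disp]
  congr 1
  field_simp

theorem disp_mul_symW (s ξ : ℝ) : (disp ξ : ℂ) * symW s ξ = th ξ * symH s ξ := by
  have q := (Real.sqrt_pos.2 (kap_pos (2 * π * ξ))).ne'
  have k := kap_mul_self (2 * π * ξ)
  have k2 := Real.mul_self_sqrt (kap_pos (2 * π * ξ)).le
  rw [symH, symW, th, ← Complex.ofReal_mul, ← Complex.ofReal_mul, disp, ← k]
  congr 1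
  field_simp
  rw [sq, k2]
  ring

theorem mulCLM_oscL_one {μ : ℝ → ℂ} (hμ : BddSymbol μ) {φ : ℝ → ℝ} (hφ : Measurable φ) (t : ℝ)
    (f : L2R) : mulCLM μ hμ (oscL bddSymbol_one hφ t f) = oscL hμ hφ t f := by
  apply Lp.ext
  filter_upwards [coeFn_mulCLM hμ (oscL bddSymbol_one hφ t f), coeFn_oscL hμ hφ t f,
    coeFn_oscL bddSymbol_one hφ t f] with ξ h1 h2 h3
  rw [h1, h2, h3]; ring

theorem oscL_oscL_neg {μ : ℝ → ℂ} (hμ : BddSymbol μ) {φ : ℝ → ℝ} (hφ : Measurable φ) (t : ℝ)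
    (f : L2R) : oscL hμ hφ t (oscL bddSymbol_one hφ (-t) f) = mulCLM μ hμ f := by
  apply Lp.ext
  filter_upwards [coeFn_mulCLM hμ f, coeFn_oscL hμ hφ t (oscL bddSymbol_one hφ (-t) f),
    coeFn_oscL bddSymbol_one hφ (-t) f] with ξ h1 h2 h3
  have e : Complex.exp (Complex.I * ((t * φ ξ : ℝ) : ℂ)) *
      Complex.exp (Complex.I * ((-t * φ ξ : ℝ) : ℂ)) = 1 := by
    rw [← Complex.exp_add, ← Complex.exp_zero]; congr 1; push_cast; ring
  rw [h1, h2, h3]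
  linear_combination (μ ξ * f ξ) * e

theorem oscL_zero_one {φ : ℝ → ℝ} (hφ : Measurable φ) (f : L2R) :
    oscL bddSymbol_one hφ 0 f = f := by
  apply Lp.ext
  filter_upwards [coeFn_oscL bddSymbol_one hφ 0 f] with ξ h
  rw [h]; simp

theorem diagU_zero (z : L2R × L2R) : diagU 0 z = z := by
  rw [diagU_apply, oscL_zero_one, oscL_zero_one]

theorem snContOn_mulCLM {σ C : ℝ} {μ : ℝ → ℂ} (hμ : BddSymbol μ)
    (h : ∀ ξ, ‖μ ξ‖ ≤ C * jw (-σ) (2 * π * ξ)) {I : Set ℝ} {f : ℝ → L2R} (hf : ContinuousOn f I) :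
    SnContOn σ I fun t => mulCLM μ hμ (f t) := by
  have b : ∀ g : L2R, sn σ (mulCLM μ hμ g) ≤ ENNReal.ofReal C * ‖g‖ₑ := fun g => by
    rw [sn_mulCLM, ← sn_zero_L2]
    refine (sn_mul_le h).trans_eq ?_
    rw [add_neg_cancel]
  intro t ht
  refine ⟨(b _).trans_lt (ENNReal.mul_lt_top ENNReal.ofReal_lt_top (by finiteness)), ?_⟩
  have lim := (tendsto_iff_edist_tendsto_0.1 (hf t ht))
  simp only [edist_eq_enorm_sub] at lim
  have lim' := ENNReal.Tendsto.const_mul (a := ENNReal.ofReal C) lim (Or.inr ENNReal.ofReal_ne_top)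
  rw [mul_zero] at lim'
  refine tendsto_of_tendsto_of_tendsto_of_le_of_le tendsto_const_nhds lim' (fun _ => zero_le)
    fun τ => ?_
  simp only [← map_sub]
  exact b _

theorem exists_mulCLM_symH_eq {s : ℝ} (hs : 2 ≤ s) {h : L2R} (hh : sn (s - 1 / 2) h < ∞)
    (herm : hermL2 h = h) : ∃ f : L2R, mulCLM _ (bddSymbol_symH hs) f = h ∧ hermL2 f = f := by
  have mh := measurable_L2 h
  have key : MemLp (fun ξ => ((jw s (2 * π * ξ) * √(kap (2 * π * ξ)) : ℝ) : ℂ) * h ξ) 2 volume := by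
    refine ⟨(by fun_prop : Measurable _).aestronglyMeasurable, ?_⟩
    rw [← sn_zero_eq]
    refine (sn_mul_le (C := 2) (τ := s - 1 / 2) fun ξ => ?_).trans_lt
      (ENNReal.mul_lt_top ENNReal.ofReal_lt_top (by rwa [zero_add]))
    have p := jw_nonneg s (2 * π * ξ)
    rw [Complex.norm_real, Real.norm_of_nonneg (by positivity)]
    calc _ ≤ jw s (2 * π * ξ) * (2 * jw (-(1 / 2)) (2 * π * ξ)) := by
          gcongr; exact sqrt_kap_le _
      _ = _ := by rw [sub_eq_add_neg, jw_add]; ring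
  refine ⟨key.toLp _, ?_, ?_⟩
  · apply Lp.ext
    filter_upwards [coeFn_mulCLM (bddSymbol_symH hs) (key.toLp _), key.coeFn_toLp] with ξ h1 h2
    rw [h1, h2, symH, ← mul_assoc, ← Complex.ofReal_mul]
    have q := (Real.sqrt_pos.2 (kap_pos (2 * π * ξ))).ne'
    have e : (jw (-s) (2 * π * ξ) * (√(kap (2 * π * ξ)))⁻¹) *
        (jw s (2 * π * ξ) * √(kap (2 * π * ξ))) = 1 := by
      have := jw_mul_neg s (2 * π * ξ)
      field_simp
      linarith
    rw [e, Complex.ofReal_one, one_mul]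
  · apply Lp.ext
    have e := (Measure.measurePreserving_neg (volume : Measure ℝ)).quasiMeasurePreserving.ae_eq_comp
      key.coeFn_toLp
    have hr := coeFn_hermL2 h
    rw [herm] at hr
    filter_upwards [coeFn_hermL2 (key.toLp _), key.coeFn_toLp, e, hr] with ξ h1 h2 h3 h4
    simp only [Function.comp_apply] at h3
    rw [h1, h2, h3, map_mul, Complex.conj_ofReal, ← h4, show 2 * π * -ξ = -(2 * π * ξ) by ring,
      kap_even, jw_even]

theorem exists_mulCLM_symW_eq {s : ℝ} (hs : 2 ≤ s) {w : L2R} (hw : sn s w < ∞)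
    (herm : hermL2 w = w) : ∃ g : L2R, mulCLM _ (bddSymbol_symW hs) g = w ∧ hermL2 g = g := by
  have mw := measurable_L2 w
  have key : MemLp (fun ξ => ((jw s (2 * π * ξ) : ℝ) : ℂ) * w ξ) 2 volume :=
    ⟨(by fun_prop : Measurable _).aestronglyMeasurable, hw⟩
  refine ⟨key.toLp _, ?_, ?_⟩
  · apply Lp.ext
    filter_upwards [coeFn_mulCLM (bddSymbol_symW hs) (key.toLp _), key.coeFn_toLp] with ξ h1 h2
    rw [h1, h2, symW, ← mul_assoc, ← Complex.ofReal_mul, mul_comm (jw (-s) _), jw_mul_neg,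
      Complex.ofReal_one, one_mul]
  · apply Lp.ext
    have e := (Measure.measurePreserving_neg (volume : Measure ℝ)).quasiMeasurePreserving.ae_eq_comp
      key.coeFn_toLp
    have hr := coeFn_hermL2 w
    rw [herm] at hr
    filter_upwards [coeFn_hermL2 (key.toLp _), key.coeFn_toLp, e, hr] with ξ h1 h2 h3 h4
    simp only [Function.comp_apply] at h3
    rw [h1, h2, h3, map_mul, Complex.conj_ofReal, ← h4, show 2 * π * -ξ = -(2 * π * ξ) by ring,
      jw_even]

/-- The derivative of `μ (e^{-itΩ} α ± e^{itΩ} β) / 2` along the interaction flow. -/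
theorem hasDerivAt_diag {s : ℝ} (hs : 2 ≤ s) {μ : ℝ → ℂ} (hμ : BddSymbol μ)
    (h : ∀ ξ, ‖μ ξ‖ ≤ 2 * jw (1 / 2 - s) (2 * π * ξ)) {φ : ℝ → ℝ} (mφ : Measurable φ)
    (hφ : ∀ ξ, |φ ξ| = |disp ξ|) {α : ℝ → L2R} {n : L2R} {t : ℝ}
    (hα : HasDerivAt α (oscL bddSymbol_one mφ (-t) n) t) :
    HasDerivAt (fun t => mulCLM μ hμ (oscL bddSymbol_one mφ t (α t)))
      (mulCLM _ (bddSymbol_disp_mul hs hμ.meas h mφ hφ) (oscL bddSymbol_one mφ t (α t))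
        + mulCLM μ hμ n) t := by
  have hC : ∀ ξ, ‖μ ξ‖ * φ ξ ^ 2 ≤ 8 := fun ξ => by
    rw [← sq_abs, hφ, sq_abs]; exact norm_mul_disp_sq_le hs h ξ
  have d := (hasDerivAt_oscL hμ mφ (bddSymbol_disp_mul hs hμ.meas h mφ hφ) hC t).clm_apply hα
  simp only [mulCLM_oscL_one]
  refine d.congr_deriv ?_
  rw [oscL_oscL_neg]

/-- The system for (f + g, f − g) is solved in the interaction picture. The decay of `symH` and
`symW` for s ≥ 2 absorbs the factors Ω produced by differentiation, so h and w are differentiable in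
L² although the diagonal variables need not be. -/
theorem exists_fourierSolution {s T : ℝ} (hs : 2 ≤ s) (hT : 0 < T) {h₀ w₀ : L2R}
    (hh : sn (s - 1 / 2) h₀ < ∞) (hw : sn s w₀ < ∞) (herm_h : hermL2 h₀ = h₀)
    (herm_w : hermL2 w₀ = w₀) : ∃ T₀ ∈ Ioc 0 T, ∃ h w h' w' : ℝ → L2R,
      FourierSolution 0 (s - 1 / 2) s T₀ h w h' w' ∧ h 0 = h₀ ∧ w 0 = w₀ ∧
        ∀ t ∈ Icc 0 T₀, hermL2 (w t) = w t := by
  obtain ⟨f₀, hf₀, sf₀⟩ := exists_mulCLM_symH_eq hs hh herm_h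
  obtain ⟨g₀, hg₀, sg₀⟩ := exists_mulCLM_symW_eq hs hw herm_w
  obtain ⟨T₀, hT₀, ζ, ζ0, hζ⟩ := exists_interaction_solution norm_diagU_le continuous_diagU
    (diagN hs) (f₀ + g₀, f₀ - g₀) hT
  have symm := interaction_solution_symm norm_diagU_le (J := hermL2.prodMap hermL2) hermL2_diagU
    (hermL2_diagN hs) (by rw [ζ0]; ext1 <;> simp [sf₀, sg₀]) hζ
  have cζ : ContinuousOn ζ (Icc 0 T₀) := fun t ht => (hζ t ht).continuousWithinAt
  set z : ℝ → L2R × L2R := fun t => diagU t (ζ t) with hz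
  have cz : ContinuousOn z (Icc 0 T₀) := continuousOn_strong_apply norm_diagU_le continuous_diagU cζ
  have sz : ∀ t ∈ Icc 0 T₀, hermL2.prodMap hermL2 (z t) = z t := fun t ht => by
    rw [hz]; simp only; rw [hermL2_diagU, symm t ht]
  have mn : ∀ ξ, |-disp ξ| = |disp ξ| := fun ξ => abs_neg _
  have mp : ∀ ξ, |disp ξ| = |disp ξ| := fun ξ => rfl
  set DH₁ := mulCLM _ (bddSymbol_disp_mul hs (bddSymbol_symH hs).meas (norm_symH_le s)
    measurable_neg_disp mn) with hDH₁
  set DH₂ := mulCLM _ (bddSymbol_disp_mul hs (bddSymbol_symH hs).meas (norm_symH_le s)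
    measurable_disp mp) with hDH₂
  set DW₁ := mulCLM _ (bddSymbol_disp_mul hs (bddSymbol_symW hs).meas norm_symW_le
    measurable_neg_disp mn) with hDW₁
  set DW₂ := mulCLM _ (bddSymbol_disp_mul hs (bddSymbol_symW hs).meas norm_symW_le
    measurable_disp mp) with hDW₂
  have dζ : ∀ t ∈ Ioo 0 T₀,
      HasDerivAt (fun t => (ζ t).1) (oscL bddSymbol_one measurable_neg_disp (-t)
        (diagN hs (z t) (z t)).1) t ∧
      HasDerivAt (fun t => (ζ t).2) (oscL bddSymbol_one measurable_disp (-t)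
        (diagN hs (z t) (z t)).2) t := fun t ht => by
    have d := (hζ t (Ioo_subset_Icc_self ht)).hasDerivAt (Icc_mem_nhds ht.1 ht.2)
    exact ⟨(ContinuousLinearMap.fst ℝ L2R L2R).hasFDerivAt.comp_hasDerivAt t d,
      (ContinuousLinearMap.snd ℝ L2R L2R).hasFDerivAt.comp_hasDerivAt t d⟩
  refine ⟨T₀, hT₀, fun t => mulCLM _ (bddSymbol_symH hs) (diagF (z t)),
    fun t => mulCLM _ (bddSymbol_symW hs) (diagG (z t)),
    fun t => (1 / 2 : ℝ) • (DH₁ (z t).1 + DH₂ (z t).2)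
      + mulCLM _ (bddSymbol_symH hs) (prodH hs (diagF (z t)) (diagG (z t))),
    fun t => (1 / 2 : ℝ) • (DW₁ (z t).1 - DW₂ (z t).2)
      + (1 / 2 : ℝ) • mulCLM _ (bddSymbol_symW hs) (prodW hs (diagG (z t)) (diagG (z t))),
    ⟨?_, ?_, ?_, ?_, ?_, ?_, ?_⟩, ?_, ?_, ?_⟩
  · exact snContOn_mulCLM (C := 2) _ (fun ξ => by
      rw [show -(s - 1 / 2) = 1 / 2 - s by ring]; exact norm_symH_le s ξ)
      (diagF.continuous.comp_continuousOn cz)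
  · exact snContOn_mulCLM (C := 1) _ (fun ξ => by rw [one_mul]; exact (norm_symW s ξ).le)
      (diagG.continuous.comp_continuousOn cz)
  · intro t ht
    have d1 := hasDerivAt_diag hs (bddSymbol_symH hs) (norm_symH_le s) measurable_neg_disp mn
      (dζ t ht).1
    have d2 := hasDerivAt_diag hs (bddSymbol_symH hs) (norm_symH_le s) measurable_disp mp
      (dζ t ht).2
    have d := (d1.add d2).const_smul (1 / 2 : ℝ)
    have e : (fun t => mulCLM _ (bddSymbol_symH hs) (diagF (z t))) = fun t => (1 / 2 : ℝ) •
        (mulCLM _ (bddSymbol_symH hs) (oscL bddSymbol_one measurable_neg_disp t (ζ t).1) +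
          mulCLM _ (bddSymbol_symH hs) (oscL bddSymbol_one measurable_disp t (ζ t).2)) := by
      ext1 t
      rw [diagF_apply, ContinuousLinearMap.map_smul_of_tower, map_add]; rfl
    rw [e]
    refine d.congr_deriv ?_
    rw [diagN_apply]
    simp only [map_add, map_sub]
    rw [show z t = (oscL bddSymbol_one measurable_neg_disp t (ζ t).1,
      oscL bddSymbol_one measurable_disp t (ζ t).2) from rfl]
    module
  · intro t ht
    have d1 := hasDerivAt_diag hs (bddSymbol_symW hs) norm_symW_le measurable_neg_disp mn
      (dζ t ht).1
    have d2 := hasDerivAt_diag hs (bddSymbol_symW hs) norm_symW_le measurable_disp mp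
      (dζ t ht).2
    have d := (d1.sub d2).const_smul (1 / 2 : ℝ)
    have e : (fun t => mulCLM _ (bddSymbol_symW hs) (diagG (z t))) = fun t => (1 / 2 : ℝ) •
        (mulCLM _ (bddSymbol_symW hs) (oscL bddSymbol_one measurable_neg_disp t (ζ t).1) -
          mulCLM _ (bddSymbol_symW hs) (oscL bddSymbol_one measurable_disp t (ζ t).2)) := by
      ext1 t
      rw [diagG_apply, ContinuousLinearMap.map_smul_of_tower, map_sub]; rfl
    rw [e]
    refine d.congr_deriv ?_
    rw [diagN_apply]
    simp only [map_add, map_sub, ContinuousLinearMap.map_smul_of_tower]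
    rw [show z t = (oscL bddSymbol_one measurable_neg_disp t (ζ t).1,
      oscL bddSymbol_one measurable_disp t (ζ t).2) from rfl]
    module
  · intro t ht
    filter_upwards [Lp.coeFn_add ((1 / 2 : ℝ) • (DH₁ (z t).1 + DH₂ (z t).2))
        (mulCLM _ (bddSymbol_symH hs) (prodH hs (diagF (z t)) (diagG (z t)))),
      Lp.coeFn_smul (1 / 2 : ℝ) (DH₁ (z t).1 + DH₂ (z t).2), Lp.coeFn_add (DH₁ (z t).1) (DH₂ (z t).2),
      coeFn_mulCLM (bddSymbol_disp_mul hs (bddSymbol_symH hs).meas (norm_symH_le s)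
        measurable_neg_disp mn) (z t).1,
      coeFn_mulCLM (bddSymbol_disp_mul hs (bddSymbol_symH hs).meas (norm_symH_le s)
        measurable_disp mp) (z t).2,
      coeFn_mulCLM (bddSymbol_symH hs) (prodH hs (diagF (z t)) (diagG (z t))),
      coeFn_convCLM (bddSymbol_symH hs) (bddSymbol_symW hs) (measurable_symQH s) _
        (eLpNorm_symQH_mul_conv_le hs) (diagF (z t)) (diagG (z t)),
      coeFn_mulCLM (bddSymbol_symW hs) (diagG (z t)),
      Lp.coeFn_smul (1 / 2 : ℝ) ((z t).1 - (z t).2), Lp.coeFn_sub (z t).1 (z t).2]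
      with ξ e1 e2 e3 e4 e5 e6 e7 e8 e9 e10
    rw [e1, Pi.add_apply, e2, Pi.smul_apply, e3, Pi.add_apply, e4, e5, e6, e8, prodH, e7,
      conv_congr (coeFn_mulCLM (bddSymbol_symH hs) (diagF (z t)))
        (coeFn_mulCLM (bddSymbol_symW hs) (diagG (z t))), diagG_apply, e9, Pi.smul_apply, e10,
      Pi.sub_apply, Complex.real_smul, Complex.real_smul, ← diagG_apply]
    have k1 := symH_mul_symQH s ξ
    have k2 := disp_mul_symH s ξ
    push_cast at k2 ⊢
    generalize conv _ _ ξ = c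
    linear_combination c * k1 + Complex.I * (1 / 2) * ((z t).2 ξ - (z t).1 ξ) * k2
  · intro t ht
    filter_upwards [Lp.coeFn_add ((1 / 2 : ℝ) • (DW₁ (z t).1 - DW₂ (z t).2))
        ((1 / 2 : ℝ) • mulCLM _ (bddSymbol_symW hs) (prodW hs (diagG (z t)) (diagG (z t)))),
      Lp.coeFn_smul (1 / 2 : ℝ) (DW₁ (z t).1 - DW₂ (z t).2), Lp.coeFn_sub (DW₁ (z t).1) (DW₂ (z t).2),
      coeFn_mulCLM (bddSymbol_disp_mul hs (bddSymbol_symW hs).meas norm_symW_le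
        measurable_neg_disp mn) (z t).1,
      coeFn_mulCLM (bddSymbol_disp_mul hs (bddSymbol_symW hs).meas norm_symW_le
        measurable_disp mp) (z t).2,
      Lp.coeFn_smul (1 / 2 : ℝ)
        (mulCLM _ (bddSymbol_symW hs) (prodW hs (diagG (z t)) (diagG (z t)))),
      coeFn_mulCLM (bddSymbol_symW hs) (prodW hs (diagG (z t)) (diagG (z t))),
      coeFn_convCLM (bddSymbol_symW hs) (bddSymbol_symW hs) (measurable_symQW s) _
        (eLpNorm_symQW_mul_conv_le hs) (diagG (z t)) (diagG (z t)),
      coeFn_mulCLM (bddSymbol_symH hs) (diagF (z t)),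
      Lp.coeFn_smul (1 / 2 : ℝ) ((z t).1 + (z t).2), Lp.coeFn_add (z t).1 (z t).2]
      with ξ e1 e2 e3 e4 e5 e6 e7 e8 e9 e10 e11
    rw [e1, Pi.add_apply, e2, Pi.smul_apply, e3, Pi.sub_apply, e4, e5, e6, Pi.smul_apply, e7, e9,
      prodW, e8, conv_congr (coeFn_mulCLM (bddSymbol_symW hs) (diagG (z t)))
        (coeFn_mulCLM (bddSymbol_symW hs) (diagG (z t))), diagF_apply, e10, Pi.smul_apply, e11,
      Pi.add_apply, Complex.real_smul, Complex.real_smul, Complex.real_smul]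
    have k1 := symW_mul_symQW s ξ
    have k2 := disp_mul_symW s ξ
    rw [zero_mul, add_zero, mul_one]
    rw [show ((Real.tanh (2 * π * ξ) : ℝ) : ℂ) = th ξ from rfl]
    push_cast
    generalize conv _ _ ξ = c
    linear_combination (1 / 2) * c * k1 - Complex.I * (1 / 2) * ((z t).1 ξ + (z t).2 ξ) * k2
  · intro t ht
    rw [hermL2_mulCLM _ (conj_symH_neg s), hermL2_diagF, sz t ht]
  · simp only [hz]
    rw [diagU_zero, ζ0, diagF_apply, ← hf₀]
    congr 1
    module
  · simp only [hz]
    rw [diagU_zero, ζ0, diagG_apply, ← hg₀]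
    congr 1
    module
  · intro t ht
    rw [hermL2_mulCLM _ (conj_symW_neg s), hermL2_diagG, sz t ht]

/-! ### From the Fourier side back to physical space -/

/-- On bounded frequencies any weighted norm is the norm of a bounded operator on L², so derivatives
in L² pass through it. -/
theorem bddSymbol_cut_jw (σ : ℝ) (n : ℕ) :
    BddSymbol ((cut n).indicator fun ξ => ((jw σ (2 * π * ξ) : ℝ) : ℂ)) := by
  have m : Continuous fun ξ : ℝ => ((jw σ (2 * π * ξ) : ℝ) : ℂ) := by
    have := continuous_jw σ
    fun_prop
  obtain ⟨C, hC⟩ := (isCompact_Icc (a := -(n : ℝ)) (b := n)).exists_bound_of_continuousOn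
    m.continuousOn
  refine ⟨m.measurable.indicator (measurableSet_cut n), max C 0, fun ξ => ?_⟩
  by_cases h : ξ ∈ cut n
  · rw [indicator_of_mem h]; exact (hC ξ h).trans (le_max_left _ _)
  · rw [indicator_of_notMem h, norm_zero]; exact le_max_right _ _

theorem enorm_mulCLM_cut_jw (σ : ℝ) (n : ℕ) (f : L2R) :
    ‖mulCLM _ (bddSymbol_cut_jw σ n) f‖ₑ = sn σ ((cut n).indicator f) := by
  rw [enorm_mulCLM, sn]
  congr 1
  ext ξ
  by_cases h : ξ ∈ cut n
  · rw [indicator_of_mem h, indicator_of_mem h]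
  · rw [indicator_of_notMem h, indicator_of_notMem h, zero_mul, mul_zero]

/-- A derivative in `L²` that is continuous in a weighted space is a derivative there. -/
theorem tendsto_sn_slope {σ : ℝ} {I : Set ℝ} (hI : IsOpen I) {f f' : ℝ → L2R}
    (hd : ∀ t ∈ I, HasDerivAt f (f' t) t) (hc : SnContOn σ I f') {t : ℝ} (ht : t ∈ I) :
    Tendsto (fun τ => sn σ ((τ - t)⁻¹ • (f τ - f t) - f' t : L2R)) (𝓝[≠] t) (𝓝 0) := by
  rw [ENNReal.tendsto_nhds_zero]
  intro ε hε
  wlog hε' : ε < ∞ generalizing ε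
  · filter_upwards [this 1 one_pos (by simp)] with τ hτ
    rw [not_lt_top_iff.1 hε']; exact le_top
  lift ε to ℝ≥0 using hε'.ne
  have ev := (ENNReal.tendsto_nhds_zero.1 (hc t ht).2) ε hε
  rw [hI.nhdsWithin_eq ht] at ev
  obtain ⟨δ, hδ, hb⟩ := Metric.eventually_nhds_iff_ball.1 (ev.and (hI.mem_nhds ht))
  filter_upwards [self_mem_nhdsWithin, nhdsWithin_le_nhds (Metric.ball_mem_nhds t hδ)] with τ hτ hτb
  -- On bounded frequencies the mean value inequality bounds the slope by the oscillation of f'.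
  -- Since δ was chosen before n, the bound survives the removal of the cutoff.
  refine sn_le_of_forall_indicator (measurable_L2 _) fun n => ?_
  rw [← cut, ← enorm_mulCLM_cut_jw]
  set A := (mulCLM _ (bddSymbol_cut_jw σ n)).restrictScalars ℝ with hA
  have dA : ∀ x ∈ Metric.ball t δ, HasDerivWithinAt (fun τ => A (f τ - τ • f' t))
      (A (f' x - f' t)) (Metric.ball t δ) x := fun x hx => by
    have d := (hd x (hb x hx).2).sub ((hasDerivAt_id x).smul_const (f' t))
    rw [one_smul] at d
    exact (A.hasFDerivAt.comp_hasDerivAt x d).hasDerivWithinAt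
  have bA : ∀ x ∈ Metric.ball t δ, ‖A (f' x - f' t)‖ ≤ ε := fun x hx => by
    have : ‖A (f' x - f' t)‖ₑ ≤ ε := by
      refine le_trans (le_of_eq_of_le (enorm_mulCLM_cut_jw σ n _) ?_) (hb x hx).1
      exact sn_indicator_le _ _ _
    rw [← ofReal_norm] at this
    exact (ENNReal.ofReal_le_coe).1 this
  have key := (convex_ball t δ).norm_image_sub_le_of_norm_hasDerivWithin_le dA bA
    (Metric.mem_ball_self hδ) hτb
  have hne : τ - t ≠ 0 := sub_ne_zero.2 hτ
  have e : (τ - t)⁻¹ • (f τ - f t) - f' t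
      = (τ - t)⁻¹ • ((f τ - τ • f' t) - (f t - t • f' t)) := by
    have : f' t = (τ - t)⁻¹ • (τ - t) • f' t := by rw [inv_smul_smul₀ hne]
    nth_rewrite 1 [this]
    module
  have : ‖A ((τ - t)⁻¹ • (f τ - f t) - f' t)‖ ≤ ε := by
    rw [e, map_smul, map_sub, norm_smul, norm_inv]
    exact (inv_mul_le_iff₀ (norm_pos_iff.2 hne)).2 (by rwa [mul_comm])
  change ‖A ((τ - t)⁻¹ • (f τ - f t) - f' t)‖ₑ ≤ ε
  rw [← ofReal_norm]
  exact (ENNReal.ofReal_le_coe).2 this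

theorem sn_two_pi_mul_le (σ : ℝ) (F : ℝ → ℂ) :
    sn σ (fun ξ => Complex.I * ((2 * π * ξ : ℝ) : ℂ) * F ξ) ≤ sn (σ + 1) F := by
  have := sn_mul_le (σ := σ) (τ := 1) (C := 1) (m := fun ξ => Complex.I * ((2 * π * ξ : ℝ) : ℂ))
    (F := F) (fun ξ => by
      rw [norm_mul, Complex.norm_I, Complex.norm_real, one_mul, one_mul]
      exact abs_le_jw_one _)
  simpa using this

/-- The continuity in time of the right hand sides of the equations. -/
theorem SnContOn.of_eq_sub_conv {σ ρ σ' : ℝ} (hσ' : 1 ≤ σ') (hσ : σ ≤ σ') {I : Set ℝ}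
    {f a p q : ℝ → L2R} {c : ℂ} (hc : ‖c‖ ≤ 1) {m : ℝ → ℂ} (hm : Measurable m)
    (hmul : ∀ F : ℝ → ℂ, sn σ (fun ξ => m ξ * F ξ) ≤ sn ρ F) (ha : SnContOn ρ I a)
    (hp : SnContOn σ' I p) (hq : SnContOn σ' I q)
    (e : ∀ t ∈ I, f t =ᵐ[volume] fun ξ => -(m ξ * a t ξ)
      - Complex.I * th ξ * (c * conv (p t) (q t) ξ)) : SnContOn σ I f := by
  have mth := measurable_th
  have hcm : ∀ F : ℝ → ℂ, sn σ (fun ξ => Complex.I * th ξ * (c * F ξ)) ≤ sn σ' F := fun F => by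
    refine (sn_I_th_mul_le σ (fun ξ => c * F ξ)).trans (le_trans ?_ (sn_mono hσ F))
    have := sn_mul_le (σ := σ) (τ := 0) (C := 1) (m := fun _ => c) (F := F)
      (fun ξ => by simpa [jw_zero] using hc)
    simpa using this
  have bound : ∀ (A : L2R) (G : ℝ → ℂ), Measurable G →
      sn σ (fun ξ => -(m ξ * A ξ) - Complex.I * th ξ * (c * G ξ)) ≤ sn ρ A + sn σ' G :=
    fun A G hG => by
      have := measurable_L2 A
      refine (sn_sub_le (F := fun ξ => -(m ξ * A ξ)) (G := fun ξ => Complex.I * th ξ * (c * G ξ))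
        (by fun_prop) (by fun_prop)).trans (add_le_add ?_ (hcm G))
      rw [sn_neg (fun ξ => m ξ * A ξ)]
      exact hmul A
  intro t ht
  refine ⟨?_, ?_⟩
  · rw [sn_congr (e t ht)]
    exact (bound _ _ (measurable_conv (measurable_L2 _) (measurable_L2 _))).trans_lt
      (ENNReal.add_lt_top.2 ⟨ha.lt_top ht, hp.conv_lt_top hσ' hq ht⟩)
  · have lim := (ha t ht).2.add (hp.tendsto_conv hσ' hq ht)
    rw [add_zero] at lim
    refine tendsto_of_tendsto_of_tendsto_of_le_of_le' tendsto_const_nhds lim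
      (Eventually.of_forall fun _ => zero_le) ?_
    filter_upwards [self_mem_nhdsWithin] with τ hτ
    have e' : (f τ - f t : L2R) =ᵐ[volume] fun ξ => -(m ξ * (a τ - a t : L2R) ξ)
        - Complex.I * th ξ * (c * (conv (p τ) (q τ) ξ - conv (p t) (q t) ξ)) := by
      filter_upwards [e τ hτ, e t ht, Lp.coeFn_sub (f τ) (f t), Lp.coeFn_sub (a τ) (a t)]
        with ξ e1 e2 e3 e4
      rw [e3, e4, Pi.sub_apply, Pi.sub_apply, e1, e2]
      ring
    rw [sn_congr e']
    exact bound _ _ ((measurable_conv (measurable_L2 _) (measurable_L2 _)).sub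
      (measurable_conv (measurable_L2 _) (measurable_L2 _)))

/-- The linear term decides: one derivative of w leaves s − 1, while the product stays in H^{s-1/2}.
-/
theorem FourierSolution.snContOn_deriv_h {s T : ℝ} (hs : 2 ≤ s) {h w h' w' : ℝ → L2R}
    (S : FourierSolution 0 (s - 1 / 2) s T h w h' w') : SnContOn (s - 1) (Ioo 0 T) h' := by
  have ch := S.cont_h.mono Ioo_subset_Icc_self
  have cw := S.cont_w.mono Ioo_subset_Icc_self
  refine SnContOn.of_eq_sub_conv (σ' := s - 1 / 2) (c := 1) (ρ := s) (by linarith) (by linarith)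
    (by simp) (m := fun ξ => Complex.I * ((2 * π * ξ : ℝ) : ℂ)) (by fun_prop) (fun F => ?_)
    cw ch (cw.mono_exp (by linarith)) (fun t ht => ?_)
  · simpa using sn_two_pi_mul_le (s - 1) F
  · simpa only [one_mul] using S.eq_h t ht

theorem FourierSolution.snContOn_deriv_w {s T : ℝ} (hs : 2 ≤ s) {h w h' w' : ℝ → L2R}
    (S : FourierSolution 0 (s - 1 / 2) s T h w h' w') : SnContOn (s - 3 / 2) (Ioo 0 T) w' := by
  have ch := S.cont_h.mono Ioo_subset_Icc_self
  have cw := S.cont_w.mono Ioo_subset_Icc_self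
  have := measurable_th
  refine SnContOn.of_eq_sub_conv (σ' := s) (c := 1 / 2) (ρ := s - 1 / 2) (by linarith)
    (by linarith) (by norm_num) (m := fun ξ => Complex.I * th ξ) (by fun_prop) (fun F => ?_)
    ch cw cw (fun t ht => ?_)
  · exact (sn_I_th_mul_le _ F).trans (sn_mono (by linarith) F)
  · filter_upwards [S.eq_w t ht] with ξ hξ
    rw [hξ, zero_mul, add_zero, mul_one, th]

/-- The inverse Fourier transform on `L²`. -/
noncomputable def invF (f : L2R) : L2R := (Lp.fourierTransformₗᵢ ℝ ℂ).symm f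

theorem fourier_invF (f : L2R) : (𝓕 (invF f) : L2R) = f :=
  (Lp.fourierTransformₗᵢ ℝ ℂ).apply_symm_apply f

theorem invF_fourier (f : L2R) : invF (𝓕 f : L2R) = f :=
  (Lp.fourierTransformₗᵢ ℝ ℂ).symm_apply_apply f

theorem SnContOn.sobolevContinuousOn {σ : ℝ} {I : Set ℝ} {f : ℝ → L2R} (h : SnContOn σ I f) :
    SobolevContinuousOn σ I fun t => invF (f t) := fun t ht => by
  simpa only [sobolevENorm_eq_sn, fourier_sub_L2, fourier_invF] using h t ht

theorem SnContOn.sobolevC1On {σ T : ℝ} {f f' : ℝ → L2R} (h : SnContOn σ (Ioo 0 T) f)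
    (h' : SnContOn σ (Ioo 0 T) f') (hd : ∀ t ∈ Ioo 0 T, HasDerivAt f (f' t) t) :
    SobolevC1On σ (Ioo 0 T) (fun t => invF (f t)) fun t => invF (f' t) := by
  refine ⟨h.sobolevContinuousOn, h'.sobolevContinuousOn, fun t ht => ?_⟩
  have e : ∀ τ, (𝓕 ((τ - t)⁻¹ • (invF (f τ) - invF (f t)) - invF (f' t)) : L2R)
      = (τ - t)⁻¹ • (f τ - f t) - f' t := fun τ => by
    have l : ∀ (c : ℝ) (g : L2R), (𝓕 (c • g) : L2R) = c • (𝓕 g : L2R) := fun c g =>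
      LinearMap.map_smul_of_tower (Lp.fourierTransformₗᵢ ℝ ℂ).toLinearEquiv.toLinearMap c g
    rw [fourier_sub_L2, l, fourier_sub_L2, fourier_invF, fourier_invF, fourier_invF]
  simpa only [sobolevENorm_eq_sn, e] using tendsto_sn_slope isOpen_Ioo hd h' ht

theorem FourierSolution.isSolution {s T : ℝ} (hs : 2 ≤ s) {h w h' w' : ℝ → L2R}
    (S : FourierSolution 0 (s - 1 / 2) s T h w h' w') (herm : ∀ t ∈ Icc 0 T, hermL2 (w t) = w t) :
    IsSolution 0 (s - 1 / 2) s T (invF (h 0)) (invF (w 0)) (fun t => invF (h t))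
      fun t => invF (w t) where
  real t ht := by
    rw [isRealValued_iff_hermL2, isRealValued_iff_hermL2, fourier_invF, fourier_invF]
    exact ⟨S.herm_h t ht, herm t ht⟩
  initial := ⟨rfl, rfl⟩
  continuous_η := S.cont_h.sobolevContinuousOn
  continuous_v := S.cont_w.sobolevContinuousOn
  equation := by
    refine ⟨fun t => invF (h' t), fun t => invF (w' t), ?_, ?_, fun t ht => ⟨?_, ?_⟩⟩
    · exact ((S.cont_h.mono Ioo_subset_Icc_self).mono_exp (by linarith)).sobolevC1On
        (S.snContOn_deriv_h hs) S.deriv_h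
    · exact ((S.cont_w.mono Ioo_subset_Icc_self).mono_exp (by linarith)).sobolevC1On
        (S.snContOn_deriv_w hs) S.deriv_w
    · simp only [fourier_mul_eq_conv, fourier_invF]
      exact S.eq_h t ht
    · simp only [fourier_L2_sq_div_two, fourier_invF]
      exact S.eq_w t ht

/-! ### The vanishing surface tension limit -/

theorem exists_isSolution {s T : ℝ} (hs : 2 ≤ s) (hT : 0 < T) {η₀ v₀ : L2R}
    (hη₀ : sobolevENorm (s - 1 / 2) η₀ < ∞) (hv₀ : sobolevENorm s v₀ < ∞)
    (rη₀ : IsRealValued η₀) (rv₀ : IsRealValued v₀) :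
    ∃ T₀ ∈ Ioc 0 T, ∃ η v : ℝ → L2R, IsSolution 0 (s - 1 / 2) s T₀ η₀ v₀ η v := by
  obtain ⟨T₀, hT₀, h, w, h', w', S, h0, w0, herm⟩ := exists_fourierSolution hs hT hη₀ hv₀
    ((isRealValued_iff_hermL2 _).1 rη₀) ((isRealValued_iff_hermL2 _).1 rv₀)
  have := S.isSolution hs herm
  rw [h0, w0, invF_fourier, invF_fourier] at this
  exact ⟨T₀, hT₀, _, _, this⟩

theorem IsSolution.unique {s T : ℝ} (hs : 2 ≤ s) {η₀ v₀ : L2R} {η v ζ u : ℝ → L2R}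
    (S : IsSolution 0 (s - 1 / 2) s T η₀ v₀ η v) (S' : IsSolution 0 (s - 1 / 2) s T η₀ v₀ ζ u) :
    ∀ t ∈ Icc 0 T, η t = ζ t ∧ v t = u t := by
  obtain ⟨_, _, F⟩ := S.exists_fourierSolution hs
  obtain ⟨_, _, F'⟩ := S'.exists_fourierSolution hs
  intro t ht
  obtain ⟨e1, e2⟩ := F.unique hs (by linarith) F' (by rw [S.initial.1, S'.initial.1])
    (by rw [S.initial.2, S'.initial.2]) t ht
  exact ⟨(Lp.fourierTransformₗᵢ ℝ ℂ).injective e1, (Lp.fourierTransformₗᵢ ℝ ℂ).injective e2⟩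

/-- Closeness of the solutions with small surface tension to the one without, together with a
bound on the extra derivative of the elevation. -/
theorem IsSolution.eventually_close {s T T' : ℝ} (hs : 2 ≤ s) (hT' : T' ∈ Ioc 0 T) {η₀ v₀ : L2R}
    (hη₀ : sobolevENorm (s + 1 / 2) η₀ < ∞) {η v : ℝ → ℝ → L2R}
    (hsol : ∀ κ ∈ Ioc (0 : ℝ) 1, IsSolution κ (s + 1 / 2) s T η₀ v₀ (η κ) (v κ))
    {ηz vz : ℝ → L2R} (hz : IsSolution 0 (s - 1 / 2) s T' η₀ v₀ ηz vz) {θ : ℝ≥0} (hθ : 0 < θ)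
    (hθ1 : θ ≤ 1) : ∀ᶠ κ : ℝ in 𝓝[>] 0, κ ∈ Ioc (0 : ℝ) 1 ∧ ∀ t ∈ Icc 0 T',
      sobolevENorm (s - 1 / 2) (η κ t - ηz t) + sobolevENorm s (v κ t - vz t) ≤ θ ∧
        ENNReal.ofReal √κ * sobolevENorm (s + 1 / 2) (η κ t) ≤ 2 := by
  obtain ⟨_, _, F'⟩ := hz.exists_fourierSolution hs
  obtain ⟨κ₀, hκ₀, hc⟩ := F'.convergence hs hT'.1.le (by rw [hz.initial.1]; exact hη₀) hθ hθ1
  filter_upwards [Ioo_mem_nhdsGT (lt_min hκ₀ one_pos)] with κ hκ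
  have h1 : κ ∈ Ioc (0 : ℝ) 1 := ⟨hκ.1, (hκ.2.trans_le (min_le_right _ _)).le⟩
  obtain ⟨_, _, F⟩ := (hsol κ h1).exists_fourierSolution hs
  refine ⟨h1, fun t ht => ?_⟩
  simp only [sobolevENorm_eq_sn, fourier_sub_L2]
  exact hc κ ⟨hκ.1, hκ.2.trans_le (min_le_left _ _)⟩ h1.2 _ _ _ _ (F.mono hT'.2)
    (by rw [(hsol κ h1).initial.1, hz.initial.1]) (by rw [(hsol κ h1).initial.2, hz.initial.2]) t ht

theorem IsSolution.tendsto {s T T' : ℝ} (hs : 2 ≤ s) (hT' : T' ∈ Ioc 0 T) {η₀ v₀ : L2R}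
    (hη₀ : sobolevENorm (s + 1 / 2) η₀ < ∞) {η v : ℝ → ℝ → L2R}
    (hsol : ∀ κ ∈ Ioc (0 : ℝ) 1, IsSolution κ (s + 1 / 2) s T η₀ v₀ (η κ) (v κ))
    {ηz vz : ℝ → L2R} (hz : IsSolution 0 (s - 1 / 2) s T' η₀ v₀ ηz vz) :
    Tendsto (fun κ : ℝ => ⨆ t ∈ Icc 0 T',
      (sobolevENorm (s - 1 / 2) (η κ t - ηz t) + sobolevENorm s (v κ t - vz t)))
      (𝓝[>] 0) (𝓝 0) := by
  rw [ENNReal.tendsto_nhds_zero]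
  intro ε hε
  obtain ⟨θ, hθ, hθε⟩ := ENNReal.lt_iff_exists_nnreal_btwn.1 (lt_min hε one_pos)
  have θ1 : θ ≤ 1 := by exact_mod_cast hθε.le.trans (min_le_right _ _)
  filter_upwards [hz.eventually_close hs hT' hη₀ hsol (by exact_mod_cast hθ) θ1] with κ hκ
  exact iSup₂_le fun t ht => (hκ.2 t ht).1.trans (hθε.le.trans (min_le_left _ _))

theorem sn_L2_le_of_sub_le {σ : ℝ} {f g : L2R} {a b : ℝ≥0∞} (h : sn σ (f - g : L2R) ≤ a)
    (hg : sn σ g ≤ b) : sn σ f ≤ a + b := by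
  have := sn_L2_add_le σ (f - g) g
  rw [sub_add_cancel] at this
  exact this.trans (add_le_add h hg)

/-- Once the solutions are known to be close, the low stability estimate applies with ε = 2√κ. -/
theorem IsSolution.rate {s T T' : ℝ} (hs : 2 ≤ s) (hT' : T' ∈ Ioc 0 T) {η₀ v₀ : L2R}
    (hη₀ : sobolevENorm (s + 1 / 2) η₀ < ∞) {η v : ℝ → ℝ → L2R}
    (hsol : ∀ κ ∈ Ioc (0 : ℝ) 1, IsSolution κ (s + 1 / 2) s T η₀ v₀ (η κ) (v κ))
    {ηz vz : ℝ → L2R} (hz : IsSolution 0 (s - 1 / 2) s T' η₀ v₀ ηz vz) :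
    ∃ C : ℝ≥0, ∀ᶠ κ : ℝ in 𝓝[>] 0, ∀ t ∈ Icc 0 T',
      sobolevENorm 0 (η κ t - ηz t) + sobolevENorm (1 / 2) (v κ t - vz t)
        ≤ C * ENNReal.ofReal √κ := by
  obtain ⟨_, _, F'⟩ := hz.exists_fourierSolution hs
  obtain ⟨b₁, hb₁⟩ := F'.cont_h.exists_le
  obtain ⟨b₂, hb₂⟩ := F'.cont_w.exists_le
  -- The 1 is the distance θ = 1 between the two solutions; b₁ and b₂ bound the limit.
  obtain ⟨C, hC⟩ := FourierSolution.low_stability T' (1 + b₁ + b₂)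
  refine ⟨C * 2, ?_⟩
  filter_upwards [hz.eventually_close hs hT' hη₀ hsol one_pos le_rfl] with κ hκ
  obtain ⟨_, _, F⟩ := (hsol κ hκ.1).exists_fourierSolution hs
  have close := hκ.2
  simp only [sobolevENorm_eq_sn, fourier_sub_L2] at close ⊢
  intro t ht
  have key := hC hκ.1.1.le hs (by linarith) (by linarith) (F.mono hT'.2) F' (ε := 2 * (√κ).toNNReal)
    (by rw [(hsol κ hκ.1).initial.1, hz.initial.1]) (by rw [(hsol κ hκ.1).initial.2, hz.initial.2])
    (fun t ht => ?_) (fun t ht => ?_) (fun t ht => ?_) (fun t ht => ?_) t ht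
  · refine key.trans (le_of_eq ?_)
    push_cast
    rw [← mul_assoc]; rfl
  · refine (sn_mono (by linarith) _).trans ((sn_L2_le_of_sub_le (le_self_add.trans (close t ht).1)
      (hb₁ t ht)).trans ?_)
    push_cast
    exact le_self_add
  · refine (sn_mono hs _).trans ((sn_L2_le_of_sub_le (le_add_self.trans (close t ht).1)
      (hb₂ t ht)).trans ?_)
    push_cast
    gcongr
    exact le_self_add
  · refine (sn_mono hs _).trans ((hb₂ t ht).trans ?_)
    push_cast
    exact le_add_self
  -- One √κ stays as the rate. The other joins the H^{5/2} norm, which is at most the H^{s+1/2}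
  -- norm, and the product is at most 2.
  · rw [← Real.mul_self_sqrt hκ.1.1.le, ENNReal.ofReal_mul (Real.sqrt_nonneg κ), mul_assoc,
      Real.mul_self_sqrt hκ.1.1.le, ENNReal.coe_mul, mul_comm ((2 : ℝ≥0) : ℝ≥0∞)]
    gcongr
    · exact le_rfl
    · refine le_trans ?_ (close t ht).2
      gcongr
      exact sn_mono (by linarith) _

theorem mainTheorem4 (s T : ℝ) (hs : 2 ≤ s) (hT : 0 < T) (η₀ v₀ : L2R)
    (hη₀ : sobolevENorm (s + 1 / 2) η₀ < ∞) (hv₀ : sobolevENorm s v₀ < ∞)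
    (η v : ℝ → ℝ → L2R)
    (hsol : ∀ κ ∈ Ioc (0 : ℝ) 1, IsSolution κ (s + 1 / 2) s T η₀ v₀ (η κ) (v κ)) :
    (∃ T₀ ∈ Ioc 0 T, ∃ ηz vz : ℝ → L2R, IsSolution 0 (s - 1 / 2) s T₀ η₀ v₀ ηz vz) ∧
    ∀ T' ∈ Ioc 0 T, ∀ ηz vz : ℝ → L2R, IsSolution 0 (s - 1 / 2) s T' η₀ v₀ ηz vz →
      (∀ ηw vw : ℝ → L2R, IsSolution 0 (s - 1 / 2) s T' η₀ v₀ ηw vw →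
        ∀ t ∈ Icc 0 T', ηw t = ηz t ∧ vw t = vz t) ∧
      Tendsto (fun κ : ℝ => ⨆ t ∈ Icc 0 T',
          (sobolevENorm (s - 1 / 2) (η κ t - ηz t) + sobolevENorm s (v κ t - vz t)))
        (𝓝[>] 0) (𝓝 0) ∧
      ((∀ σ : ℝ, sobolevENorm σ η₀ < ∞ ∧ sobolevENorm σ v₀ < ∞) →
        ∃ C : ℝ≥0, ∀ᶠ κ : ℝ in 𝓝[>] 0, ∀ t ∈ Icc 0 T',
          sobolevENorm 0 (η κ t - ηz t) + sobolevENorm (1 / 2) (v κ t - vz t)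
            ≤ C * ENNReal.ofReal √κ) := by
  -- The data are real because they are the value at time 0 of the solution with κ = 1.
  obtain ⟨r0, i0⟩ := And.intro (hsol 1 (by simp)).real (hsol 1 (by simp)).initial
  have real₀ := r0 0 ⟨le_rfl, hT.le⟩
  rw [i0.1, i0.2] at real₀
  have hη₀' : sobolevENorm (s - 1 / 2) η₀ < ∞ := (sn_mono (by linarith) _).trans_lt hη₀
  exact ⟨exists_isSolution hs hT hη₀' hv₀ real₀.1 real₀.2, fun T' hT' ηz vz hz =>
    ⟨fun ηw vw hw => hw.unique hs hz, hz.tendsto hs hT' hη₀ hsol, fun _ => hz.rate hs hT' hη₀ hsol⟩⟩
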